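/- **Model.** Let $\mathcal S=\{S_1,\dots,S_n\}$ be a family of $n$ sets over a ground set $\mathcal E$ of $m$ elements. A stream consists of pairs $(S,e)\in\mathcal S\times\mathcal E$, each saying that $e$ belongs to $S$ (pairs may repeat). For a window size $W\ge 1$, let $G$ be the set (bipartite graph) of the pairs among the last $W$ items of the stream (all items, if there are fewer). For $\mathcal P\subseteq\mathcal S$ let $\mathcal C_G(\mathcal P)$ be the number of elements $e$ with $(S,e)\in G$ for some $S\in\mathcal P$, and let $\mathrm{OPT}_k(G)=\max_{|\mathcal P|=k}\mathcal C_G(\mathcal P)$, where $1\le k\le n$. Algorithms are programs for a randomized word RAM with the usual unit-cost word operations (arithmetic, comparison, indirect addressing, drawing a uniformly random element of $\{0,\dots,b\}$ for a word $b$). Words have $\Theta(\log n+\log m+\log W+\log\frac1\varepsilon+\log\log\frac1{\delta'})$ bits, independently of the length of the stream. Space is the largest number of memory cells in use (holding a nonzero word) at any time. An algorithm is initialized with the parameters (with $1/\varepsilon$ and $\log_2(1/\delta')$ rounded up to integers), is then updated with one stream item at a time, and is queried at the end of the stream. Below, $\log x$ stands for $\max\{1,\log_2 x\}$. **Theorem.**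 There are a randomized algorithm (a single program for all parameters) and an absolute constant $C$ such that for all $n,m,W$ with $W\ge1$, all $1\le k\le n$, all real $\varepsilon,\delta'\in(0,0.5)$ and every finite stream the following holds. Put $\delta=\delta'/\log W$ and $$F=\frac{n\,\log(1/\delta)\,\log(1/\varepsilon)\,\log(n)\,\log(W)}{\varepsilon^{3}},\qquad U=k\,\log(1/\delta)\,\log(n)\,\log(W).$$ 1. For all random choices, the algorithm halts in every phase, it uses space at most $C\cdot F$ at any time (initialization and query included), each update takes at most $C\cdot U$ steps, and the query at the end of the stream takes at most $C\cdot F\log F$ steps. Thus, up to polylogarithmic factors in the displayed quantities, the space and the final running time are $\widetilde O\big(n\log(1/\delta')\log(W)/\varepsilon^3\big)$ and the update time is $\widetilde O\big(k\log(1/\delta')\log(n)\log(W)\big)$. 2. With probability at least $1-\delta'$ the query outputs a number $v$ with $$\Big(1-\frac1e-\varepsilon\Big)\mathrm{OPT}_k(G)\le v\le \mathrm{OPT}_k(G)$$ together with a family $\mathcal P\subseteq\mathcal S$ of exactly $k$ sets such that $\mathcal C_G(\mathcal P)\ge\big(1-\frac1e-\varepsilon\big)\mathrm{OPT}_k(G)$,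 where $G$ is the edge set of the window at the end of the stream. -/

import Mathlib

open MeasureTheory

/-! ### Randomized word RAM

Words have `w` bits. A program works on registers (finitely many, since a program is a finite text)
and on a memory of cells addressed by words, all of them `0` at the beginning. -/

namespace WordRAM

/-- Binary operations on words; sums and products are reduced modulo `2 ^ w`, comparisons return
`1` or `0`. -/
inductive Op
  | add | sub | mul | div | mod | lt | eq

def Op.eval (w : ℕ) : Op → ℕ → ℕ → ℕ
  | .add, a, b => (a + b) % 2 ^ w
  | .sub, a, b => a - b
  | .mul, a, b => (a * b) % 2 ^ w
  | .div, a, b => a / b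
  | .mod, a, b => a % b
  | .lt, a, b => (if a < b then 1 else 0) % 2 ^ w
  | .eq, a, b => (if a = b then 1 else 0) % 2 ^ w

/-- Expressions: a literal, the content of a register, the content of the memory cell whose address
is the value of an expression, and binary operations. -/
inductive Expr
  | lit (c : ℕ)
  | reg (r : ℕ)
  | load (a : Expr)
  | op (o : Op) (a b : Expr)

/-- Commands: `r := e`; `mem[a] := e`; `r :=` a fresh uniformly random element of `{0, …, b}`;
sequencing, branching and loops (a condition holds if its value is not `0`). -/
inductive Prog
  | skip
  | assign (r : ℕ) (e : Expr)
  | store (a e : Expr)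
  | rand (r : ℕ) (b : Expr)
  | seq (p q : Prog)
  | ite (e : Expr) (p q : Prog)
  | while (e : Expr) (p : Prog)

/-- `draws` is the number of random numbers drawn so far. -/
structure State where
  reg : ℕ → ℕ
  mem : ℕ →₀ ℕ
  draws : ℕ

def State.setReg (s : State) (r v : ℕ) : State := { s with reg := Function.update s.reg r v }

noncomputable def State.setMem (s : State) (a v : ℕ) : State := { s with mem := s.mem.update a v }

/-- The number of memory cells in use, i.e. of cells that do not hold `0`. -/
def State.space (s : State) : ℕ := s.mem.support.card

def Expr.eval (w : ℕ) (s : State) : Expr → ℕ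
  | .lit c => c % 2 ^ w
  | .reg r => s.reg r
  | .load a => s.mem (a.eval w s)
  | .op o a b => o.eval w (a.eval w s) (b.eval w s)

/-- The number of steps to evaluate an expression: one for each of its nodes. -/
def Expr.cost : Expr → ℕ
  | .lit _ => 1
  | .reg _ => 1
  | .load a => a.cost + 1
  | .op _ a b => a.cost + b.cost + 1

/-- The random choices: the `i`-th draw, if it is one from `{0, …, b}`, returns `ω (i, b)`. -/
abbrev Coins : Type := (i : ℕ × ℕ) → Fin (i.2 + 1)

/-- All `ω (i, b)` are independent, and `ω (i, b)` is uniform on `{0, …, b}`. -/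
noncomputable def coinMeasure : Measure Coins :=
  Measure.infinitePi fun i : ℕ × ℕ => (PMF.uniformOfFintype (Fin (i.2 + 1))).toMeasure

/-- `Exec w ω S p s s' t`: with word length `w` and random choices `ω`, the program `p` started in
state `s` halts in state `s'` after exactly `t` steps, and at no time are more than `S` memory
cells in use. -/
inductive Exec (w : ℕ) (ω : Coins) (S : ℝ) : Prog → State → State → ℕ → Prop
  | skip (s : State) (hs : (s.space : ℝ) ≤ S) : Exec w ω S .skip s s 1
  | assign (s : State) (r : ℕ) (e : Expr) (hs : (s.space : ℝ) ≤ S) :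
      Exec w ω S (.assign r e) s (s.setReg r (e.eval w s)) (e.cost + 1)
  | store (s : State) (a e : Expr) (hs : (s.space : ℝ) ≤ S)
      (hs' : ((s.setMem (a.eval w s) (e.eval w s)).space : ℝ) ≤ S) :
      Exec w ω S (.store a e) s (s.setMem (a.eval w s) (e.eval w s)) (a.cost + e.cost + 1)
  | rand (s : State) (r : ℕ) (b : Expr) (hs : (s.space : ℝ) ≤ S) :
      Exec w ω S (.rand r b) s
        { s.setReg r (ω (s.draws, b.eval w s)) with draws := s.draws + 1 } (b.cost + 1)
  | seq {p q : Prog} {s s' s'' : State} {t t' : ℕ}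
      (hp : Exec w ω S p s s' t) (hq : Exec w ω S q s' s'' t') :
      Exec w ω S (.seq p q) s s'' (t + t')
  | ite_true {e : Expr} {p q : Prog} {s s' : State} {t : ℕ} (he : e.eval w s ≠ 0)
      (hp : Exec w ω S p s s' t) : Exec w ω S (.ite e p q) s s' (e.cost + 1 + t)
  | ite_false {e : Expr} {p q : Prog} {s s' : State} {t : ℕ} (he : e.eval w s = 0)
      (hq : Exec w ω S q s s' t) : Exec w ω S (.ite e p q) s s' (e.cost + 1 + t)
  | while_true {e : Expr} {p : Prog} {s s' s'' : State} {t t' : ℕ} (he : e.eval w s ≠ 0)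
      (hp : Exec w ω S p s s' t) (hw : Exec w ω S (.while e p) s' s'' t') :
      Exec w ω S (.while e p) s s'' (e.cost + 1 + t + t')
  | while_false {e : Expr} {p : Prog} {s : State} (he : e.eval w s = 0)
      (hs : (s.space : ℝ) ≤ S) : Exec w ω S (.while e p) s s (e.cost + 1)

/-- A streaming algorithm: `init` runs once before the stream starts, `update` once for every
stream item, `query` at the end of the stream. -/
structure StreamAlg where
  init : Prog
  update : Prog
  query : Prog

end WordRAM

/-! ### `k`-cover in the edge-arrival sliding window model -/

namespace KCover

open WordRAM

variable {n m : ℕ}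

/-- The edge set given by the last `W` items of the stream (by all items if there are fewer). -/
def window (W : ℕ) (σ : List (Fin n × Fin m)) : Finset (Fin n × Fin m) :=
  (σ.drop (σ.length - W)).toFinset

/-- The number of elements that belong to at least one of the sets in `P`; an edge `(S, e)` says
that the element `e` belongs to the set `S`. -/
def coverage (G : Finset (Fin n × Fin m)) (P : Finset (Fin n)) : ℕ :=
  ((G.filter fun x => x.1 ∈ P).image Prod.snd).card

/-- The optimal `k`-cover value. -/
def opt (k : ℕ) (G : Finset (Fin n × Fin m)) : ℕ :=
  ((Finset.univ : Finset (Fin n)).powersetCard k).sup (coverage G)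

/-- The parameters of a problem instance: number of sets, number of elements, size of the cover,
window size, accuracy, failure probability. -/
structure Params where
  n : ℕ
  m : ℕ
  k : ℕ
  W : ℕ
  ε : ℝ
  δ : ℝ

structure Params.Valid (I : Params) : Prop where
  one_le_k : 1 ≤ I.k
  k_le_n : I.k ≤ I.n
  one_le_W : 1 ≤ I.W
  ε_pos : 0 < I.ε
  ε_lt : I.ε < 1 / 2
  δ_pos : 0 < I.δ
  δ_lt : I.δ < 1 / 2

/-- `1 / ε`, as an integer that the machine can read. -/
noncomputable def Params.invAcc (I : Params) : ℕ := ⌈1 / I.ε⌉₊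

/-- `log (1 / δ)`, as an integer that the machine can read. -/
noncomputable def Params.logConf (I : Params) : ℕ := ⌈Real.logb 2 (1 / I.δ)⌉₊

/-- Word length: `c` times the total bit length of the integer parameters. In particular it does
not depend on the length of the stream. -/
noncomputable def Params.wordLength (c : ℕ) (I : Params) : ℕ :=
  c * (I.n.size + I.m.size + I.W.size + I.invAcc.size + I.logConf.size)

/-- At the beginning the parameters are in the registers `0, …, 5`; the rest is zero. -/
noncomputable def Params.start (I : Params) : State where
  reg := fun
    | 0 => I.n
    | 1 => I.m
    | 2 => I.k
    | 3 => I.W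
    | 4 => I.invAcc
    | 5 => I.logConf
    | _ => 0
  mem := 0
  draws := 0

/-- An arriving edge `(S, e)` is put into the registers `0` and `1`. -/
def receive (s : State) (x : Fin n × Fin m) : State := (s.setReg 0 x.1).setReg 1 x.2

/-- `Processed A w ω S T s₀ σ s`: started in `s₀`, the algorithm `A` is in state `s` after its
initialization and after processing the stream `σ`; at no time are more than `S` memory cells in
use, and each update took at most `T` steps. -/
inductive Processed (A : StreamAlg) (w : ℕ) (ω : Coins) (S T : ℝ) (s₀ : State) :
    List (Fin n × Fin m) → State → Prop
  | init {s : State} {t : ℕ} (h : Exec w ω S A.init s₀ s t) : Processed A w ω S T s₀ [] s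
  | update {σ : List (Fin n × Fin m)} {x : Fin n × Fin m} {s s' : State} {t : ℕ}
      (hσ : Processed A w ω S T s₀ σ s)
      (hx : Exec w ω S A.update (receive s x) s' t) (ht : (t : ℝ) ≤ T) :
      Processed A w ω S T s₀ (σ ++ [x]) s'

/-- As `Processed`, followed by the query, which halts in state `s` after at most `Q` steps. -/
def Answers (A : StreamAlg) (w : ℕ) (ω : Coins) (S T Q : ℝ) (s₀ : State)
    (σ : List (Fin n × Fin m)) (s : State) : Prop :=
  ∃ (s₁ : State) (t : ℕ), Processed A w ω S T s₀ σ s₁ ∧ Exec w ω S A.query s₁ s t ∧ (t : ℝ) ≤ Q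

/-- The output in the final state `s`: the fraction of the registers `0` and `1` is an
`α`-approximation (`α ≤ 1`) of the optimal value, and the `k` cells from the address in register
`2` on hold `k` different sets whose coverage is an `α`-approximation of it. -/
def IsApprox (α : ℝ) (k : ℕ) (G : Finset (Fin n × Fin m)) (s : State) : Prop :=
  (0 < s.reg 1 ∧ α * opt k G ≤ (s.reg 0 : ℝ) / s.reg 1 ∧ (s.reg 0 : ℝ) / s.reg 1 ≤ opt k G) ∧
  ∃ f : Fin k ↪ Fin n, (∀ i : Fin k, s.mem (s.reg 2 + i) = f i) ∧
    α * opt k G ≤ coverage G (Finset.univ.map f)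

/-- The binary logarithm, kept at least `1` so that it is meaningful as a factor of a bound. -/
noncomputable def lg (x : ℝ) : ℝ := max 1 (Real.logb 2 x)

/-- The failure probability granted to each of the `O(log W)` guesses of the optimum. -/
noncomputable def Params.δ₀ (I : Params) : ℝ := I.δ / lg I.W

/-- `n log(1/δ₀) log(1/ε) log(n) log(W) / ε³`. -/
noncomputable def Params.sizeBound (I : Params) : ℝ :=
  I.n * lg (1 / I.δ₀) * lg (1 / I.ε) * lg I.n * lg I.W / I.ε ^ 3

/-- `k log(1/δ₀) log(n) log(W)`. -/
noncomputable def Params.updateBound (I : Params) : ℝ :=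
  I.k * lg (1 / I.δ₀) * lg I.n * lg I.W

end KCover

namespace WordRAM

/-! ### Running programs without overflow -/

/-! Elements are subsampled by a random polynomial hash modulo a prime `q`. An element with hash
value below `q / 2 ^ i` belongs to the `i`-th sample, so the samples are nested and each is roughly
half of the one before. For every level the algorithm remembers recent edges only: at most `D` for
each element and at most `B` for the level. The query takes the largest sample known to be complete
(each of its levels holds fewer than `B` edges), runs the greedy algorithm on it and rescales the
number of covered elements.

Why recent edges suffice. Order the distinct edges of the window by their last occurrence. An
arriving item moves one edge to the front, and only the last edge of the list can expire. Both
truncations prefer recent edges, and a discarded edge expires before those that displaced it, so it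
is not missed unless it arrives again. Hence the truncated lists obey a recursion of their own
(`atLevel_trunc_cons`, `cap_touch_take`, `keptUnexpired_eq`), and the memory content is determined
by the window and the hash function.

Why truncation is cheap. Let `A` be `1 / ε` rounded up. From an optimal cover give up about `k / (8
* A)` sets, chosen by averaging so that little is lost, and replace them by random sets. These hit
almost every element of degree above `D`, which is about `16 * A * log A * n / k`; the other
elements lose no edge (`exists_coverage_truncated`). On the other hand `k` random sets cover an
element of degree `d` with probability at least half of `min 1 (k * d / n)`, so these minima add up
to at most twice the optimum (`sum_min_le_two_mul_opt`). Therefore the truncated graph has at most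
`2 * D * opt` edges, and a sample that keeps about `μ` elements of an optimal cover has `O(μ * D)`
edges; `B` is of this order.

Why the samples are representative. The hash is `2 * r`-wise independent, so its moments up to order
`2 * r` are those of fully independent variables (`LimitedIndep.sum_pow`). Markov's inequality
bounds each failure by `2 * (1 / 2) ^ r` once the expected sample of an optimal cover reaches `μ =
1536 * A ^ 2 * r` (`card_deviation_le`). With `r` about `k log n + log (1 / δ) + log log W`, a union
bound over all covers and levels is affordable (`card_bad_le`). In the good event the query does not
go beyond the last level with enough sampled elements (`edges_lt_of_good`), and the guarantee of the
greedy algorithm (`IsGreedy.le`) passes from the sample to the graph (`answer_of_good`).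

Why it is fast and small. In `A ^ 2 * r * D` the factor `k` of `r` cancels the `1 / k` of `D`, which
leaves `n / ε ^ 3` times logarithms per level. An update inspects the tail of every level and
evaluates one polynomial. The query is linear in the stored edges thanks to lazily maintained
buckets. Programs are verified over the natural numbers together with the absence of overflow
(`Run`). As a step fills at most one cell, time bounds also yield space bounds (`Run.exec`). -/

instance (c : ℕ) : OfNat Expr c := ⟨.lit c⟩
instance : Add Expr := ⟨.op .add⟩
instance : Sub Expr := ⟨.op .sub⟩
instance : Mul Expr := ⟨.op .mul⟩
instance : Div Expr := ⟨.op .div⟩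
instance : Mod Expr := ⟨.op .mod⟩

/-- The expression with value `1` if `a < b`, and `0` otherwise. -/
def Expr.less (a b : Expr) : Expr := .op .lt a b

/-- The expression with value `1` if `a = b`, and `0` otherwise. -/
def Expr.same (a b : Expr) : Expr := .op .eq a b

/-- The cell `i` of the `j`-th of sixteen interleaved arrays. -/
def Expr.cell (j : ℕ) (i : Expr) : Expr := .load (.op .add (.op .mul (.lit 16) i) (.lit j))

/-- Assignment to the cell `i` of the `j`-th of sixteen interleaved arrays. -/
def Prog.put (j : ℕ) (i e : Expr) : Prog := .store (.op .add (.op .mul (.lit 16) i) (.lit j)) e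

infixr:60 " ;; " => WordRAM.Prog.seq

/-- Evaluation over the natural numbers, without reduction. -/
def Op.val : Op → ℕ → ℕ → ℕ
  | .add, a, b => a + b
  | .sub, a, b => a - b
  | .mul, a, b => a * b
  | .div, a, b => a / b
  | .mod, a, b => a % b
  | .lt, a, b => if a < b then 1 else 0
  | .eq, a, b => if a = b then 1 else 0

def Expr.val (s : State) : Expr → ℕ
  | .lit c => c
  | .reg r => s.reg r
  | .load a => s.mem (a.val s)
  | .op o a b => o.val (a.val s) (b.val s)

/-- No literal, sum or product in the evaluation reaches `N`. -/
def Expr.Ok (N : ℕ) (s : State) : Expr → Prop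
  | .lit c => c < N
  | .reg _ => True
  | .load a => a.Ok N s
  | .op .add a b => a.Ok N s ∧ b.Ok N s ∧ a.val s + b.val s < N
  | .op .mul a b => a.Ok N s ∧ b.Ok N s ∧ a.val s * b.val s < N
  | .op .lt a b => a.Ok N s ∧ b.Ok N s ∧ 1 < N
  | .op .eq a b => a.Ok N s ∧ b.Ok N s ∧ 1 < N
  | .op _ a b => a.Ok N s ∧ b.Ok N s

/-- Without overflow the reductions modulo `2 ^ w` do nothing. Differences, quotients and remainders
are never reduced, so they need no bound of their own. -/
theorem Expr.eval_eq_val {w : ℕ} {s : State} : ∀ {e : Expr}, e.Ok (2 ^ w) s → e.eval w s = e.val s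
  | .lit _, h => Nat.mod_eq_of_lt h
  | .reg _, _ => rfl
  | .load a, h => by
      have := Expr.eval_eq_val (e := a) h
      simp only [Expr.eval, Expr.val, this]
  | .op o a b, h => by
      cases o <;> simp only [Expr.Ok] at h <;>
        simp only [Expr.eval, Expr.val, Expr.eval_eq_val h.1] <;>
        first
        | rw [Expr.eval_eq_val h.2.1]
        | rw [Expr.eval_eq_val h.2]
      · exact Nat.mod_eq_of_lt h.2.2
      · rfl
      · exact Nat.mod_eq_of_lt h.2.2
      · rfl
      · rfl
      · simp only [Op.eval, Op.val]
        exact Nat.mod_eq_of_lt (by split_ifs <;> omega)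
      · simp only [Op.eval, Op.val]
        exact Nat.mod_eq_of_lt (by split_ifs <;> omega)

noncomputable def State.setArr (s : State) (j i v : ℕ) : State := s.setMem (16 * i + j) v

/-- The content of the sixteen interleaved arrays. -/
def State.arr (s : State) (j i : ℕ) : ℕ := s.mem (16 * i + j)

def State.draw (s : State) (r v : ℕ) : State := { s.setReg r v with draws := s.draws + 1 }

section Simp

variable (s : State) (N j j' i i' r r' v : ℕ) (a b e : Expr)

@[simp] theorem val_ofNat (c : ℕ) : (no_index (OfNat.ofNat c) : Expr).val s = c := rfl
@[simp] theorem val_lit : (Expr.lit i).val s = i := rfl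
@[simp] theorem val_reg : (Expr.reg r).val s = s.reg r := rfl
@[simp] theorem val_add : (a + b).val s = a.val s + b.val s := rfl
@[simp] theorem val_sub : (a - b).val s = a.val s - b.val s := rfl
@[simp] theorem val_mul : (a * b).val s = a.val s * b.val s := rfl
@[simp] theorem val_div : (a / b).val s = a.val s / b.val s := rfl
@[simp] theorem val_mod : (a % b).val s = a.val s % b.val s := rfl
@[simp] theorem val_less : (a.less b).val s = if a.val s < b.val s then 1 else 0 := rfl
@[simp] theorem val_same : (a.same b).val s = if a.val s = b.val s then 1 else 0 := rfl
@[simp] theorem val_cell : (Expr.cell j a).val s = s.arr j (a.val s) := rfl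

@[simp] theorem ok_ofNat (c : ℕ) : (no_index (OfNat.ofNat c) : Expr).Ok N s ↔ c < N := Iff.rfl
@[simp] theorem ok_lit : (Expr.lit i).Ok N s ↔ i < N := Iff.rfl
@[simp] theorem ok_reg : (Expr.reg r).Ok N s ↔ True := Iff.rfl
@[simp] theorem ok_add : (a + b).Ok N s ↔ a.Ok N s ∧ b.Ok N s ∧ a.val s + b.val s < N := Iff.rfl
@[simp] theorem ok_sub : (a - b).Ok N s ↔ a.Ok N s ∧ b.Ok N s := Iff.rfl
@[simp] theorem ok_mul : (a * b).Ok N s ↔ a.Ok N s ∧ b.Ok N s ∧ a.val s * b.val s < N := Iff.rfl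
@[simp] theorem ok_div : (a / b).Ok N s ↔ a.Ok N s ∧ b.Ok N s := Iff.rfl
@[simp] theorem ok_mod : (a % b).Ok N s ↔ a.Ok N s ∧ b.Ok N s := Iff.rfl
@[simp] theorem ok_less : (a.less b).Ok N s ↔ a.Ok N s ∧ b.Ok N s ∧ 1 < N := Iff.rfl
@[simp] theorem ok_same : (a.same b).Ok N s ↔ a.Ok N s ∧ b.Ok N s ∧ 1 < N := Iff.rfl
@[simp] theorem ok_cell : (Expr.cell j a).Ok N s ↔
    (16 < N ∧ a.Ok N s ∧ 16 * a.val s < N) ∧ j < N ∧ 16 * a.val s + j < N := Iff.rfl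

@[simp] theorem setReg_reg : (s.setReg r v).reg r' = if r' = r then v else s.reg r' := by
  simp [State.setReg, Function.update_apply]
@[simp] theorem setReg_mem : (s.setReg r v).mem = s.mem := rfl
@[simp] theorem setReg_arr : (s.setReg r v).arr = s.arr := rfl
@[simp] theorem setReg_draws : (s.setReg r v).draws = s.draws := rfl
@[simp] theorem draw_reg : (s.draw r v).reg r' = if r' = r then v else s.reg r' := by
  simp [State.draw, State.setReg, Function.update_apply]
@[simp] theorem draw_mem : (s.draw r v).mem = s.mem := rfl
@[simp] theorem draw_arr : (s.draw r v).arr = s.arr := rfl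
@[simp] theorem draw_draws : (s.draw r v).draws = s.draws + 1 := rfl
@[simp] theorem setArr_reg : (s.setArr j i v).reg = s.reg := rfl
@[simp] theorem setArr_draws : (s.setArr j i v).draws = s.draws := rfl
@[simp] theorem setMem_reg : (s.setMem i v).reg = s.reg := rfl
@[simp] theorem setMem_draws : (s.setMem i v).draws = s.draws := rfl
@[simp] theorem setMem_mem : (s.setMem i v).mem i' = if i' = i then v else s.mem i' := by
  simp [State.setMem, Finsupp.update_apply]

/-- For `j < 16` the address `16 * i + j` determines both `i` and `j`, so the interleaved arrays do
not interfere although all of them are unbounded. -/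
theorem setArr_arr (hj : j < 16) (hj' : j' < 16) :
    (s.setArr j i v).arr j' i' = if j' = j ∧ i' = i then v else s.arr j' i' := by
  simp only [State.setArr, State.arr, setMem_mem]
  have : 16 * i' + j' = 16 * i + j ↔ j' = j ∧ i' = i := by omega
  simp only [this]

end Simp

/-- `Run N ω p s s' t`: the program `p` started in `s` halts in `s'` after `t` steps, and no number
that occurs reaches `N`. -/
inductive Run (N : ℕ) (ω : Coins) : Prog → State → State → ℕ → Prop
  | skip (s : State) : Run N ω .skip s s 1
  | assign (s : State) (r : ℕ) (e : Expr) (h : e.Ok N s) :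
      Run N ω (.assign r e) s (s.setReg r (e.val s)) (e.cost + 1)
  | store (s : State) (a e : Expr) (ha : a.Ok N s) (he : e.Ok N s) :
      Run N ω (.store a e) s (s.setMem (a.val s) (e.val s)) (a.cost + e.cost + 1)
  | rand (s : State) (r : ℕ) (b : Expr) (h : b.Ok N s) :
      Run N ω (.rand r b) s (s.draw r (ω (s.draws, b.val s))) (b.cost + 1)
  | seq {p q : Prog} {s s' s'' : State} {t t' : ℕ}
      (hp : Run N ω p s s' t) (hq : Run N ω q s' s'' t') :
      Run N ω (.seq p q) s s'' (t + t')
  | ite_true {e : Expr} {p q : Prog} {s s' : State} {t : ℕ} (h : e.Ok N s) (he : e.val s ≠ 0)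
      (hp : Run N ω p s s' t) : Run N ω (.ite e p q) s s' (e.cost + 1 + t)
  | ite_false {e : Expr} {p q : Prog} {s s' : State} {t : ℕ} (h : e.Ok N s) (he : e.val s = 0)
      (hq : Run N ω q s s' t) : Run N ω (.ite e p q) s s' (e.cost + 1 + t)
  | while_true {e : Expr} {p : Prog} {s s' s'' : State} {t t' : ℕ} (h : e.Ok N s)
      (he : e.val s ≠ 0) (hp : Run N ω p s s' t) (hw : Run N ω (.while e p) s' s'' t') :
      Run N ω (.while e p) s s'' (e.cost + 1 + t + t')
  | while_false {e : Expr} {p : Prog} {s : State} (h : e.Ok N s) (he : e.val s = 0) :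
      Run N ω (.while e p) s s (e.cost + 1)

theorem Expr.cost_pos : ∀ e : Expr, 0 < e.cost
  | .lit _ => Nat.one_pos
  | .reg _ => Nat.one_pos
  | .load _ => Nat.succ_pos _
  | .op _ _ _ => Nat.succ_pos _

theorem space_setMem_le (s : State) (a v : ℕ) : (s.setMem a v).space ≤ s.space + 1 := by
  classical
  refine (Finset.card_le_card (t := insert a s.mem.support) ?_).trans (Finset.card_insert_le _ _)
  intro b hb
  simp only [State.setMem, Finsupp.mem_support_iff, Finsupp.update_apply] at hb
  simp only [Finset.mem_insert, Finsupp.mem_support_iff]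
  split_ifs at hb with h
  · exact Or.inl h
  · exact Or.inr hb

/-- A step fills at most one new cell, so the cells in use never exceed those at the start plus the
elapsed time. This spares `Run` any space bookkeeping. -/
theorem Run.exec {w : ℕ} {ω : Coins} {p : Prog} {s s' : State} {t : ℕ}
    (h : Run (2 ^ w) ω p s s' t) :
    s'.space ≤ s.space + t ∧ ∀ S : ℝ, (s.space : ℝ) + t ≤ S → Exec w ω S p s s' t := by
  induction h with
  | skip s => exact ⟨by simp, fun S hS => .skip s (by push_cast at hS; linarith)⟩
  | assign s r e h =>
    refine ⟨by simp [State.space], fun S hS => ?_⟩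
    rw [← Expr.eval_eq_val h]
    exact .assign s r e (le_trans (by simp; positivity) hS)
  | store s a e ha he =>
    have := space_setMem_le s (a.val s) (e.val s)
    refine ⟨by omega, fun S hS => ?_⟩
    rw [← Expr.eval_eq_val ha, ← Expr.eval_eq_val he]
    have h2 := space_setMem_le s (a.eval w s) (e.eval w s)
    refine .store s a e (le_trans (by simp; positivity) hS) (le_trans ?_ hS)
    have h3 := a.cost_pos
    exact_mod_cast h2.trans (by omega)
  | rand s r b h =>
    refine ⟨by simp [State.space], fun S hS => ?_⟩
    rw [← Expr.eval_eq_val h]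
    exact .rand s r b (le_trans (by simp; positivity) hS)
  | seq _ _ hp hq =>
    refine ⟨by omega, fun S hS => .seq (hp.2 S ?_) (hq.2 S ?_)⟩
    · exact le_trans (by push_cast; linarith) hS
    · refine le_trans ?_ hS
      exact_mod_cast (by omega)
  | ite_true h he _ hp =>
    refine ⟨by omega, fun S hS => ?_⟩
    rw [← Expr.eval_eq_val h] at he
    exact .ite_true he (hp.2 S (le_trans (by push_cast; linarith) hS))
  | ite_false h he _ hp =>
    refine ⟨by omega, fun S hS => ?_⟩
    rw [← Expr.eval_eq_val h] at he
    exact .ite_false he (hp.2 S (le_trans (by push_cast; linarith) hS))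
  | while_true h he _ _ hp hq =>
    refine ⟨by omega, fun S hS => ?_⟩
    rw [← Expr.eval_eq_val h] at he
    refine .while_true he (hp.2 S (le_trans (by push_cast; linarith) hS)) (hq.2 S (le_trans ?_ hS))
    exact_mod_cast (by omega)
  | while_false h he =>
    refine ⟨by omega, fun S hS => ?_⟩
    rw [← Expr.eval_eq_val h] at he
    exact .while_false he (le_trans (by simp; positivity) hS)

/-- The program does not write to the memory. -/
def Prog.NoStore : Prog → Prop
  | .skip => True
  | .assign _ _ => True
  | .store _ _ => False
  | .rand _ _ => True
  | .seq p q => p.NoStore ∧ q.NoStore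
  | .ite _ p q => p.NoStore ∧ q.NoStore
  | .while _ p => p.NoStore

/-- Needed for the search of the prime modulus: it may take far longer than the space bound, but it
works in registers only. -/
theorem Run.exec_noStore {w : ℕ} {ω : Coins} {p : Prog} {s s' : State} {t : ℕ}
    (h : Run (2 ^ w) ω p s s' t) (hp : p.NoStore) :
    s'.mem = s.mem ∧ ∀ S : ℝ, (s.space : ℝ) ≤ S → Exec w ω S p s s' t := by
  induction h with
  | skip s => exact ⟨rfl, fun S hS => .skip s hS⟩
  | assign s r e h =>
    refine ⟨rfl, fun S hS => ?_⟩
    rw [← Expr.eval_eq_val h]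
    exact .assign s r e hS
  | store s a e ha he => exact hp.elim
  | rand s r b h =>
    refine ⟨rfl, fun S hS => ?_⟩
    rw [← Expr.eval_eq_val h]
    exact .rand s r b hS
  | seq _ _ h1 h2 =>
    refine ⟨(h2 hp.2).1.trans (h1 hp.1).1, fun S hS => .seq ((h1 hp.1).2 S hS) ((h2 hp.2).2 S ?_)⟩
    rwa [State.space, (h1 hp.1).1]
  | ite_true h he _ h1 =>
    refine ⟨(h1 hp.1).1, fun S hS => ?_⟩
    rw [← Expr.eval_eq_val h] at he
    exact .ite_true he ((h1 hp.1).2 S hS)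
  | ite_false h he _ h1 =>
    refine ⟨(h1 hp.2).1, fun S hS => ?_⟩
    rw [← Expr.eval_eq_val h] at he
    exact .ite_false he ((h1 hp.2).2 S hS)
  | while_true h he _ _ h1 h2 =>
    refine ⟨(h2 hp).1.trans (h1 hp).1, fun S hS => ?_⟩
    rw [← Expr.eval_eq_val h] at he
    refine .while_true he ((h1 hp).2 S hS) ((h2 hp).2 S ?_)
    rwa [State.space, (h1 hp).1]
  | while_false h he =>
    refine ⟨rfl, fun S hS => ?_⟩
    rw [← Expr.eval_eq_val h] at he
    exact .while_false he hS

/-! ### Programs without loops -/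

/-- The final state of a program without loops. -/
noncomputable def Prog.den (ω : Coins) : Prog → State → State
  | .skip, s => s
  | .assign r e, s => s.setReg r (e.val s)
  | .store a e, s => s.setMem (a.val s) (e.val s)
  | .rand r b, s => s.draw r (ω (s.draws, b.val s))
  | .seq p q, s => q.den ω (p.den ω s)
  | .ite e p q, s => if e.val s ≠ 0 then p.den ω s else q.den ω s
  | .while _ _, s => s

/-- The program meets no loop and no overflow. -/
def Prog.Safe (N : ℕ) (ω : Coins) : Prog → State → Prop
  | .skip, _ => True
  | .assign _ e, s => e.Ok N s
  | .store a e, s => a.Ok N s ∧ e.Ok N s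
  | .rand _ b, s => b.Ok N s
  | .seq p q, s => p.Safe N ω s ∧ q.Safe N ω (p.den ω s)
  | .ite e p q, s => e.Ok N s ∧ (e.val s ≠ 0 → p.Safe N ω s) ∧ (e.val s = 0 → q.Safe N ω s)
  | .while _ _, _ => False

/-- The value for loops is a dummy; it is harmless because `Safe` excludes them. -/
def Prog.maxCost : Prog → ℕ
  | .skip => 1
  | .assign _ e => e.cost + 1
  | .store a e => a.cost + e.cost + 1
  | .rand _ b => b.cost + 1
  | .seq p q => p.maxCost + q.maxCost
  | .ite e p q => e.cost + 1 + max p.maxCost q.maxCost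
  | .while _ _ => 0

theorem Prog.Safe.run {N : ℕ} {ω : Coins} : ∀ {p : Prog} {s : State}, p.Safe N ω s →
    ∃ t ≤ p.maxCost, Run N ω p s (p.den ω s) t
  | .skip, s, _ => ⟨_, le_rfl, .skip s⟩
  | .assign r e, s, h => ⟨_, le_rfl, .assign s r e h⟩
  | .store a e, s, h => ⟨_, le_rfl, .store s a e h.1 h.2⟩
  | .rand r b, s, h => ⟨_, le_rfl, .rand s r b h⟩
  | .seq p q, s, h => by
      obtain ⟨t, ht, h1⟩ := Prog.Safe.run h.1
      obtain ⟨t', ht', h2⟩ := Prog.Safe.run h.2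
      exact ⟨_, Nat.add_le_add ht ht', .seq h1 h2⟩
  | .ite e p q, s, h => by
      by_cases he : e.val s = 0
      · obtain ⟨t, ht, h1⟩ := Prog.Safe.run (h.2.2 he)
        have h2 : Prog.den ω (.ite e p q) s = q.den ω s := if_neg (not_not.2 he)
        rw [h2]
        refine ⟨_, ?_, Run.ite_false h.1 he h1⟩
        simp only [Prog.maxCost]
        omega
      · obtain ⟨t, ht, h1⟩ := Prog.Safe.run (h.2.1 he)
        have h2 : Prog.den ω (.ite e p q) s = p.den ω s := if_pos he
        rw [h2]
        refine ⟨_, ?_, Run.ite_true h.1 he h1⟩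
        simp only [Prog.maxCost]
        omega
  | .while e p, s, h => h.elim

section Simp

variable (ω : Coins) (N : ℕ) (s : State) (r j : ℕ) (a b e : Expr) (p q : Prog)

@[simp] theorem den_skip : Prog.den ω .skip s = s := rfl
@[simp] theorem den_assign : Prog.den ω (.assign r e) s = s.setReg r (e.val s) := rfl
@[simp] theorem den_store : Prog.den ω (.store a e) s = s.setMem (a.val s) (e.val s) := rfl
@[simp] theorem den_put : Prog.den ω (.put j a e) s = s.setArr j (a.val s) (e.val s) := rfl
@[simp] theorem den_rand : Prog.den ω (.rand r b) s = s.draw r (ω (s.draws, b.val s)) := rfl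
@[simp] theorem den_seq : Prog.den ω (p ;; q) s = q.den ω (p.den ω s) := rfl
@[simp] theorem den_ite :
    Prog.den ω (.ite e p q) s = if e.val s ≠ 0 then p.den ω s else q.den ω s := rfl
@[simp] theorem safe_skip : Prog.Safe N ω .skip s ↔ True := Iff.rfl
@[simp] theorem safe_assign : Prog.Safe N ω (.assign r e) s ↔ e.Ok N s := Iff.rfl
@[simp] theorem safe_store : Prog.Safe N ω (.store a e) s ↔ a.Ok N s ∧ e.Ok N s := Iff.rfl
@[simp] theorem safe_put : Prog.Safe N ω (.put j a e) s ↔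
    ((16 < N ∧ a.Ok N s ∧ 16 * a.val s < N) ∧ j < N ∧ 16 * a.val s + j < N) ∧ e.Ok N s := Iff.rfl
@[simp] theorem safe_rand : Prog.Safe N ω (.rand r b) s ↔ b.Ok N s := Iff.rfl
@[simp] theorem safe_seq :
    Prog.Safe N ω (p ;; q) s ↔ p.Safe N ω s ∧ q.Safe N ω (p.den ω s) := Iff.rfl
@[simp] theorem safe_ite : Prog.Safe N ω (.ite e p q) s ↔
    e.Ok N s ∧ (e.val s ≠ 0 → p.Safe N ω s) ∧ (e.val s = 0 → q.Safe N ω s) := Iff.rfl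

end Simp

/-! ### Program logic -/

/-- Started in `s`, the program `p` halts after at most `T` steps in a state with property `Q`. -/
def Runs (N : ℕ) (ω : Coins) (p : Prog) (s : State) (T : ℕ) (Q : State → Prop) : Prop :=
  ∃ s' t, Run N ω p s s' t ∧ t ≤ T ∧ Q s'

section Logic

variable {N : ℕ} {ω : Coins} {p q : Prog} {s : State} {T T' : ℕ} {Q R : State → Prop}

theorem Runs.mono (h : Runs N ω p s T Q) (hT : T ≤ T') (hQ : ∀ s', Q s' → R s') :
    Runs N ω p s T' R := by
  obtain ⟨s', t, h1, h2, h3⟩ := h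
  exact ⟨s', t, h1, h2.trans hT, hQ _ h3⟩

/-- For code without loops, safety and final state come from simplification and the cost from
evaluation; this reduces every straight-line piece below to arithmetic. -/
theorem Runs.block (hs : p.Safe N ω s) (hT : p.maxCost ≤ T) (hQ : Q (p.den ω s)) :
    Runs N ω p s T Q := by
  obtain ⟨t, ht, h⟩ := hs.run
  exact ⟨_, t, h, ht.trans hT, hQ⟩

theorem Runs.seq (hp : Runs N ω p s T R) (hq : ∀ s', R s' → Runs N ω q s' T' Q) :
    Runs N ω (p ;; q) s (T + T') Q := by
  obtain ⟨s', t, h1, h2, h3⟩ := hp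
  obtain ⟨s'', t', h4, h5, h6⟩ := hq _ h3
  exact ⟨s'', _, .seq h1 h4, Nat.add_le_add h2 h5, h6⟩

theorem Runs.ite {e : Expr} (he : e.Ok N s) (hp : e.val s ≠ 0 → Runs N ω p s T Q)
    (hq : e.val s = 0 → Runs N ω q s T Q) : Runs N ω (.ite e p q) s (e.cost + 1 + T) Q := by
  by_cases h : e.val s = 0
  · obtain ⟨s', t, h1, h2, h3⟩ := hq h
    exact ⟨s', _, .ite_false he h h1, by omega, h3⟩
  · obtain ⟨s', t, h1, h2, h3⟩ := hp h
    exact ⟨s', _, .ite_true he h h1, by omega, h3⟩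

/-- A loop whose steps are paid for by the potential `Φ`. -/
theorem Runs.while {e : Expr} (Inv : State → Prop) (Φ : State → ℕ) (hI : Inv s)
    (he : ∀ s, Inv s → e.Ok N s)
    (hp : ∀ s, Inv s → e.val s ≠ 0 → ∃ T, Runs N ω p s T
      fun s' => Inv s' ∧ Φ s' + T + e.cost + 1 ≤ Φ s) :
    Runs N ω (.while e p) s (Φ s + e.cost + 1) fun s' => Inv s' ∧ e.val s' = 0 := by
  induction h : Φ s using Nat.strong_induction_on generalizing s with
  | _ n ih =>
    by_cases h0 : e.val s = 0
    · exact ⟨s, _, .while_false (he s hI) h0, by omega, hI, h0⟩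
    · obtain ⟨T, s', t, h1, h2, h3, h4⟩ := hp s hI h0
      obtain ⟨s'', t', h5, h6, h7⟩ := ih (Φ s') (by omega) h3 rfl
      exact ⟨s'', _, .while_true (he s hI) h0 h1 h5, by omega, h7⟩

/-- A loop with at most `n` rounds of at most `T` steps each. -/
theorem Runs.for {e : Expr} {n : ℕ} (Inv : ℕ → State → Prop) (hI : Inv n s)
    (he : ∀ i s, Inv i s → e.Ok N s)
    (hp : ∀ i s, Inv i s → e.val s ≠ 0 → ∃ j < i, Runs N ω p s T (Inv j)) :
    Runs N ω (.while e p) s (n * (T + e.cost + 1) + e.cost + 1)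
      fun s' => ∃ i, Inv i s' ∧ e.val s' = 0 := by
  induction n using Nat.strong_induction_on generalizing s with
  | _ n ih =>
    by_cases h0 : e.val s = 0
    · exact ⟨s, _, .while_false (he n s hI) h0, by omega, n, hI, h0⟩
    · obtain ⟨j, hj, s', t, h1, h2, h3⟩ := hp n s hI h0
      obtain ⟨s'', t', h5, h6, h7⟩ := ih j hj h3
      refine ⟨s'', _, .while_true (he n s hI) h0 h1 h5, ?_, h7⟩
      have : (j + 1) * (T + e.cost + 1) ≤ n * (T + e.cost + 1) := Nat.mul_le_mul_right _ hj
      rw [add_one_mul] at this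
      omega

end Logic

end WordRAM

namespace KCover

/-! ### Doubly linked lists in arrays -/

/-- The successor of `x` in a list, `0` if there is none. -/
def nxt : List ℕ → ℕ → ℕ
  | a :: b :: l, x => if x = a then b else nxt (b :: l) x
  | _, _ => 0

/-- The pointer `0` stands for the head `h`. -/
def deref (h p : ℕ) : ℕ := if p = 0 then h else p

theorem nxt_of_notMem {x : ℕ} : ∀ {l : List ℕ}, x ∉ l → nxt l x = 0
  | [], _ => rfl
  | [_], _ => rfl
  | a :: b :: l, h => by
      simp only [List.mem_cons, not_or] at h
      rw [nxt, if_neg h.1]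
      exact nxt_of_notMem (by simp [h.2])

theorem nxt_append_cons {y : ℕ} (B : List ℕ) :
    ∀ {A : List ℕ}, y ∉ A → nxt (A ++ y :: B) y = B.headD 0
  | [], _ => by cases B <;> simp [nxt]
  | [a], h => by
      simp only [List.mem_singleton] at h
      simp only [List.singleton_append, nxt, if_neg h]
      exact nxt_append_cons (A := []) B (by simp)
  | a :: b :: A, h => by
      simp only [List.mem_cons, not_or] at h
      simp only [List.cons_append, nxt, if_neg h.1]
      exact nxt_append_cons (A := b :: A) B (by simp [h.2])

theorem nxt_cons_of_ne {a z : ℕ} {l : List ℕ} (h : z ≠ a) : nxt (a :: l) z = nxt l z := by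
  cases l with
  | nil => rfl
  | cons b l => rw [nxt, if_neg h]

theorem nxt_cons_self {a : ℕ} (l : List ℕ) : nxt (a :: l) a = l.headD 0 :=
  nxt_append_cons (A := []) l (by simp)

theorem nxt_remove {a y z : ℕ} {B : List ℕ} :
    ∀ {A : List ℕ}, (A ++ a :: y :: B).Nodup → nxt (A ++ a :: B) z =
      if z = y then 0 else if z = a then B.headD 0 else nxt (A ++ a :: y :: B) z
  | [], h => by
      simp only [List.nil_append, List.nodup_cons, List.mem_cons, not_or] at h
      simp only [List.nil_append]
      split_ifs with h1 h2
      · subst h1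
        exact nxt_of_notMem (by simp [Ne.symm h.1.1, h.2.1])
      · subst h2
        exact nxt_cons_self B
      · rw [nxt_cons_of_ne h2, nxt_cons_of_ne h2, nxt_cons_of_ne h1]
  | c :: A, h => by
      have ih := nxt_remove (z := z) (List.nodup_cons.1 h).2
      have hc : c ∉ A ++ a :: y :: B := (List.nodup_cons.1 h).1
      simp only [List.mem_append, List.mem_cons, not_or] at hc
      by_cases hz : z = c
      · subst hz
        rw [if_neg hc.2.2.1, if_neg hc.2.1]
        cases A <;> simp only [List.cons_append, List.nil_append, nxt, if_true]
      · simp only [List.cons_append, nxt_cons_of_ne hz, ih]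

theorem nxt_concat {a x z : ℕ} :
    ∀ {A : List ℕ}, (A ++ [a, x]).Nodup →
      nxt (A ++ [a, x]) z = if z = a then x else nxt (A ++ [a]) z
  | [], h => by simp [nxt]
  | c :: A, h => by
      have ih := nxt_concat (z := z) (List.nodup_cons.1 h).2
      have hc : c ∉ A ++ [a, x] := (List.nodup_cons.1 h).1
      simp only [List.mem_append, List.mem_cons, not_or] at hc
      by_cases hz : z = c
      · subst hz
        rw [if_neg hc.2.1]
        cases A <;> simp only [List.cons_append, List.nil_append, nxt, if_true]
      · simp only [List.cons_append, nxt_cons_of_ne hz, ih]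

/-- A backward pointer of the first member is `0`, the default of `headD`. Reading it as the head
`h` yields the true last cell before the split in either case. -/
theorem deref_headD_reverse (h : ℕ) {A : List ℕ} (h0 : 0 ∉ A) :
    ∃ A', h :: A = A' ++ [deref h (A.reverse.headD 0)] := by
  rcases List.eq_nil_or_concat A with rfl | ⟨A', a, rfl⟩
  · exact ⟨[], by simp [deref]⟩
  · refine ⟨h :: A', ?_⟩
    have : a ≠ 0 := by rintro rfl; simp at h0
    simp [deref, this]

/-- Unlinking: the predecessor inherits the successor of `y`. The predecessor is found as the
successor of `y` in the reversed list. -/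
theorem nxt_erase {h y : ℕ} {L : List ℕ} (hL : (h :: L).Nodup) (h0 : 0 ∉ L) (hy : y ∈ L) (z : ℕ) :
    nxt (h :: L.erase y) z = if z = y then 0
      else if z = deref h (nxt (h :: L.reverse) y) then nxt (h :: L) y else nxt (h :: L) z := by
  obtain ⟨A, B, rfl⟩ := List.append_of_mem hy
  have hyA : y ∉ A := fun hA => by
    have := (List.nodup_cons.1 hL).2
    rw [List.nodup_append] at this
    exact this.2.2 y hA y (by simp) rfl
  have hyB : y ∉ B := fun hB => by
    have := (List.nodup_cons.1 hL).2.of_append_right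
    exact (List.nodup_cons.1 this).1 hB
  have hyh : y ≠ h := fun e => (List.nodup_cons.1 hL).1 (by simp [e])
  have e1 : (A ++ y :: B).erase y = A ++ B := by
    rw [List.erase_append_right _ hyA, List.erase_cons_head]
  have e2 : nxt (h :: (A ++ y :: B)) y = B.headD 0 :=
    nxt_append_cons (A := h :: A) B (by simp [hyh, hyA])
  have e3 : nxt (h :: (A ++ y :: B).reverse) y = A.reverse.headD 0 := by
    have := nxt_append_cons (A := h :: B.reverse) (y := y) A.reverse (by simp [hyh, hyB])
    simpa using this
  obtain ⟨A', hA'⟩ := deref_headD_reverse h (A := A) (fun hA => h0 (by simp [hA]))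
  rw [e1, e2, e3, ← List.cons_append, ← List.cons_append, hA']
  have := nxt_remove (A := A') (a := deref h (A.reverse.headD 0)) (y := y) (B := B) (z := z) (by
    rw [← List.cons_append, hA'] at hL
    simpa using hL)
  simpa using this

theorem nxt_push {h x z : ℕ} {L : List ℕ} (hx : x ≠ h) :
    nxt (h :: x :: L) z = if z = x then nxt (h :: L) h else if z = h then x
      else nxt (h :: L) z := by
  split_ifs with h1 h2
  · subst h1
    rw [nxt_cons_of_ne hx, nxt_cons_self, nxt_cons_self]
  · subst h2
    rw [nxt_cons_self]
    rfl
  · rw [nxt_cons_of_ne h2, nxt_cons_of_ne h1, nxt_cons_of_ne h2]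

theorem nxt_push_reverse {h x z : ℕ} {L : List ℕ} (hL : (h :: x :: L).Nodup) (h0 : 0 ∉ L) :
    nxt (h :: (x :: L).reverse) z =
      if z = deref h (nxt (h :: L) h) then x else nxt (h :: L.reverse) z := by
  rw [nxt_cons_self]
  obtain ⟨A', hA'⟩ := deref_headD_reverse h (A := L.reverse) (by simpa using h0)
  rw [List.reverse_reverse] at hA'
  rw [List.reverse_cons, ← List.cons_append, hA']
  have := nxt_concat (A := A') (a := deref h (L.headD 0)) (x := x) (z := z) (by
    have h1 : (h :: L.reverse ++ [x]).Nodup := by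
      refine (List.Perm.nodup_iff ?_).1 hL
      rw [List.cons_append]
      refine List.Perm.cons _ ?_
      rw [← List.reverse_cons]
      exact (List.reverse_perm _).symm
    rw [hA'] at h1
    simpa using h1)
  simpa using this

/-- The arrays `nx` and `pv` hold the cyclic doubly linked lists `hd i :: L i`; the cell `z` can
belong to the list `own z` only. -/
structure Dll (nx pv own hd : ℕ → ℕ) (L : ℕ → List ℕ) : Prop where
  nx_eq : ∀ z, nx z = nxt (hd (own z) :: L (own z)) z
  pv_eq : ∀ z, pv z = nxt (hd (own z) :: (L (own z)).reverse) z

/-- Backward pointers are forward pointers of the reversed list, so both halves of the unlinking are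
instances of `nxt_erase`. The cleared pointers of `y` matter for the space bound. -/
theorem Dll.erase {nx pv own hd : ℕ → ℕ} {L : ℕ → List ℕ} (H : Dll nx pv own hd L) {i y : ℕ}
    (hi : own y = i) (hh : own (hd i) = i) (hx : ∀ x ∈ L i, own x = i)
    (hL : (hd i :: L i).Nodup) (h0 : 0 ∉ L i) (hy : y ∈ L i) :
    Dll (fun z => if z = y then 0 else if z = deref (hd i) (pv y) then nx y else nx z)
      (fun z => if z = y then 0 else if z = deref (hd i) (nx y) then pv y else pv z) own hd
      (Function.update L i ((L i).erase y)) := by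
  have hn : nx y = nxt (hd i :: L i) y := by rw [H.nx_eq, hi]
  have hp : pv y = nxt (hd i :: (L i).reverse) y := by rw [H.pv_eq, hi]
  -- A pointer read at `y` leads to the head or to a member of list `i`, so the cell that gets
  -- rewritten belongs to list `i` and all other lists stay intact.
  have key : ∀ (M : List ℕ) (p : ℕ), (∀ x ∈ M, own x = i) → p = nxt (hd i :: M) y →
      own (deref (hd i) p) = i := by
    intro M p hM hp
    unfold deref
    split_ifs with h
    · exact hh
    · have : p ∈ M := by
        have : ∀ (l : List ℕ) (a : ℕ), nxt (a :: l) y ≠ 0 → nxt (a :: l) y ∈ l := by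
          intro l
          induction l with
          | nil => intro a h; exact absurd rfl h
          | cons b l ih =>
            intro a h
            rw [nxt] at h ⊢
            split_ifs at h ⊢ with h1
            · simp
            · exact List.mem_cons_of_mem _ (ih b h)
        rw [hp] at h ⊢
        exact this _ _ h
      exact hM _ this
  constructor
  · intro z
    by_cases hz : own z = i
    · rw [hz, Function.update_self, nxt_erase hL h0 hy, ← hn, ← hp, H.nx_eq z, hz]
    · rw [Function.update_of_ne hz, if_neg (fun e : z = _ => hz (e ▸ hi)), if_neg, H.nx_eq]
      rintro rfl
      exact hz (key (L i).reverse _ (by simpa using hx) hp)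
  · intro z
    by_cases hz : own z = i
    · have e : ((L i).erase y).reverse = (L i).reverse.erase y := by
        have h1 := (List.nodup_cons.1 hL).2
        rw [h1.erase_eq_filter, (List.nodup_reverse.2 h1).erase_eq_filter, List.filter_reverse]
      have := nxt_erase (h := hd i) (y := y) (L := (L i).reverse)
        (by simpa using hL) (by simpa using h0) (by simpa using hy) z
      rw [List.reverse_reverse, ← hn, ← hp] at this
      rw [hz, Function.update_self, e, this, H.pv_eq z, hz]
    · rw [Function.update_of_ne hz, if_neg (fun e : z = _ => hz (e ▸ hi)), if_neg, H.pv_eq]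
      rintro rfl
      exact hz (key (L i) _ hx hn)

/-- Inserting in front means appending to the reversed list. Hence the only backward pointer that
changes is that of the former first member, or of the head if the list was empty. -/
theorem Dll.push {nx pv own hd : ℕ → ℕ} {L : ℕ → List ℕ} (H : Dll nx pv own hd L) {i x : ℕ}
    (hi : own x = i) (hh : own (hd i) = i) (hx : ∀ x ∈ L i, own x = i)
    (hL : (hd i :: x :: L i).Nodup) (h0 : 0 ∉ L i) :
    Dll (fun z => if z = x then nx (hd i) else if z = hd i then x else nx z)
      (fun z => if z = deref (hd i) (nx (hd i)) then x else pv z) own hd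
      (Function.update L i (x :: L i)) := by
  have hn : nx (hd i) = nxt (hd i :: L i) (hd i) := by rw [H.nx_eq, hh]
  have hxh : x ≠ hd i := fun e => (List.nodup_cons.1 hL).1 (by simp [e])
  constructor
  · intro z
    by_cases hz : own z = i
    · rw [hz, Function.update_self, nxt_push hxh, hn, H.nx_eq z, hz]
    · rw [Function.update_of_ne hz, if_neg (fun e : z = _ => hz (e ▸ hi)),
        if_neg (fun e : z = _ => hz (e ▸ hh)), H.nx_eq]
  · intro z
    by_cases hz : own z = i
    · rw [hz, Function.update_self, nxt_push_reverse hL h0, hn, H.pv_eq z, hz]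
    · rw [Function.update_of_ne hz, if_neg, H.pv_eq]
      rintro rfl
      apply hz
      rw [hn, nxt_cons_self]
      unfold deref
      split_ifs with h
      · exact hh
      · cases hl : L i with
        | nil => simp [hl] at h
        | cons a l => exact hx _ (by simp [hl])

/-! ### The list of recent edges -/

/-- Positions are counted from `1`, the argument is the reversed stream. -/
def lastTime : List ℕ → ℕ → ℕ
  | [], _ => 0
  | y :: ρ, x => if x = y then ρ.length + 1 else lastTime ρ x

/-- The distinct edges among the last `W` items, the most recent ones first. -/
def recency (W : ℕ) : List ℕ → List ℕ
  | [] => []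
  | y :: ρ => y :: (recency W ρ).filter fun x => x ≠ y ∧ ρ.length + 1 < lastTime ρ x + W

theorem lastTime_le (x : ℕ) : ∀ ρ : List ℕ, lastTime ρ x ≤ ρ.length
  | [] => le_rfl
  | y :: ρ => by
      have := lastTime_le x ρ
      simp only [lastTime, List.length_cons]
      split_ifs <;> omega

theorem mem_take_iff_lastTime (x : ℕ) :
    ∀ (ρ : List ℕ) (j : ℕ), x ∈ ρ.take j ↔ x ∈ ρ ∧ ρ.length < lastTime ρ x + j
  | [], j => by simp
  | y :: ρ, 0 => by
      have := lastTime_le x (y :: ρ)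
      simp only [List.take_zero, List.not_mem_nil, false_iff, not_and]
      omega
  | y :: ρ, j + 1 => by
      have := mem_take_iff_lastTime x ρ j
      simp only [List.take_succ_cons, List.mem_cons, this, lastTime, List.length_cons]
      by_cases h : x = y
      · simp [h]
      · simp only [h, false_or, if_false]
        constructor <;> rintro ⟨h1, h2⟩ <;> exact ⟨h1, by omega⟩

theorem mem_recency {W : ℕ} (hW : 1 ≤ W) (x : ℕ) :
    ∀ ρ : List ℕ, x ∈ recency W ρ ↔ x ∈ ρ.take W
  | [] => by simp [recency]
  | y :: ρ => by
      have ih := mem_recency hW x ρ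
      obtain ⟨W, rfl⟩ := Nat.exists_eq_add_of_le' hW
      rw [mem_take_iff_lastTime] at ih
      simp only [recency, List.take_succ_cons, List.mem_cons, List.mem_filter, ih,
        mem_take_iff_lastTime x ρ W, decide_eq_true_eq]
      constructor
      · rintro (h | ⟨⟨h1, h2⟩, h3, h4⟩)
        · exact Or.inl h
        · exact Or.inr ⟨h1, by omega⟩
      · rintro (h | ⟨h1, h2⟩)
        · exact Or.inl h
        · by_cases h : x = y
          · exact Or.inl h
          · exact Or.inr ⟨⟨h1, by omega⟩, h, by omega⟩

theorem nodup_recency (W : ℕ) : ∀ ρ : List ℕ, (recency W ρ).Nodup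
  | [] => List.nodup_nil
  | y :: ρ => by
      rw [recency, List.nodup_cons]
      exact ⟨by simp, (nodup_recency W ρ).filter _⟩

theorem pairwise_recency (W : ℕ) :
    ∀ ρ : List ℕ, (recency W ρ).Pairwise fun a b => lastTime ρ b < lastTime ρ a
  | [] => List.Pairwise.nil
  | y :: ρ => by
      rw [recency, List.pairwise_cons]
      constructor
      · intro b hb
        simp only [List.mem_filter, decide_eq_true_eq] at hb
        have := lastTime_le b ρ
        simp only [lastTime, if_neg hb.2.1, if_true]
        omega
      · refine ((pairwise_recency W ρ).filter _).imp_of_mem fun {a b} ha hb h => ?_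
        simp only [List.mem_filter, decide_eq_true_eq] at ha hb
        simpa only [lastTime, if_neg ha.2.1, if_neg hb.2.1] using h

/-- The edges that are still in the window when the next item has arrived. -/
def unexpired (W : ℕ) (ρ : List ℕ) : List ℕ :=
  (recency W ρ).filter fun x => ρ.length + 1 < lastTime ρ x + W

theorem recency_cons (W y : ℕ) (ρ : List ℕ) :
    recency W (y :: ρ) = y :: (unexpired W ρ).erase y := by
  rw [recency, unexpired, ((nodup_recency W ρ).filter _).erase_eq_filter, List.filter_filter]
  congr 1
  refine List.filter_congr fun x _ => ?_
  by_cases h : x = y <;> simp [h]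

/-- Last occurrences strictly decrease along the list and all lie in the window, so only the final
edge can sit at the oldest position, the one that is about to leave. -/
theorem recency_eq_unexpired {W : ℕ} (hW : 1 ≤ W) (ρ : List ℕ) : recency W ρ = unexpired W ρ ∨
    ∃ y, recency W ρ = unexpired W ρ ++ [y] ∧ ρ.length + 1 = lastTime ρ y + W := by
  have h1 : ∀ x ∈ recency W ρ, ρ.length + 1 ≤ lastTime ρ x + W := fun x hx =>
    ((mem_take_iff_lastTime x ρ W).1 ((mem_recency hW x ρ).1 hx)).2
  have h2 := pairwise_recency W ρ
  unfold unexpired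
  rcases List.eq_nil_or_concat (recency W ρ) with h | ⟨R, y, h⟩
  · exact Or.inl (by simp [h])
  · simp only [h] at h1 h2 ⊢
    have hR : R.filter (fun x => decide (ρ.length + 1 < lastTime ρ x + W)) = R := by
      rw [List.filter_eq_self]
      intro a ha
      rw [List.concat_eq_append, List.pairwise_append] at h2
      have := h2.2.2 a ha y (by simp)
      have := h1 y (by simp)
      simp only [decide_eq_true_eq]
      omega
    by_cases hy : ρ.length + 1 < lastTime ρ y + W
    · exact Or.inl (by simp [hR, hy])
    · refine Or.inr ⟨y, by simp [hR, hy], ?_⟩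
      have := h1 y (by simp)
      omega

end KCover

namespace KCover

/-! ### Truncation and levels -/

/-- The edges in a list with element `e`; the element of the edge code `x` is `x % m`. -/
def atElem (m e : ℕ) (R : List ℕ) : List ℕ := R.filter fun x => x % m = e

/-- At most `D` edges are kept for each element. -/
def trunc (m D : ℕ) (R : List ℕ) : List ℕ :=
  R.filter fun x => x ∈ (atElem m (x % m) R).take D

/-- The edges whose element has level `l`. -/
def atLevel (m : ℕ) (lev : ℕ → ℕ) (l : ℕ) (R : List ℕ) : List ℕ :=
  R.filter fun x => lev (x % m) = l

/-- Put `x` in front of a list, drop the last edge of the element of `x` if there are more than `D`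
of them, and drop the last edge if there are more than `B`. -/
def touch (m D x : ℕ) (K : List ℕ) : List ℕ :=
  if D < (atElem m (x % m) (x :: K.erase x)).length then
    (x :: K.erase x).erase ((atElem m (x % m) (x :: K.erase x)).getLastD 0)
  else x :: K.erase x

def cap (B : ℕ) (K : List ℕ) : List ℕ :=
  if B < K.length then K.erase (K.getLastD 0) else K

theorem filter_mem_take {R : List ℕ} (hR : R.Nodup) (D : ℕ) :
    R.filter (fun x => x ∈ R.take D) = R.take D := by
  conv_lhs => arg 2; rw [← List.take_append_drop D R]
  rw [List.filter_append, List.filter_eq_self.2 (by simp), List.filter_eq_nil_iff.2, List.append_nil]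
  intro a ha
  have := List.disjoint_take_drop hR (le_refl D)
  simp only [decide_eq_true_eq]
  exact fun h => this h ha

theorem atElem_trunc {m D e : ℕ} {R : List ℕ} (hR : R.Nodup) :
    atElem m e (trunc m D R) = (atElem m e R).take D := by
  rw [← filter_mem_take (R := atElem m e R) (hR.filter _) D, atElem, trunc, List.filter_filter]
  conv_rhs => rw [atElem, List.filter_filter]
  refine List.filter_congr fun x _ => ?_
  by_cases h : x % m = e
  · subst h
    rw [Bool.eq_iff_iff]
    simp only [decide_true, Bool.true_and, Bool.and_true, atElem]
    rfl
  · simp [h]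

theorem atElem_atLevel {m e l : ℕ} {lev : ℕ → ℕ} (h : lev e = l) (R : List ℕ) :
    atElem m e (atLevel m lev l R) = atElem m e R := by
  rw [atElem, atLevel, List.filter_filter, atElem]
  refine List.filter_congr fun x _ => ?_
  by_cases hx : x % m = e
  · simp [hx, h]
  · simp [hx]

theorem erase_getLastD {K : List ℕ} (hK : K.Nodup) : K.erase (K.getLastD 0) = K.dropLast := by
  rcases List.eq_nil_or_concat K with rfl | ⟨K, a, rfl⟩
  · rfl
  · have : a ∉ K := fun h => by
      rw [List.concat_eq_append, List.nodup_append] at hK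
      exact hK.2.2 a h a (by simp) rfl
    rw [List.concat_eq_append, List.getLastD_concat, List.erase_append_right _ this]
    simp

theorem take_erase_of_mem {z : ℕ} : ∀ {T : List ℕ} {B : ℕ}, z ∈ T.take B →
    (T.take B).erase z = (T.erase z).take (B - 1)
  | [], _, h => by simp at h
  | a :: T, 0, h => by simp at h
  | a :: T, B + 1, h => by
      by_cases ha : a = z
      · subst ha; simp
      · have h1 : z ∈ T.take B := by
          simpa [Ne.symm ha] using h
        have hB : B ≠ 0 := by rintro rfl; simp at h1
        obtain ⟨B, rfl⟩ := Nat.exists_eq_succ_of_ne_zero hB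
        have := take_erase_of_mem h1
        rw [List.take_succ_cons, List.erase_cons_tail (by simpa using ha),
          List.erase_cons_tail (by simpa using ha), this]
        simp

theorem take_erase_of_notMem {z : ℕ} : ∀ {T : List ℕ} {B : ℕ}, z ∉ T.take B →
    (T.erase z).take B = T.take B
  | [], _, h => by simp
  | a :: T, 0, h => by simp
  | a :: T, B + 1, h => by
      have ha : a ≠ z := by rintro rfl; simp at h
      have h1 : z ∉ T.take B := fun h2 => h (by simp [h2])
      rw [List.erase_cons_tail (by simpa using ha), List.take_succ_cons, List.take_succ_cons,
        take_erase_of_notMem h1]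

theorem atElem_cons_erase {m x : ℕ} {R : List ℕ} (hR : R.Nodup) :
    atElem m (x % m) (x :: R.erase x) = x :: (atElem m (x % m) R).erase x := by
  rw [atElem, List.filter_cons_of_pos (by simp), atElem, hR.erase_eq_filter,
    (hR.filter _).erase_eq_filter, List.filter_filter, List.filter_filter]
  simp [Bool.and_comm]

theorem atElem_cons_erase_of_ne {m x e : ℕ} {R : List ℕ} (h : x % m ≠ e) (hR : R.Nodup) :
    atElem m e (x :: R.erase x) = atElem m e R := by
  rw [atElem, List.filter_cons_of_neg (by simpa using h), atElem, hR.erase_eq_filter,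
    List.filter_filter]
  refine List.filter_congr fun y _ => ?_
  by_cases hy : y = x
  · subst hy; simp [h]
  · simp [hy]

/-! ### Effect of an arriving edge on the truncated lists -/

section Touch

variable {m D : ℕ} {lev : ℕ → ℕ} {R : List ℕ} {x : ℕ}

theorem atLevel_trunc_cons_of_ne {l : ℕ} (hR : R.Nodup) (hl : lev (x % m) ≠ l) :
    atLevel m lev l (trunc m D (x :: R.erase x)) = atLevel m lev l (trunc m D R) := by
  rw [atLevel, trunc, List.filter_filter, List.filter_cons_of_neg (by simp [hl]), atLevel, trunc,
    List.filter_filter, hR.erase_eq_filter, List.filter_filter, ← hR.erase_eq_filter]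
  refine List.filter_congr fun y _ => ?_
  by_cases hy : lev (y % m) = l
  · have h1 : x % m ≠ y % m := fun h => hl (h ▸ hy)
    have h2 : y ≠ x := by rintro rfl; exact h1 rfl
    rw [atElem_cons_erase_of_ne h1 hR]
    simp [hy, h2]
  · simp [hy]

/-- Moving `x` to the front changes the `D` most recent edges of its own element only. Nothing drops
out if `x` was among them or if there were fewer than `D`; otherwise the oldest of them does. All
this is visible in the truncated list, so the discarded edges need not be known. -/
theorem atLevel_trunc_cons (hD : 1 ≤ D) (hR : R.Nodup) :
    atLevel m lev (lev (x % m)) (trunc m D (x :: R.erase x)) =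
      touch m D x (atLevel m lev (lev (x % m)) (trunc m D R)) := by
  set T := atLevel m lev (lev (x % m)) (trunc m D R) with hT
  set Re := atElem m (x % m) R with hRe
  have hRe' : Re.Nodup := hR.filter _
  have hTn : T.Nodup := (hR.filter _).filter _
  have hTe : atElem m (x % m) T = Re.take D := by
    rw [hT, atElem_atLevel rfl, atElem_trunc hR]
  have hxRe : x ∈ Re ↔ x ∈ R := by simp [hRe, atElem]
  have hxT : x ∈ T ↔ x ∈ Re.take D := by
    rw [hT, atLevel, List.mem_filter, trunc, List.mem_filter]
    constructor
    · intro h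
      simpa using h.1.2
    · intro h
      refine ⟨⟨hxRe.1 (List.mem_of_mem_take h), by simpa using h⟩, by simp⟩
  have hE : atElem m (x % m) (x :: R.erase x) = x :: Re.erase x := atElem_cons_erase hR
  have hET : atElem m (x % m) (x :: T.erase x) = x :: (Re.take D).erase x := by
    rw [atElem_cons_erase hTn, hTe]
  -- Here `z` is the edge that drops out; the choice `z = x` encodes that none does.
  have hL : ∀ z, (∀ y ∈ R, y ≠ x → y % m = x % m →
        (y ∈ (Re.erase x).take (D - 1) ↔ y ∈ Re.take D ∧ y ≠ z)) →
      (∀ y ∈ T, y ≠ x → y = z → y % m = x % m) →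
      atLevel m lev (lev (x % m)) (trunc m D (x :: R.erase x)) =
        x :: (T.filter fun y => y ≠ x ∧ y ≠ z) := by
    intro z hz hz'
    obtain ⟨D, rfl⟩ := Nat.exists_eq_add_of_le' hD
    rw [atLevel, trunc, List.filter_filter, List.filter_cons_of_pos, hR.erase_eq_filter,
      List.filter_filter, ← hR.erase_eq_filter, hT, atLevel, trunc, List.filter_filter,
      List.filter_filter]
    · congr 1
      refine List.filter_congr fun y hy => ?_
      by_cases hyx : y = x
      · simp [hyx]
      by_cases hyl : lev (y % m) = lev (x % m)
      · by_cases hye : y % m = x % m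
        · have := hz y hy hyx hye
          simp only [Nat.add_sub_cancel] at this
          rw [hye, hE, ← hRe, Bool.eq_iff_iff]
          simp [hyx, this]
          tauto
        · rw [atElem_cons_erase_of_ne (Ne.symm hye) hR, Bool.eq_iff_iff]
          simp only [hyl, decide_true, Bool.true_and, bne_iff_ne, ne_eq, hyx, not_false_eq_true,
            Bool.and_eq_true, decide_eq_true_eq, and_true, true_and]
          constructor
          · intro h
            refine ⟨fun e => hye (hz' y ?_ hyx e), h⟩
            rw [hT, atLevel, List.mem_filter, trunc, List.mem_filter]
            exact ⟨⟨hy, by simpa using h⟩, by simpa using hyl⟩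
          · exact fun h => h.2
      · simp [hyl]
    · simp [hE]
  unfold touch
  rw [hET]
  by_cases hx : x ∈ Re.take D
  · rw [if_neg, hL x]
    · simp [hTn.erase_eq_filter, decide_not]
      refine List.filter_congr fun y _ => ?_
      by_cases h : y = x <;> simp [h]
    · intro y _ hyx _
      rw [← take_erase_of_mem hx, (hRe'.sublist (List.take_sublist _ _)).mem_erase_iff]
      tauto
    · exact fun y _ h1 h2 => absurd h2 h1
    · have := List.length_erase_add_one hx
      have := List.length_take_le D Re
      simp only [List.length_cons]
      omega
  · have hxT' : x ∉ T := fun h => hx (hxT.1 h)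
    have h1 : (Re.erase x).take (D - 1) = Re.take (D - 1) := by
      refine take_erase_of_notMem fun h => hx ?_
      exact (List.take_sublist_take_left (l := Re) (Nat.sub_le D 1)).subset h
    rw [List.erase_of_not_mem hx, List.erase_of_not_mem hxT']
    have hTf : T.filter (fun y => y ≠ x) = T :=
      List.filter_eq_self.2 fun y hy => by simpa using fun e : y = x => hxT' (e ▸ hy)
    by_cases hlen : Re.length < D
    · rw [if_neg, hL x]
      · simpa using hTf
      · intro y _ hyx _
        rw [h1, List.take_of_length_le (by omega), List.take_of_length_le (by omega)]
        tauto
      · exact fun y _ h1 h2 => absurd h2 h1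
      · simp only [List.length_cons, List.length_take]
        omega
    · obtain ⟨D, rfl⟩ := Nat.exists_eq_add_of_le' hD
      have hDl : D < Re.length := by omega
      have hz : (x :: Re.take (D + 1)).getLastD 0 = Re[D] := by
        rw [List.take_succ_eq_append_getElem hDl, ← List.cons_append, List.getLastD_concat]
      rw [if_pos, hz]
      · have hzm : Re[D] ∈ Re.take (D + 1) := by
          rw [List.take_succ_eq_append_getElem hDl]
          exact List.mem_append_right _ (List.mem_singleton_self _)
        have hzx : Re[D] ≠ x := fun e => hx (e ▸ hzm)
        rw [List.erase_cons_tail (by simpa using hzx.symm), hTn.erase_eq_filter, hL Re[D]]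
        · congr 1
          refine List.filter_congr fun y hy => ?_
          have : y ≠ x := fun e : y = x => hxT' (e ▸ hy)
          rw [Bool.eq_iff_iff]
          simp [this]
        · intro y _ hyx _
          rw [h1, Nat.add_sub_cancel, List.take_succ_eq_append_getElem hDl]
          have hnd := hRe'.sublist (List.take_sublist (D + 1) _)
          rw [List.take_succ_eq_append_getElem hDl, List.nodup_append] at hnd
          simp only [List.mem_append, List.mem_singleton]
          constructor
          · exact fun h => ⟨Or.inl h, hnd.2.2 y h _ (by simp)⟩
          · rintro ⟨h | h, h'⟩
            · exact h
            · exact absurd h h'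
        · intro y hy _ hyz
          have : Re[D] ∈ Re := List.getElem_mem _
          rw [← hyz, hRe, atElem, List.mem_filter] at this
          simpa using this.2
      · simp only [List.length_cons, List.length_take]
        omega

end Touch

/-- Cutting to `B` edges commutes with an arrival. At most one edge leaves besides the move of `x`;
if it lies beyond the cut, the cut list overflows and its own last edge goes instead, which is what
the cut of the full list prescribes. -/
theorem cap_touch_take {m D B x : ℕ} {T : List ℕ} (hB : 1 ≤ B) (hD : 1 ≤ D) (hT : T.Nodup)
    (hTe : (atElem m (x % m) T).length ≤ D) :
    cap B (touch m D x (T.take B)) = (touch m D x T).take B := by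
  obtain ⟨B, rfl⟩ := Nat.exists_eq_add_of_le' hB
  set K := T.take (B + 1) with hKd
  have hK : K.Nodup := hT.sublist (List.take_sublist _ _)
  have hpre : atElem m (x % m) K <+: atElem m (x % m) T :=
    (List.take_prefix (B + 1) T).filter _
  have hKe := hpre.length_le
  have hKlen : K.length ≤ B + 1 := List.length_take_le _ _
  by_cases hx : x ∈ K
  · have hxT : x ∈ T := List.mem_of_mem_take hx
    have hmem : ∀ L : List ℕ, x ∈ L → x ∈ atElem m (x % m) L := fun L h => by simp [atElem, h]
    have h1 := List.length_erase_add_one (hmem K hx)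
    have h2 := List.length_erase_add_one (hmem T hxT)
    have h3 := List.length_erase_add_one hx
    rw [touch, touch, atElem_cons_erase hK, atElem_cons_erase hT, if_neg, if_neg, cap, if_neg,
      List.take_succ_cons, hKd, take_erase_of_mem hx, Nat.add_sub_cancel]
    · simp only [List.length_cons]; omega
    · simp only [List.length_cons]; omega
    · simp only [List.length_cons]; omega
  · have hcapx : ∀ M : List ℕ, (x :: K).Nodup → K.length = B + 1 →
        M.take B = T.take B → cap (B + 1) (x :: K) = x :: M.take B := by
      intro M h1 h2 h3
      rw [cap, if_pos (by simp [h2]), erase_getLastD h1, h3, List.dropLast_cons_of_ne_nil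
        (by intro h; simp [h] at h2), List.dropLast_eq_take, h2, hKd, List.take_take]
      simp
    have hxK : (x :: K).Nodup := List.nodup_cons.2 ⟨hx, hK⟩
    have hKe' : atElem m (x % m) (x :: K.erase x) = x :: atElem m (x % m) K := by
      rw [atElem_cons_erase hK, List.erase_of_not_mem]
      exact fun h => hx (List.mem_of_mem_filter h)
    have hTB : ∀ z, z ∉ K → (T.erase z).take B = T.take B := fun z hz =>
      take_erase_of_notMem fun h => hz
        ((List.take_sublist_take_left (l := T) (Nat.le_succ B)).subset h)
    have hlt : ∀ z, z ∈ T → z ∉ K → K.length = B + 1 := by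
      intro z hz hzK
      rw [hKd, List.length_take]
      by_contra hcon
      exact hzK (by rw [hKd, List.take_of_length_le (by omega)]; exact hz)
    by_cases hxT : x ∈ T
    · have hxe : x ∈ atElem m (x % m) T := by simp [atElem, hxT]
      have h2 := List.length_erase_add_one hxe
      have h4 : (atElem m (x % m) K).length < (atElem m (x % m) T).length := by
        refine lt_of_le_of_ne hKe fun h => hx ?_
        have := hpre.eq_of_length h
        rw [← this] at hxe
        exact List.mem_of_mem_filter hxe
      rw [touch, touch, hKe', atElem_cons_erase hT, if_neg, if_neg, List.erase_of_not_mem hx,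
        hcapx (T.erase x) hxK (hlt x hxT hx) (hTB x hx), List.take_succ_cons]
      · simp only [List.length_cons]; omega
      · simp only [List.length_cons]; omega
    · have hTe' : atElem m (x % m) (x :: T.erase x) = x :: atElem m (x % m) T := by
        rw [atElem_cons_erase hT, List.erase_of_not_mem]
        exact fun h => hxT (List.mem_of_mem_filter h)
      rw [touch, touch, hKe', hTe', List.erase_of_not_mem hx, List.erase_of_not_mem hxT]
      by_cases hlen : (atElem m (x % m) T).length < D
      · rw [if_neg (by simp only [List.length_cons]; omega),
          if_neg (by simp only [List.length_cons]; omega)]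
        by_cases hKB : K.length = B + 1
        · rw [hcapx T hxK hKB rfl, List.take_succ_cons]
        · rw [cap, if_neg (by simp only [List.length_cons]; omega), List.take_succ_cons]
          rw [hKd, List.length_take] at hKB
          rw [hKd, List.take_of_length_le (by omega), List.take_of_length_le (by omega)]
      · rw [if_pos (c := D < (x :: atElem m (x % m) T).length)
          (by simp only [List.length_cons]; omega)]
        -- The element already has `D` edges, so its oldest edge `z` has to go; the question is
        -- whether `z` survived the cut.
        obtain ⟨E, z, hE⟩ : ∃ E z, atElem m (x % m) T = E ++ [z] := by
          rcases List.eq_nil_or_concat (atElem m (x % m) T) with h | ⟨E, z, h⟩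
          · rw [h] at hlen; simp at hlen; omega
          · exact ⟨E, z, by simpa using h⟩
        have hzT : z ∈ T := by
          have : z ∈ atElem m (x % m) T := by simp [hE]
          exact List.mem_of_mem_filter this
        have hzx : x ≠ z := fun e => hxT (e ▸ hzT)
        have hlast : (x :: atElem m (x % m) T).getLastD 0 = z := by
          rw [hE, ← List.cons_append, List.getLastD_concat]
        have he : ∀ M : List ℕ, (x :: M).erase z = x :: M.erase z := fun M =>
          List.erase_cons_tail (by simpa using hzx)
        rw [hlast, he T]
        by_cases hzK : z ∈ K
        -- As `K` is a prefix of `T` and contains the oldest edge of the element, it contains all of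
        -- them; both lists therefore notice the same excess.
        · have hEq : atElem m (x % m) K = atElem m (x % m) T := by
            obtain ⟨t, ht⟩ := hpre
            rcases List.eq_nil_or_concat t with rfl | ⟨t, a, rfl⟩
            · simpa using ht
            · exfalso
              have hzE : z ∈ atElem m (x % m) K := by
                have : z ∈ atElem m (x % m) T := by simp [hE]
                simp only [atElem, List.mem_filter] at this ⊢
                exact ⟨hzK, this.2⟩
              have hnd : (atElem m (x % m) T).Nodup := hT.filter _
              rw [← ht, List.concat_eq_append, ← List.append_assoc] at hnd
              rw [List.concat_eq_append, ← List.append_assoc, hE] at ht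
              have := (List.append_inj' ht (by simp)).2
              rw [List.nodup_append] at hnd
              exact hnd.2.2 z (by simp [hzE]) a (by simp) (by simpa using this.symm)
          have h3 := List.length_erase_add_one hzK
          rw [hEq, hlast, if_pos (by simp only [List.length_cons]; omega),
            he K, cap, if_neg, hKd, take_erase_of_mem hzK,
            List.take_succ_cons, Nat.add_sub_cancel]
          simp only [List.length_cons]; omega
        · have h4 : (atElem m (x % m) K).length < (atElem m (x % m) T).length := by
            refine lt_of_le_of_ne hKe fun h => hzK ?_
            have := hpre.eq_of_length h
            have h5 : z ∈ atElem m (x % m) K := by simp [this, hE]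
            exact List.mem_of_mem_filter h5
          rw [if_neg (by simp only [List.length_cons]; omega),
            hcapx (T.erase z) hxK (hlt z hzT hzK) (hTB z hzK), List.take_succ_cons]

/-- The list that the algorithm keeps for level `l` after the reversed stream `ρ`. -/
def kept (W m D B : ℕ) (lev : ℕ → ℕ) (ρ : List ℕ) (l : ℕ) : List ℕ :=
  (atLevel m lev l (trunc m D (recency W ρ))).take B

/-- As `kept`, after the expiry of an edge that leaves the window with the next item. -/
def keptUnexpired (W m D B : ℕ) (lev : ℕ → ℕ) (ρ : List ℕ) (l : ℕ) : List ℕ :=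
  (atLevel m lev l (trunc m D (unexpired W ρ))).take B

/-! ### Recursion for the kept lists -/

section Kept

variable {W m D B : ℕ} {lev : ℕ → ℕ} {ρ : List ℕ} {x l : ℕ}

theorem nodup_unexpired : (unexpired W ρ).Nodup := (nodup_recency W ρ).filter _

theorem kept_cons_of_ne (h : lev (x % m) ≠ l) :
    kept W m D B lev (x :: ρ) l = keptUnexpired W m D B lev ρ l := by
  rw [kept, recency_cons, atLevel_trunc_cons_of_ne nodup_unexpired h, keptUnexpired]

theorem kept_cons (hB : 1 ≤ B) (hD : 1 ≤ D) :
    kept W m D B lev (x :: ρ) (lev (x % m)) =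
      cap B (touch m D x (keptUnexpired W m D B lev ρ (lev (x % m)))) := by
  rw [kept, recency_cons, atLevel_trunc_cons hD nodup_unexpired, keptUnexpired,
    cap_touch_take (T := atLevel m lev (lev (x % m)) (trunc m D (unexpired W ρ))) hB hD
      ((nodup_unexpired.filter _).filter _)]
  rw [atElem_atLevel rfl, atElem_trunc nodup_unexpired]
  exact List.length_take_le _ _

/-- An edge older than all others displaces none of them from the `D` most recent ones. Read
backwards: its expiry brings no discarded edge back. -/
theorem trunc_concat {m D y : ℕ} {R : List ℕ} (h : (R ++ [y]).Nodup) :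
    trunc m D (R ++ [y]) = trunc m D R ∨ trunc m D (R ++ [y]) = trunc m D R ++ [y] := by
  have hyR : y ∉ R := fun h1 => by
    rw [List.nodup_append] at h
    exact h.2.2 y h1 y (by simp) rfl
  have key : R.filter (fun x => decide (x ∈ (atElem m (x % m) (R ++ [y])).take D)) =
      trunc m D R := by
    refine List.filter_congr fun x hx => ?_
    have hxy : x ≠ y := fun e => hyR (e ▸ hx)
    rw [atElem, List.filter_append, List.take_append, ← atElem]
    simp only [List.mem_append, decide_eq_decide, or_iff_left_iff_imp]
    intro h1
    have := List.mem_of_mem_filter (List.mem_of_mem_take h1)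
    simp [hxy] at this
  rw [trunc, List.filter_append, key]
  by_cases hy : y ∈ (atElem m (y % m) (R ++ [y])).take D
  · exact Or.inr (by simp [hy])
  · exact Or.inl (by simp [hy])

/-- Only the last edge of a kept list can expire. -/
theorem keptUnexpired_eq (hW : 1 ≤ W) : keptUnexpired W m D B lev ρ l =
    if ρ.length + 1 = lastTime ρ ((kept W m D B lev ρ l).getLastD 0) + W ∧
        kept W m D B lev ρ l ≠ [] then
      (kept W m D B lev ρ l).erase ((kept W m D B lev ρ l).getLastD 0)
    else kept W m D B lev ρ l := by
  have hun : ∀ x ∈ keptUnexpired W m D B lev ρ l, ρ.length + 1 < lastTime ρ x + W := by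
    intro x hx
    have := List.mem_of_mem_filter (List.mem_of_mem_filter (List.mem_of_mem_take hx))
    simpa [unexpired] using (List.mem_filter.1 this).2
  have hsame : keptUnexpired W m D B lev ρ l = kept W m D B lev ρ l →
      ¬ (ρ.length + 1 = lastTime ρ ((kept W m D B lev ρ l).getLastD 0) + W ∧
        kept W m D B lev ρ l ≠ []) := by
    rintro h ⟨h1, h2⟩
    have := hun ((kept W m D B lev ρ l).getLastD 0) (by
      rw [h]
      rcases List.eq_nil_or_concat (kept W m D B lev ρ l) with h | ⟨E, z, h⟩
      · exact absurd h h2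
      · simp [h])
    omega
  rcases recency_eq_unexpired hW ρ with h | ⟨y, h, hy⟩
  · have : keptUnexpired W m D B lev ρ l = kept W m D B lev ρ l := by
      rw [kept, keptUnexpired, h]
    rw [if_neg (hsame this), this]
  · have hnd : (unexpired W ρ ++ [y]).Nodup := h ▸ nodup_recency W ρ
    set T := atLevel m lev l (trunc m D (unexpired W ρ)) with hT
    have hT2 : atLevel m lev l (trunc m D (recency W ρ)) = T ∨
        atLevel m lev l (trunc m D (recency W ρ)) = T ++ [y] := by
      rw [h]
      rcases trunc_concat (m := m) (D := D) hnd with h1 | h1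
      · exact Or.inl (by rw [h1])
      · rw [h1, atLevel, List.filter_append, ← atLevel, ← hT]
        by_cases hyl : lev (y % m) = l
        · exact Or.inr (by simp [hyl])
        · exact Or.inl (by simp [hyl])
    -- The expiring edge is the oldest of the window. Truncation, restriction to the level and the
    -- cut at `B` either remove it or leave it in last place.
    have hcase : kept W m D B lev ρ l = keptUnexpired W m D B lev ρ l ∨
        kept W m D B lev ρ l = keptUnexpired W m D B lev ρ l ++ [y] := by
      rcases hT2 with h1 | h1
      · exact Or.inl (by rw [kept, keptUnexpired, h1])
      · by_cases hlen : B ≤ T.length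
        · left
          rw [kept, keptUnexpired, h1, List.take_append_of_le_length hlen]
        · right
          rw [kept, keptUnexpired, h1, ← hT, List.take_of_length_le (by simp; omega),
            List.take_of_length_le (by omega)]
    rcases hcase with h1 | h1
    · rw [if_neg (hsame h1.symm), h1]
    · have hyU : y ∉ keptUnexpired W m D B lev ρ l := fun h2 => by
        have := hun y h2
        omega
      rw [h1, List.getLastD_concat, if_pos ⟨hy, by simp⟩, List.erase_append_right _ hyU]
      simp

end Kept

end KCover

namespace KCover

open WordRAM

/-! ### The memory representation of the kept edges -/

/-- The numbers the algorithm works with. -/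
structure Conf where
  (n m k W A q d LV D B : ℕ)

/-- All edge codes are below this number. -/
def Conf.codes (K : Conf) : ℕ := (K.n + 1) * K.m

/-- The registers that stay constant after the initialization. -/
structure Conf.Regs (K : Conf) (s : State) : Prop where
  k : s.reg 2 = K.k
  W : s.reg 3 = K.W
  A : s.reg 4 = K.A
  n : s.reg 10 = K.n
  m : s.reg 11 = K.m
  q : s.reg 12 = K.q
  d : s.reg 13 = K.d
  LV : s.reg 14 = K.LV
  D : s.reg 15 = K.D
  B : s.reg 16 = K.B
  codes : s.reg 18 = K.codes

theorem Conf.Regs.congr {K : Conf} {s s' : State} (h : K.Regs s)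
    (hr : ∀ r < 20, s'.reg r = s.reg r) : K.Regs s' where
  k := by rw [hr _ (by norm_num), h.k]
  W := by rw [hr _ (by norm_num), h.W]
  A := by rw [hr _ (by norm_num), h.A]
  n := by rw [hr _ (by norm_num), h.n]
  m := by rw [hr _ (by norm_num), h.m]
  q := by rw [hr _ (by norm_num), h.q]
  d := by rw [hr _ (by norm_num), h.d]
  LV := by rw [hr _ (by norm_num), h.LV]
  D := by rw [hr _ (by norm_num), h.D]
  B := by rw [hr _ (by norm_num), h.B]
  codes := by rw [hr _ (by norm_num), h.codes]

/-- The words are long enough. -/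
structure Conf.Fits (K : Conf) (N : ℕ) : Prop where
  cells : 32 * (K.codes + K.LV) + 100 ≤ N
  coefs : 32 * K.d + 100 ≤ N
  hash : K.q * K.m + K.q ≤ N
  window : K.W + 1 < N
  set_index : (K.n + 1) * K.m + K.m ≤ N
  elem : 32 * K.m + 100 ≤ N

/-- Cells below `K.codes` are edges and belong to the level of their element; the cell `K.codes + l`
is the head of level `l`. -/
def levelOwn (K : Conf) (lev : ℕ → ℕ) (z : ℕ) : ℕ :=
  if z < K.codes then lev (z % K.m) else z - K.codes

/-- The kept edges are codes of edges, of the right level. -/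
structure Wf (K : Conf) (lev : ℕ → ℕ) (st : ℕ → List ℕ) : Prop where
  nodup : ∀ l, (st l).Nodup
  level : ∀ l, ∀ x ∈ st l, lev (x % K.m) = l
  ge : ∀ l, ∀ x ∈ st l, K.m ≤ x
  lt : ∀ l, ∀ x ∈ st l, x < K.codes

/-- The memory holds the coefficients `co`, the lists `st` and the time stamps `ts`. -/
structure Rep (K : Conf) (co lev : ℕ → ℕ) (st : ℕ → List ℕ) (ts : ℕ → ℕ) (s : State) : Prop where
  coef : ∀ j, s.arr 0 j = if j < K.d then co j else 0
  level : Dll (s.arr 2) (s.arr 3) (levelOwn K lev) (K.codes + ·) st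
  elem : Dll (s.arr 4) (s.arr 5) (· % K.m) id fun e => atElem K.m e (st (lev e))
  time : ∀ x, s.arr 6 x = if x ∈ st (lev (x % K.m)) then ts x else 0
  count : ∀ l, s.arr 7 l = (st l).length
  elem_count : ∀ e, s.arr 8 e = (atElem K.m e (st (lev e))).length
  rest : ∀ i, s.arr 1 i = 0 ∧ s.arr 9 i = 0 ∧ s.arr 10 i = 0 ∧ s.arr 11 i = 0 ∧ s.arr 12 i = 0 ∧
    s.arr 13 i = 0 ∧ s.arr 14 i = 0 ∧ s.arr 15 i = 0

theorem Rep.congr {K : Conf} {co lev : ℕ → ℕ} {st : ℕ → List ℕ} {ts : ℕ → ℕ} {s s' : State}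
    (h : Rep K co lev st ts s) (e : s'.arr = s.arr) : Rep K co lev st ts s' := by
  obtain ⟨h1, h2, h3, h4, h5, h6, h7⟩ := h
  constructor <;> simpa only [e]

theorem nxt_mem {z : ℕ} : ∀ {l : List ℕ} {a : ℕ}, nxt (a :: l) z ≠ 0 → nxt (a :: l) z ∈ l
  | [], a, h => absurd rfl h
  | b :: l, a, h => by
      rw [nxt] at h ⊢
      split_ifs at h ⊢ with h1
      · simp
      · exact List.mem_cons_of_mem _ (nxt_mem h)

theorem nxt_le {z a M : ℕ} {l : List ℕ} (h : ∀ x ∈ l, x < M) : nxt (a :: l) z ≤ M := by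
  by_cases h0 : nxt (a :: l) z = 0
  · omega
  · exact (h _ (nxt_mem h0)).le

/-- Lets the programs dereference by arithmetic, adding the head times the truth value of `p = 0`,
without a branch. -/
theorem deref_eq (h p : ℕ) : (p + if p = 0 then h else 0) = deref h p := by
  unfold deref
  split_ifs <;> simp [*]

section Wf

variable {K : Conf} {lev : ℕ → ℕ} {st : ℕ → List ℕ}

theorem Wf.m_pos (h : Wf K lev st) {l x : ℕ} (hx : x ∈ st l) : 0 < K.m := by
  have := h.lt l x hx
  rw [Conf.codes] at this
  exact Nat.pos_of_ne_zero fun e => by simp [e] at this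

theorem Wf.zero_notMem (h : Wf K lev st) (l : ℕ) : 0 ∉ st l := fun h0 => by
  have h1 := h.ge l 0 h0
  have h2 := h.m_pos h0
  omega

theorem Wf.mod_lt (h : Wf K lev st) {l x : ℕ} (hx : x ∈ st l) : x % K.m < K.m :=
  Nat.mod_lt _ (h.m_pos hx)

theorem Wf.length_le (h : Wf K lev st) (l : ℕ) : (st l).length ≤ K.codes := by
  have := List.toFinset_card_of_nodup (h.nodup l)
  rw [← this, ← Finset.card_range K.codes]
  exact Finset.card_le_card fun x hx => by simpa using h.lt l x (by simpa using hx)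

theorem levelOwn_hd (l : ℕ) : levelOwn K lev (K.codes + l) = l := by
  simp [levelOwn]

theorem Wf.levelOwn_eq (h : Wf K lev st) {l x : ℕ} (hx : x ∈ st l) : levelOwn K lev x = l := by
  rw [levelOwn, if_pos (h.lt l x hx), h.level l x hx]

theorem Wf.nodup_level (h : Wf K lev st) (l : ℕ) : ((K.codes + l) :: st l).Nodup := by
  refine List.nodup_cons.2 ⟨fun hl => ?_, h.nodup l⟩
  have := h.lt l _ hl
  omega

/-- The cell `e < K.m` serves as head of the list of the element `e`. Edge codes start at `K.m`, so
no head is a member. -/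
theorem Wf.nodup_elem (h : Wf K lev st) {l x : ℕ} (hx : x ∈ st l) :
    (x % K.m :: atElem K.m (x % K.m) (st (lev (x % K.m)))).Nodup := by
  refine List.nodup_cons.2 ⟨fun hl => ?_, (h.nodup _).filter _⟩
  have h1 := h.ge _ _ (List.mem_of_mem_filter hl)
  have := h.mod_lt hx
  omega

theorem Wf.erase (h : Wf K lev st) (l y : ℕ) :
    Wf K lev (Function.update st l ((st l).erase y)) := by
  have key : ∀ l' x, x ∈ Function.update st l ((st l).erase y) l' → x ∈ st l' := by
    intro l' x hx
    by_cases h : l' = l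
    · subst h
      rw [Function.update_self] at hx
      exact List.mem_of_mem_erase hx
    · rwa [Function.update_of_ne h] at hx
  refine ⟨fun l' => ?_, fun l' x hx => h.level _ _ (key _ _ hx), fun l' x hx => h.ge _ _ (key _ _ hx),
    fun l' x hx => h.lt _ _ (key _ _ hx)⟩
  by_cases h' : l' = l
  · subst h'
    rw [Function.update_self]
    exact (h.nodup _).erase _
  · rw [Function.update_of_ne h']
    exact h.nodup _

theorem Wf.push (h : Wf K lev st) {x : ℕ} (h1 : K.m ≤ x) (h2 : x < K.codes)
    (h3 : x ∉ st (lev (x % K.m))) :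
    Wf K lev (Function.update st (lev (x % K.m)) (x :: st (lev (x % K.m)))) := by
  have key : ∀ l' z, z ∈ Function.update st (lev (x % K.m)) (x :: st (lev (x % K.m))) l' →
      z ∈ st l' ∨ (z = x ∧ l' = lev (x % K.m)) := by
    intro l' z hz
    by_cases h : l' = lev (x % K.m)
    · subst h
      rw [Function.update_self, List.mem_cons] at hz
      tauto
    · rw [Function.update_of_ne h] at hz
      exact Or.inl hz
  refine ⟨fun l' => ?_, fun l' z hz => ?_, fun l' z hz => ?_, fun l' z hz => ?_⟩
  · by_cases h' : l' = lev (x % K.m)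
    · subst h'
      rw [Function.update_self]
      exact List.nodup_cons.2 ⟨h3, h.nodup _⟩
    · rw [Function.update_of_ne h']
      exact h.nodup _
  · rcases key _ _ hz with h' | ⟨rfl, rfl⟩
    · exact h.level _ _ h'
    · rfl
  · rcases key _ _ hz with h' | ⟨rfl, rfl⟩
    · exact h.ge _ _ h'
    · exact h1
  · rcases key _ _ hz with h' | ⟨rfl, rfl⟩
    · exact h.lt _ _ h'
    · exact h2

theorem atElem_erase (h : Wf K lev st) {l y : ℕ} (hy : y ∈ st l) :
    (fun e => atElem K.m e (Function.update st l ((st l).erase y) (lev e))) =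
      Function.update (fun e => atElem K.m e (st (lev e))) (y % K.m)
        ((atElem K.m (y % K.m) (st (lev (y % K.m)))).erase y) := by
  funext e
  have hl := h.level l y hy
  by_cases he : e = y % K.m
  · subst he
    rw [Function.update_self, hl, Function.update_self, atElem, atElem, (h.nodup l).erase_eq_filter,
      ((h.nodup l).filter _).erase_eq_filter, List.filter_filter, List.filter_filter]
    simp only [Bool.and_comm]
  · rw [Function.update_of_ne he]
    by_cases hle : lev e = l
    · rw [hle, Function.update_self, atElem, atElem, (h.nodup l).erase_eq_filter, List.filter_filter]
      refine List.filter_congr fun x _ => ?_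
      by_cases hx : x = y
      · subst hx; simp [Ne.symm he]
      · simp [hx]
    · rw [Function.update_of_ne hle]

theorem atElem_push {x : ℕ} :
    (fun e => atElem K.m e
        (Function.update st (lev (x % K.m)) (x :: st (lev (x % K.m))) (lev e))) =
      Function.update (fun e => atElem K.m e (st (lev e))) (x % K.m)
        (x :: atElem K.m (x % K.m) (st (lev (x % K.m)))) := by
  funext e
  by_cases he : e = x % K.m
  · subst he
    rw [Function.update_self, Function.update_self, atElem, List.filter_cons_of_pos (by simp),
      atElem]
  · rw [Function.update_of_ne he]
    by_cases hle : lev e = lev (x % K.m)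
    · rw [hle, Function.update_self, atElem, List.filter_cons_of_neg (by simpa using Ne.symm he),
        atElem]
    · rw [Function.update_of_ne hle]

end Wf

/-- Remove the edge in register `30` of the level in register `31`. -/
def eraseEdge : Prog :=
  .assign 32 (.cell 3 (.reg 30)) ;; .assign 33 (.cell 2 (.reg 30)) ;;
  .assign 34 (.reg 18 + .reg 31) ;;
  .put 2 (.reg 32 + .same (.reg 32) 0 * .reg 34) (.reg 33) ;;
  .put 3 (.reg 33 + .same (.reg 33) 0 * .reg 34) (.reg 32) ;;
  .put 2 (.reg 30) 0 ;; .put 3 (.reg 30) 0 ;;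
  .assign 34 (.reg 30 % .reg 11) ;;
  .assign 32 (.cell 5 (.reg 30)) ;; .assign 33 (.cell 4 (.reg 30)) ;;
  .put 4 (.reg 32 + .same (.reg 32) 0 * .reg 34) (.reg 33) ;;
  .put 5 (.reg 33 + .same (.reg 33) 0 * .reg 34) (.reg 32) ;;
  .put 4 (.reg 30) 0 ;; .put 5 (.reg 30) 0 ;;
  .put 6 (.reg 30) 0 ;; .put 7 (.reg 31) (.cell 7 (.reg 31) - 1) ;;
  .put 8 (.reg 34) (.cell 8 (.reg 34) - 1)

/-- Put the edge in register `30` in front of the list of the level in register `31`. -/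
def pushEdge : Prog :=
  .assign 34 (.reg 18 + .reg 31) ;; .assign 33 (.cell 2 (.reg 34)) ;;
  .put 2 (.reg 30) (.reg 33) ;; .put 2 (.reg 34) (.reg 30) ;;
  .put 3 (.reg 33 + .same (.reg 33) 0 * .reg 34) (.reg 30) ;;
  .assign 34 (.reg 30 % .reg 11) ;; .assign 33 (.cell 4 (.reg 34)) ;;
  .put 4 (.reg 30) (.reg 33) ;; .put 4 (.reg 34) (.reg 30) ;;
  .put 5 (.reg 33 + .same (.reg 33) 0 * .reg 34) (.reg 30) ;;
  .put 6 (.reg 30) (.reg 17) ;; .put 7 (.reg 31) (.cell 7 (.reg 31) + 1) ;;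
  .put 8 (.reg 34) (.cell 8 (.reg 34) + 1)

/-! ### Correctness of unlinking and inserting an edge -/

section Edges

variable {K : Conf} {N : ℕ} {ω : Coins} {co lev : ℕ → ℕ} {st : ℕ → List ℕ} {ts : ℕ → ℕ} {s : State}

theorem Rep.pointer_le (hW : Wf K lev st) (h : Rep K co lev st ts s) (z : ℕ) :
    s.arr 2 z ≤ K.codes ∧ s.arr 3 z ≤ K.codes ∧ s.arr 4 z ≤ K.codes ∧ s.arr 5 z ≤ K.codes := by
  refine ⟨?_, ?_, ?_, ?_⟩
  · rw [h.level.nx_eq]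
    exact nxt_le (hW.lt _)
  · rw [h.level.pv_eq]
    exact nxt_le fun x hx => hW.lt _ x (by simpa using hx)
  · rw [h.elem.nx_eq]
    exact nxt_le fun x hx => hW.lt _ x (List.mem_of_mem_filter hx)
  · rw [h.elem.pv_eq]
    exact nxt_le fun x hx => hW.lt _ x (List.mem_of_mem_filter (List.mem_reverse.1 hx))

/-- Each edge sits in two doubly linked lists, that of its level and that of its element, so
`Dll.erase` is used twice. Clearing all cells of the edge keeps the number of nonzero cells
proportional to the stored edges. -/
theorem eraseEdge_runs (hK : K.Fits N) (hW : Wf K lev st) (h : Rep K co lev st ts s)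
    (hR : K.Regs s) {l y : ℕ} (h30 : s.reg 30 = y) (h31 : s.reg 31 = l) (hl : l < K.LV)
    (hy : y ∈ st l) :
    Runs N ω eraseEdge s 300 fun s' =>
      Rep K co lev (Function.update st l ((st l).erase y)) ts s' ∧
      ∀ r, r < 32 ∨ 35 ≤ r → s'.reg r = s.reg r := by
  obtain ⟨p2, p3, p4, p5⟩ := h.pointer_le hW y
  have hcells := hK.cells
  have helem := hK.elem
  have hylt := hW.lt l y hy
  have hmod := hW.mod_lt hy
  have hlev := hW.level l y hy
  have hy6 : y ∈ st (lev (y % K.m)) := by rwa [hlev]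
  have hcm : K.m ≤ K.codes := Nat.le_mul_of_pos_left _ (Nat.succ_pos _)
  refine Runs.block ?_ (Nat.le_of_ble_eq_true rfl) ⟨?_, ?_⟩
  · simp [eraseEdge, h30, h31, hR.codes, hR.m, setArr_arr]
    refine ⟨?_, ?_, ?_, ?_, ?_, ?_, ?_, ?_, ?_, ?_, ?_, ?_, ?_, ?_, ?_, ?_, ?_⟩
    all_goals first
      | omega
      | split_ifs <;> omega
  · constructor
    · intro j
      simpa [eraseEdge, setArr_arr] using h.coef j
    · convert h.level.erase (i := l) (y := y) (hW.levelOwn_eq hy) (levelOwn_hd l)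
        (fun x hx => hW.levelOwn_eq hx) (hW.nodup_level l) (hW.zero_notMem l) hy using 1
      · funext z
        simp [eraseEdge, setArr_arr, h30, h31, hR.codes, hR.m, deref_eq]
      · funext z
        simp [eraseEdge, setArr_arr, h30, h31, hR.codes, hR.m, deref_eq]
    · rw [atElem_erase hW hy]
      convert h.elem.erase (i := y % K.m) (y := y) rfl (Nat.mod_eq_of_lt hmod)
        (fun x hx => by simpa using (List.mem_filter.1 hx).2) (hW.nodup_elem hy)
        (fun h0 => hW.zero_notMem _ (List.mem_of_mem_filter h0))
        (List.mem_filter.2 ⟨hy6, by simp⟩) using 1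
      · funext z
        simp [eraseEdge, setArr_arr, h30, h31, hR.codes, hR.m, deref_eq]
      · funext z
        simp [eraseEdge, setArr_arr, h30, h31, hR.codes, hR.m, deref_eq]
    · intro x
      simp [eraseEdge, setArr_arr, h30, h31, hR.codes, hR.m, h.time x]
      by_cases hx : x = y
      · subst hx
        simp [hlev, (hW.nodup l).mem_erase_iff]
      · by_cases hxl : lev (x % K.m) = l
        · simp [hx, hxl, (hW.nodup l).mem_erase_iff]
        · simp [hx, Function.update_of_ne hxl]
    · intro l'
      simp [eraseEdge, setArr_arr, h30, h31, hR.codes, hR.m, h.count]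
      by_cases hl' : l' = l
      · subst hl'
        simp [List.length_erase_of_mem hy]
      · simp [hl']
    · intro e
      have := congrFun (atElem_erase hW hy) e
      beta_reduce at this
      rw [this]
      simp [eraseEdge, setArr_arr, h30, h31, hR.codes, hR.m, h.elem_count]
      by_cases he : e = y % K.m
      · subst he
        have : y ∈ atElem K.m (y % K.m) (st (lev (y % K.m))) := List.mem_filter.2 ⟨hy6, by simp⟩
        simp [List.length_erase_of_mem this]
      · simp [he]
    · intro i
      simpa [eraseEdge, setArr_arr] using h.rest i
  · intro r hr
    have h32 : r ≠ 32 := by omega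
    have h33 : r ≠ 33 := by omega
    have h34 : r ≠ 34 := by omega
    simp [eraseEdge, h32, h33, h34]

theorem pushEdge_runs (hK : K.Fits N) (hW : Wf K lev st) (h : Rep K co lev st ts s)
    (hR : K.Regs s) {x : ℕ} (h30 : s.reg 30 = x) (h31 : s.reg 31 = lev (x % K.m))
    (hl : lev (x % K.m) < K.LV) (hx : x ∉ st (lev (x % K.m))) (hm : 0 < K.m) (hxm : K.m ≤ x)
    (hxlt : x < K.codes) :
    Runs N ω pushEdge s 300 fun s' =>
      Rep K co lev (Function.update st (lev (x % K.m)) (x :: st (lev (x % K.m))))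
        (Function.update ts x (s.reg 17)) s' ∧
      ∀ r, r < 32 ∨ 35 ≤ r → s'.reg r = s.reg r := by
  set l := lev (x % K.m) with hl'
  have p2 := (h.pointer_le hW (K.codes + l)).1
  have p4 := (h.pointer_le hW (x % K.m)).2.2.1
  have hcells := hK.cells
  have helem := hK.elem
  have hmod : x % K.m < K.m := Nat.mod_lt _ hm
  have hcm : K.m ≤ K.codes := Nat.le_mul_of_pos_left _ (Nat.succ_pos _)
  have hlen := hW.length_le l
  have hlen2 : (atElem K.m (x % K.m) (st l)).length ≤ K.codes :=
    (List.length_filter_le _ _).trans hlen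
  have hx1 : x ≠ x % K.m := by omega
  have hx2 : x ≠ K.codes + l := by omega
  refine Runs.block ?_ (Nat.le_of_ble_eq_true rfl) ⟨?_, ?_⟩
  · simp [pushEdge, h30, h31, hR.codes, hR.m, setArr_arr, h.count, h.elem_count, ← hl']
    refine ⟨?_, ?_, ?_, ?_, ?_, ?_, ?_, ?_, ?_, ?_, ?_, ?_⟩
    all_goals first
      | omega
      | split_ifs <;> omega
  · constructor
    · intro j
      simpa [pushEdge, setArr_arr] using h.coef j
    · convert h.level.push (i := l) (x := x) (by rw [levelOwn, if_pos hxlt]) (levelOwn_hd l)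
        (fun x hx => hW.levelOwn_eq hx) (by
          have := hW.nodup_level l
          simp only [List.nodup_cons, List.mem_cons, not_or] at this ⊢
          exact ⟨⟨hx2.symm, this.1⟩, hx, this.2⟩) (hW.zero_notMem l) using 1
      · funext z
        simp [pushEdge, setArr_arr, h30, h31, hR.codes, hR.m, deref_eq]
        split_ifs <;> omega
      · funext z
        simp [pushEdge, setArr_arr, h30, h31, hR.codes, hR.m, deref_eq]
    · rw [atElem_push]
      have hnd : (x % K.m :: x :: atElem K.m (x % K.m) (st (lev (x % K.m)))).Nodup := by
        simp only [List.nodup_cons, List.mem_cons, not_or]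
        refine ⟨⟨hx1.symm, fun h1 => ?_⟩, fun h1 => hx (List.mem_of_mem_filter h1),
          (hW.nodup _).filter _⟩
        have := hW.ge _ _ (List.mem_of_mem_filter h1)
        omega
      convert h.elem.push (i := x % K.m) (x := x) rfl (Nat.mod_eq_of_lt hmod)
        (fun x hx => by simpa using (List.mem_filter.1 hx).2) hnd
        (fun h0 => hW.zero_notMem _ (List.mem_of_mem_filter h0)) using 1
      · funext z
        simp [pushEdge, setArr_arr, h30, h31, hR.codes, hR.m, deref_eq]
        split_ifs <;> omega
      · funext z
        simp [pushEdge, setArr_arr, h30, h31, hR.codes, hR.m, deref_eq]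
    · intro z
      simp [pushEdge, setArr_arr, h30, h31, hR.codes, hR.m, h.time z]
      by_cases hz : z = x
      · subst hz
        simp [hl']
      · by_cases hzl : lev (z % K.m) = l
        · simp [hz, hzl]
        · simp [hz, Function.update_of_ne hzl]
    · intro l'
      simp [pushEdge, setArr_arr, h30, h31, hR.codes, hR.m, h.count]
      by_cases hl' : l' = l
      · subst hl'
        simp
      · simp [hl']
    · intro e
      have := congrFun (atElem_push (K := K) (lev := lev) (st := st) (x := x)) e
      beta_reduce at this
      rw [hl', this]
      simp [pushEdge, setArr_arr, h30, h31, hR.codes, hR.m, h.elem_count]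
      by_cases he : e = x % K.m
      · subst he
        simp
      · simp [he]
    · intro i
      simpa [pushEdge, setArr_arr] using h.rest i
  · intro r hr
    have h33 : r ≠ 33 := by omega
    have h34 : r ≠ 34 := by omega
    simp [pushEdge, h33, h34]

end Edges

end KCover

namespace KCover

open WordRAM

/-! ### The update -/

/-- The hash value of `e`: a polynomial modulo `q` with coefficients `co`. -/
def hashVal (q d : ℕ) (co : ℕ → ℕ) (e : ℕ) : ℕ :=
  (List.range d).foldl (fun a j => (a * e + co j) % q) 0

/-- The level of a hash value. -/
def levelOf (q LV h : ℕ) : ℕ := Nat.findGreatest (fun i => h < q / 2 ^ i) (LV - 1)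

/-- The level of an element. -/
def Conf.lev (K : Conf) (co : ℕ → ℕ) (e : ℕ) : ℕ := levelOf K.q K.LV (hashVal K.q K.d co e)

/-- The time stamp of the time `t`. -/
def slot (W t : ℕ) : ℕ := if t = 0 then 0 else (t - 1) % W + 1

/-- Drop the edge that leaves the window. -/
def expireEdges : Prog :=
  .assign 40 0 ;; .while (.less (.reg 40) (.reg 14)) (
    .assign 30 (.cell 3 (.reg 18 + .reg 40)) ;; .assign 31 (.reg 40) ;;
    .ite (.same (.cell 6 (.reg 30)) (.reg 17)) eraseEdge .skip ;;
    .assign 40 (.reg 40 + 1))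

/-- Compute the hash value of the element in register `1`. -/
def computeHash : Prog :=
  (.assign 41 0 ;; .assign 42 0) ;; .while (.less (.reg 42) (.reg 13)) (
    .assign 41 ((.reg 41 * .reg 1 + .cell 0 (.reg 42)) % .reg 12) ;; .assign 42 (.reg 42 + 1))

/-- Compute the level of the hash value in register `41`. -/
def computeLevel : Prog :=
  (.assign 31 0 ;; .assign 43 (.reg 12 / 2)) ;;
  .while (.less (.reg 31 + 1) (.reg 14) * .less (.reg 41) (.reg 43)) (
    .assign 43 (.reg 43 / 2) ;; .assign 31 (.reg 31 + 1))

/-- Insert the edge in the registers `0` and `1` into the level in register `31`. -/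
def insertEdge : Prog :=
  .assign 30 ((.reg 0 + 1) * .reg 11 + .reg 1) ;;
  .ite (.cell 6 (.reg 30)) eraseEdge .skip ;;
  pushEdge ;;
  .ite (.less (.reg 15) (.cell 8 (.reg 1))) (.assign 30 (.cell 5 (.reg 1)) ;; eraseEdge) .skip ;;
  .ite (.less (.reg 16) (.cell 7 (.reg 31)))
    (.assign 30 (.cell 3 (.reg 18 + .reg 31)) ;; eraseEdge) .skip

def updateProg : Prog :=
  .assign 17 (.reg 17 % .reg 3 + 1) ;; expireEdges ;; computeHash ;; computeLevel ;; insertEdge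

theorem levelOf_lt {q LV h : ℕ} (hLV : 1 ≤ LV) : levelOf q LV h < LV := by
  have := Nat.findGreatest_le (P := fun i => h < q / 2 ^ i) (LV - 1)
  unfold levelOf
  omega

/-- The thresholds decrease, so the levels from `i` on together form the sample with threshold `q /
2 ^ i`. -/
theorem le_levelOf_iff {q LV h i : ℕ} (hi : i < LV) (hq : h < q) :
    i ≤ levelOf q LV h ↔ h < q / 2 ^ i := by
  constructor
  · intro h1
    have h2 : h < q / 2 ^ levelOf q LV h :=
      Nat.findGreatest_spec (P := fun i => h < q / 2 ^ i) (m := 0) (Nat.zero_le _) (by simpa using hq)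
    exact h2.trans_le (Nat.div_le_div_left (Nat.pow_le_pow_right (by norm_num) h1) (by positivity))
  · intro h1
    exact Nat.le_findGreatest (by omega) h1

theorem hashVal_succ (q d : ℕ) (co : ℕ → ℕ) (e : ℕ) :
    hashVal q (d + 1) co e = (hashVal q d co e * e + co d) % q := by
  simp [hashVal, List.range_succ]

theorem hashVal_lt {q : ℕ} (hq : 0 < q) (d : ℕ) (co : ℕ → ℕ) (e : ℕ) : hashVal q d co e < q := by
  cases d with
  | zero => simpa [hashVal] using hq
  | succ d => rw [hashVal_succ]; exact Nat.mod_lt _ hq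

theorem slot_succ (W t : ℕ) : slot W t % W + 1 = slot W (t + 1) := by
  unfold slot
  by_cases h : t = 0
  · simp [h]
  · obtain ⟨t, rfl⟩ := Nat.exists_eq_succ_of_ne_zero h
    simp

/-- Words are too short for positions in the stream, so time is kept modulo `W`, with values from
`1` on to leave `0` for absent edges. Within the window two stamps agree only at distance `W`, which
is the moment of expiry. -/
theorem slot_eq_iff {W t l : ℕ} (h1 : 1 ≤ l) (h2 : l ≤ t) (h3 : t < l + W) :
    slot W l = slot W (t + 1) ↔ t + 1 = l + W := by
  obtain ⟨l, rfl⟩ := Nat.exists_eq_add_of_le' h1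
  simp only [slot, Nat.succ_ne_zero, if_false, Nat.add_sub_cancel, Nat.add_right_cancel_iff]
  constructor
  · intro h
    have h4 : W ∣ t - l := (Nat.modEq_iff_dvd' (by omega)).1 h
    have h5 := Nat.le_of_dvd (by omega) h4
    omega
  · intro h
    have : t = l + W := by omega
    rw [this, Nat.add_mod_right]

theorem mem_of_mem_recency {W x : ℕ} (hW : 1 ≤ W) {ρ : List ℕ} (h : x ∈ recency W ρ) : x ∈ ρ :=
  List.mem_of_mem_take ((mem_recency hW x ρ).1 h)

theorem one_le_lastTime {x : ℕ} : ∀ {ρ : List ℕ}, x ∈ ρ → 1 ≤ lastTime ρ x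
  | y :: ρ, h => by
      rw [lastTime]
      split_ifs with h1
      · omega
      · exact one_le_lastTime (by simpa [h1] using h)

section Update

variable {K : Conf} {N : ℕ} {ω : Coins} {co : ℕ → ℕ} {ρ : List ℕ} {s : State}

theorem mem_recency_of_mem_kept {W m D B : ℕ} {lev : ℕ → ℕ} {l x : ℕ}
    (h : x ∈ kept W m D B lev ρ l) : x ∈ recency W ρ ∧ lev (x % m) = l := by
  have h1 := List.mem_filter.1 (List.mem_of_mem_take h)
  exact ⟨List.mem_of_mem_filter h1.1, by simpa using h1.2⟩

theorem mem_recency_of_mem_keptUnexpired {W m D B : ℕ} {lev : ℕ → ℕ} {l x : ℕ}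
    (h : x ∈ keptUnexpired W m D B lev ρ l) : x ∈ recency W ρ ∧ lev (x % m) = l := by
  have h1 := List.mem_filter.1 (List.mem_of_mem_take h)
  exact ⟨List.mem_of_mem_filter (List.mem_of_mem_filter h1.1), by simpa using h1.2⟩

/-- The mixture over `j` describes the state in the middle of the expiry loop, when the levels below
`j` have been treated. -/
theorem wf_kept (lev : ℕ → ℕ) (hW : 1 ≤ K.W) (hρ : ∀ x ∈ ρ, K.m ≤ x ∧ x < K.codes) (j : ℕ) :
    Wf K lev fun l => if l < j then keptUnexpired K.W K.m K.D K.B lev ρ l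
      else kept K.W K.m K.D K.B lev ρ l := by
  have key : ∀ l x, x ∈ (if l < j then keptUnexpired K.W K.m K.D K.B lev ρ l
      else kept K.W K.m K.D K.B lev ρ l) → x ∈ recency K.W ρ ∧ lev (x % K.m) = l := by
    intro l x h
    split_ifs at h
    · exact mem_recency_of_mem_keptUnexpired h
    · exact mem_recency_of_mem_kept h
  refine ⟨fun l => ?_, fun l x h => (key l x h).2,
    fun l x h => (hρ x (mem_of_mem_recency hW (key l x h).1)).1,
    fun l x h => (hρ x (mem_of_mem_recency hW (key l x h).1)).2⟩
  split_ifs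
  · exact ((nodup_unexpired.filter _).filter _).sublist (List.take_sublist _ _)
  · exact (((nodup_recency _ _).filter _).filter _).sublist (List.take_sublist _ _)

theorem Rep.tail {st : ℕ → List ℕ} {lev ts : ℕ → ℕ} (h : Rep K co lev st ts s) (l : ℕ) :
    s.arr 3 (K.codes + l) = (st l).getLastD 0 := by
  rw [h.level.pv_eq, levelOwn_hd, nxt_cons_self]
  rcases List.eq_nil_or_concat (st l) with h | ⟨E, z, h⟩ <;> simp [h]

theorem Rep.elem_tail {st : ℕ → List ℕ} {lev ts : ℕ → ℕ} (h : Rep K co lev st ts s) {e : ℕ}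
    (he : e < K.m) : s.arr 5 e = (atElem K.m e (st (lev e))).getLastD 0 := by
  rw [h.elem.pv_eq]
  simp only [Nat.mod_eq_of_lt he, id, nxt_cons_self]
  rcases List.eq_nil_or_concat (atElem K.m e (st (lev e))) with h | ⟨E, z, h⟩ <;> simp [h]

theorem getLastD_mem {L : List ℕ} (h : L ≠ []) : L.getLastD 0 ∈ L := by
  rcases List.eq_nil_or_concat L with h1 | ⟨E, z, h1⟩
  · exact absurd h1 h
  · simp [h1]

/-- By `keptUnexpired_eq` only the tail of a level can expire, and by `slot_eq_iff` its stamp then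
equals the clock, which has already been advanced. One comparison per level is enough. -/
theorem expireEdges_runs (hK : K.Fits N) (hW : 1 ≤ K.W) (lev : ℕ → ℕ) (hlev : ∀ e, lev e < K.LV)
    (hρ : ∀ x ∈ ρ, K.m ≤ x ∧ x < K.codes) (hR : K.Regs s)
    (h17 : s.reg 17 = slot K.W (ρ.length + 1))
    (h : Rep K co lev (kept K.W K.m K.D K.B lev ρ) (fun x => slot K.W (lastTime ρ x)) s) :
    Runs N ω expireEdges s (400 * K.LV + 20) fun s' =>
      Rep K co lev (keptUnexpired K.W K.m K.D K.B lev ρ) (fun x => slot K.W (lastTime ρ x)) s' ∧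
      ∀ r, r < 30 → s'.reg r = s.reg r := by
  have hcells := hK.cells
  set st : ℕ → ℕ → List ℕ := fun j l => if l < j then keptUnexpired K.W K.m K.D K.B lev ρ l
      else kept K.W K.m K.D K.B lev ρ l with hst
  set ts : ℕ → ℕ := fun x => slot K.W (lastTime ρ x) with hts
  have hwf : ∀ j, Wf K lev (st j) := wf_kept lev hW hρ
  have hloop := Runs.for (N := N) (ω := ω) (n := K.LV) (T := 380) (s := s.setReg 40 0)
    (e := .less (.reg 40) (.reg 14))
    (p := .assign 30 (.cell 3 (.reg 18 + .reg 40)) ;; .assign 31 (.reg 40) ;;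
      .ite (.same (.cell 6 (.reg 30)) (.reg 17)) eraseEdge .skip ;; .assign 40 (.reg 40 + 1))
    (fun i s' => i ≤ K.LV ∧ s'.reg 40 = K.LV - i ∧ (∀ r < 30, s'.reg r = s.reg r) ∧
      Rep K co lev (st (K.LV - i)) ts s')
    ⟨le_rfl, by simp, fun r hr => by simp [show r ≠ 40 by omega], by
      have : st (K.LV - K.LV) = kept K.W K.m K.D K.B lev ρ := by
        funext l
        simp [hst]
      rw [this]
      exact h.congr rfl⟩
    (fun i s' _ => by simp; omega) (by
      rintro i s1 ⟨hi, h40, hreg, hrep⟩ hlt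
      simp only [val_less, val_reg, h40, (hR.congr fun r hr => hreg r (by omega)).LV] at hlt
      have hi0 : i ≠ 0 := by
        rintro rfl
        simp at hlt
      set j := K.LV - i with hj
      have hj' : K.LV - (i - 1) = j + 1 := by omega
      have hjl : j < K.LV := by omega
      have hR1 : K.Regs s1 := hR.congr fun r hr => hreg r (by omega)
      have h18 := hR1.codes
      have htail := hrep.tail j
      have hstj : st j j = kept K.W K.m K.D K.B lev ρ j := by simp [hst]
      rw [hstj] at htail
      set y := (kept K.W K.m K.D K.B lev ρ j).getLastD 0 with hy
      have hyle : y ≤ K.codes := by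
        rw [← htail]
        exact (hrep.pointer_le (hwf j) _).2.1
      have hnext : ∀ L : List ℕ, keptUnexpired K.W K.m K.D K.B lev ρ j = L →
          Function.update (st j) j L = st (j + 1) := by
        intro L hL
        funext l
        by_cases hl : l = j
        · subst hl
          simp [hst, hL]
        · rw [Function.update_of_ne hl]
          have : l < j ↔ l < j + 1 := by omega
          simp [hst, this]
      have hself : Function.update (st j) j (kept K.W K.m K.D K.B lev ρ j) = st j := by
        rw [← hstj]; exact Function.update_eq_self _ _
      refine ⟨i - 1, by omega, ?_⟩
      refine Runs.mono (T := 18 + 362) (Q := fun s' => K.LV - (i - 1) = s'.reg 40 ∧ (∀ r < 30, s'.reg r = s.reg r) ∧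
          Rep K co lev (st (j + 1)) ts s') ?_ (by norm_num) (fun s' hs' => ⟨by omega, hs'.1.symm, hs'.2.1, ?_⟩)
      swap
      · rw [hj']; exact hs'.2.2
      rw [hj']
      have hsafe1 : (Prog.assign 30 (.cell 3 (.reg 18 + .reg 40))).Safe N ω s1 := by
        simp [h18, h40]
        omega
      refine (Runs.block (T := 9) hsafe1 (Nat.le_of_ble_eq_true rfl) (Q := fun s' => s' = s1.setReg 30 y)
        (by simp [h18, h40, htail])).seq (T' := 371) ?_
      rintro s2 rfl
      refine (Runs.block (T := 9) (by simp) (Nat.le_of_ble_eq_true rfl)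
        (Q := fun s' => s' = (s1.setReg 30 y).setReg 31 j)
        (by simp [h40])).seq (T' := 362) ?_
      rintro s2 rfl
      set s2 := (s1.setReg 30 y).setReg 31 j with hs2
      have hrep2 : Rep K co lev (st j) ts s2 := hrep.congr rfl
      have hR2 : K.Regs s2 := hR1.congr fun r hr => by
        simp [hs2, show r ≠ 31 by omega, show r ≠ 30 by omega]
      have h17' : s2.reg 17 = slot K.W (ρ.length + 1) := by
        simp [hs2, hreg 17 (by norm_num), h17]
      refine Runs.seq (T := 350) (R := fun s' => s'.reg 40 = j ∧ (∀ r < 30, s'.reg r = s.reg r) ∧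
        Rep K co lev (st (j + 1)) ts s') (T' := 12) ?_ ?_
      · refine Runs.mono (T := (Expr.cost (.same (.cell 6 (.reg 30)) (.reg 17))) + 1 + 300)
          (Runs.ite ?_ ?_ ?_) (Nat.le_of_ble_eq_true rfl) (fun _ h => h)
        · simp [hs2]
          omega
        · intro hval
          have hv : s2.arr 6 y = slot K.W (ρ.length + 1) := by
            by_contra hne
            apply hval
            simp [h17']
            rw [← show s2.reg 30 = y by simp [hs2]] at hne
            exact hne
          -- An empty level has tail `0`, whose stamp cell is `0`, whereas the clock is at least
          -- `1`; hence the test cannot succeed by accident.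
          have hpos : s2.arr 6 y ≠ 0 := by rw [hv]; simp [slot]
          have hymem : y ∈ st j (lev (y % K.m)) := by
            by_contra hn
            rw [hrep2.time, if_neg hn] at hpos
            exact hpos rfl
          have hne : kept K.W K.m K.D K.B lev ρ j ≠ [] := by
            intro h0
            have : y = 0 := by rw [hy, h0]; rfl
            exact (hwf j).zero_notMem _ (this ▸ hymem)
          have hyj : y ∈ st j j := by
            rw [hstj]; exact getLastD_mem hne
          have hyr : y ∈ recency K.W ρ := (mem_recency_of_mem_kept (hstj ▸ hyj)).1
          have hrec := (mem_take_iff_lastTime y ρ K.W).1 ((mem_recency hW y ρ).1 hyr)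
          have hexp : ρ.length + 1 = lastTime ρ y + K.W := by
            rw [hrep2.time, if_pos hymem] at hv
            exact (slot_eq_iff (one_le_lastTime hrec.1) (lastTime_le y ρ) hrec.2).1 hv
          refine (eraseEdge_runs hK (hwf j) hrep2 hR2 (by simp [hs2]) (by simp [hs2]) hjl hyj).mono
            le_rfl fun s' hs' => ⟨?_, fun r hr => ?_, ?_⟩
          · rw [hs'.2 40 (by norm_num)]
            simp [hs2, h40]
          · rw [hs'.2 r (by omega)]
            simp [hs2, show r ≠ 31 by omega, show r ≠ 30 by omega, hreg r hr]
          · rw [← hnext ((st j j).erase y)]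
            · exact hs'.1
            · rw [keptUnexpired_eq hW, ← hy, if_pos ⟨hexp, hne⟩, hstj]
        · intro hval
          have hv : s2.arr 6 y ≠ slot K.W (ρ.length + 1) := by
            intro he
            have : s2.reg 30 = y := by simp [hs2]
            simp [h17', this, he] at hval
          refine Runs.block (by simp) (Nat.le_of_ble_eq_true rfl) ⟨?_, fun r hr => ?_, ?_⟩
          · simp [hs2, h40]
          · simp [hs2, show r ≠ 31 by omega, show r ≠ 30 by omega, hreg r hr]
          · rw [← hnext (kept K.W K.m K.D K.B lev ρ j), hself]
            · exact hrep2
            · rw [keptUnexpired_eq hW, ← hy, if_neg]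
              rintro ⟨h1, h2⟩
              apply hv
              have hyj : y ∈ kept K.W K.m K.D K.B lev ρ j := getLastD_mem h2
              have hyl : lev (y % K.m) = j := (mem_recency_of_mem_kept hyj).2
              have hyr : y ∈ recency K.W ρ := (mem_recency_of_mem_kept hyj).1
              have hrec := (mem_take_iff_lastTime y ρ K.W).1 ((mem_recency hW y ρ).1 hyr)
              rw [hrep2.time, hyl, hstj, if_pos hyj]
              exact (slot_eq_iff (one_le_lastTime hrec.1) (lastTime_le y ρ) hrec.2).2 h1
      · rintro s3 ⟨h1, h2, h3⟩
        refine Runs.block (by simp [h1]; omega) (Nat.le_of_ble_eq_true rfl) ⟨?_, fun r hr => ?_, ?_⟩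
        · simp [h1]
        · simp [show r ≠ 40 by omega, h2 r hr]
        · exact h3.congr rfl)
  refine ((Runs.block (T := 2) (by simp; omega) (Nat.le_of_ble_eq_true rfl)
    (Q := fun s' => s' = s.setReg 40 0) (by simp)).seq (T' := 400 * K.LV + 18) ?_).mono (by omega) (fun _ h => h)
  rintro s1 rfl
  refine hloop.mono ?_ ?_
  · simp only [Expr.less, Expr.cost]
    omega
  · rintro s' ⟨i, ⟨hi, h40, hreg, hrep⟩, hval⟩
    refine ⟨?_, hreg⟩
    have h14 := (hR.congr fun r hr => hreg r (by omega)).LV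
    have hi0 : i = 0 := by
      simp only [val_less, val_reg, h40, h14] at hval
      by_contra hne
      rw [if_pos (by have := hlev 0; omega)] at hval
      exact one_ne_zero hval
    subst hi0
    convert hrep using 1
    funext l
    simp only [hst, Nat.sub_zero]
    split_ifs with hl
    · rfl
    · have e1 : keptUnexpired K.W K.m K.D K.B lev ρ l = [] :=
        List.eq_nil_iff_forall_not_mem.2 fun x hx => by
          have := (mem_recency_of_mem_keptUnexpired hx).2
          exact hl (this ▸ hlev _)
      have e2 : kept K.W K.m K.D K.B lev ρ l = [] :=
        List.eq_nil_iff_forall_not_mem.2 fun x hx => by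
          have := (mem_recency_of_mem_kept hx).2
          exact hl (this ▸ hlev _)
      rw [e1, e2]

theorem computeHash_runs (hK : K.Fits N) (hq : 0 < K.q) (hco : ∀ j < K.d, co j < K.q)
    (hR : K.Regs s) (hc : ∀ j < K.d, s.arr 0 j = co j) {e : ℕ} (he : s.reg 1 = e) (hem : e < K.m) :
    Runs N ω computeHash s (40 * K.d + 20) fun s' => s'.arr = s.arr ∧
      s'.reg 41 = hashVal K.q K.d co e ∧ ∀ r, r < 41 → s'.reg r = s.reg r := by
  have hcoefs := hK.coefs
  have hhash := hK.hash
  have hcells := hK.cells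
  have hloop := Runs.for (N := N) (ω := ω) (n := K.d) (T := 24) (s := (s.setReg 41 0).setReg 42 0)
    (e := .less (.reg 42) (.reg 13))
    (p := .assign 41 ((.reg 41 * .reg 1 + .cell 0 (.reg 42)) % .reg 12) ;; .assign 42 (.reg 42 + 1))
    (fun i s' => i ≤ K.d ∧ s'.reg 42 = K.d - i ∧ s'.reg 41 = hashVal K.q (K.d - i) co e ∧
      s'.arr = s.arr ∧ ∀ r, r < 41 → s'.reg r = s.reg r)
    ⟨le_rfl, by simp, by simp [hashVal], rfl,
      fun r hr => by simp [show r ≠ 41 by omega, show r ≠ 42 by omega]⟩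
    (fun i s' _ => by simp; omega) (by
      rintro i s1 ⟨hi, h42, h41, harr, hreg⟩ hlt
      have hR1 : K.Regs s1 := hR.congr fun r hr => hreg r (by omega)
      simp only [val_less, val_reg, h42, hR1.d] at hlt
      have hi0 : i ≠ 0 := by
        rintro rfl
        simp at hlt
      have hj' : K.d - (i - 1) = K.d - i + 1 := by omega
      have hjd : K.d - i < K.d := by omega
      have hlt1 := hashVal_lt hq (K.d - i) co e
      have hmul : hashVal K.q (K.d - i) co e * e + co (K.d - i) < N := by
        have h1 := Nat.mul_le_mul hlt1.le hem.le
        have h2 := hco _ hjd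
        omega
      have hmul' : hashVal K.q (K.d - i) co e * e < N := lt_of_le_of_lt (Nat.le_add_right _ _) hmul
      refine ⟨i - 1, by omega, Runs.block ?_ (Nat.le_of_ble_eq_true rfl) ⟨by omega, ?_, ?_, ?_, ?_⟩⟩
      · simp [h42, h41, harr, hreg 1 (by norm_num), he, hc _ hjd, hmul, hmul']
        omega
      · simp [h42, hj']
      · simp [h42, h41, harr, hreg 1 (by norm_num), he, hc _ hjd, hR1.q, hj', hashVal_succ]
      · simp [harr]
      · intro r hr
        simp [show r ≠ 41 by omega, show r ≠ 42 by omega, hreg r hr])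
  refine ((Runs.block (T := 4) (by simp; omega) (Nat.le_of_ble_eq_true rfl)
    (Q := fun s' => s' = (s.setReg 41 0).setReg 42 0) (by simp)).seq (T' := 40 * K.d + 16) ?_).mono
      (by omega) (fun _ h => h)
  rintro s1 rfl
  refine hloop.mono ?_ ?_
  · simp only [Expr.less, Expr.cost]
    omega
  · rintro s' ⟨i, ⟨hi, h42, h41, harr, hreg⟩, hval⟩
    have h13 := (hR.congr fun r hr => hreg r (by omega)).d
    have hi0 : i = 0 := by
      simp only [val_less, val_reg, h42, h13] at hval
      by_contra hne
      rw [if_pos (by omega)] at hval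
      exact one_ne_zero hval
    subst hi0
    exact ⟨harr, by simpa using h41, hreg⟩

/-- Thresholds decrease, so stopping at the first one that the hash value misses finds the last one
that it meets. Register `43` runs one halving ahead of the level. -/
theorem computeLevel_runs (hK : K.Fits N) (hLV : 1 ≤ K.LV) (hR : K.Regs s) {h : ℕ}
    (hh : s.reg 41 = h) (hq : h < K.q) :
    Runs N ω computeLevel s (40 * K.LV + 20) fun s' => s'.arr = s.arr ∧
      s'.reg 31 = levelOf K.q K.LV h ∧ ∀ r, r < 30 → s'.reg r = s.reg r := by
  have hcells := hK.cells
  set l := levelOf K.q K.LV h with hl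
  have hllt : l < K.LV := levelOf_lt hLV
  have hloop := Runs.for (N := N) (ω := ω) (n := l) (T := 24)
    (s := (s.setReg 31 0).setReg 43 (K.q / 2))
    (e := .less (.reg 31 + 1) (.reg 14) * .less (.reg 41) (.reg 43))
    (p := .assign 43 (.reg 43 / 2) ;; .assign 31 (.reg 31 + 1))
    (fun i s' => i ≤ l ∧ s'.reg 31 = l - i ∧ s'.reg 43 = K.q / 2 ^ (l - i + 1) ∧ s'.reg 41 = h ∧
      s'.arr = s.arr ∧ ∀ r, r < 30 → s'.reg r = s.reg r)
    ⟨le_rfl, by simp, by simp, by simp [hh], rfl,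
      fun r hr => by simp [show r ≠ 31 by omega, show r ≠ 43 by omega]⟩
    (fun i s' ⟨hi, h31, _, _, _⟩ => by
      have hb : ∀ (p : Prop) [Decidable p], (if p then 1 else 0) < N := by
        intro p _
        split_ifs <;> omega
      simp [h31]
      repeat' apply And.intro
      all_goals first | omega | (split_ifs <;> first | omega | exact hb _)) (by
      rintro i s1 ⟨hi, h31, h43, h41, harr, hreg⟩ hlt
      have hR1 : K.Regs s1 := hR.congr fun r hr => hreg r (by omega)
      simp only [val_less, val_reg, val_mul, val_add, val_ofNat, h31, h43, h41, hR1.LV, ne_eq,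
        mul_eq_zero, not_or, ite_eq_right_iff, one_ne_zero, imp_false, not_not] at hlt
      have hi0 : i ≠ 0 := by
        rintro rfl
        have := (le_levelOf_iff (i := l - 0 + 1) hlt.1 hq).2 hlt.2
        omega
      have hj' : l - (i - 1) = l - i + 1 := by omega
      refine ⟨i - 1, by omega, Runs.block ?_ (Nat.le_of_ble_eq_true rfl) ⟨by omega, ?_, ?_, ?_, ?_, ?_⟩⟩
      · simp [h31]
        omega
      · simp [h31, hj']
      · simp [h43, hj', Nat.div_div_eq_div_mul, pow_succ]
      · simp [h41]
      · simp [harr]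
      · intro r hr
        simp [show r ≠ 31 by omega, show r ≠ 43 by omega, hreg r hr])
  refine ((Runs.block (T := 6) (by simp; omega) (Nat.le_of_ble_eq_true rfl)
    (Q := fun s' => s' = (s.setReg 31 0).setReg 43 (K.q / 2)) (by simp [hR.q])).seq
      (T' := 40 * K.LV + 14) ?_).mono (by omega) (fun _ h => h)
  rintro s1 rfl
  refine hloop.mono ?_ ?_
  · have : (Expr.cost (.less (.reg 31 + 1) (.reg 14) * .less (.reg 41) (.reg 43))) = 9 := rfl
    rw [this]
    omega
  · rintro s' ⟨i, ⟨hi, h31, h43, h41, harr, hreg⟩, hval⟩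
    have h14 := (hR.congr fun r hr => hreg r (by omega)).LV
    have hi0 : i = 0 := by
      by_contra hne
      simp only [val_less, val_reg, val_mul, val_add, val_ofNat, h31, h43, h41, h14] at hval
      have c1 : l - i + 1 < K.LV := by omega
      rw [if_pos c1, if_pos ((le_levelOf_iff c1 hq).1 (by omega))] at hval
      exact one_ne_zero hval
    subst hi0
    exact ⟨harr, by simpa using h31, hreg⟩

/-- The four phases are removal of an old copy, insertion, the drop prescribed by `touch` and the
one prescribed by `cap`. Stored edges have positive stamps, so the stamp cell doubles as the
membership test. -/
theorem insertEdge_runs (hK : K.Fits N) {lev : ℕ → ℕ} {st : ℕ → List ℕ} {ts : ℕ → ℕ}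
    (hWf : Wf K lev st) (h : Rep K co lev st ts s) (hR : K.Regs s)
    (hts : ∀ l, ∀ x ∈ st l, 0 < ts x) {S e : ℕ} (hS : S < K.n)
    (he : e < K.m) (h0 : s.reg 0 = S) (h1 : s.reg 1 = e) (hl : lev e < K.LV)
    (h31 : s.reg 31 = lev e) :
    Runs N ω insertEdge s 1400 fun s' =>
      Rep K co lev (Function.update st (lev e)
          (cap K.B (touch K.m K.D ((S + 1) * K.m + e) (st (lev e)))))
        (Function.update ts ((S + 1) * K.m + e) (s.reg 17)) s' ∧
      ∀ r, r < 30 → s'.reg r = s.reg r := by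
  have hcells := hK.cells
  have hindex := hK.set_index
  have helem := hK.elem
  set x := (S + 1) * K.m + e with hx
  have hxe : x % K.m = e := by rw [hx, Nat.mul_add_mod_self_right, Nat.mod_eq_of_lt he]
  have hxlt : x < K.codes := by
    have : (S + 1 + 1) * K.m ≤ (K.n + 1) * K.m := Nat.mul_le_mul_right _ (by omega)
    rw [Conf.codes]
    rw [add_one_mul] at this
    omega
  have hxge : K.m ≤ x := by
    have : 1 * K.m ≤ (S + 1) * K.m := Nat.mul_le_mul_right _ (by omega)
    omega
  have hcm : K.m ≤ K.codes := Nat.le_mul_of_pos_left _ (Nat.succ_pos _)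
  have h11 := hR.m
  set l := lev e with hle
  set s1 := s.setReg 30 x with hs1
  have hrep1 : Rep K co lev st ts s1 := h.congr rfl
  have hR1 : K.Regs s1 := hR.congr fun r hr => by simp [hs1, show r ≠ 30 by omega]
  -- the edge is removed
  have step1 : Runs N ω (.ite (.cell 6 (.reg 30)) eraseEdge .skip) s1 310 fun s' =>
      Rep K co lev (Function.update st l ((st l).erase x)) ts s' ∧
        (∀ r, r < 32 ∨ 35 ≤ r → s'.reg r = s1.reg r) := by
    have h6 : s1.arr 6 x = if x ∈ st l then ts x else 0 := by rw [hrep1.time, hxe]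
    refine Runs.mono (T := (Expr.cost (.cell 6 (.reg 30))) + 1 + 300)
      (Runs.ite ?_ ?_ ?_) (Nat.le_of_ble_eq_true rfl) (fun _ h => h)
    · simp [hs1]
      omega
    · intro hval
      have hxm : x ∈ st l := by
        by_contra hn
        simp [show s1.reg 30 = x by simp [hs1], h6, hn] at hval
      exact eraseEdge_runs hK hWf hrep1 hR1 (by simp [hs1]) (by simp [hs1, h31]) hl hxm
    · intro hval
      have hxm : x ∉ st l := by
        intro hm
        simp [show s1.reg 30 = x by simp [hs1], h6, hm] at hval
        have := hts l x hm
        omega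
      rw [List.erase_of_not_mem hxm, Function.update_eq_self]
      exact Runs.block (by simp) (Nat.le_of_ble_eq_true rfl) ⟨hrep1, fun r _ => rfl⟩
  set st1 := Function.update st l ((st l).erase x) with hst1
  have hWf1 : Wf K lev st1 := hWf.erase l x
  have hst1l : st1 l = (st l).erase x := Function.update_self _ _ _
  have hx1 : x ∉ st1 l := by
    rw [hst1l, (hWf.nodup l).mem_erase_iff]
    exact fun h => h.1 rfl
  set st2 := Function.update st1 l (x :: (st l).erase x) with hst2
  have hst2' : st2 = Function.update st l (x :: (st l).erase x) := by
    rw [hst2, hst1, Function.update_idem]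
  have hst2l : st2 l = x :: (st l).erase x := Function.update_self _ _ _
  have hWf2 : Wf K lev st2 := by
    have := hWf1.push (x := x) hxge hxlt (by rwa [hxe])
    rw [hxe, ← hle, hst1l] at this
    exact this
  set ts2 := Function.update ts x (s.reg 17) with hts2
  -- truncation at the element
  have step3 : ∀ s2, Rep K co lev st2 ts2 s2 → (∀ r, r < 32 ∨ 35 ≤ r → s2.reg r = s1.reg r) →
      Runs N ω (.ite (.less (.reg 15) (.cell 8 (.reg 1)))
        (.assign 30 (.cell 5 (.reg 1)) ;; eraseEdge) .skip) s2 330 fun s' =>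
      Rep K co lev (Function.update st2 l (touch K.m K.D x (st l))) ts2 s' ∧
        (∀ r, r ≠ 30 → r < 32 ∨ 35 ≤ r → s'.reg r = s1.reg r) := by
    intro s2 hrep2 hreg2
    have hR2 : K.Regs s2 := hR1.congr fun r hr => hreg2 r (by omega)
    have h21 : s2.reg 1 = e := by rw [hreg2 1 (by norm_num)]; simp [hs1, h1]
    have h231 : s2.reg 31 = l := by rw [hreg2 31 (by norm_num)]; simp [hs1, h31]
    have h8 : s2.arr 8 e = (atElem K.m (x % K.m) (x :: (st l).erase x)).length := by
      rw [hrep2.elem_count, ← hle, hst2l, hxe]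
    refine Runs.mono (T := (Expr.cost (.less (.reg 15) (.cell 8 (.reg 1)))) + 1 + 310)
      (Runs.ite ?_ ?_ ?_) (Nat.le_of_ble_eq_true rfl) (fun _ h => h)
    · simp [h21]
      omega
    · intro hval
      simp [h21, hR2.D, h8] at hval
      have h5 := hrep2.elem_tail he
      rw [← hle, hst2l, ← hxe] at h5
      set z := (atElem K.m (x % K.m) (x :: (st l).erase x)).getLastD 0 with hz
      have hzm : z ∈ x :: (st l).erase x := by
        refine List.mem_of_mem_filter (getLastD_mem (L := atElem K.m (x % K.m) (x :: (st l).erase x)) ?_)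
        intro h0
        rw [h0] at hval
        simp at hval
      refine (Runs.block (T := 10) (by simp [h21]; omega) (Nat.le_of_ble_eq_true rfl)
        (Q := fun s' => s' = s2.setReg 30 z) (by rw [← h5, hxe]; simp [h21])).seq (T' := 300) ?_
      rintro s3 rfl
      refine (eraseEdge_runs hK hWf2 (s := s2.setReg 30 z) (y := z) (hrep2.congr rfl)
        (hR2.congr fun r hr => by simp [show r ≠ 30 by omega]) (by simp)
        (by simp [h231]) hl (by rw [hst2l]; exact hzm)).mono le_rfl ?_
      rintro s' ⟨hs', hreg'⟩
      refine ⟨?_, fun r h30 hr => ?_⟩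
      · rw [touch, if_pos hval, ← hst2l]
        rw [hst2l]
        rw [hst2l] at hs'
        exact hs'
      · rw [hreg' r hr]
        simp [h30, hreg2 r hr]
    · intro hval
      simp [h21, hR2.D, h8] at hval
      rw [touch, if_neg (by omega), ← hst2l, Function.update_eq_self]
      exact Runs.block (by simp) (Nat.le_of_ble_eq_true rfl) ⟨hrep2, fun r _ hr => hreg2 r hr⟩
  set M := touch K.m K.D x (st l) with hM
  set st3 := Function.update st2 l M with hst3
  have hst3l : st3 l = M := Function.update_self _ _ _
  have hWf3 : Wf K lev st3 := by
    by_cases hc : K.D < (atElem K.m (x % K.m) (x :: (st l).erase x)).length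
    · rw [hst3, hM, touch, if_pos hc, ← hst2l]
      exact hWf2.erase l _
    · rw [hst3, hM, touch, if_neg hc, ← hst2l, Function.update_eq_self]
      exact hWf2
  -- truncation of the level
  have step4 : ∀ s2, Rep K co lev st3 ts2 s2 →
      (∀ r, r ≠ 30 → r < 32 ∨ 35 ≤ r → s2.reg r = s1.reg r) →
      Runs N ω (.ite (.less (.reg 16) (.cell 7 (.reg 31)))
        (.assign 30 (.cell 3 (.reg 18 + .reg 31)) ;; eraseEdge) .skip) s2 330 fun s' =>
      Rep K co lev (Function.update st3 l (cap K.B M)) ts2 s' ∧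
        (∀ r, r < 30 → s'.reg r = s1.reg r) := by
    intro s2 hrep2 hreg2
    have hR2 : K.Regs s2 := hR1.congr fun r hr => hreg2 r (by omega) (by omega)
    have h231 : s2.reg 31 = l := by rw [hreg2 31 (by norm_num) (by norm_num)]; simp [hs1, h31]
    have h7 : s2.arr 7 l = M.length := by
      rw [hrep2.count, hst3l]
    refine Runs.mono (T := (Expr.cost (.less (.reg 16) (.cell 7 (.reg 31)))) + 1 + 310)
      (Runs.ite ?_ ?_ ?_) (Nat.le_of_ble_eq_true rfl) (fun _ h => h)
    · simp [h231]
      omega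
    · intro hval
      simp [h231, hR2.B, h7] at hval
      have h5 := hrep2.tail l
      rw [hst3l] at h5
      have hzm : M.getLastD 0 ∈ M := by
        refine getLastD_mem ?_
        intro h0
        rw [h0] at hval
        simp at hval
      refine (Runs.block (T := 10) (by simp [h231, hR2.codes]; omega) (Nat.le_of_ble_eq_true rfl)
        (Q := fun s' => s' = s2.setReg 30 (M.getLastD 0))
        (by rw [← h5]; simp [h231, hR2.codes])).seq (T' := 300) ?_
      rintro s3 rfl
      refine (eraseEdge_runs hK hWf3 (s := s2.setReg 30 (M.getLastD 0)) (y := M.getLastD 0) (hrep2.congr rfl)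
        (hR2.congr fun r hr => by simp [show r ≠ 30 by omega]) (by simp)
        (by simp [h231]) hl (by rw [hst3l]; exact hzm)).mono le_rfl ?_
      rintro s' ⟨hs', hreg'⟩
      refine ⟨?_, fun r hr => ?_⟩
      · rw [hst3l] at hs'
        rw [cap, if_pos hval]
        exact hs'
      · rw [hreg' r (by omega)]
        simp [show r ≠ 30 by omega, hreg2 r (by omega) (by omega)]
    · intro hval
      simp [h231, hR2.B, h7] at hval
      rw [cap, if_neg (by omega), ← hst3l, Function.update_eq_self]
      exact Runs.block (by simp) (Nat.le_of_ble_eq_true rfl)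
        ⟨hrep2, fun r hr => hreg2 r (by omega) (by omega)⟩
  have hmul : (S + 1) * K.m < N := by omega
  refine ((Runs.block (T := 20) ?_ (Nat.le_of_ble_eq_true rfl)
    (Q := fun s' => s' = s1) (by simp [h0, h1, h11, hs1, hx])).seq (T' := 310 + (300 + (330 + 330))) ?_).mono
      (by norm_num) (fun _ h => h)
  · simp [h0, h1, h11, hmul]
    have : S + 1 ≤ (S + 1) * K.m := Nat.le_mul_of_pos_right _ (by omega)
    omega
  rintro _ rfl
  refine step1.seq ?_
  rintro s2 ⟨hrep2, hreg2⟩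
  have hR2 : K.Regs s2 := hR1.congr fun r hr => hreg2 r (by omega)
  have hpush := pushEdge_runs (ω := ω) hK hWf1 hrep2 hR2 (x := x)
    (by rw [hreg2 30 (by norm_num)]; simp [hs1])
    (by rw [hreg2 31 (by norm_num), hxe]; simp [hs1, h31, hle]) (by rwa [hxe])
    (by rwa [hxe]) (by omega) hxge hxlt
  rw [hxe, ← hle, hst1l] at hpush
  refine hpush.seq ?_
  rintro s3 ⟨hrep3, hreg3⟩
  have h17' : s2.reg 17 = s.reg 17 := by rw [hreg2 17 (by norm_num)]; simp [hs1]
  rw [h17'] at hrep3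
  refine (step3 s3 hrep3 fun r hr => (hreg3 r hr).trans (hreg2 r hr)).seq ?_
  rintro s4 ⟨hrep4, hreg4⟩
  refine (step4 s4 hrep4 hreg4).mono le_rfl ?_
  rintro s5 ⟨hrep5, hreg5⟩
  refine ⟨?_, fun r hr => ?_⟩
  · convert hrep5 using 1
    rw [hst3, Function.update_idem, hst2', Function.update_idem]
  · rw [hreg5 r hr]
    simp [hs1, show r ≠ 30 by omega]

/-- The state after the reversed stream `ρ` of edge codes. -/
structure Ready (K : Conf) (co : ℕ → ℕ) (ρ : List ℕ) (s : State) : Prop where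
  regs : K.Regs s
  time : s.reg 17 = slot K.W ρ.length
  rep : Rep K co (K.lev co) (kept K.W K.m K.D K.B (K.lev co) ρ) (fun x => slot K.W (lastTime ρ x)) s

/-- The program follows the recursion `kept_cons`, `kept_cons_of_ne`: expiry acts on every level,
insertion on the level of the new element alone. The time is linear in the number of levels and of
coefficients. -/
theorem updateProg_runs (hK : K.Fits N) (hW : 1 ≤ K.W) (hD : 1 ≤ K.D) (hB : 1 ≤ K.B)
    (hLV : 1 ≤ K.LV) (hq : 0 < K.q) (hco : ∀ j < K.d, co j < K.q)
    (hρ : ∀ x ∈ ρ, K.m ≤ x ∧ x < K.codes) {S e : ℕ} (hS : S < K.n) (he : e < K.m)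
    (h : Ready K co ρ s) :
    Runs N ω updateProg ((s.setReg 0 S).setReg 1 e) (440 * K.LV + 40 * K.d + 1470)
      (Ready K co (((S + 1) * K.m + e) :: ρ)) := by
  have hwin := hK.window
  set x := (S + 1) * K.m + e with hx
  have hxe : x % K.m = e := by rw [hx, Nat.mul_add_mod_self_right, Nat.mod_eq_of_lt he]
  set s0 := (s.setReg 0 S).setReg 1 e with hs0
  set s1 := s0.setReg 17 (slot K.W (ρ.length + 1)) with hs1
  have hR1 : K.Regs s1 := by
    obtain ⟨h1, h2, h3, h4, h5, h6, h7, h8, h9, h10, h11⟩ := h.regs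
    constructor <;> simp [*]
  have hlev : ∀ a, K.lev co a < K.LV := fun a => levelOf_lt hLV
  have h17 : s0.reg 17 = slot K.W ρ.length := by simp [hs0, h.time]
  have h3 : s0.reg 3 = K.W := by simp [hs0, h.regs.W]
  have hmod : slot K.W ρ.length % K.W < K.W := Nat.mod_lt _ hW
  refine ((Runs.block (T := 6) (by simp [h17, h3]; omega) (Nat.le_of_ble_eq_true rfl)
    (Q := fun s' => s' = s1) (by simp [h17, h3, slot_succ, hs1])).seq
    (T' := (400 * K.LV + 20) + ((40 * K.d + 20) + ((40 * K.LV + 20) + 1400))) ?_).mono (by omega)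
      (fun _ h => h)
  rintro _ rfl
  refine (expireEdges_runs hK hW (K.lev co) hlev hρ hR1 (by simp [hs1]) (h.rep.congr rfl)).seq ?_
  rintro s2 ⟨hrep2, hreg2⟩
  have hR2 : K.Regs s2 := hR1.congr fun r hr => hreg2 r (by omega)
  refine (computeHash_runs hK hq hco hR2 (fun j hj => by rw [hrep2.coef, if_pos hj]) (e := e)
    (by rw [hreg2 1 (by norm_num)]; simp [hs1, hs0]) he).seq ?_
  rintro s3 ⟨harr3, h41, hreg3⟩
  have hR3 : K.Regs s3 := hR2.congr fun r hr => hreg3 r (by omega)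
  refine (computeLevel_runs hK hLV hR3 h41 (hashVal_lt hq _ _ _)).seq ?_
  rintro s4 ⟨harr4, h31, hreg4⟩
  have hR4 : K.Regs s4 := hR3.congr fun r hr => hreg4 r (by omega)
  have hreg : ∀ r < 30, s4.reg r = s1.reg r := fun r hr => by
    rw [hreg4 r hr, hreg3 r (by omega), hreg2 r hr]
  have hWf : Wf K (K.lev co) (keptUnexpired K.W K.m K.D K.B (K.lev co) ρ) := by
    have := wf_kept (K.lev co) hW hρ K.LV
    convert this using 1
    funext l
    split_ifs with hl
    · rfl
    · have e1 : keptUnexpired K.W K.m K.D K.B (K.lev co) ρ l = [] :=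
        List.eq_nil_iff_forall_not_mem.2 fun x hx => by
          have := (mem_recency_of_mem_keptUnexpired hx).2
          exact hl (this ▸ hlev _)
      have e2 : kept K.W K.m K.D K.B (K.lev co) ρ l = [] :=
        List.eq_nil_iff_forall_not_mem.2 fun x hx => by
          have := (mem_recency_of_mem_kept hx).2
          exact hl (this ▸ hlev _)
      rw [e1, e2]
  have h417 : s4.reg 17 = slot K.W (ρ.length + 1) := by rw [hreg 17 (by norm_num)]; simp [hs1]
  have hrep4 : Rep K co (K.lev co) (keptUnexpired K.W K.m K.D K.B (K.lev co) ρ)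
      (fun x => slot K.W (lastTime ρ x)) s4 := hrep2.congr (harr4.trans harr3)
  refine (insertEdge_runs hK hWf hrep4 hR4 ?_ (S := S) (e := e) hS he
    (by rw [hreg 0 (by norm_num)]; simp [hs1, hs0]) (by rw [hreg 1 (by norm_num)]; simp [hs1, hs0])
    (hlev e) h31).mono le_rfl ?_
  · intro l y hy
    have := one_le_lastTime (mem_of_mem_recency hW (mem_recency_of_mem_keptUnexpired hy).1)
    simp only [slot]
    rw [if_neg (by omega)]
    omega
  · rintro s5 ⟨hrep5, hreg5⟩
    refine ⟨hR4.congr fun r hr => hreg5 r (by omega), ?_, ?_⟩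
    · rw [hreg5 17 (by norm_num), h417]
      simp
    · rw [← hx, h417] at hrep5
      convert hrep5 using 1
      · funext l
        by_cases hl : l = K.lev co e
        · subst hl
          have := kept_cons (W := K.W) (m := K.m) (lev := K.lev co) (ρ := ρ) (x := x) hB hD
          rw [hxe] at this
          rw [Function.update_self, this]
        · rw [Function.update_of_ne hl, kept_cons_of_ne]
          rw [hxe]
          exact Ne.symm hl
      · funext z
        by_cases hz : z = x
        · subst hz
          simp [lastTime]
        · simp [lastTime, hz]

end Update

end KCover

/-! ### Single arrays and the traversal of linked lists -/

namespace WordRAM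

theorem setArr_arr_of_ne {s : State} {j j' i v : ℕ} (hj : j < 16) (hj' : j' < 16) (h : j' ≠ j) :
    (s.setArr j i v).arr j' = s.arr j' := by
  funext i'
  rw [setArr_arr _ _ _ _ _ _ hj hj', if_neg fun h1 => h h1.1]

theorem setArr_arr_self {s : State} {j i v : ℕ} (hj : j < 16) :
    (s.setArr j i v).arr j = Function.update (s.arr j) i v := by
  funext i'
  rw [setArr_arr _ _ _ _ _ _ hj hj, Function.update_apply]
  simp

/-- Traversal of a list; the last argument of `I` but one is the time that is left. -/
theorem Runs.traverse {N : ℕ} {ω : Coins} {p : Prog} {r : ℕ} (I : List ℕ → ℕ → State → Prop)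
    (h0 : ∀ b s, I [] b s → s.reg r = 0)
    (hc : ∀ x R b s, I (x :: R) b s → s.reg r ≠ 0 ∧ ∃ c b', c + b' + 2 ≤ b ∧ Runs N ω p s c (I R b')) :
    ∀ {L : List ℕ} {b : ℕ} {s : State}, I L b s →
      Runs N ω (.while (.reg r) p) s (b + 2) fun s' => ∃ b', I [] b' s'
  | [], b, s, hI => ⟨s, _, .while_false (by simp) (h0 b s hI), Nat.le_add_left _ _, b, hI⟩
  | x :: R, b, s, hI => by
      obtain ⟨h1, c, b', hb, s', t, h2, h3, h4⟩ := hc x R b s hI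
      obtain ⟨s'', t', h5, h6, h7⟩ := Runs.traverse I h0 hc h4
      refine ⟨s'', _, .while_true (by simp) h1 h2 h5, ?_, h7⟩
      simp only [Expr.cost]
      omega

end WordRAM

namespace KCover

open WordRAM

/-! ### Singly linked lists -/

/-- Starting with the pointer `p`, the array `nx` links the members of a list. -/
def Linked (nx : ℕ → ℕ) : ℕ → List ℕ → Prop
  | p, [] => p = 0
  | p, x :: l => p = x ∧ x ≠ 0 ∧ Linked nx (nx x) l

theorem Linked.congr {nx nx' : ℕ → ℕ} : ∀ {l : List ℕ} {p : ℕ}, Linked nx p l →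
    (∀ x ∈ l, nx' x = nx x) → Linked nx' p l
  | [], _, h, _ => h
  | x :: l, p, h, he => by
      refine ⟨h.1, h.2.1, ?_⟩
      rw [he x (by simp)]
      exact h.2.2.congr fun y hy => he y (by simp [hy])

/-- The query only walks forwards, so all it needs is a chain of successors that ends in `0`. -/
theorem Dll.linked {nx pv own hd : ℕ → ℕ} {L : ℕ → List ℕ} (H : Dll nx pv own hd L) {i : ℕ}
    (hh : own (hd i) = i) (hx : ∀ x ∈ L i, own x = i) (hL : (hd i :: L i).Nodup) (h0 : 0 ∉ L i) :
    Linked nx (nx (hd i)) (L i) := by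
  have key : ∀ (R A : List ℕ) , L i = A ++ R → Linked nx (R.headD 0) R := by
    intro R
    induction R with
    | nil => intro A _; rfl
    | cons x R ih =>
      intro A hA
      have hxm : x ∈ L i := by simp [hA]
      refine ⟨rfl, fun e => h0 (e ▸ hxm), ?_⟩
      have : nx x = R.headD 0 := by
        rw [H.nx_eq, hx x hxm, hA, ← List.cons_append]
        refine nxt_append_cons R fun h => ?_
        rw [hA, ← List.cons_append, List.nodup_append] at hL
        exact hL.2.2 x h x (by simp) rfl
      rw [this]
      exact ih (A ++ [x]) (by simp [hA])
  have := key (L i) [] rfl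
  rwa [H.nx_eq, hh, nxt_cons_self]

/-! ### The query -/

/-- Find the smallest level such that this and all higher levels are complete. -/
def chooseLevel : Prog :=
  .assign 20 (.reg 14) ;;
  .while (.less 0 (.reg 20) * .less (.cell 7 (.reg 20 - 1)) (.reg 16)) (.assign 20 (.reg 20 - 1))

/-- Compute the threshold of the level in register `20`. -/
def threshold : Prog :=
  (.assign 21 (.reg 12) ;; .assign 22 0) ;;
  .while (.less (.reg 22) (.reg 20)) (.assign 21 (.reg 21 / 2) ;; .assign 22 (.reg 22 + 1))

/-- Collect the edges of each set and count them. -/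
def collect : Prog :=
  (.assign 22 (.reg 20) ;; .assign 23 0) ;;
  .while (.less (.reg 22) (.reg 14)) (
    .assign 24 (.cell 2 (.reg 18 + .reg 22)) ;;
    .while (.reg 24) (
      .assign 25 (.reg 24 / .reg 11 - 1) ;; .put 9 (.reg 24) (.cell 10 (.reg 25)) ;;
      .put 10 (.reg 25) (.reg 24) ;; .put 11 (.reg 25) (.cell 11 (.reg 25) + 1) ;;
      .assign 23 (.reg 23 + 1) ;; .assign 24 (.cell 2 (.reg 24))) ;;
    .assign 22 (.reg 22 + 1))

/-- Put each set into the bucket of its number of edges. -/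
def fillBuckets : Prog :=
  .assign 22 0 ;;
  .while (.less (.reg 22) (.reg 10)) (
    .assign 24 (.cell 11 (.reg 22)) ;; .put 12 (.reg 22) (.cell 13 (.reg 24)) ;;
    .put 13 (.reg 24) (.reg 22 + 1) ;; .assign 22 (.reg 22 + 1))

section Query

variable {K : Conf} {N : ℕ} {ω : Coins} {co lev : ℕ → ℕ} {st : ℕ → List ℕ} {ts : ℕ → ℕ} {s : State}

/-- A kept list shorter than `K.B` was not cut, so its length certifies that the level is complete.
Scanning downwards stops at the first full level, which maximizes the sample. -/
theorem chooseLevel_runs (hK : K.Fits N) (h : Rep K co lev st ts s) (hR : K.Regs s) :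
    Runs N ω chooseLevel s (40 * K.LV + 40) fun s' => s'.arr = s.arr ∧
      (∀ r, r < 20 → s'.reg r = s.reg r) ∧ s'.reg 20 ≤ K.LV ∧
      (∀ l, s'.reg 20 ≤ l → l < K.LV → (st l).length < K.B) ∧
      (s'.reg 20 ≠ 0 → K.B ≤ (st (s'.reg 20 - 1)).length) := by
  have hcells := hK.cells
  have hloop := Runs.for (N := N) (ω := ω) (n := K.LV) (T := 5) (s := s.setReg 20 K.LV)
    (e := .less 0 (.reg 20) * .less (.cell 7 (.reg 20 - 1)) (.reg 16))
    (p := .assign 20 (.reg 20 - 1))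
    (fun i s' => i ≤ K.LV ∧ s'.reg 20 = i ∧ s'.arr = s.arr ∧ (∀ r, r < 20 → s'.reg r = s.reg r) ∧
      ∀ l, i ≤ l → l < K.LV → (st l).length < K.B)
    ⟨le_rfl, by simp, rfl, fun r hr => by simp [show r ≠ 20 by omega], by omega⟩
    (fun i s' ⟨hi, h20, _⟩ => by
      simp [h20]
      repeat' apply And.intro
      all_goals first | omega | (split_ifs <;> omega)) (by
      rintro i s1 ⟨hi, h20, harr, hreg, hlen⟩ hlt
      have hR1 : K.Regs s1 := hR.congr fun r hr => hreg r (by omega)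
      simp only [val_less, val_reg, val_mul, val_sub, val_ofNat, val_cell, h20, hR1.B, ne_eq, harr,
        h.count, mul_eq_zero, not_or, ite_eq_right_iff, one_ne_zero, imp_false, not_not] at hlt
      refine ⟨i - 1, by omega, Runs.block (by simp; omega) (Nat.le_of_ble_eq_true rfl)
        ⟨by omega, by simp [h20], by simp [harr], fun r hr => ?_, fun l hl hl' => ?_⟩⟩
      · simp [show r ≠ 20 by omega, hreg r hr]
      · by_cases h1 : l = i - 1
        · rw [h1]; exact hlt.2
        · exact hlen l (by omega) hl')
  refine ((Runs.block (T := 6) (by simp) (Nat.le_of_ble_eq_true rfl)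
    (Q := fun s' => s' = s.setReg 20 K.LV) (by simp [hR.LV])).seq
      (T' := 40 * K.LV + 34) ?_).mono (by omega) (fun _ h => h)
  rintro s1 rfl
  refine hloop.mono ?_ ?_
  · have : (Expr.cost (.less 0 (.reg 20) * .less (.cell 7 (.reg 20 - 1)) (.reg 16))) = 14 := rfl
    rw [this]
    omega
  · rintro s' ⟨i, ⟨hi, h20, harr, hreg, hlen⟩, hval⟩
    have hR1 : K.Regs s' := hR.congr fun r hr => hreg r (by omega)
    refine ⟨harr, hreg, by omega, fun l hl hl' => hlen l (by omega) hl', fun hne => ?_⟩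
    by_contra hcon
    rw [h20] at hne hcon
    simp only [val_less, val_reg, val_mul, val_sub, val_ofNat, val_cell, h20, hR1.B, harr,
        h.count] at hval
    rw [if_pos (by omega), if_pos (by omega)] at hval
    exact one_ne_zero hval

theorem threshold_runs (hK : K.Fits N) (hR : K.Regs s) (h20 : s.reg 20 ≤ K.LV) :
    Runs N ω threshold s (40 * K.LV + 40) fun s' => s'.arr = s.arr ∧
      (∀ r, r < 21 → s'.reg r = s.reg r) ∧ s'.reg 21 = K.q / 2 ^ s.reg 20 := by
  have hcells := hK.cells
  have hloop := Runs.for (N := N) (ω := ω) (n := s.reg 20) (T := 24)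
    (s := (s.setReg 21 K.q).setReg 22 0)
    (e := .less (.reg 22) (.reg 20))
    (p := .assign 21 (.reg 21 / 2) ;; .assign 22 (.reg 22 + 1))
    (fun i s' => i ≤ s.reg 20 ∧ s'.reg 22 = s.reg 20 - i ∧
      s'.reg 21 = K.q / 2 ^ (s.reg 20 - i) ∧ s'.arr = s.arr ∧ (∀ r, r < 21 → s'.reg r = s.reg r))
    ⟨le_rfl, by simp, by simp, rfl, fun r hr => by
      simp [show r ≠ 21 by omega, show r ≠ 22 by omega]⟩
    (fun i s' _ => by simp; omega) (by
      rintro i s1 ⟨hi, h22, h21, harr, hreg⟩ hlt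
      simp only [val_less, val_reg, h22, hreg 20 (by norm_num)] at hlt
      have hi0 : i ≠ 0 := by
        rintro rfl
        simp at hlt
      have hj' : s.reg 20 - (i - 1) = s.reg 20 - i + 1 := by omega
      refine ⟨i - 1, by omega, Runs.block (by simp [h22]; omega) (Nat.le_of_ble_eq_true rfl)
        ⟨by omega, by simp [h22, hj'], ?_, by simp [harr], fun r hr => ?_⟩⟩
      · simp [h21, hj', Nat.div_div_eq_div_mul, pow_succ]
      · simp [show r ≠ 21 by omega, show r ≠ 22 by omega, hreg r hr])
  refine ((Runs.block (T := 6) (by simp; omega) (Nat.le_of_ble_eq_true rfl)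
    (Q := fun s' => s' = (s.setReg 21 K.q).setReg 22 0) (by simp [hR.q])).seq
      (T' := 40 * K.LV + 34) ?_).mono (by omega) (fun _ h => h)
  rintro s1 rfl
  refine hloop.mono ?_ ?_
  · simp only [Expr.less, Expr.cost]
    omega
  · rintro s' ⟨i, ⟨hi, h22, h21, harr, hreg⟩, hval⟩
    have hi0 : i = 0 := by
      by_contra hne
      simp only [val_less, val_reg, h22, hreg 20 (by norm_num)] at hval
      rw [if_pos (by omega)] at hval
      exact one_ne_zero hval
    subst hi0
    exact ⟨harr, hreg, by simpa using h21⟩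

/-- The edges of the levels from `i` on, below `j`. -/
def edgesFrom (st : ℕ → List ℕ) (i j : ℕ) : List ℕ := ((List.range' i (j - i)).flatMap st).reverse

theorem edgesFrom_self (i : ℕ) : edgesFrom st i i = [] := by simp [edgesFrom]

theorem edgesFrom_succ {i j : ℕ} (h : i ≤ j) :
    edgesFrom st i (j + 1) = (st j).reverse ++ edgesFrom st i j := by
  rw [edgesFrom, edgesFrom, show j + 1 - i = (j - i) + 1 by omega, List.range'_concat,
    List.flatMap_append, List.reverse_append]
  simp [show i + (j - i) = j by omega]

theorem mem_edgesFrom {i j x : ℕ} : x ∈ edgesFrom st i j ↔ ∃ l, i ≤ l ∧ l < j ∧ x ∈ st l := by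
  simp only [edgesFrom, List.mem_reverse, List.mem_flatMap, List.mem_range'_1]
  constructor
  · rintro ⟨l, h1, h2⟩
    exact ⟨l, by omega, by omega, h2⟩
  · rintro ⟨l, h1, h2, h3⟩
    exact ⟨l, by omega, h3⟩

theorem nodup_edgesFrom (hW : Wf K lev st) (i j : ℕ) : (edgesFrom st i j).Nodup := by
  rw [edgesFrom, List.nodup_reverse, List.nodup_flatMap]
  refine ⟨fun l _ => hW.nodup l, ?_⟩
  have hr : (List.range' i (j - i)).Nodup := List.nodup_range'
  refine List.Pairwise.imp (fun {a b} hab x hxa hxb => hab ?_) hr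
  rw [← hW.level a x hxa, ← hW.level b x hxb]

/-- The edges of the set `S` in a list of edge codes. -/
def atSet (m S : ℕ) (P : List ℕ) : List ℕ := P.filter fun x => x / m - 1 = S

/-- The edges `P` have been collected. -/
structure Collected (K : Conf) (P : List ℕ) (s : State) : Prop where
  linked : ∀ S, Linked (s.arr 9) (s.arr 10 S) (atSet K.m S P)
  count : ∀ S, s.arr 11 S = (atSet K.m S P).length
  rest : ∀ i, s.arr 12 i = 0 ∧ s.arr 13 i = 0 ∧ s.arr 14 i = 0 ∧ s.arr 15 i = 0

theorem set_lt (hW : Wf K lev st) {l x : ℕ} (hx : x ∈ st l) : x / K.m - 1 < K.n := by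
  have h1 := hW.lt l x hx
  have h2 := Nat.div_lt_of_lt_mul (by rw [Conf.codes, mul_comm] at h1; exact h1)
  have h3 := Nat.div_pos (hW.ge l x hx) (hW.m_pos hx)
  omega

/-- Pushing each edge on the list of its set (links in array `9`, heads in array `10`) takes
constant time, and array `11` counts them. The element lists of the stream phase are left alone and
used again later. -/
theorem collect_runs (hK : K.Fits N) (hn : 32 * K.n + 100 ≤ N) (hW : Wf K lev st)
    (h : Rep K co lev st ts s) (hR : K.Regs s) {i₀ : ℕ} (h20 : s.reg 20 = i₀) (hi₀ : i₀ ≤ K.LV) :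
    Runs N ω collect s (100 * ((edgesFrom st i₀ K.LV).length + K.LV) + 40) fun s' =>
      (∀ r, r < 22 → s'.reg r = s.reg r) ∧ s'.reg 23 = (edgesFrom st i₀ K.LV).length ∧
      Collected K (edgesFrom st i₀ K.LV) s' ∧ ∀ j < 9, s'.arr j = s.arr j := by
  have hcells := hK.cells
  set P : ℕ → List ℕ := fun j => edgesFrom st i₀ j with hP
  have hPlen : ∀ j, (P j).length ≤ K.codes := by
    intro j
    have := List.toFinset_card_of_nodup (nodup_edgesFrom hW i₀ j)
    rw [hP, ← this, ← Finset.card_range K.codes]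
    refine Finset.card_le_card fun x hx => ?_
    rw [List.mem_toFinset, mem_edgesFrom] at hx
    obtain ⟨l, _, _, hl⟩ := hx
    simpa using hW.lt l x hl
  -- one level
  have inner : ∀ j, i₀ ≤ j → j < K.LV → ∀ s1 : State, (∀ r, r < 22 → s1.reg r = s.reg r) →
      s1.reg 22 = j → s1.reg 23 = (P j).length → Collected K (P j) s1 →
      (∀ a < 9, s1.arr a = s.arr a) → s1.reg 24 = s.arr 2 (K.codes + j) →
      Runs N ω (.while (.reg 24) (
        .assign 25 (.reg 24 / .reg 11 - 1) ;; .put 9 (.reg 24) (.cell 10 (.reg 25)) ;;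
        .put 10 (.reg 25) (.reg 24) ;; .put 11 (.reg 25) (.cell 11 (.reg 25) + 1) ;;
        .assign 23 (.reg 23 + 1) ;; .assign 24 (.cell 2 (.reg 24)))) s1 (80 * (st j).length + 2)
      fun s' => (∀ r, r < 22 → s'.reg r = s.reg r) ∧ s'.reg 22 = j ∧
        s'.reg 23 = (P (j + 1)).length ∧ Collected K (P (j + 1)) s' ∧
        ∀ a < 9, s'.arr a = s.arr a := by
    intro j hij hj s1 hreg1 h22 h23 hcol harr1 h24
    have hl := h.level.linked (i := j) (levelOwn_hd j) (fun x hx => hW.levelOwn_eq hx)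
      (hW.nodup_level j) (hW.zero_notMem j)
    refine (Runs.traverse (N := N) (ω := ω) (L := st j) (fun R b s' => b = 80 * R.length ∧ ∃ C, st j = C ++ R ∧
      (∀ r, r < 22 → s'.reg r = s.reg r) ∧ s'.reg 22 = j ∧
        s'.reg 23 = (C.reverse ++ P j).length ∧ Collected K (C.reverse ++ P j) s' ∧
        (∀ a < 9, s'.arr a = s.arr a) ∧ Linked (s.arr 2) (s'.reg 24) R) ?_ ?_ (b := 80 * (st j).length)
      ⟨rfl, [], rfl, hreg1, h22, by simpa using h23, by simpa using hcol, harr1,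
        by rw [h24]; exact hl⟩).mono le_rfl ?_
    · rintro b s' ⟨-, C, -, -, -, -, -, -, h24⟩
      exact h24
    · rintro x R b s' ⟨hb, C, hC, hreg, h22, h23, hcol, harr, h24, hx0, hlk⟩
      refine ⟨by omega, 78, 80 * R.length, by simp only [List.length_cons] at hb; omega, ?_⟩
      have hxj : x ∈ st j := by simp [hC]
      have hS := set_lt hW hxj
      set S := x / K.m - 1 with hSd
      have hxlt := hW.lt j x hxj
      have hR' : K.Regs s' := hR.congr fun r hr => hreg r (by omega)
      -- The link cell of a code not yet collected is unused, so writing it breaks no chain built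
      -- before.
      have hxnew : x ∉ C.reverse ++ P j := by
        rw [List.mem_append, List.mem_reverse, not_or]
        constructor
        · intro hx
          have := hW.nodup j
          rw [hC, List.nodup_append] at this
          exact this.2.2 x hx x (by simp) rfl
        · intro hx
          obtain ⟨l, h1, h2, h3⟩ := mem_edgesFrom.1 hx
          have := hW.level j x hxj
          rw [hW.level l x h3] at this
          omega
      have hlenle : (C.reverse ++ P j).length ≤ K.codes := by
        refine le_trans ?_ (hPlen (j + 1))
        rw [hP]
        simp only [edgesFrom_succ hij, List.length_append, List.length_reverse, hC]
        omega
      have hcnt : s'.arr 11 S ≤ K.codes := by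
        rw [hcol.count]
        exact (List.length_filter_le _ _).trans hlenle
      have hmemrest : ∀ S', ∀ y ∈ atSet K.m S' (C.reverse ++ P j), y ≠ x := fun S' y hy e =>
        hxnew (e ▸ List.mem_of_mem_filter hy)
      refine Runs.block ?_ (Nat.le_of_ble_eq_true rfl) ⟨rfl, C ++ [x], by simp [hC], ?_, ?_, ?_, ?_, ?_, ?_⟩
      · simp [h24, hR'.m, h23, ← hSd, setArr_arr]
        rw [List.length_append, List.length_reverse] at hlenle
        refine ⟨?_, ?_, ?_, ?_, ?_⟩ <;> omega
      · intro r hr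
        simp [show r ≠ 23 by omega, show r ≠ 24 by omega, show r ≠ 25 by omega, hreg r hr]
      · simp [h22]
      · simp [h23]
      · have hcons : (C ++ [x]).reverse ++ P j = x :: (C.reverse ++ P j) := by simp
        rw [hcons]
        constructor
        · intro S'
          have h1 := hcol.linked S'
          by_cases hS' : S' = S
          · subst hS'
            rw [atSet, List.filter_cons_of_pos (by simp [← hSd]), ← atSet]
            refine ⟨by simp [setArr_arr, h24, hR'.m, ← hSd], hx0, ?_⟩
            refine Linked.congr (nx := s'.arr 9) ?_ fun y hy => ?_
            · simpa [setArr_arr, h24, hR'.m, ← hSd] using h1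
            · simp [setArr_arr, h24, hmemrest _ y hy]
          · rw [atSet, List.filter_cons_of_neg (by simpa [← hSd] using Ne.symm hS'), ← atSet]
            have : s'.arr 10 S' = ((Prog.den ω (.assign 25 (.reg 24 / .reg 11 - 1) ;;
                .put 9 (.reg 24) (.cell 10 (.reg 25)) ;;
                .put 10 (.reg 25) (.reg 24) ;; .put 11 (.reg 25) (.cell 11 (.reg 25) + 1) ;;
                .assign 23 (.reg 23 + 1) ;; .assign 24 (.cell 2 (.reg 24))) s').arr 10 S') := by
              simp [setArr_arr, h24, hR'.m, ← hSd, hS']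
            rw [← this]
            refine h1.congr fun y hy => ?_
            simp [setArr_arr, h24, hmemrest _ y hy]
        · intro S'
          by_cases hS' : S' = S
          · subst hS'
            rw [atSet, List.filter_cons_of_pos (by simp [← hSd]), ← atSet]
            simp [setArr_arr, h24, hR'.m, ← hSd, hcol.count]
          · rw [atSet, List.filter_cons_of_neg (by simpa [← hSd] using Ne.symm hS'), ← atSet]
            simp [setArr_arr, h24, hR'.m, ← hSd, hS', hcol.count]
        · intro i
          simpa [setArr_arr] using hcol.rest i
      · intro a ha
        funext i
        rw [← harr a ha]
        simp [setArr_arr, show a < 16 by omega, show a ≠ 9 by omega, show a ≠ 10 by omega,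
          show a ≠ 11 by omega]
      · have : s'.arr 2 = s.arr 2 := harr 2 (by norm_num)
        simpa [setArr_arr, h24, this] using hlk
    · rintro s' ⟨b, -, C, hC, hreg, h22, h23, hcol, harr, -⟩
      rw [List.append_nil] at hC
      have : P (j + 1) = C.reverse ++ P j := by
        simp only [hP, edgesFrom_succ hij, hC]
      rw [this]
      exact ⟨hreg, h22, h23, hcol, harr⟩
  set body : Prog := .assign 24 (.cell 2 (.reg 18 + .reg 22)) ;;
    .while (.reg 24) (
      .assign 25 (.reg 24 / .reg 11 - 1) ;; .put 9 (.reg 24) (.cell 10 (.reg 25)) ;;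
      .put 10 (.reg 25) (.reg 24) ;; .put 11 (.reg 25) (.cell 11 (.reg 25) + 1) ;;
      .assign 23 (.reg 23 + 1) ;; .assign 24 (.cell 2 (.reg 24))) ;;
    .assign 22 (.reg 22 + 1) with hbody
  have hlenP : ∀ j, i₀ ≤ j → (P (j + 1)).length = (st j).length + (P j).length := by
    intro j hj
    simp only [hP, edgesFrom_succ hj, List.length_append, List.length_reverse]
  have hPmono : ∀ j, i₀ ≤ j → j ≤ K.LV → (P j).length ≤ (P K.LV).length := by
    intro j hij hj
    have key : ∀ t, (P j).length ≤ (P (j + t)).length := by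
      intro t
      induction t with
      | zero => exact le_rfl
      | succ t ih =>
        have := hlenP (j + t) (by omega)
        rw [add_assoc] at this
        omega
    have := key (K.LV - j)
    rwa [Nat.add_sub_cancel' hj] at this
  -- The potential charges for every edge still to be collected and for every level still to be
  -- visited, so empty levels are paid for as well.
  have outer := Runs.while (N := N) (ω := ω) (s := (s.setReg 22 i₀).setReg 23 0)
    (e := .less (.reg 22) (.reg 14)) (p := body)
    (fun s' => i₀ ≤ s'.reg 22 ∧ s'.reg 22 ≤ K.LV ∧ (∀ r, r < 22 → s'.reg r = s.reg r) ∧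
      s'.reg 23 = (P (s'.reg 22)).length ∧ Collected K (P (s'.reg 22)) s' ∧ ∀ a < 9, s'.arr a = s.arr a)
    (fun s' => 100 * (((P K.LV).length - (P (s'.reg 22)).length) + (K.LV - s'.reg 22)))
    ⟨by simp, by simpa using hi₀, fun r hr => by simp [show r ≠ 22 by omega, show r ≠ 23 by omega],
      by simp [hP, edgesFrom_self], by
        have e : ((s.setReg 22 i₀).setReg 23 0).reg 22 = i₀ := by simp
        rw [e]
        simp only [hP, edgesFrom_self]
        constructor
        · intro S
          simpa [atSet, Linked] using (h.rest S).2.2.1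
        · intro S
          simpa [atSet] using (h.rest S).2.2.2.1
        · intro i
          simpa using (h.rest i).2.2.2.2, fun a _ => rfl⟩
    (fun s' _ => by simp; omega) (by
      rintro s1 ⟨hi, hle, hreg, h23, hcol, harr⟩ hlt
      have hR1 : K.Regs s1 := hR.congr fun r hr => hreg r (by omega)
      simp only [val_less, val_reg, hR1.LV] at hlt
      have hlt' : s1.reg 22 < K.LV := by
        by_contra hcon
        rw [if_neg hcon] at hlt
        exact hlt rfl
      set j := s1.reg 22 with hj
      refine ⟨9 + ((80 * (st j).length + 2) + 5), ?_⟩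
      have h2 : s1.arr 2 = s.arr 2 := harr 2 (by norm_num)
      refine (Runs.block (T := 9) (by simp [hR1.codes, ← hj]; omega) (Nat.le_of_ble_eq_true rfl)
        (Q := fun s' => s' = s1.setReg 24 (s.arr 2 (K.codes + j)))
        (by simp [hR1.codes, ← hj, h2])).seq ?_
      rintro s2 rfl
      refine (inner j hi hlt' (s1.setReg 24 (s.arr 2 (K.codes + j))) (fun r hr => by rw [setReg_reg, if_neg (by omega), hreg r hr])
        (by simp [← hj]) (by simp [h23]) ⟨hcol.linked, hcol.count, hcol.rest⟩ harr
        (by rw [setReg_reg, if_pos rfl])).seq ?_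
      rintro s2 ⟨hreg2, h22, h23, hcol2, harr2⟩
      have e22 : (Prog.den ω (.assign 22 (.reg 22 + 1)) s2).reg 22 = j + 1 := by simp [h22]
      refine Runs.block (by simp [h22]; omega) (Nat.le_of_ble_eq_true rfl) ⟨⟨?_, ?_, ?_, ?_, ?_, ?_⟩, ?_⟩
      · rw [e22]; omega
      · rw [e22]; omega
      · intro r hr
        simp [show r ≠ 22 by omega, hreg2 r hr]
      · rw [e22]; simp [h23]
      · rw [e22]; exact ⟨hcol2.linked, hcol2.count, hcol2.rest⟩
      · exact harr2
      · rw [e22]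
        have h1 := hlenP j hi
        have h3 := hPmono (j + 1) (by omega) (by omega)
        simp only [Expr.less, Expr.cost]
        omega)
  refine ((Runs.block (T := 6) (by simp; omega) (Nat.le_of_ble_eq_true rfl)
    (Q := fun s' => s' = (s.setReg 22 i₀).setReg 23 0) (by simp [h20])).seq
      (T' := 100 * ((P K.LV).length + K.LV) + 10) ?_).mono (by simp only [hP]; omega) (fun _ h => h)
  rintro s1 rfl
  refine outer.mono ?_ ?_
  · simp only [Expr.less, Expr.cost]
    omega
  · rintro s' ⟨⟨hi, hle, hreg, h23, hcol, harr⟩, hval⟩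
    have h14 := (hR.congr fun r hr => hreg r (by omega)).LV
    have : s'.reg 22 = K.LV := by
      by_contra hne
      simp only [val_less, val_reg, h14] at hval
      rw [if_pos (by omega)] at hval
      exact one_ne_zero hval
    rw [this] at h23 hcol
    exact ⟨hreg, h23, hcol, harr⟩

end Query

end KCover

namespace WordRAM

/-- A loop; the first argument of `I` is the time that is left. -/
theorem Runs.while_budget {N : ℕ} {ω : Coins} {p : Prog} {e : Expr} (I : ℕ → State → Prop)
    (he : ∀ b s, I b s → e.Ok N s)
    (hp : ∀ b s, I b s → e.val s ≠ 0 → ∃ c b', c + b' + e.cost + 1 ≤ b ∧ Runs N ω p s c (I b'))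
    {b : ℕ} {s : State} (hI : I b s) :
    Runs N ω (.while e p) s (b + e.cost + 1) fun s' => ∃ b', I b' s' ∧ e.val s' = 0 := by
  induction b using Nat.strong_induction_on generalizing s with
  | _ b ih =>
    by_cases h0 : e.val s = 0
    · exact ⟨s, _, .while_false (he b s hI) h0, by omega, b, hI, h0⟩
    · obtain ⟨c, b', hb, s', t, h1, h2, h3⟩ := hp b s hI h0
      obtain ⟨s'', t', h5, h6, h7⟩ := ih b' (by omega) h3
      exact ⟨s'', _, .while_true (he b s hI) h0 h1 h5, by omega, h7⟩

end WordRAM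

namespace KCover

open WordRAM

/-! ### Buckets -/

/-- The lists `Bk g`, linked by the arrays `nx` and `hd`, hold the members `p` of `U` with
`b p = g`. -/
structure Buckets (nx hd : ℕ → ℕ) (U : Finset ℕ) (b : ℕ → ℕ) (Bk : ℕ → List ℕ) : Prop where
  linked : ∀ g, Linked (fun p => nx (p - 1)) (hd g) (Bk g)
  nodup : ∀ g, (Bk g).Nodup
  mem : ∀ g p, p ∈ Bk g ↔ p ∈ U ∧ b p = g
  pos : ∀ p ∈ U, 1 ≤ p

/-- A pointer is the index of a set plus one, since `0` ends a list; array cells are therefore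
addressed by `p - 1`. The fresh `p` shares its cell with no other member because all of them are
positive. -/
theorem Buckets.push {nx hd : ℕ → ℕ} {U : Finset ℕ} {b : ℕ → ℕ} {Bk : ℕ → List ℕ}
    (H : Buckets nx hd U b Bk) {p g : ℕ} (hp : p ∉ U) (h1 : 1 ≤ p) :
    Buckets (Function.update nx (p - 1) (hd g)) (Function.update hd g p) (insert p U)
      (Function.update b p g) (Function.update Bk g (p :: Bk g)) := by
  have hpB : ∀ g', p ∉ Bk g' := fun g' h => hp ((H.mem g' p).1 h).1
  have hne : ∀ g', ∀ x ∈ Bk g', Function.update nx (p - 1) (hd g) (x - 1) = nx (x - 1) := by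
    intro g' x hx
    have hxU := ((H.mem g' x).1 hx).1
    have := H.pos x hxU
    rw [Function.update_of_ne]
    intro e
    exact hpB g' ((show x = p by omega) ▸ hx)
  refine ⟨fun g' => ?_, fun g' => ?_, fun g' x => ?_, fun x hx => ?_⟩
  · by_cases hg : g' = g
    · subst hg
      rw [Function.update_self, Function.update_self]
      refine ⟨rfl, by omega, ?_⟩
      simp only [Function.update_self]
      exact (H.linked g').congr (hne g')
    · rw [Function.update_of_ne hg, Function.update_of_ne hg]
      exact (H.linked g').congr (hne g')
  · by_cases hg : g' = g
    · subst hg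
      rw [Function.update_self]
      exact List.nodup_cons.2 ⟨hpB g', H.nodup g'⟩
    · rw [Function.update_of_ne hg]
      exact H.nodup g'
  · by_cases hx : x = p
    · subst hx
      rw [Function.update_self]
      by_cases hg : g' = g
      · subst hg
        simp
      · rw [Function.update_of_ne hg]
        simp [hpB, Ne.symm hg]
    · rw [Function.update_of_ne hx]
      by_cases hg : g' = g
      · subst hg
        simp [hx, H.mem]
      · rw [Function.update_of_ne hg]
        simp [hx, H.mem]
  · rcases Finset.mem_insert.1 hx with rfl | hx
    · exact h1
    · exact H.pos x hx

theorem Buckets.pop {nx hd : ℕ → ℕ} {U : Finset ℕ} {b : ℕ → ℕ} {Bk : ℕ → List ℕ}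
    (H : Buckets nx hd U b Bk) {p g : ℕ} {l : List ℕ} (hl : Bk g = p :: l) :
    Buckets nx (Function.update hd g (nx (p - 1))) (U.erase p) b (Function.update Bk g l) := by
  have hnd := H.nodup g
  rw [hl, List.nodup_cons] at hnd
  have hpg : p ∈ U ∧ b p = g := (H.mem g p).1 (by simp [hl])
  refine ⟨fun g' => ?_, fun g' => ?_, fun g' x => ?_, fun x hx => H.pos x (Finset.mem_of_mem_erase hx)⟩
  · by_cases hg : g' = g
    · subst hg
      rw [Function.update_self, Function.update_self]
      have := H.linked g'
      rw [hl] at this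
      exact this.2.2
    · rw [Function.update_of_ne hg, Function.update_of_ne hg]
      exact H.linked g'
  · by_cases hg : g' = g
    · subst hg
      rw [Function.update_self]
      exact hnd.2
    · rw [Function.update_of_ne hg]
      exact H.nodup g'
  · rw [Finset.mem_erase]
    by_cases hg : g' = g
    · subst hg
      rw [Function.update_self]
      have := H.mem g' x
      rw [hl, List.mem_cons] at this
      constructor
      · intro hx
        have h2 := this.1 (Or.inr hx)
        exact ⟨⟨fun e => hnd.1 (e ▸ hx), h2.1⟩, h2.2⟩
      · rintro ⟨⟨h1, h2⟩, h3⟩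
        exact (this.2 ⟨h2, h3⟩).resolve_left h1
    · rw [Function.update_of_ne hg, H.mem]
      constructor
      · rintro ⟨h1, h2⟩
        exact ⟨⟨fun e => hg (by rw [← h2, e, hpg.2]), h1⟩, h2⟩
      · rintro ⟨⟨_, h1⟩, h2⟩
        exact ⟨h1, h2⟩

/-! ### The greedy algorithm -/

/-- The elements covered by the sets in `sel`. -/
def covSet (m : ℕ) (Es sel : List ℕ) : Finset ℕ :=
  ((Es.filter fun x => x / m - 1 ∈ sel).map (· % m)).toFinset

/-- In each step a set that covers the most is added. -/
def IsGreedy (n m : ℕ) (Es sel : List ℕ) : Prop :=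
  ∀ j < sel.length, ∀ S < n,
    (covSet m Es (S :: sel.take j)).card ≤ (covSet m Es (sel.take (j + 1))).card

/-- The edges whose element is not in `X`. -/
def uncovered (m : ℕ) (X : Finset ℕ) (Es : List ℕ) : List ℕ := Es.filter fun x => x % m ∉ X

theorem mem_covSet {m e : ℕ} {Es sel : List ℕ} :
    e ∈ covSet m Es sel ↔ ∃ x ∈ Es, x / m - 1 ∈ sel ∧ x % m = e := by
  simp [covSet, and_assoc]

theorem covSet_congr {m : ℕ} {Es sel sel' : List ℕ} (h : ∀ S, S ∈ sel ↔ S ∈ sel') :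
    covSet m Es sel = covSet m Es sel' := by
  ext e
  simp [mem_covSet, h]

theorem covSet_cons {m S : ℕ} {Es sel : List ℕ} :
    covSet m Es (S :: sel) = covSet m Es sel ∪ ((atSet m S Es).map (· % m)).toFinset := by
  ext e
  simp only [mem_covSet, Finset.mem_union, List.mem_toFinset, List.mem_map, atSet, List.mem_filter,
    List.mem_cons, decide_eq_true_eq]
  constructor
  · rintro ⟨x, h1, h2 | h2, h3⟩
    · exact Or.inr ⟨x, ⟨h1, h2⟩, h3⟩
    · exact Or.inl ⟨x, h1, h2, h3⟩
  · rintro (⟨x, h1, h2, h3⟩ | ⟨x, ⟨h1, h2⟩, h3⟩)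
    · exact ⟨x, h1, Or.inr h2, h3⟩
    · exact ⟨x, h1, Or.inl h2, h3⟩

/-- Different edges of one set have different elements, so the marginal gain of a set is the number
of its uncovered edges. This is the counter that the machine maintains. -/
theorem card_covSet_cons {m S : ℕ} {Es sel : List ℕ} (hEs : Es.Nodup) (hm : ∀ x ∈ Es, m ≤ x ∧ 0 < m) :
    (covSet m Es (S :: sel)).card =
      (covSet m Es sel).card + (atSet m S (uncovered m (covSet m Es sel) Es)).length := by
  set X := covSet m Es sel with hX
  have hnd : ((atSet m S (uncovered m X Es)).map (· % m)).Nodup := by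
    refine List.Nodup.map_on ?_ ((hEs.filter _).filter _)
    intro x hx y hy hxy
    simp only [atSet, uncovered, List.mem_filter, decide_eq_true_eq] at hx hy
    have h1 := hm x hx.1.1
    have h2 := hm y hy.1.1
    -- Positivity of the quotients makes the truncated `x / m - 1` injective, so set and element
    -- determine the code.
    have h3 := Nat.div_pos h1.1 h1.2
    have h4 := Nat.div_pos h2.1 h2.2
    rw [← Nat.div_add_mod x m, ← Nat.div_add_mod y m, hxy, show x / m = y / m by omega]
  have hU : covSet m Es (S :: sel) = X ∪ ((atSet m S (uncovered m X Es)).map (· % m)).toFinset := by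
    rw [covSet_cons]
    ext e
    simp only [Finset.mem_union, List.mem_toFinset, List.mem_map, atSet, uncovered,
      List.mem_filter, decide_eq_true_eq, ← hX]
    constructor
    · rintro (h | ⟨x, ⟨h1, h2⟩, h3⟩)
      · exact Or.inl h
      · by_cases h : e ∈ X
        · exact Or.inl h
        · exact Or.inr ⟨x, ⟨⟨h1, by rwa [h3]⟩, h2⟩, h3⟩
    · rintro (h | ⟨x, ⟨⟨h1, _⟩, h2⟩, h3⟩)
      · exact Or.inl h
      · exact Or.inr ⟨x, ⟨h1, h2⟩, h3⟩
  rw [hU, Finset.card_union_of_disjoint, List.toFinset_card_of_nodup hnd, List.length_map]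
  rw [Finset.disjoint_left]
  intro e he he'
  simp only [List.mem_toFinset, List.mem_map, atSet, uncovered, List.mem_filter,
    decide_eq_true_eq] at he'
  obtain ⟨x, ⟨⟨_, h1⟩, _⟩, h2⟩ := he'
  exact h1 (h2 ▸ he)

/-- Mark the element in register `32` as covered. -/
def coverElem : Prog :=
  (.put 14 (.reg 32) 1 ;; .assign 33 (.cell 4 (.reg 32))) ;;
  .while (.reg 33) (
    .put 11 (.reg 33 / .reg 11 - 1) (.cell 11 (.reg 33 / .reg 11 - 1) - 1) ;;
    .assign 33 (.cell 4 (.reg 33)))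

/-- Mark the elements of the list in register `31` as covered. -/
def coverSet : Prog :=
  .while (.reg 31) (
    .assign 32 (.reg 31 % .reg 11) ;;
    .ite (.cell 14 (.reg 32)) .skip coverElem ;;
    .assign 31 (.cell 9 (.reg 31)))

def greedyStep : Prog :=
  .assign 29 (.cell 13 (.reg 26)) ;;
  .ite (.reg 29)
    ((.put 13 (.reg 26) (.cell 12 (.reg 29 - 1)) ;; .assign 30 (.cell 11 (.reg 29 - 1))) ;;
      .ite (.same (.reg 30) (.reg 26))
        ((.put 15 (.reg 27) (.reg 29 - 1) ;; .assign 27 (.reg 27 + 1) ;;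
          .assign 28 (.reg 28 + .reg 26) ;; .assign 31 (.cell 10 (.reg 29 - 1))) ;; coverSet)
        (.put 12 (.reg 29 - 1) (.cell 13 (.reg 30)) ;; .put 13 (.reg 30) (.reg 29)))
    (.assign 26 (.reg 26 - 1))

/-- Select as many sets as register `2` tells. -/
def greedy : Prog :=
  (.assign 26 (.reg 23) ;; .assign 27 0 ;; .assign 28 0) ;;
  .while (.less (.reg 27) (.reg 2)) greedyStep

/-- Write the result to its place. -/
def output : Prog :=
  (.assign 22 0 ;; .assign 24 (16 * .reg 2 + 16)) ;;
  .while (.less (.reg 22) (.reg 2)) (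
    .store (.reg 24 + .reg 22) (.cell 15 (.reg 22)) ;; .assign 22 (.reg 22 + 1)) ;;
  (.assign 0 (.reg 28 * .reg 12 * (8 * .reg 4)) ;; .assign 1 (.reg 21 * (8 * .reg 4 + 1)) ;;
    .assign 2 (.reg 24))

def queryProg : Prog :=
  chooseLevel ;; threshold ;; collect ;; fillBuckets ;; greedy ;; output

/-- The edges `Es` are in the memory, in lists for each set and each element. -/
structure GraphMem (K : Conf) (Es : List ℕ) (s : State) : Prop where
  nodup : Es.Nodup
  code : ∀ x ∈ Es, K.m ≤ x ∧ x < K.codes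
  sets : ∀ S, Linked (s.arr 9) (s.arr 10 S) (atSet K.m S Es)
  elems : ∀ x ∈ Es, ∃ L, Linked (s.arr 4) (s.arr 4 (x % K.m)) L ∧ L.Perm (atElem K.m (x % K.m) Es)

/-- The array of the gains and the array of the covered elements. -/
structure Covered (K : Conf) (Es : List ℕ) (X : Finset ℕ) (s : State) : Prop where
  gain : ∀ S, s.arr 11 S = (atSet K.m S (uncovered K.m X Es)).length
  mark : ∀ e, s.arr 14 e = if e ∈ X then 1 else 0

theorem GraphMem.congr {K : Conf} {Es : List ℕ} {s s' : State} (h : GraphMem K Es s)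
    (h4 : s'.arr 4 = s.arr 4) (h9 : s'.arr 9 = s.arr 9) (h10 : s'.arr 10 = s.arr 10) :
    GraphMem K Es s' := by
  obtain ⟨h1, h2, h3, h5⟩ := h
  constructor <;> simpa only [h4, h9, h10]

theorem Covered.congr {K : Conf} {Es : List ℕ} {X : Finset ℕ} {s s' : State} (h : Covered K Es X s)
    (h11 : s'.arr 11 = s.arr 11) (h14 : s'.arr 14 = s.arr 14) : Covered K Es X s' := by
  obtain ⟨h1, h2⟩ := h
  constructor <;> simpa only [h11, h14]

/-! ### Maintaining the gains -/

section Greedy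

variable {K : Conf} {N : ℕ} {ω : Coins} {Es : List ℕ} {s : State}

theorem GraphMem.m_pos (h : GraphMem K Es s) {x : ℕ} (hx : x ∈ Es) : 0 < K.m := by
  have := (h.code x hx).2
  rw [Conf.codes] at this
  exact Nat.pos_of_ne_zero fun e => by simp [e] at this

theorem GraphMem.set_lt (h : GraphMem K Es s) {x : ℕ} (hx : x ∈ Es) : x / K.m - 1 < K.n := by
  have h1 := (h.code x hx).2
  have h2 := Nat.div_lt_of_lt_mul (by rw [Conf.codes, mul_comm] at h1; exact h1)
  have h3 := Nat.div_pos (h.code x hx).1 (h.m_pos hx)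
  omega

theorem GraphMem.length_le (h : GraphMem K Es s) : Es.length ≤ K.codes := by
  rw [← List.toFinset_card_of_nodup h.nodup, ← Finset.card_range K.codes]
  exact Finset.card_le_card fun x hx => by simpa using (h.code x (by simpa using hx)).2

theorem length_uncovered_insert {m e : ℕ} {X : Finset ℕ} (he : e ∉ X) :
    (uncovered m X Es).length = (uncovered m (insert e X) Es).length + (atElem m e Es).length := by
  induction Es with
  | nil => rfl
  | cons x Es ih =>
    by_cases h1 : x % m = e
    · simp [uncovered, atElem, h1, he] at ih ⊢
      omega
    · by_cases h2 : x % m ∈ X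
      · simpa [uncovered, atElem, h1, h2] using ih
      · simp [uncovered, atElem, h1, h2] at ih ⊢
        omega

theorem atSet_uncovered_insert {m e S : ℕ} {X : Finset ℕ} (he : e ∉ X) :
    (atSet m S (uncovered m X Es)).length =
      (atSet m S (uncovered m (insert e X) Es)).length + (atSet m S (atElem m e Es)).length := by
  have h := length_uncovered_insert (m := m) (Es := atSet m S Es) he
  have c1 : ∀ X, atSet m S (uncovered m X Es) = uncovered m X (atSet m S Es) := fun X => by
    simp [atSet, uncovered, List.filter_filter, Bool.and_comm]
  have c2 : atSet m S (atElem m e Es) = atElem m e (atSet m S Es) := by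
    simp [atSet, atElem, List.filter_filter, Bool.and_comm]
  rw [c1, c1, c2, h]

/-- Covering an element lowers the gain of each set containing it by one. These sets are found along
the list of the element, in time proportional to its degree. -/
theorem coverElem_runs (hK : K.Fits N) (hn : 32 * K.n + 100 ≤ N) (hR : K.Regs s)
    (h : GraphMem K Es s) {X : Finset ℕ} (hX : Covered K Es X s) {x : ℕ} (hx : x ∈ Es)
    (h32 : s.reg 32 = x % K.m) (he : x % K.m ∉ X) :
    Runs N ω coverElem s (60 * (atElem K.m (x % K.m) Es).length + 20) fun s' =>
      Covered K Es (insert (x % K.m) X) s' ∧ (∀ r, r < 33 → s'.reg r = s.reg r) ∧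
      (∀ j < 16, j ≠ 11 → j ≠ 14 → s'.arr j = s.arr j) := by
  have hcells := hK.cells
  have helem := hK.elem
  obtain ⟨L, hL, hperm⟩ := h.elems x hx
  have hmpos := h.m_pos hx
  have hmod := Nat.mod_lt x hmpos
  set e := x % K.m with hed
  set s1 := (s.setArr 14 e 1).setReg 33 (s.arr 4 e) with hs1
  refine ((Runs.block (T := 16) (Q := fun s' => s' = s1) ?_ (Nat.le_of_ble_eq_true rfl) ?_).seq
    (T' := 60 * L.length + 2) ?_).mono (by rw [hperm.length_eq]; omega) (fun _ h => h)
  · simp [h32]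
    omega
  · simp [h32, hs1, setArr_arr]
  rintro _ rfl
  have harr1 : ∀ j < 16, j ≠ 14 → s1.arr j = s.arr j := fun j hj h => by
    rw [hs1, setReg_arr, setArr_arr_of_ne (by norm_num) hj h]
  refine (Runs.traverse (N := N) (ω := ω) (L := L) (b := 60 * L.length)
    (fun R b s' => b = 60 * R.length ∧ ∃ C, L = C ++ R ∧ (∀ r, r < 33 → s'.reg r = s.reg r) ∧
      (∀ j < 16, j ≠ 11 → s'.arr j = s1.arr j) ∧ Linked (s.arr 4) (s'.reg 33) R ∧
      ∀ S, s'.arr 11 S = s.arr 11 S - (atSet K.m S C).length) ?_ ?_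
    ⟨rfl, [], rfl, fun r hr => by simp [hs1, show r ≠ 33 by omega], fun j _ _ => rfl,
      by simpa [hs1] using hL, fun S => by simp [harr1 11, atSet]⟩).mono le_rfl ?_
  · rintro b s' ⟨-, C, -, -, -, h, -⟩
    exact h
  · rintro y R b s' ⟨hb, C, hC, hreg, harr, ⟨h33, hy0, hlk⟩, h11⟩
    refine ⟨by omega, 58, 60 * R.length, by simp only [List.length_cons] at hb; omega, ?_⟩
    have hyEs : y ∈ Es := by
      have : y ∈ L := by simp [hC]
      exact List.mem_of_mem_filter (hperm.mem_iff.1 this)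
    have hS := h.set_lt hyEs
    have hylt := (h.code y hyEs).2
    have hR' : K.Regs s' := hR.congr fun r hr => hreg r (by omega)
    have h4 : s'.arr 4 = s.arr 4 := by rw [harr 4 (by norm_num) (by norm_num), harr1 4 (by norm_num) (by norm_num)]
    refine Runs.block ?_ (Nat.le_of_ble_eq_true rfl) ⟨rfl, C ++ [y], by simp [hC], ?_, ?_, ?_, ?_⟩
    · simp [h33, hR'.m]
      refine ⟨?_, ?_⟩ <;> omega
    · intro r hr
      simp [show r ≠ 33 by omega, hreg r hr]
    · intro j hj hj'
      rw [← harr j hj hj']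
      simp [setArr_arr_of_ne, hj, hj']
    · simpa [setArr_arr, h33, h4] using hlk
    · intro S
      have := h11 S
      by_cases hSe : S = y / K.m - 1
      · subst hSe
        simp [setArr_arr, h33, hR'.m, atSet] at this ⊢
        omega
      · simp [setArr_arr, h33, hR'.m, atSet, hSe] at this ⊢
        simp [Ne.symm hSe, this]
  · rintro s' ⟨b, -, C, hC, hreg, harr, -, h11⟩
    rw [List.append_nil] at hC
    subst hC
    refine ⟨⟨fun S => ?_, fun e' => ?_⟩, hreg, fun j hj h1 h2 => (harr j hj h1).trans (harr1 j hj h2)⟩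
    · have hp : (atSet K.m S L).length = (atSet K.m S (atElem K.m e Es)).length :=
        (hperm.filter _).length_eq
      rw [h11 S, hX.gain, atSet_uncovered_insert he, hp, Nat.add_sub_cancel]
    · rw [harr 14 (by norm_num) (by norm_num), hs1, setReg_arr, setArr_arr _ _ _ _ _ _ (by norm_num) (by norm_num), hX.mark]
      by_cases h1 : e' = e
      · simp [h1]
      · simp [h1]

/-- The budget `b` pays for each edge of the chosen set and for each edge whose element becomes
covered. The second kind of payment happens only once per edge in the whole run. -/
theorem coverSet_runs (hK : K.Fits N) (hn : 32 * K.n + 100 ≤ N) (hR : K.Regs s)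
    (h : GraphMem K Es s) {X : Finset ℕ} (hX : Covered K Es X s) {S : ℕ}
    (h31 : s.reg 31 = s.arr 10 S) {b : ℕ}
    (hb : 60 * (atSet K.m S Es).length + 60 * (uncovered K.m X Es).length ≤ b + 60 *
      (uncovered K.m (X ∪ ((atSet K.m S Es).map (· % K.m)).toFinset) Es).length) :
    Runs N ω coverSet s (b + 2) fun s' =>
      Covered K Es (X ∪ ((atSet K.m S Es).map (· % K.m)).toFinset) s' ∧
      (∀ r, r < 31 → s'.reg r = s.reg r) ∧
      (∀ j < 16, j ≠ 11 → j ≠ 14 → s'.arr j = s.arr j) := by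
  have hcells := hK.cells
  have helem := hK.elem
  set X' := X ∪ ((atSet K.m S Es).map (· % K.m)).toFinset with hX'
  refine (Runs.traverse (N := N) (ω := ω) (L := atSet K.m S Es) (b := b)
    (fun R b s' => ∃ C Y, atSet K.m S Es = C ++ R ∧ Y = X ∪ (C.map (· % K.m)).toFinset ∧
      60 * R.length + 60 * (uncovered K.m Y Es).length ≤ b + 60 * (uncovered K.m X' Es).length ∧
      (∀ r, r < 31 → s'.reg r = s.reg r) ∧ Covered K Es Y s' ∧
      (∀ j < 16, j ≠ 11 → j ≠ 14 → s'.arr j = s.arr j) ∧ Linked (s.arr 9) (s'.reg 31) R) ?_ ?_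
    ⟨[], X, rfl, by simp, hb, fun r hr => rfl, hX, fun j _ _ _ => rfl, by rw [h31]; exact h.sets S⟩).mono
      le_rfl ?_
  · rintro b s' ⟨C, Y, -, -, -, -, -, -, h⟩
    exact h
  · rintro x R b s' ⟨C, Y, hC, hY, hb, hreg, hcov, harr, h31, hx0, hlk⟩
    refine ⟨by omega, ?_⟩
    have hxS : x ∈ atSet K.m S Es := by simp [hC]
    have hxEs : x ∈ Es := List.mem_of_mem_filter hxS
    have hxlt := (h.code x hxEs).2
    have hR' : K.Regs s' := hR.congr fun r hr => hreg r (by omega)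
    have hmod := Nat.mod_lt x (h.m_pos hxEs)
    have h9 : s'.arr 9 = s.arr 9 := harr 9 (by norm_num) (by norm_num) (by norm_num)
    have hh : GraphMem K Es s' := h.congr (harr 4 (by norm_num) (by norm_num) (by norm_num)) h9
      (harr 10 (by norm_num) (by norm_num) (by norm_num))
    have hYs : ∀ Y', Y' = X ∪ ((C ++ [x]).map (· % K.m)).toFinset →
        Y' = insert (x % K.m) Y := by
      rintro Y' rfl
      rw [hY]
      ext e
      simp
    have hsub : insert (x % K.m) Y ⊆ X' := by
      rw [← hYs _ rfl, hX', hC]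
      refine Finset.union_subset_union_right fun e => ?_
      simp only [List.mem_toFinset, List.mem_map, List.mem_append, List.mem_cons]
      rintro ⟨a, h1 | h1 | h1, h2⟩
      · exact ⟨a, Or.inl h1, h2⟩
      · exact ⟨a, Or.inr (Or.inl h1), h2⟩
      · simp at h1
    have hmono : (uncovered K.m X' Es).length ≤ (uncovered K.m (insert (x % K.m) Y) Es).length := by
      refine (List.monotone_filter_right Es ?_).length_le
      intro a ha
      simp only [decide_eq_true_eq] at ha ⊢
      exact fun h => ha (hsub h)
    -- Common to both branches; `c` is the price of the round and `b'` the remaining budget.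
    have hpush : ∀ (c : ℕ) (b' : ℕ) (hc : c + b' + 2 ≤ b) (_ : 20 ≤ c)
        (_ : 60 * R.length + 60 * (uncovered K.m (insert (x % K.m) Y) Es).length ≤
          b' + 60 * (uncovered K.m X' Es).length)
        (_ : ∀ s1 : State, s1 = s'.setReg 32 (x % K.m) →
          Runs N ω (.ite (.cell 14 (.reg 32)) .skip coverElem) s1 (c - 11) fun s2 =>
            Covered K Es (insert (x % K.m) Y) s2 ∧ (∀ r, r < 33 → s2.reg r = s1.reg r) ∧
            (∀ j < 16, j ≠ 11 → j ≠ 14 → s2.arr j = s1.arr j)),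
        ∃ c b', c + b' + 2 ≤ b ∧ Runs N ω
          (.assign 32 (.reg 31 % .reg 11) ;; .ite (.cell 14 (.reg 32)) .skip coverElem ;;
            .assign 31 (.cell 9 (.reg 31))) s' c fun s' => ∃ C Y, atSet K.m S Es = C ++ R ∧
              Y = X ∪ (C.map (· % K.m)).toFinset ∧
              60 * R.length + 60 * (uncovered K.m Y Es).length ≤ b' + 60 * (uncovered K.m X' Es).length ∧
              (∀ r, r < 31 → s'.reg r = s.reg r) ∧ Covered K Es Y s' ∧
              (∀ j < 16, j ≠ 11 → j ≠ 14 → s'.arr j = s.arr j) ∧ Linked (s.arr 9) (s'.reg 31) R := by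
      intro c b' hc hc2 hb' hite
      refine ⟨c, b', hc, ?_⟩
      refine ((Runs.block (T := 4) (Q := fun s1 => s1 = s'.setReg 32 (x % K.m)) (by simp)
        (Nat.le_of_ble_eq_true rfl) (by simp [h31, hR'.m])).seq
        (T' := (c - 11) + 7) ?_).mono (by omega) (fun _ h => h)
      rintro s1 rfl
      refine (hite _ rfl).seq ?_
      rintro s2 ⟨hcov2, hreg2, harr2⟩
      have h312 : s2.reg 31 = x := by rw [hreg2 31 (by norm_num)]; simp [h31]
      have h92 : s2.arr 9 = s.arr 9 := by
        rw [harr2 9 (by norm_num) (by norm_num) (by norm_num), setReg_arr, h9]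
      refine Runs.block ?_ (Nat.le_of_ble_eq_true rfl) ⟨C ++ [x], insert (x % K.m) Y, by simp [hC],
        (hYs _ rfl).symm, hb', fun r hr => ?_, hcov2.congr rfl rfl, fun j hj h1 h2 => ?_, ?_⟩
      · simp [h312]
        omega
      · simp [show r ≠ 31 by omega]
        rw [hreg2 r (by omega)]
        simp [show r ≠ 32 by omega, hreg r hr]
      · have := harr2 j hj h1 h2
        simp [this, harr j hj h1 h2]
      · simpa [h312, h92] using hlk
    have hlen : (x :: R).length = R.length + 1 := rfl
    have hcell : (Expr.cell 14 (.reg 32)).Ok N (s'.setReg 32 (x % K.m)) := by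
      simp
      omega
    have hm14 : (Expr.cell 14 (.reg 32)).val (s'.setReg 32 (x % K.m)) =
        if x % K.m ∈ Y then 1 else 0 := by
      simp [hcov.mark]
    by_cases he : x % K.m ∈ Y
    · have hins : insert (x % K.m) Y = Y := Finset.insert_eq_of_mem he
      rw [hins] at hpush hmono
      refine hpush 30 (b - 32) (by omega) (by omega) (by omega) ?_
      rintro s1 rfl
      refine Runs.mono (T := (Expr.cost (.cell 14 (.reg 32))) + 1 + 1)
        (Runs.ite hcell (fun _ => Runs.block (by simp) (Nat.le_of_ble_eq_true rfl)
          ⟨hcov.congr rfl rfl, fun r _ => rfl, fun j _ _ _ => rfl⟩) fun h0 => ?_)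
        (Nat.le_of_ble_eq_true rfl) (fun _ h => h)
      rw [hm14, if_pos he] at h0
      exact absurd h0 one_ne_zero
    · have hcount := length_uncovered_insert (m := K.m) (Es := Es) he
      refine hpush (60 * (atElem K.m (x % K.m) Es).length + 40)
        (b - (60 * (atElem K.m (x % K.m) Es).length + 42)) (by omega) (by omega) (by omega) ?_
      rintro s1 rfl
      refine Runs.mono (T := (Expr.cost (.cell 14 (.reg 32))) + 1 +
          (60 * (atElem K.m (x % K.m) Es).length + 20))
        (Runs.ite hcell (fun h0 => ?_) fun h0 => ?_) ?_ (fun _ h => h)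
      · rw [hm14, if_neg he] at h0
        exact absurd rfl h0
      · exact coverElem_runs (s := s'.setReg 32 (x % K.m)) (X := Y) hK hn
          (hR'.congr fun r hr => by simp [show r ≠ 32 by omega])
          (hh.congr rfl rfl rfl) (hcov.congr rfl rfl) hxEs (by simp) he
      · have : Expr.cost (.cell 14 (.reg 32)) = 6 := rfl
        omega
  · rintro s' ⟨b', C, Y, hC, hY, -, hreg, hcov, harr, -⟩
    rw [List.append_nil] at hC
    rw [← hC] at hY
    subst hY
    exact ⟨hcov, hreg, harr⟩

end Greedy

end KCover

namespace KCover

open WordRAM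

/-! ### The greedy loop with lazily updated buckets -/

section Greedy

variable {K : Conf} {N : ℕ} {ω : Coins} {Es : List ℕ} {s : State}

theorem fillBuckets_runs (hn : 32 * K.n + 100 ≤ N) (hR : K.Regs s)
    (h11 : ∀ S, 32 * s.arr 11 S + 100 ≤ N) (h0 : ∀ i, s.arr 12 i = 0 ∧ s.arr 13 i = 0) :
    Runs N ω fillBuckets s (60 * K.n + 10) fun s' =>
      (∀ r, r < 22 ∨ r = 23 → s'.reg r = s.reg r) ∧
      (∀ j < 16, j ≠ 12 → j ≠ 13 → s'.arr j = s.arr j) ∧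
      ∃ Bk, Buckets (s'.arr 12) (s'.arr 13) (Finset.Icc 1 K.n) (fun p => s.arr 11 (p - 1)) Bk := by
  refine ((Runs.block (T := 2) (Q := fun s' => s' = s.setReg 22 0) (by simp; omega)
    (Nat.le_of_ble_eq_true rfl) (by simp)).seq (T' := 60 * K.n + 4) ?_).mono (by omega) (fun _ h => h)
  rintro s1 rfl
  refine (Runs.for (N := N) (ω := ω) (n := K.n) (T := 56) (s := s.setReg 22 0)
    (fun i s' => i ≤ K.n ∧ s'.reg 22 = K.n - i ∧ (∀ r, r < 22 ∨ r = 23 → s'.reg r = s.reg r) ∧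
      (∀ j < 16, j ≠ 12 → j ≠ 13 → s'.arr j = s.arr j) ∧
      ∃ Bk, Buckets (s'.arr 12) (s'.arr 13) (Finset.Icc 1 (K.n - i)) (fun p => s.arr 11 (p - 1)) Bk)
    ⟨le_rfl, by simp, fun r hr => by simp [show r ≠ 22 by omega], fun j _ _ _ => rfl, fun _ => [], ?_⟩
    (fun i s' _ => by simp; omega) ?_).mono ?_ ?_
  · refine ⟨fun g => by simpa [Linked] using (h0 g).2, fun g => List.nodup_nil, fun g p => ?_, ?_⟩
    · simp
    · simp
  · rintro i s1 ⟨hi, h22, hreg, harr, Bk, hB⟩ hlt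
    have hR1 : K.Regs s1 := hR.congr fun r hr => hreg r (Or.inl (by omega))
    simp only [val_less, val_reg, h22, hR1.n] at hlt
    have hi0 : i ≠ 0 := by
      rintro rfl
      simp at hlt
    have e11 : s1.arr 11 = s.arr 11 := harr 11 (by norm_num) (by norm_num) (by norm_num)
    have hg := h11 (K.n - i)
    have hpush := hB.push (p := K.n - i + 1) (g := s.arr 11 (K.n - i)) (by simp) (by omega)
    have eb : Function.update (fun p => s.arr 11 (p - 1)) (K.n - i + 1) (s.arr 11 (K.n - i)) =
        fun p => s.arr 11 (p - 1) := Function.update_eq_self_iff.2 (by simp)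
    rw [eb] at hpush
    refine ⟨i - 1, by omega, Runs.block ?_ (Nat.le_of_ble_eq_true rfl)
      ⟨by omega, ?_, fun r hr => ?_, fun j hj h1 h2 => ?_, Function.update Bk (s.arr 11 (K.n - i))
        ((K.n - i + 1) :: Bk (s.arr 11 (K.n - i))), ?_⟩⟩
    · simp [h22, e11]
      omega
    · simp [h22]
      omega
    · simp [show r ≠ 22 by omega, show r ≠ 24 by omega, hreg r hr]
    · rw [← harr j hj h1 h2]
      simp [setArr_arr_of_ne, hj, h1, h2]
    · have e12 : Finset.Icc 1 (K.n - (i - 1)) = insert (K.n - i + 1) (Finset.Icc 1 (K.n - i)) := by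
        ext x
        simp
        omega
      rw [e12]
      convert hpush using 1
      · simp [setArr_arr_of_ne, setArr_arr_self, h22, e11]
      · simp [setArr_arr_of_ne, setArr_arr_self, h22, e11]
  · simp only [Expr.less, Expr.cost]
    omega
  · rintro s' ⟨i, ⟨hi, h22, hreg, harr, Bk, hB⟩, hval⟩
    have hR1 : K.Regs s' := hR.congr fun r hr => hreg r (Or.inl (by omega))
    have hi0 : i = 0 := by
      by_contra hne
      simp only [val_less, val_reg, h22, hR1.n] at hval
      rw [if_pos (by omega)] at hval
      exact one_ne_zero hval
    subst hi0
    exact ⟨hreg, harr, Bk, hB⟩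

/-- The state of the greedy algorithm after the sets in `sel` have been selected. -/
structure Selected (K : Conf) (Es sel : List ℕ) (s : State) : Prop where
  nodup : sel.Nodup
  lt : ∀ S ∈ sel, S < K.n
  greedy : IsGreedy K.n K.m Es sel
  arr : ∀ j (hj : j < sel.length), s.arr 15 j = sel[j]
  card : s.reg 28 = (covSet K.m Es sel).card

/-- The invariant of the loop of the greedy algorithm, with at most `b` steps to go. -/
structure GreedyInv (K : Conf) (Es : List ℕ) (s₀ : State) (b : ℕ) (sel : List ℕ) (U : Finset ℕ)
    (bb : ℕ → ℕ) (Bk : ℕ → List ℕ) (s : State) : Prop where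
  reg : ∀ r, r < 26 → s.reg r = s₀.reg r
  graph : GraphMem K Es s
  covered : Covered K Es (covSet K.m Es sel) s
  selected : Selected K Es sel s
  length : s.reg 27 = sel.length
  le : sel.length ≤ K.k
  buckets : Buckets (s.arr 12) (s.arr 13) U bb Bk
  rest : ∀ p, p ∈ U ↔ 1 ≤ p ∧ p ≤ K.n ∧ p - 1 ∉ sel
  bound : ∀ p ∈ U, s.arr 11 (p - 1) ≤ bb p ∧ bb p ≤ s.reg 26
  codes : s.reg 26 ≤ K.codes
  time : 100 * (s.reg 26 + ∑ p ∈ U, (bb p + 1 + (atSet K.m (p - 1) Es).length) +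
    (uncovered K.m (covSet K.m Es sel) Es).length) ≤ b

theorem IsGreedy.append {n m S : ℕ} {sel : List ℕ} (h : IsGreedy n m Es sel)
    (hS : ∀ S' < n, (covSet m Es (S' :: sel)).card ≤ (covSet m Es (sel ++ [S])).card) :
    IsGreedy n m Es (sel ++ [S]) := by
  intro j hj S' hS'
  rw [List.length_append, List.length_singleton] at hj
  rcases Nat.lt_succ_iff_lt_or_eq.1 hj with h1 | rfl
  · rw [List.take_append_of_le_length h1.le, List.take_append_of_le_length h1]
    exact h j h1 S' hS'
  · rw [List.take_append_of_le_length le_rfl, List.take_length, List.take_of_length_le (by simp)]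
    exact hS S' hS'

/-- Gains only decrease, so the bucket number of a set is an upper bound of its gain and need not be
kept current. If the top bucket `g` is empty, lower `g`. If its first set still has gain `g`, no
other set can have more, and it is selected. If its gain has fallen, it moves to the right bucket.
In each case the potential in `GreedyInv.time` decreases enough to pay. -/
theorem greedyStep_runs (hK : K.Fits N) (hn : 32 * K.n + 100 ≤ N) (hkn : K.k ≤ K.n) {s₀ : State}
    (hR : K.Regs s₀) {b : ℕ} {sel : List ℕ} {U : Finset ℕ} {bb : ℕ → ℕ} {Bk : ℕ → List ℕ}
    (h : GreedyInv K Es s₀ b sel U bb Bk s) (hlt : sel.length < K.k) :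
    ∃ c b', c + b' + 4 ≤ b ∧ Runs N ω greedyStep s c fun s' =>
      ∃ sel U bb Bk, GreedyInv K Es s₀ b' sel U bb Bk s' := by
  have hcells := hK.cells
  have hRs : K.Regs s := hR.congr fun r hr => h.reg r (by omega)
  set g := s.reg 26 with hg
  have hgc := h.codes
  rw [← hg] at hgc
  have hlink := h.buckets.linked g
  have htime := h.time
  rw [← hg] at htime
  set X := covSet K.m Es sel with hX
  -- Fewer than `K.k ≤ K.n` sets are selected, so some set is still in a bucket. For this reason
  -- bucket `0` is never found empty and `g` can be lowered.
  have hUne : U.Nonempty := by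
    by_contra hU
    rw [Finset.not_nonempty_iff_eq_empty] at hU
    have : Finset.range K.n ⊆ sel.toFinset := fun S hS => by
      by_contra hcon
      have := (h.rest (S + 1)).2 ⟨by omega, by simpa using hS, by simpa using hcon⟩
      simp [hU] at this
    have := Finset.card_le_card this
    rw [Finset.card_range, List.toFinset_card_of_nodup h.selected.nodup] at this
    omega
  have hfirst : ∀ (T : ℕ) (Q : State → Prop),
      (∀ s1, s1 = s.setReg 29 (s.arr 13 g) → Runs N ω (.ite (.reg 29)
        ((.put 13 (.reg 26) (.cell 12 (.reg 29 - 1)) ;; .assign 30 (.cell 11 (.reg 29 - 1))) ;;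
        .ite (.same (.reg 30) (.reg 26))
        ((.put 15 (.reg 27) (.reg 29 - 1) ;; .assign 27 (.reg 27 + 1) ;;
          .assign 28 (.reg 28 + .reg 26) ;; .assign 31 (.cell 10 (.reg 29 - 1))) ;; coverSet)
        (.put 12 (.reg 29 - 1) (.cell 13 (.reg 30)) ;; .put 13 (.reg 30) (.reg 29)))
        (.assign 26 (.reg 26 - 1))) s1 T Q) → Runs N ω greedyStep s (8 + T) Q := by
    intro T Q hT
    refine (Runs.block (T := 8) (Q := fun s1 => s1 = s.setReg 29 (s.arr 13 g)) ?_
      (Nat.le_of_ble_eq_true rfl) (by simp [← hg])).seq hT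
    simp [← hg]
    omega
  rcases hBk : Bk g with _ | ⟨p, l⟩
  · -- the bucket is empty
    rw [hBk] at hlink
    have h13 : s.arr 13 g = 0 := hlink
    have hne : ∀ p ∈ U, bb p ≠ g := fun p hp e => by
      have := (h.buckets.mem g p).2 ⟨hp, e⟩
      simp [hBk] at this
    have hg0 : g ≠ 0 := by
      rintro h0
      obtain ⟨p, hp⟩ := hUne
      have h1 := (h.bound p hp).2
      rw [← hg] at h1
      exact hne p hp (by omega)
    refine ⟨8 + 6, b - 18, by omega, hfirst _ _ ?_⟩
    rintro s1 rfl
    refine Runs.mono (T := (Expr.reg 29).cost + 1 + 4) (Runs.ite (by simp) (fun h0 => ?_) fun _ => ?_)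
      (Nat.le_of_ble_eq_true rfl) (fun _ h => h)
    · simp [h13] at h0
    refine Runs.block (by simp; omega) (Nat.le_of_ble_eq_true rfl) ⟨sel, U, bb, Bk, ?_⟩
    refine ⟨fun r hr => ?_, h.graph.congr rfl rfl rfl, h.covered.congr rfl rfl,
      ⟨h.selected.nodup, h.selected.lt, h.selected.greedy, h.selected.arr, ?_⟩, ?_, h.le, h.buckets,
      h.rest, fun p hp => ?_, ?_, ?_⟩
    · simp [show r ≠ 26 by omega, show r ≠ 29 by omega, h.reg r hr]
    · simp [h.selected.card]
    · simp [h.length]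
    · have h1 := h.bound p hp
      have h2 := hne p hp
      rw [← hg] at h1
      refine ⟨h1.1, ?_⟩
      simp [← hg]
      omega
    · simp [← hg]
      omega
    · simp [← hg, ← hX]
      omega
  · have hpm : p ∈ U ∧ bb p = g := (h.buckets.mem g p).1 (by simp [hBk])
    obtain ⟨hp1, hpn, hps⟩ := (h.rest p).1 hpm.1
    rw [hBk] at hlink
    obtain ⟨h13, hp0, -⟩ := hlink
    have hpop := h.buckets.pop hBk
    set S := p - 1 with hS
    have hgain := h.covered.gain S
    have hgle : s.arr 11 S ≤ g := (h.bound p hpm.1).1.trans hpm.2.le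
    set s2 := ((s.setReg 29 p).setArr 13 g (s.arr 12 S)).setReg 30 (s.arr 11 S) with hs2
    have hsum := Finset.add_sum_erase U (fun p => bb p + 1 + (atSet K.m (p - 1) Es).length) hpm.1
    simp only [← hS, hpm.2] at hsum
    have a12 : s2.arr 12 = s.arr 12 := by
      rw [hs2, setReg_arr, setArr_arr_of_ne (by norm_num) (by norm_num) (by norm_num), setReg_arr]
    have a13 : s2.arr 13 = Function.update (s.arr 13) g (s.arr 12 S) := by
      rw [hs2, setReg_arr, setArr_arr_self (by norm_num), setReg_arr]
    have aj : ∀ j < 16, j ≠ 13 → s2.arr j = s.arr j := fun j hj h1 => by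
      rw [hs2, setReg_arr, setArr_arr_of_ne (by norm_num) hj h1, setReg_arr]
    have hsecond : ∀ (T : ℕ) (Q : State → Prop), (∀ s1, s1 = s2 → Runs N ω
        (.ite (.same (.reg 30) (.reg 26))
        ((.put 15 (.reg 27) (.reg 29 - 1) ;; .assign 27 (.reg 27 + 1) ;;
          .assign 28 (.reg 28 + .reg 26) ;; .assign 31 (.cell 10 (.reg 29 - 1))) ;; coverSet)
        (.put 12 (.reg 29 - 1) (.cell 13 (.reg 30)) ;; .put 13 (.reg 30) (.reg 29))) s1 T Q) →
        Runs N ω greedyStep s (8 + (2 + (24 + T))) Q := by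
      intro T Q hT
      refine hfirst _ _ ?_
      rintro s1 rfl
      refine Runs.mono (T := (Expr.reg 29).cost + 1 + (24 + T))
        (Runs.ite (by simp) (fun _ => ?_) fun h0 => ?_)
        (by simp only [Expr.cost]; omega) (fun _ h => h)
      · refine (Runs.block (T := 24) (Q := fun s1 => s1 = s2) ?_
          (Nat.le_of_ble_eq_true rfl) ?_).seq hT
        · simp [← hg, h13]
          omega
        · simp [← hg, h13, hs2, setArr_arr, ← hS]
      · simp [h13] at h0
        omega
    by_cases hgg : s.arr 11 S = g
    · -- the set is selected
      have hXS : covSet K.m Es (sel ++ [S]) = covSet K.m Es (S :: sel) :=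
        covSet_congr fun S' => by simp [or_comm]
      have hcc := covSet_cons (m := K.m) (S := S) (Es := Es) (sel := sel)
      have hcard := card_covSet_cons (m := K.m) (S := S) (sel := sel) h.graph.nodup fun x hx =>
        ⟨(h.graph.code x hx).1, h.graph.m_pos hx⟩
      rw [← hX] at hcc hcard
      rw [← hgain, hgg] at hcard
      have hsub : X ⊆ covSet K.m Es (S :: sel) := by
        rw [hcc]
        exact Finset.subset_union_left
      have hmono : (uncovered K.m (covSet K.m Es (S :: sel)) Es).length ≤
          (uncovered K.m X Es).length := by
        refine (List.monotone_filter_right Es ?_).length_le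
        intro a ha
        simp only [decide_eq_true_eq] at ha ⊢
        exact fun h => ha (hsub h)
      have hlenN : sel.length < K.n := by omega
      set c := 60 * (atSet K.m S Es).length + 60 * ((uncovered K.m X Es).length -
        (uncovered K.m (covSet K.m Es (S :: sel)) Es).length) with hc
      refine ⟨8 + (2 + (24 + (36 + (c + 2)))), b - (c + 76), by omega, hsecond _ _ ?_⟩
      rintro s1 rfl
      set s3 := (((s2.setArr 15 sel.length S).setReg 27 (sel.length + 1)).setReg 28
        (X.card + g)).setReg 31 (s.arr 10 S) with hs3
      refine Runs.mono (T := (Expr.same (.reg 30) (.reg 26)).cost + 1 + (32 + (c + 2)))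
        (Runs.ite (by simp; omega) (fun _ => ?_) fun h0 => ?_)
        (by simp only [Expr.same, Expr.cost]; omega) (fun _ h => h)
      swap
      · simp [hs2, ← hg, hgg] at h0
      have hXle : X.card + g ≤ K.codes := by
        rw [← hcard]
        refine le_trans ?_ h.graph.length_le
        refine (List.toFinset_card_le _).trans ?_
        rw [List.length_map]
        exact List.length_filter_le _ _
      refine (Runs.block (T := 32) (Q := fun s1 => s1 = s3) ?_
        (Nat.le_of_ble_eq_true rfl) ?_).seq ?_
      · simp [hs2, h.length, h.selected.card, ← hX, ← hg, ← hS]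
        omega
      · simp [hs2, h.length, h.selected.card, ← hX, ← hg, ← hS, hs3, setArr_arr]
      rintro s1 rfl
      have bj : ∀ j < 16, j ≠ 13 → j ≠ 15 → s3.arr j = s.arr j := fun j hj h1 h2 => by
        rw [hs3, setReg_arr, setReg_arr, setReg_arr, setArr_arr_of_ne (by norm_num) hj h2, aj j hj h1]
      have hreg3 : ∀ r < 26, s3.reg r = s.reg r := fun r hr => by
        simp [hs3, hs2, show r ≠ 27 by omega, show r ≠ 28 by omega, show r ≠ 31 by omega,
          show r ≠ 29 by omega, show r ≠ 30 by omega]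
      refine (coverSet_runs (s := s3) (X := X) (S := S) (b := c) hK hn
        (hRs.congr fun r hr => hreg3 r (by omega))
        (h.graph.congr (bj 4 (by norm_num) (by norm_num) (by norm_num))
          (bj 9 (by norm_num) (by norm_num) (by norm_num))
          (bj 10 (by norm_num) (by norm_num) (by norm_num)))
        (h.covered.congr (bj 11 (by norm_num) (by norm_num) (by norm_num))
          (bj 14 (by norm_num) (by norm_num) (by norm_num))) ?_ ?_).mono le_rfl ?_
      · rw [bj 10 (by norm_num) (by norm_num) (by norm_num)]
        simp [hs3]
      · rw [← hcc]
        omega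
      rintro s4 ⟨hcov, hreg4, harr4⟩
      rw [← hcc] at hcov
      have cj : ∀ j < 16, j ≠ 11 → j ≠ 14 → j ≠ 13 → j ≠ 15 → s4.arr j = s.arr j :=
        fun j hj h1 h2 h3 h4 => (harr4 j hj h1 h2).trans (bj j hj h3 h4)
      have r26 : s4.reg 26 = g := by rw [hreg4 26 (by norm_num)]; simp [hs3, hs2, ← hg]
      have c13 : s4.arr 13 = Function.update (s.arr 13) g (s.arr 12 S) := by
        rw [harr4 13 (by norm_num) (by norm_num) (by norm_num), hs3, setReg_arr, setReg_arr,
          setReg_arr, setArr_arr_of_ne (by norm_num) (by norm_num) (by norm_num), a13]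
      have c15 : s4.arr 15 = Function.update (s.arr 15) sel.length S := by
        rw [harr4 15 (by norm_num) (by norm_num) (by norm_num), hs3, setReg_arr, setReg_arr,
          setReg_arr, setArr_arr_self (by norm_num), aj 15 (by norm_num) (by norm_num)]
      have hgainle : ∀ p ∈ U, s4.arr 11 (p - 1) ≤ s.arr 11 (p - 1) := fun p' _ => by
        rw [hcov.gain, h.covered.gain, ← hX]
        refine ((List.monotone_filter_right Es ?_).filter _).length_le
        intro a ha
        simp only [decide_eq_true_eq] at ha ⊢
        exact fun h => ha (hsub h)
      refine ⟨sel ++ [S], U.erase p, bb, Function.update Bk g l, ?_⟩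
      refine ⟨fun r hr => ?_, h.graph.congr (cj 4 (by norm_num) (by norm_num) (by norm_num) (by norm_num) (by norm_num))
        (cj 9 (by norm_num) (by norm_num) (by norm_num) (by norm_num) (by norm_num))
        (cj 10 (by norm_num) (by norm_num) (by norm_num) (by norm_num) (by norm_num)), by rwa [hXS],
        ⟨?_, ?_, h.selected.greedy.append fun S' hS' => ?_, fun j hj => ?_, ?_⟩, ?_, ?_, ?_, fun p' => ?_,
        fun p' hp' => ?_, ?_, ?_⟩
      · rw [hreg4 r (by omega), hreg3 r hr, h.reg r hr]
      · rw [List.nodup_append]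
        exact ⟨h.selected.nodup, List.nodup_singleton _, fun a ha b hb e => hps (by simp at hb; rwa [← hb, ← e])⟩
      · intro S' hS'
        rcases List.mem_append.1 hS' with h1 | h1
        · exact h.selected.lt S' h1
        · simp at h1
          omega
      · rw [hXS, hcard]
        -- `IsGreedy` compares with all sets. One already selected gains nothing, and any other is
        -- bounded by its bucket number, hence by `g`.
        by_cases hm : S' ∈ sel
        · have : covSet K.m Es (S' :: sel) = X := covSet_congr fun S'' => by
            simp only [List.mem_cons]
            constructor
            · rintro (rfl | h1)
              · exact hm
              · exact h1
            · exact Or.inr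
          rw [this]
          omega
        · have hp' := (h.rest (S' + 1)).2 ⟨by omega, by omega, by simpa using hm⟩
          have h1 := h.bound _ hp'
          rw [Nat.add_sub_cancel, h.covered.gain] at h1
          rw [card_covSet_cons h.graph.nodup fun x hx =>
            ⟨(h.graph.code x hx).1, h.graph.m_pos hx⟩, ← hX]
          rw [← hX, ← hg] at h1
          omega
      · rw [c15]
        rw [List.length_append, List.length_singleton] at hj
        by_cases hjl : j = sel.length
        · subst hjl
          simp
        · rw [Function.update_of_ne hjl, h.selected.arr j (by omega),
            List.getElem_append_left (by omega)]
      · rw [hXS, hcard, hreg4 28 (by norm_num)]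
        simp [hs3]
      · rw [hreg4 27 (by norm_num)]
        simp [hs3]
      · simp
        omega
      · rw [cj 12 (by norm_num) (by norm_num) (by norm_num) (by norm_num) (by norm_num), c13]
        exact hpop
      · rw [Finset.mem_erase, h.rest]
        simp only [List.mem_append, List.mem_singleton]
        constructor
        · rintro ⟨h1, h2, h3, h4⟩
          exact ⟨h2, h3, fun h5 => h5.elim h4 (by omega)⟩
        · rintro ⟨h2, h3, h4⟩
          exact ⟨fun e => h4 (Or.inr (by rw [e])), h2, h3, fun h5 => h4 (Or.inl h5)⟩
      · have hp'U := Finset.mem_of_mem_erase hp'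
        have h1 := h.bound p' hp'U
        rw [r26]
        exact ⟨(hgainle p' hp'U).trans h1.1, h1.2⟩
      · rw [r26]
        exact hgc
      · rw [r26, hXS]
        omega
    · -- the set gets into another bucket
      have hlt' : s.arr 11 S < g := by omega
      have hpush := hpop.push (p := p) (g := s.arr 11 S) (by simp) hp1
      rw [Finset.insert_erase hpm.1] at hpush
      refine ⟨8 + (2 + (24 + 40)), b - 80, by omega, hsecond _ _ ?_⟩
      rintro s1 rfl
      refine Runs.mono (T := (Expr.same (.reg 30) (.reg 26)).cost + 1 + 30)
        (Runs.ite (by simp; omega) (fun h0 => ?_) fun _ => ?_)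
        (Nat.le_of_ble_eq_true rfl) (fun _ h => h)
      · simp [hs2, ← hg, hgg] at h0
      have r29 : s2.reg 29 = p := by simp [hs2]
      have r30 : s2.reg 30 = s.arr 11 S := by simp [hs2]
      refine Runs.block (by simp [r29, r30]; omega) (Nat.le_of_ble_eq_true rfl) ?_
      set s3 := (s2.setArr 12 S (s2.arr 13 (s.arr 11 S))).setArr 13 (s.arr 11 S) p with hs3
      have e3 : Prog.den ω (.put 12 (.reg 29 - 1) (.cell 13 (.reg 30)) ;; .put 13 (.reg 30) (.reg 29)) s2
          = s3 := by
        simp [hs3, r29, r30, ← hS]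
      rw [e3]
      have bj : ∀ j < 16, j ≠ 13 → j ≠ 12 → s3.arr j = s.arr j := fun j hj h1 h2 => by
        rw [hs3, setArr_arr_of_ne (by norm_num) hj h1, setArr_arr_of_ne (by norm_num) hj h2, aj j hj h1]
      have r3 : ∀ r, r ≠ 29 → r ≠ 30 → s3.reg r = s.reg r := fun r h1 h2 => by
        simp [hs3, hs2, h1, h2]
      have hsum' := Finset.add_sum_erase U
        (fun p' => Function.update bb p (s.arr 11 S) p' + 1 + (atSet K.m (p' - 1) Es).length) hpm.1
      simp only [Function.update_self, ← hS] at hsum'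
      have hsum2 : ∑ p' ∈ U.erase p, (Function.update bb p (s.arr 11 S) p' + 1 +
          (atSet K.m (p' - 1) Es).length) =
          ∑ p' ∈ U.erase p, (bb p' + 1 + (atSet K.m (p' - 1) Es).length) :=
        Finset.sum_congr rfl fun p' hp' => by rw [Function.update_of_ne (Finset.ne_of_mem_erase hp')]
      refine ⟨sel, U, Function.update bb p (s.arr 11 S),
        Function.update (Function.update Bk g l) (s.arr 11 S)
          (p :: Function.update Bk g l (s.arr 11 S)),
        ⟨fun r hr => ?_, h.graph.congr (bj 4 (by norm_num) (by norm_num) (by norm_num))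
          (bj 9 (by norm_num) (by norm_num) (by norm_num))
          (bj 10 (by norm_num) (by norm_num) (by norm_num)),
          h.covered.congr (bj 11 (by norm_num) (by norm_num) (by norm_num))
          (bj 14 (by norm_num) (by norm_num) (by norm_num)),
        ⟨h.selected.nodup, h.selected.lt, h.selected.greedy, ?_, ?_⟩, ?_, h.le, ?_,
        h.rest, fun p' hp' => ?_, ?_, ?_⟩⟩
      · rw [r3 r (by omega) (by omega), h.reg r hr]
      · rw [bj 15 (by norm_num) (by norm_num) (by norm_num)]
        exact h.selected.arr
      · rw [r3 28 (by norm_num) (by norm_num)]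
        exact h.selected.card
      · rw [r3 27 (by norm_num) (by norm_num)]
        exact h.length
      · convert hpush using 1
        · rw [hs3, setArr_arr_of_ne (by norm_num) (by norm_num) (by norm_num),
            setArr_arr_self (by norm_num), a12, a13]
        · rw [hs3, setArr_arr_self (by norm_num), setArr_arr_of_ne (by norm_num) (by norm_num) (by norm_num), a13]
      · rw [bj 11 (by norm_num) (by norm_num) (by norm_num), r3 26 (by norm_num) (by norm_num)]
        by_cases he : p' = p
        · subst he
          rw [Function.update_self]
          exact ⟨le_rfl, hgle⟩
        · rw [Function.update_of_ne he]
          exact h.bound p' hp'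
      · rw [r3 26 (by norm_num) (by norm_num)]
        exact hgc
      · rw [r3 26 (by norm_num) (by norm_num), ← hg, ← hX]
        omega

theorem sum_length_atSet_le (m n : ℕ) (Es : List ℕ) :
    ∑ p ∈ Finset.Icc 1 n, (atSet m (p - 1) Es).length ≤ Es.length := by
  induction Es with
  | nil => simp [atSet]
  | cons x Es ih =>
    have : ∀ p ∈ Finset.Icc 1 n, (atSet m (p - 1) (x :: Es)).length =
        (if x / m - 1 + 1 = p then 1 else 0) + (atSet m (p - 1) Es).length := by
      intro p hp
      rw [Finset.mem_Icc] at hp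
      by_cases h : x / m - 1 = p - 1
      · rw [if_pos (by omega), atSet, List.filter_cons_of_pos (by simpa using h), ← atSet,
          List.length_cons, add_comm]
      · rw [if_neg (by omega), atSet, List.filter_cons_of_neg (by simpa using h), ← atSet, zero_add]
    rw [Finset.sum_congr rfl this, Finset.sum_add_distrib, Finset.sum_ite_eq, List.length_cons]
    split_ifs <;> omega

/-- The initial potential contains the number of edges four times: as the top bucket, as the sum of
the bucket numbers, as the sum of the set sizes and as the uncovered edges. In addition there is one
unit per set. -/
theorem greedy_runs (hK : K.Fits N) (hn : 32 * K.n + 100 ≤ N) (hkn : K.k ≤ K.n)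
    (hR : K.Regs s) (h : GraphMem K Es s) (hcov : Covered K Es ∅ s) (h23 : s.reg 23 = Es.length)
    {Bk : ℕ → List ℕ}
    (hB : Buckets (s.arr 12) (s.arr 13) (Finset.Icc 1 K.n) (fun p => s.arr 11 (p - 1)) Bk) :
    Runs N ω greedy s (400 * Es.length + 100 * K.n + 20) fun s' =>
      (∀ r, r < 26 → s'.reg r = s.reg r) ∧ ∃ sel, sel.length = K.k ∧ Selected K Es sel s' := by
  have hcells := hK.cells
  have hlen := h.length_le
  have hX0 : covSet K.m Es [] = ∅ := by simp [covSet]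
  have hunc : uncovered K.m ∅ Es = Es := by simp [uncovered]
  have hgain : ∀ S, s.arr 11 S = (atSet K.m S Es).length := fun S => by rw [hcov.gain, hunc]
  set s1 := ((s.setReg 26 Es.length).setReg 27 0).setReg 28 0 with hs1
  refine ((Runs.block (T := 6) (Q := fun s' => s' = s1) ?_ (Nat.le_of_ble_eq_true rfl) ?_).seq
    (T' := (400 * Es.length + 100 * K.n) + 4) ?_).mono (by omega) (fun _ h => h)
  · simp [h23]
    omega
  · simp [hs1, h23]
  rintro s' rfl
  refine (Runs.while_budget (N := N) (ω := ω) (b := 400 * Es.length + 100 * K.n)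
    (fun b s' => ∃ sel U bb Bk, GreedyInv K Es s b sel U bb Bk s') ?_ ?_
    ⟨[], Finset.Icc 1 K.n, fun p => s.arr 11 (p - 1), Bk, ?_⟩).mono le_rfl ?_
  · intro b s' _
    simp
    omega
  · rintro b s' ⟨sel, U, bb, Bk, hI⟩ hlt
    have hRs : K.Regs s' := hR.congr fun r hr => hI.reg r (by omega)
    simp only [val_less, val_reg, hI.length, hRs.k] at hlt
    refine greedyStep_runs hK hn hkn hR hI ?_
    by_contra hcon
    rw [if_neg hcon] at hlt
    exact hlt rfl
  · refine ⟨fun r hr => ?_, h.congr rfl rfl rfl, by rw [hX0]; exact hcov.congr rfl rfl,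
      ⟨List.nodup_nil, by simp, fun j hj => by simp at hj, fun j hj => by simp at hj, ?_⟩, ?_, by simp,
      hB, fun p => by simp, fun p hp => ⟨le_rfl, ?_⟩, ?_, ?_⟩
    · simp [hs1, show r ≠ 26 by omega, show r ≠ 27 by omega, show r ≠ 28 by omega]
    · simp [hs1, hX0]
    · simp [hs1]
    · rw [hgain]
      have : (atSet K.m (p - 1) Es).length ≤ Es.length := List.length_filter_le _ _
      simpa [hs1] using this
    · simpa [hs1] using hlen
    · have h1 := sum_length_atSet_le K.m K.n Es
      rw [hX0, hunc, Finset.sum_add_distrib, Finset.sum_add_distrib]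
      simp only [hgain, Finset.sum_const, Nat.card_Icc, smul_eq_mul, hs1, setReg_reg]
      simp
      omega
  · rintro s' ⟨b, ⟨sel, U, bb, Bk, hI⟩, h0⟩
    have hRs : K.Regs s' := hR.congr fun r hr => hI.reg r (by omega)
    refine ⟨hI.reg, sel, ?_, hI.selected⟩
    simp only [val_less, val_reg, hI.length, hRs.k] at h0
    have := hI.le
    by_contra hne
    rw [if_pos (by omega)] at h0
    exact one_ne_zero h0

/-- The selected sets are copied from array `15` to consecutive cells from `16 * K.k + 16` on. All
cells still to be read lie below that address, so nothing needed is overwritten. -/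
theorem output_runs (hk : 32 * K.k + 100 ≤ N) (hR : K.Regs s) {sel : List ℕ}
    (hlen : sel.length = K.k) (hsel : ∀ j (hj : j < sel.length), s.arr 15 j = sel[j]) {c θ : ℕ}
    (h28 : s.reg 28 = c) (h21 : s.reg 21 = θ) (hv : c * K.q * (8 * K.A) < N)
    (hθ : θ * (8 * K.A + 1) < N) (hA : 0 < K.A) (h8A : 8 * K.A + 1 < N) :
    Runs N ω output s (40 * K.k + 60) fun s' =>
      s'.reg 0 = c * K.q * (8 * K.A) ∧ s'.reg 1 = θ * (8 * K.A + 1) ∧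
      ∀ j (hj : j < sel.length), s'.mem (s'.reg 2 + j) = sel[j] := by
  set s1 := (s.setReg 22 0).setReg 24 (16 * K.k + 16) with hs1
  refine ((Runs.block (T := 8) (Q := fun s' => s' = s1) ?_ (Nat.le_of_ble_eq_true rfl) ?_).seq
    (T' := (40 * K.k + 4) + 30) ?_).mono (by omega) (fun _ h => h)
  · simp [hR.k]
    omega
  · simp [hs1, hR.k]
  rintro s' rfl
  have hloop := Runs.for (N := N) (ω := ω) (n := K.k) (T := 30)
    (fun i s' => i ≤ K.k ∧ s'.reg 22 = K.k - i ∧ s'.reg 24 = 16 * K.k + 16 ∧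
      (∀ r, r ≠ 22 → r ≠ 24 → s'.reg r = s.reg r) ∧
      (∀ a < 16 * K.k + 16, s'.mem a = s.mem a) ∧
      ∀ j (hj : j < sel.length), j < K.k - i → s'.mem (16 * K.k + 16 + j) = sel[j])
    (e := .less (.reg 22) (.reg 2))
    (p := .store (.reg 24 + .reg 22) (.cell 15 (.reg 22)) ;; .assign 22 (.reg 22 + 1))
    (s := s1) ⟨le_rfl, by simp [hs1], by simp [hs1], fun r h1 h2 => by simp [hs1, h1, h2],
      fun _ _ => rfl, by omega⟩
    (fun i s' _ => by simp; omega) (by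
    rintro i s2 ⟨hi, h22, h24, hreg, hmem, hout⟩ hlt
    simp only [val_less, val_reg, h22, hreg 2 (by norm_num) (by norm_num), hR.k] at hlt
    have hi0 : i ≠ 0 := by
      rintro rfl
      simp at hlt
    have hcell : s2.arr 15 (K.k - i) = s.arr 15 (K.k - i) := hmem _ (by omega)
    refine ⟨i - 1, by omega, Runs.block ?_ (Nat.le_of_ble_eq_true rfl)
      ⟨by omega, ?_, ?_, fun r h1 h2 => ?_, fun a ha => ?_, fun j hj hj' => ?_⟩⟩
    · simp [h22, h24]
      omega
    · simp [h22]
      omega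
    · simp [h24]
    · simp [h1, hreg r h1 h2]
    · simp [h22, h24, hmem a ha]
      omega
    · simp [h22, h24]
      by_cases hjk : j = K.k - i
      · subst hjk
        rw [if_pos rfl, hcell, hsel _ hj]
      · rw [if_neg hjk]
        exact hout j hj (by omega))
  refine Runs.seq (hloop.mono ?_ fun _ h => h) ?_
  · simp only [Expr.less, Expr.cost]
    omega
  rintro s2 ⟨i, ⟨hi, h22, h24, hreg, hmem, hout⟩, h0⟩
  have hi0 : i = 0 := by
    by_contra hne
    simp only [val_less, val_reg, h22, hreg 2 (by norm_num) (by norm_num), hR.k] at h0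
    rw [if_pos (by omega)] at h0
    exact one_ne_zero h0
  have hcq : c * K.q < N := lt_of_le_of_lt (Nat.le_mul_of_pos_right _ (by omega)) hv
  have e28 := hreg 28 (by norm_num) (by norm_num)
  have e12 := hreg 12 (by norm_num) (by norm_num)
  have e21 := hreg 21 (by norm_num) (by norm_num)
  have e4 := hreg 4 (by norm_num) (by norm_num)
  refine Runs.block ?_ (Nat.le_of_ble_eq_true rfl) ⟨?_, ?_, fun j hj => ?_⟩
  · simp [e28, e12, e21, e4, h28, h21, hR.q, hR.A]
    refine ⟨⟨hcq, by omega, hv⟩, ⟨by omega, hθ⟩⟩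
  · simp [e28, e12, e21, e4, h28, h21, hR.q, hR.A]
  · simp [e28, e12, e21, e4, h28, h21, hR.q, hR.A]
  · simp [h24]
    exact hout j hj (by omega)

/-- The bounds that the query needs. -/
structure Conf.FitsQuery (K : Conf) (N : ℕ) : Prop where
  sets : 32 * K.n + 100 ≤ N
  value : K.m * K.q * (8 * K.A) < N
  denom : K.q * (8 * K.A + 1) < N
  k_le_n : K.k ≤ K.n
  A_pos : 0 < K.A
  q_pos : 0 < K.q

theorem covSet_card_le {m : ℕ} {sel : List ℕ} (hm : ∀ x ∈ Es, 0 < m) :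
    (covSet m Es sel).card ≤ m := by
  refine (Finset.card_le_card (t := Finset.range m) fun e he => ?_).trans (Finset.card_range m).le
  obtain ⟨x, hx, -, rfl⟩ := mem_covSet.1 he
  exact Finset.mem_range.2 (Nat.mod_lt _ (hm x hx))

end Greedy

/-! ### The query as a whole -/

section Query

variable {K : Conf} {N : ℕ} {ω : Coins} {co lev : ℕ → ℕ} {st : ℕ → List ℕ} {ts : ℕ → ℕ} {s : State}

/-- All edges of an element lie in one level. Hence the element list kept since the stream phase
already consists of the collected edges of that element, up to order. -/
theorem graphMem (hW : Wf K lev st) (h : Rep K co lev st ts s) {i : ℕ} {s' : State}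
    (hc : Collected K (edgesFrom st i K.LV) s')
    (h4 : s'.arr 4 = s.arr 4) : GraphMem K (edgesFrom st i K.LV) s' := by
  refine ⟨nodup_edgesFrom hW _ _, fun x hx => ?_, hc.linked, fun x hx => ?_⟩
  · obtain ⟨l, -, -, hl⟩ := mem_edgesFrom.1 hx
    exact ⟨hW.ge l x hl, hW.lt l x hl⟩
  · obtain ⟨l, h1, h2, hl⟩ := mem_edgesFrom.1 hx
    have hll := hW.level l x hl
    have hl' : x ∈ st (lev (x % K.m)) := by rwa [hll]
    refine ⟨atElem K.m (x % K.m) (st (lev (x % K.m))), ?_, ?_⟩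
    · rw [h4]
      refine h.elem.linked (i := x % K.m) (Nat.mod_mod _ _) (fun y hy => ?_) (hW.nodup_elem hl')
        fun h0 => hW.zero_notMem _ (List.mem_of_mem_filter h0)
      simpa [atElem] using (List.mem_filter.1 hy).2
    · refine (List.perm_ext_iff_of_nodup ((hW.nodup _).filter _) ((nodup_edgesFrom hW _ _).filter _)).2
        fun y => ?_
      simp only [List.mem_filter, mem_edgesFrom, decide_eq_true_eq]
      refine and_congr_left fun hy => ⟨fun hy' => ⟨_, by rwa [hll], by rwa [hll], hy'⟩, ?_⟩
      rintro ⟨l', -, -, hy'⟩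
      rwa [← hy, hW.level l' y hy']

theorem query_runs (hK : K.Fits N) (hQ : K.FitsQuery N) (hW : Wf K lev st)
    (h : Rep K co lev st ts s) (hR : K.Regs s) {E : ℕ}
    (hE : ∀ i, (edgesFrom st i K.LV).length ≤ E) :
    Runs N ω queryProg s (500 * (E + K.LV + K.n) + 300) fun s' =>
      ∃ i sel, i ≤ K.LV ∧ (∀ l, i ≤ l → l < K.LV → (st l).length < K.B) ∧
        (i ≠ 0 → K.B ≤ (st (i - 1)).length) ∧ sel.length = K.k ∧ sel.Nodup ∧ (∀ S ∈ sel, S < K.n) ∧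
        IsGreedy K.n K.m (edgesFrom st i K.LV) sel ∧
        s'.reg 0 = (covSet K.m (edgesFrom st i K.LV) sel).card * K.q * (8 * K.A) ∧
        s'.reg 1 = K.q / 2 ^ i * (8 * K.A + 1) ∧
        ∀ j (hj : j < sel.length), s'.mem (s'.reg 2 + j) = sel[j] := by
  have hcells := hK.cells
  have hn := hQ.sets
  have hkn := hQ.k_le_n
  refine ((chooseLevel_runs hK h hR).seq (T' := 40 * K.LV + 40 + ((100 * (E + K.LV) + 40) +
    ((60 * K.n + 10) + ((400 * E + 100 * K.n + 20) + (40 * K.n + 60))))) ?_).mono (by omega)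
    (fun _ h => h)
  rintro s1 ⟨harr1, hreg1, h20, hlt, hge⟩
  have hR1 : K.Regs s1 := hR.congr hreg1
  refine (threshold_runs hK hR1 h20).seq ?_
  rintro s2 ⟨harr2, hreg2, h21⟩
  have hR2 : K.Regs s2 := hR1.congr fun r hr => hreg2 r (by omega)
  have h20' : s2.reg 20 = s1.reg 20 := hreg2 20 (by norm_num)
  set i := s1.reg 20 with hi
  set Es := edgesFrom st i K.LV with hEs
  have hEl : Es.length ≤ E := hE i
  refine ((collect_runs hK hn hW (h.congr (harr2.trans harr1)) hR2 h20' h20).mono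
    (by rw [← hEs]; omega) (fun _ h => h)).seq ?_
  rintro s3 ⟨hreg3, h23, hcol, harr3⟩
  rw [← hEs] at h23 hcol
  have hR3 : K.Regs s3 := hR2.congr fun r hr => hreg3 r (by omega)
  have hg3 : GraphMem K Es s3 := graphMem hW h hcol (by
    rw [harr3 4 (by norm_num), harr2, harr1])
  have hlc := hg3.length_le
  refine (fillBuckets_runs hn hR3 (fun S => ?_) fun i => ⟨(hcol.rest i).1, (hcol.rest i).2.1⟩).seq ?_
  · rw [hcol.count]
    have : (atSet K.m S Es).length ≤ Es.length := List.length_filter_le _ _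
    omega
  rintro s4 ⟨hreg4, harr4, Bk, hB⟩
  have hR4 : K.Regs s4 := hR3.congr fun r hr => hreg4 r (Or.inl (by omega))
  have e11 : s4.arr 11 = s3.arr 11 := harr4 11 (by norm_num) (by norm_num) (by norm_num)
  rw [← e11] at hB
  have hg4 : GraphMem K Es s4 := hg3.congr (harr4 4 (by norm_num) (by norm_num) (by norm_num))
    (harr4 9 (by norm_num) (by norm_num) (by norm_num))
    (harr4 10 (by norm_num) (by norm_num) (by norm_num))
  have hc4 : Covered K Es ∅ s4 := by
    refine ⟨fun S => ?_, fun e => ?_⟩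
    · rw [e11, hcol.count]
      simp [uncovered]
    · rw [harr4 14 (by norm_num) (by norm_num) (by norm_num)]
      simpa using (hcol.rest e).2.2.1
  refine ((greedy_runs hK hn hkn hR4 hg4 hc4 ((hreg4 23 (Or.inr rfl)).trans h23) hB).mono
    (by omega) (fun _ h => h)).seq ?_
  rintro s5 ⟨hreg5, sel, hsl, hsel⟩
  have hR5 : K.Regs s5 := hR4.congr fun r hr => hreg5 r (by omega)
  have hcm : (covSet K.m Es sel).card ≤ K.m := covSet_card_le fun x hx => hg4.m_pos hx
  have hθ : K.q / 2 ^ i ≤ K.q := Nat.div_le_self _ _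
  have hv := hQ.value
  have hd := hQ.denom
  refine ((output_runs (by omega) hR5 hsl hsel.arr hsel.card (θ := K.q / 2 ^ i) ?_ ?_ ?_ hQ.A_pos ?_).mono
    (by omega) (fun _ h => h)).mono le_rfl ?_
  · rw [hreg5 21 (by norm_num), hreg4 21 (by norm_num), hreg3 21 (by norm_num), h21]
  · exact lt_of_le_of_lt (Nat.mul_le_mul_right _ (Nat.mul_le_mul_right _ hcm)) hv
  · exact lt_of_le_of_lt (Nat.mul_le_mul_right _ hθ) hd
  · exact lt_of_le_of_lt (Nat.le_mul_of_pos_left _ hQ.q_pos) hd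
  · rintro s6 ⟨h0, h1, h2⟩
    exact ⟨i, sel, h20, hlt, hge, hsl, hsel.nodup, hsel.lt, hsel.greedy, h0, h1, h2⟩

end Query

end KCover

namespace KCover

open WordRAM

/-! ### The initialization -/

/-- The smallest prime number from `a` on. -/
noncomputable def nextPrime (a : ℕ) : ℕ := Nat.find (Nat.exists_infinite_primes a)

theorem le_nextPrime (a : ℕ) : a ≤ nextPrime a := (Nat.find_spec (Nat.exists_infinite_primes a)).1

theorem prime_nextPrime (a : ℕ) : (nextPrime a).Prime :=
  (Nat.find_spec (Nat.exists_infinite_primes a)).2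

theorem nextPrime_le {a p : ℕ} (h : a ≤ p) (hp : p.Prime) : nextPrime a ≤ p :=
  Nat.find_min' _ ⟨h, hp⟩

/-- Bertrand's postulate; it keeps the modulus within the word length. -/
theorem nextPrime_le_two_mul {a : ℕ} (ha : a ≠ 0) : nextPrime a ≤ 2 * a := by
  obtain ⟨p, hp, h1, h2⟩ := Nat.exists_prime_lt_and_le_two_mul a ha
  exact (nextPrime_le h1.le hp).trans h2

/-- Half of the degree of independence of the hash function. -/
def halfIndep (n k W L : ℕ) : ℕ := k * n.size + L + W.size.size + 2

/-- The maximal number of edges that are kept for an element. -/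
def maxDegree (n k A : ℕ) : ℕ := n * (16 * A * (A.size + 3)) / k + 1

/-- The maximal number of edges that are kept in a level. -/
def maxEdges (n k W A L : ℕ) : ℕ := 12 * (1536 * (A * A) * halfIndep n k W L) * maxDegree n k A + 1

/-- The numbers the algorithm works with, for given parameters. -/
noncomputable def conf (n m k W A L : ℕ) : Conf where
  n := n
  m := m
  k := k
  W := W
  A := A
  q := nextPrime (m + 4 * W + 2)
  d := 2 * halfIndep n k W L
  LV := W.size + 1
  D := maxDegree n k A
  B := maxEdges n k W A L

/-- Put the number of binary digits of `e` into register `r`. -/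
def computeSize (r : ℕ) (e : Expr) : Prog :=
  (.assign r 0 ;; .assign 30 e) ;;
  .while (.reg 30) (.assign 30 (.reg 30 / 2) ;; .assign r (.reg r + 1))

def computeParams : Prog :=
  (.assign 10 (.reg 0) ;; .assign 11 (.reg 1)) ;;
  computeSize 20 (.reg 10) ;; computeSize 14 (.reg 3) ;; computeSize 21 (.reg 14) ;;
  computeSize 22 (.reg 4) ;;
  (.assign 23 (.reg 2 * .reg 20 + .reg 5 + .reg 21 + 2) ;; .assign 13 (2 * .reg 23) ;;
    .assign 14 (.reg 14 + 1) ;;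
    .assign 15 (.reg 10 * (16 * .reg 4 * (.reg 22 + 3)) / .reg 2 + 1) ;;
    .assign 16 (12 * (1536 * (.reg 4 * .reg 4) * .reg 23) * .reg 15 + 1) ;;
    .assign 18 ((.reg 10 + 1) * .reg 11) ;; .assign 12 (.reg 11 + 4 * .reg 3 + 2) ;; .assign 24 1)

/-- Increase register `12` until it holds a prime number. -/
def findPrime : Prog :=
  .while (.reg 24) (
    (.assign 24 0 ;; .assign 25 2) ;;
    .while (.less (.reg 25) (.reg 12)) (
      .ite (.reg 12 % .reg 25) .skip (.assign 24 1) ;; .assign 25 (.reg 25 + 1)) ;;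
    .assign 12 (.reg 12 + .reg 24))

def drawCoefs : Prog :=
  .assign 26 0 ;;
  .while (.less (.reg 26) (.reg 13)) (
    .rand 27 (.reg 12 - 1) ;; .put 0 (.reg 26) (.reg 27) ;; .assign 26 (.reg 26 + 1))

def initProg : Prog := (computeParams ;; findPrime) ;; drawCoefs

section Init

variable {N : ℕ} {ω : Coins} {s : State}

theorem computeSize_runs {r v : ℕ} {e : Expr} (hr : r ≠ 30) (he : e.Ok N (s.setReg r 0))
    (hv : e.val (s.setReg r 0) = v) (hN : 2 < N) (hvN : v.size + 1 < N) :
    Runs N ω (computeSize r e) s (e.cost + 3 + (v.size * 20 + 20)) fun s' => s'.reg r = v.size ∧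
      s'.mem = s.mem ∧ s'.draws = s.draws ∧ ∀ r', r' ≠ r → r' ≠ 30 → s'.reg r' = s.reg r' := by
  refine (Runs.block (T := e.cost + 3) (Q := fun s' => s' = (s.setReg r 0).setReg 30 v)
    (by simp [he]; omega) ?_ (by simp [hv])).seq ?_
  · change (0 : Expr).cost + 1 + (e.cost + 1) ≤ _
    have : (0 : Expr).cost = 1 := rfl
    omega
  rintro s1 rfl
  refine (Runs.for (N := N) (ω := ω) (n := v.size) (T := 8) (s := (s.setReg r 0).setReg 30 v)
    (fun i s' => (s'.reg 30).size = i ∧ s'.reg r + i = v.size ∧ s'.mem = s.mem ∧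
      s'.draws = s.draws ∧ ∀ r', r' ≠ r → r' ≠ 30 → s'.reg r' = s.reg r')
    ⟨by simp, by simp [hr], rfl, rfl, fun r' h1 h2 => by simp [h1, h2]⟩ (fun _ _ _ => by simp)
    ?_).mono ?_ ?_
  · rintro i s1 ⟨h30, hri, hm, hd, hreg⟩ h0
    rw [val_reg] at h0
    have hsz : (s1.reg 30 / 2).size + 1 = (s1.reg 30).size := by
      rcases Nat.eq_zero_or_pos (s1.reg 30 / 2) with h | h
      · have : s1.reg 30 = 1 := by omega
        rw [this]
        rfl
      · have := Nat.size_shiftLeft (m := s1.reg 30 / 2) (by omega) 1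
        have h1 := Nat.div_add_mod (s1.reg 30) 2
        have h2 : ∀ a : ℕ, a ≠ 0 → (2 * a).size = a.size + 1 := fun a ha => by
          have := Nat.size_shiftLeft (m := a) ha 1
          rwa [Nat.shiftLeft_eq, pow_one, mul_comm] at this
        have h3 : ∀ a : ℕ, (2 * a + 1).size = a.size + 1 := fun a => by
          have := Nat.size_bit (b := true) (n := a) (by simp [Nat.bit])
          simpa [Nat.bit] using this
        rcases Nat.mod_two_eq_zero_or_one (s1.reg 30) with h4 | h4
        · rw [h4, add_zero] at h1
          conv_rhs => rw [← h1]
          rw [h2 _ (by omega)]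
        · rw [h4] at h1
          conv_rhs => rw [← h1]
          rw [h3]
    refine ⟨i - 1, by omega, Runs.block ?_ (Nat.le_of_ble_eq_true rfl)
      ⟨?_, ?_, hm, hd, fun r' h1 h2 => ?_⟩⟩
    · simp [hr]
      omega
    · simp [Ne.symm hr]
      omega
    · simp [hr]
      omega
    · simp [h1, h2, hreg r' h1 h2]
  · simp only [Expr.cost]
    omega
  · rintro s' ⟨i, ⟨h30, hri, hm, hd, hreg⟩, h0⟩
    rw [val_reg] at h0
    rw [h0] at h30
    simp at h30
    exact ⟨by omega, hm, hd, hreg⟩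

/-- Plain trial division, with register `24` equal to `1` as long as the candidate is composite.
Only halting matters here, because the time of the initialization is not restricted. -/
theorem findPrime_runs {a : ℕ} (ha : 2 ≤ a) (hN : 2 * a + 2 < N) (h12 : s.reg 12 = a)
    (h24 : s.reg 24 = 1) :
    ∃ T, Runs N ω findPrime s T fun s' => s'.reg 12 = nextPrime a ∧ s'.mem = s.mem ∧
      s'.draws = s.draws ∧ ∀ r, r ≠ 12 → r ≠ 24 → r ≠ 25 → s'.reg r = s.reg r := by
  set P := nextPrime a with hP
  have hP2 : P ≤ 2 * a := nextPrime_le_two_mul (by omega)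
  have inner : ∀ s1 : State, a ≤ s1.reg 12 → s1.reg 12 ≤ P →
      Runs N ω (.while (.less (.reg 25) (.reg 12)) (
        .ite (.reg 12 % .reg 25) .skip (.assign 24 1) ;; .assign 25 (.reg 25 + 1)))
        ((s1.setReg 24 0).setReg 25 2) (P * 20 + 4) fun s' =>
        (∀ r, r ≠ 24 → r ≠ 25 → s'.reg r = s1.reg r) ∧ s'.mem = s1.mem ∧ s'.draws = s1.draws ∧
        s'.reg 24 = if (s1.reg 12).Prime then 0 else 1 := by
    intro s1 h1 h2
    refine (Runs.for (N := N) (ω := ω) (n := s1.reg 12 - 2) (T := 10)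
      (s := (s1.setReg 24 0).setReg 25 2)
      (fun i s' => s'.reg 25 + i = s1.reg 12 ∧ 2 ≤ s'.reg 25 ∧
        (∀ r, r ≠ 24 → r ≠ 25 → s'.reg r = s1.reg r) ∧ s'.mem = s1.mem ∧ s'.draws = s1.draws ∧
        s'.reg 24 ≤ 1 ∧ (s'.reg 24 = 1 ↔ ∃ b, 2 ≤ b ∧ b < s'.reg 25 ∧ b ∣ s1.reg 12))
      ⟨by simp; omega, by simp, fun r h1 h2 => by simp [h1, h2], rfl, rfl, by simp, ?_⟩
      (fun _ _ _ => by simp; omega) ?_).mono ?_ ?_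
    · simp
      omega
    · rintro i s2 ⟨h25, h25', hreg, hm, hd, h24⟩ hlt
      have e12 : s2.reg 12 = s1.reg 12 := hreg 12 (by norm_num) (by norm_num)
      simp only [val_less, val_reg, e12] at hlt
      have hi0 : i ≠ 0 := by
        rintro rfl
        rw [if_neg (by omega)] at hlt
        exact hlt rfl
      by_cases hdiv : s2.reg 25 ∣ s1.reg 12
      · have hmod := Nat.mod_eq_zero_of_dvd hdiv
        refine ⟨i - 1, by omega, Runs.block ?_ (Nat.le_of_ble_eq_true rfl)
          ⟨?_, ?_, fun r h1 h2 => ?_, ?_, ?_, ?_, ?_⟩⟩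
        · simp [e12, hmod]
          omega
        · simp [e12, hmod]
          omega
        · simp [e12, hmod]
          omega
        · simp [e12, hmod, h1, h2, hreg r h1 h2]
        · simp [e12, hmod, hm]
        · simp [e12, hmod, hd]
        · simp [e12, hmod]
        · simp [e12, hmod]
          exact ⟨s2.reg 25, h25', by omega, hdiv⟩
      · have hmod : s1.reg 12 % s2.reg 25 ≠ 0 := fun h => hdiv (Nat.dvd_of_mod_eq_zero h)
        refine ⟨i - 1, by omega, Runs.block ?_ (Nat.le_of_ble_eq_true rfl)
          ⟨?_, ?_, fun r h1 h2 => ?_, ?_, ?_, ?_, ?_⟩⟩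
        · simp [e12, hmod]
          omega
        · simp [e12, hmod]
          omega
        · simp [e12, hmod]
          omega
        · simp [e12, hmod, h2, hreg r h1 h2]
        · simp [e12, hmod, hm]
        · simp [e12, hmod, hd]
        · simp [e12, hmod, h24.1]
        · simp [e12, hmod, h24.2]
          constructor
          · rintro ⟨b, hb1, hb2, hb3⟩
            exact ⟨b, hb1, by omega, hb3⟩
          · rintro ⟨b, hb1, hb2, hb3⟩
            refine ⟨b, hb1, ?_, hb3⟩
            rcases Nat.lt_or_eq_of_le hb2 with h | h
            · exact h
            · exact absurd (h ▸ hb3) hdiv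
    · simp only [Expr.less, Expr.cost]
      omega
    · rintro s2 ⟨i, ⟨h25, h25', hreg, hm, hd, h24⟩, h0⟩
      have e12 : s2.reg 12 = s1.reg 12 := hreg 12 (by norm_num) (by norm_num)
      simp only [val_less, val_reg, e12] at h0
      have hi0 : i = 0 := by
        by_contra hi
        rw [if_pos (by omega)] at h0
        exact one_ne_zero h0
      refine ⟨hreg, hm, hd, ?_⟩
      by_cases hp : (s1.reg 12).Prime
      · rw [if_pos hp]
        have : ¬ s2.reg 24 = 1 := by
          rw [h24.2]
          rintro ⟨b, hb1, hb2, hb3⟩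
          rcases (Nat.dvd_prime hp).1 hb3 with h | h <;> omega
        have := h24.1
        omega
      · rw [if_neg hp, h24.2]
        obtain ⟨b, hb1, hb2, hb3⟩ := Nat.exists_dvd_of_not_prime2 (by omega) hp
        exact ⟨b, hb2, by omega, hb1⟩
  refine ⟨_, (Runs.for (N := N) (ω := ω) (n := P - a + 1) (T := 4 + (P * 20 + 4 + 4))
    (fun i s' => a ≤ s'.reg 12 ∧ s'.reg 12 ≤ P ∧ s'.mem = s.mem ∧ s'.draws = s.draws ∧
      (∀ r, r ≠ 12 → r ≠ 24 → r ≠ 25 → s'.reg r = s.reg r) ∧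
      (s'.reg 24 = 0 ∧ s'.reg 12 = P ∨ s'.reg 24 = 1 ∧ i = P - s'.reg 12 + 1))
    ⟨by omega, by rw [h12]; exact le_nextPrime a, rfl, rfl, fun _ _ _ _ => rfl,
      Or.inr ⟨h24, by rw [h12]⟩⟩ (fun _ _ _ => by simp) ?_).mono le_rfl ?_⟩
  · rintro i s1 ⟨h1, h2, hm, hd, hreg, hf⟩ h0
    rw [val_reg] at h0
    have hi : i = P - s1.reg 12 + 1 := by
      rcases hf with ⟨h, -⟩ | ⟨-, h⟩
      · exact absurd h h0
      · exact h
    refine ⟨i - 1, by omega, ?_⟩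
    refine (Runs.block (T := 4) (Q := fun s' => s' = (s1.setReg 24 0).setReg 25 2) (by simp; omega)
      (Nat.le_of_ble_eq_true rfl) (by simp)).seq ?_
    rintro s2 rfl
    refine (inner s1 h1 h2).seq ?_
    rintro s2 ⟨hreg2, hm2, hd2, h24⟩
    have e12 : s2.reg 12 = s1.reg 12 := hreg2 12 (by norm_num) (by norm_num)
    have key : s1.reg 12 + s2.reg 24 ≤ P ∧ (s2.reg 24 = 0 ∧ s1.reg 12 = P ∨
        s2.reg 24 = 1 ∧ i - 1 = P - (s1.reg 12 + 1) + 1) := by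
      by_cases hp : (s1.reg 12).Prime
      · rw [if_pos hp] at h24
        have := nextPrime_le h1 hp
        omega
      · rw [if_neg hp] at h24
        have : s1.reg 12 ≠ P := fun e => hp (e ▸ prime_nextPrime a)
        omega
    refine Runs.block (by simp [e12]; omega) (Nat.le_of_ble_eq_true rfl)
      ⟨by simp [e12]; omega, by simp [e12]; omega, hm2.trans hm, hd2.trans hd, fun r a1 a2 a3 => ?_, ?_⟩
    · simp [a1, hreg2 r a2 a3, hreg r a1 a2 a3]
    · simp [e12]
      omega
  · rintro s' ⟨i, ⟨h1, h2, hm, hd, hreg, hf⟩, h0⟩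
    rw [val_reg] at h0
    exact ⟨by omega, hm, hd, hreg⟩

/-- The counter of draws starts at `0` and runs along with the index, so coefficient `i` is the coin
`ω (i, q - 1)`: a fixed set of independent coordinates. -/
theorem drawCoefs_runs {d q : ℕ} (hd : 32 * d + 100 ≤ N) (h13 : s.reg 13 = d) (h12 : s.reg 12 = q)
    (hm : s.mem = 0) (hdr : s.draws = 0) :
    Runs N ω drawCoefs s (30 * d + 10) fun s' => (∀ r < 26, s'.reg r = s.reg r) ∧
      ∀ j i, j < 16 → s'.arr j i = if j = 0 ∧ i < d then (ω (i, q - 1) : ℕ) else 0 := by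
  refine ((Runs.block (T := 2) (Q := fun s' => s' = s.setReg 26 0) (by simp; omega)
    (Nat.le_of_ble_eq_true rfl) (by simp)).seq (T' := 30 * d + 8) ?_).mono (by omega) (fun _ h => h)
  rintro s1 rfl
  refine (Runs.for (N := N) (ω := ω) (n := d) (T := 26) (s := s.setReg 26 0)
    (fun i s' => i ≤ d ∧ s'.reg 26 = d - i ∧ s'.draws = d - i ∧ (∀ r < 26, s'.reg r = s.reg r) ∧
      ∀ j i', j < 16 → s'.arr j i' = if j = 0 ∧ i' < d - i then (ω (i', q - 1) : ℕ) else 0)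
    ⟨le_rfl, by simp, by simp [hdr], fun r hr => by simp [show r ≠ 26 by omega],
      fun j i' _ => by simp [State.arr, hm]⟩ (fun _ _ _ => by simp; omega) ?_).mono ?_ ?_
  · rintro i s1 ⟨hi, h26, hdr1, hreg, harr⟩ hlt
    simp only [val_less, val_reg, h26, hreg 13 (by norm_num), h13] at hlt
    have hi0 : i ≠ 0 := by
      rintro rfl
      simp at hlt
    refine ⟨i - 1, by omega, Runs.block ?_ (Nat.le_of_ble_eq_true rfl)
      ⟨by omega, ?_, ?_, fun r hr => ?_, fun j i' hj => ?_⟩⟩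
    · simp [h26]
      omega
    · simp [h26]
      omega
    · simp [hdr1]
      omega
    · simp [show r ≠ 26 by omega, show r ≠ 27 by omega, hreg r hr]
    · simp [h26, setArr_arr, hj, harr j i' hj]
      by_cases h1 : j = 0 ∧ i' = d - i
      · obtain ⟨rfl, rfl⟩ := h1
        have hω : ∀ a b, a = d - i → b = q - 1 → (ω (a, b) : ℕ) = ω (d - i, q - 1) := by
          rintro _ _ rfl rfl
          rfl
        rw [if_pos ⟨rfl, rfl⟩, if_pos ⟨rfl, by omega⟩]
        exact hω _ _ hdr1 (by rw [hreg 12 (by norm_num), h12])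
      · rw [if_neg h1]
        exact if_congr ⟨fun h => ⟨h.1, by omega⟩, fun h => ⟨h.1, by omega⟩⟩ rfl rfl
  · simp only [Expr.less, Expr.cost]
    omega
  · rintro s' ⟨i, ⟨hi, h26, -, hreg, harr⟩, h0⟩
    simp only [val_less, val_reg, h26, hreg 13 (by norm_num), h13] at h0
    have hi0 : i = 0 := by
      by_contra hne
      rw [if_pos (by omega)] at h0
      exact one_ne_zero h0
    subst hi0
    exact ⟨hreg, harr⟩

theorem rep_empty {K : Conf} {co lev ts : ℕ → ℕ} {s : State}
    (h : ∀ j i, j < 16 → s.arr j i = if j = 0 ∧ i < K.d then co i else 0) :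
    Rep K co lev (fun _ => []) ts s := by
  have h0 : ∀ j, j < 16 → j ≠ 0 → ∀ i, s.arr j i = 0 := fun j hj hj' i => by
    rw [h j i hj, if_neg fun h => hj' h.1]
  refine ⟨fun j => by simp [h 0 j (by norm_num)], ⟨fun z => ?_, fun z => ?_⟩,
    ⟨fun z => ?_, fun z => ?_⟩, fun x => ?_, fun l => ?_, fun e => ?_, fun i => ?_⟩ <;>
    simp [h0, nxt, atElem]

/-- The words are long enough for the initialization. -/
structure InitFits (N n m k W A L : ℕ) : Prop where
  half : k * n.size + L + W.size.size + 2 + 2 * halfIndep n k W L < N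
  deg : n * (16 * A * (A.size + 3)) + 1 < N
  edges : maxEdges n k W A L < N
  big : 1536 * (A * A) + 12 * (1536 * (A * A) * halfIndep n k W L) + 2000 < N
  start : 2 * (m + 4 * W + 2) + 2 < N
  codes : (n + 1) * m + n + W.size + 10 + A.size < N

/-- The registers are described for later states that may differ in register `12`, which holds only
the start of the prime search. -/
theorem computeParams_runs {n m k W A L : ℕ} (hF : InitFits N n m k W A L) (hn : 1 ≤ n)
    (h0 : s.reg 0 = n) (h1 : s.reg 1 = m) (h2 : s.reg 2 = k) (h3 : s.reg 3 = W) (h4 : s.reg 4 = A)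
    (h5 : s.reg 5 = L) :
    ∃ T, Runs N ω computeParams s T fun s' => s'.reg 12 = m + 4 * W + 2 ∧ s'.reg 24 = 1 ∧
      s'.reg 17 = s.reg 17 ∧ s'.mem = s.mem ∧ s'.draws = s.draws ∧
      ∀ s'' : State, s''.reg 12 = (conf n m k W A L).q →
        (∀ r < 20, r ≠ 12 → s''.reg r = s'.reg r) → (conf n m k W A L).Regs s'' := by
  have hbig := hF.big
  have hhalf := hF.half
  have hedges := hF.edges
  have hdeg := hF.deg
  have hstart := hF.start
  have hcodes := hF.codes
  have hAs : ∀ a : ℕ, a.size ≤ a := fun a => Nat.size_le.2 (Nat.lt_two_pow_self)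
  have hnn := hAs n
  have hss := hAs W.size
  refine ⟨_, (Runs.block (T := 4) (Q := fun s' => s' = (s.setReg 10 n).setReg 11 m) (by simp)
    (Nat.le_of_ble_eq_true rfl) (by simp [h0, h1])).seq
    (T' := (((1 + 3 + (n.size * 20 + 20)) + ((1 + 3 + (W.size * 20 + 20)) +
      ((1 + 3 + (W.size.size * 20 + 20)) + ((1 + 3 + (A.size * 20 + 20)) + 100)))))) ?_⟩
  rintro s1 rfl
  refine (computeSize_runs (r := 20) (v := n) (e := .reg 10) (by norm_num) (by simp) (by simp)
    (by omega) (by omega)).seq ?_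
  rintro s2 ⟨a20, m2, d2, r2⟩
  refine (computeSize_runs (r := 14) (v := W) (e := .reg 3) (by norm_num) (by simp)
    (by simp [r2 3 (by norm_num) (by norm_num), h3]) (by omega) (by omega)).seq ?_
  rintro s3 ⟨a14, m3, d3, r3⟩
  refine (computeSize_runs (r := 21) (v := W.size) (e := .reg 14) (by norm_num) (by simp)
    (by simp [a14]) (by omega) (by omega)).seq ?_
  rintro s4 ⟨a21, m4, d4, r4⟩
  refine (computeSize_runs (r := 22) (v := A) (e := .reg 4) (by norm_num) (by simp)
    (by simp [r4 4 (by norm_num) (by norm_num), r3 4 (by norm_num) (by norm_num),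
      r2 4 (by norm_num) (by norm_num), h4]) (by omega) (by omega)).seq ?_
  rintro s5 ⟨a22, m5, d5, r5⟩
  have b20 : s5.reg 20 = n.size := by
    rw [r5 _ (by norm_num) (by norm_num), r4 _ (by norm_num) (by norm_num),
      r3 _ (by norm_num) (by norm_num), a20]
  have b14 : s5.reg 14 = W.size := by
    rw [r5 _ (by norm_num) (by norm_num), r4 _ (by norm_num) (by norm_num), a14]
  have b21 : s5.reg 21 = W.size.size := by rw [r5 _ (by norm_num) (by norm_num), a21]
  have key : ∀ r, r ≠ 20 → r ≠ 14 → r ≠ 21 → r ≠ 22 → r ≠ 30 →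
      s5.reg r = ((s.setReg 10 n).setReg 11 m).reg r := fun r e1 e2 e3 e4 e5 => by
    rw [r5 r e4 e5, r4 r e3 e5, r3 r e2 e5, r2 r e1 e5]
  have c2 : s5.reg 2 = k := by simp [key, h2]
  have c3 : s5.reg 3 = W := by simp [key, h3]
  have c4 : s5.reg 4 = A := by simp [key, h4]
  have c5 : s5.reg 5 = L := by simp [key, h5]
  have c10 : s5.reg 10 = n := by simp [key]
  have c11 : s5.reg 11 = m := by simp [key]
  have c17 : s5.reg 17 = s.reg 17 := by simp [key]
  have hkn : k * n.size + L + W.size.size + 2 = halfIndep n k W L := rfl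
  have hDd : n * (16 * A * (A.size + 3)) / k + 1 = maxDegree n k A := rfl
  have hBd : 12 * (1536 * (A * A) * halfIndep n k W L) * maxDegree n k A + 1 = maxEdges n k W A L := rfl
  refine Runs.block ?_ (Nat.le_of_ble_eq_true rfl) ⟨?_, ?_, ?_, ?_, ?_,
    fun s'' hq hs => ?_⟩
  · simp [c2, c3, c4, c5, c10, c11, b20, b14, b21, a22, hkn, hDd, hBd]
    have e1 : n * (16 * A * (A.size + 3)) / k ≤ n * (16 * A * (A.size + 3)) := Nat.div_le_self _ _
    have e2 : 16 * A * (A.size + 3) ≤ n * (16 * A * (A.size + 3)) := Nat.le_mul_of_pos_left _ hn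
    have e3 : 16 * A ≤ 16 * A * (A.size + 3) := Nat.le_mul_of_pos_right _ (by omega)
    refine ⟨?_, ?_, ?_, ?_, ?_, ?_⟩ <;> omega
  · simp [c3, c11]
  · simp
  · simp [c17]
  · have : s5.mem = s.mem := by rw [m5, m4, m3, m2]; rfl
    simpa using this
  · have : s5.draws = s.draws := by rw [d5, d4, d3, d2]; rfl
    simpa using this
  · constructor <;> first | exact hq | rw [hs _ (by norm_num) (by norm_num)]
    · simp [c2, conf]
    · simp [c3, conf]
    · simp [c4, conf]
    · simp [c10, conf]
    · simp [c11, conf]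
    · simp [c2, c5, b20, b21, conf, halfIndep]
    · simp [b14, conf]
    · simp [c10, c4, c2, a22, conf, maxDegree]
    · simp [c2, c4, c5, c10, b20, b21, a22, conf, hkn, hDd, hBd]
    · simp [c10, c11, conf, Conf.codes]

/-- Two phases are kept apart because their space is controlled differently: the first stores
nothing, the second is short. -/
theorem init_runs {n m k W A L : ℕ} (hF : InitFits N n m k W A L) (hn : 1 ≤ n)
    (hd : 32 * (conf n m k W A L).d + 100 ≤ N)
    (h0 : s.reg 0 = n) (h1 : s.reg 1 = m) (h2 : s.reg 2 = k) (h3 : s.reg 3 = W) (h4 : s.reg 4 = A)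
    (h5 : s.reg 5 = L) (h17 : s.reg 17 = 0) (hm : s.mem = 0) (hdr : s.draws = 0) :
    ∃ T, Runs N ω (computeParams ;; findPrime) s T fun s₁ => s₁.mem = 0 ∧
      Runs N ω drawCoefs s₁ (30 * (conf n m k W A L).d + 10)
        (Ready (conf n m k W A L) (fun i => ω (i, (conf n m k W A L).q - 1)) []) := by
  obtain ⟨T, hT⟩ := computeParams_runs (ω := ω) hF hn h0 h1 h2 h3 h4 h5
  obtain ⟨s1, t1, hr1, -, a12, a24, a17, am, ad, hR⟩ := hT
  obtain ⟨T2, s2, t2, hr2, -, b12, bm, bd, breg⟩ :=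
    findPrime_runs (ω := ω) (by omega) hF.start a12 a24
  refine ⟨_, s2, _, hr1.seq hr2, le_rfl, bm.trans (am.trans hm), ?_⟩
  have hR2 := hR s2 b12 fun r hr hr' => breg r hr' (by omega) (by omega)
  refine (drawCoefs_runs hd hR2.d hR2.q (bm.trans (am.trans hm)) (bd.trans (ad.trans hdr))).mono le_rfl ?_
  rintro s3 ⟨creg, carr⟩
  refine ⟨hR2.congr fun r hr => creg r (by omega), ?_, ?_⟩
  · rw [creg 17 (by norm_num), breg 17 (by norm_num) (by norm_num) (by norm_num), a17, h17]
    rfl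
  · have : kept W m (conf n m k W A L).D (conf n m k W A L).B
        ((conf n m k W A L).lev fun i => ω (i, (conf n m k W A L).q - 1)) [] = fun _ => [] := by
      funext l
      simp [kept, recency, trunc, atLevel]
    change Rep _ _ _ (kept W m _ _ _ _) _ _
    rw [this]
    exact rep_empty carr

theorem noStore_init : (computeParams ;; findPrime).NoStore := by
  simp [Prog.NoStore, computeParams, findPrime, computeSize]

end Init

end KCover

namespace KCover

/-! ### Moments of sums of variables with limited independence -/

/-- The fibres of a surjective homomorphism are cosets of the kernel, all of the same size, so it
carries averages over `G` to averages over `H`. -/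
theorem card_mul_sum_comp {G H : Type*} [AddGroup G] [AddGroup H] [Fintype G] [Fintype H]
    (f : G →+ H) (hf : Function.Surjective f) (Φ : H → ℝ) :
    (Fintype.card H : ℝ) * ∑ a, Φ (f a) = Fintype.card G * ∑ b, Φ b := by
  classical
  have hfib : ∀ b, (Finset.univ.filter fun a => f a = b).card =
      (Finset.univ.filter fun a => f a = 0).card := fun b =>
    AddMonoidHom.card_fiber_eq_of_mem_range f (hf b) (hf 0)
  set c := (Finset.univ.filter fun a => f a = 0).card with hc
  have h1 : ∑ a, Φ (f a) = c * ∑ b, Φ b := by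
    rw [← Finset.sum_fiberwise Finset.univ f, Finset.mul_sum]
    refine Finset.sum_congr rfl fun b _ => ?_
    rw [Finset.sum_congr rfl (g := fun _ => Φ b) (by simp +contextual), Finset.sum_const, hfib b,
      nsmul_eq_mul]
  have h2 : Fintype.card G = c * Fintype.card H := by
    rw [← Finset.card_univ, Finset.card_eq_sum_card_fiberwise (f := f) (t := Finset.univ) (by simp)]
    simp [hfib, mul_comm]
  rw [h1, h2]
  push_cast
  ring

section Moments

variable {ι Z G : Type*} [Fintype ι] [DecidableEq ι] [AddCommGroup Z] [Fintype Z] [AddCommGroup G]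
  [Fintype G]

/-- Any `t` of the variables `T · e` are independent and uniformly distributed. -/
def LimitedIndep (T : G →+ (ι → Z)) (t : ℕ) : Prop :=
  ∀ S : Finset ι, S.card ≤ t → ∀ y : ι → Z, ∃ a, ∀ e ∈ S, T a e = y e

/-- A monomial of the expanded power involves at most `n ≤ t` coordinates. On these, the image of
`T` and the full product both project uniformly, so the two averages agree term by term. -/
theorem LimitedIndep.sum_pow {T : G →+ (ι → Z)} {t n : ℕ} (hT : LimitedIndep T t) (hn : n ≤ t)
    (f : ι → Z → ℝ) :
    (Fintype.card (ι → Z) : ℝ) * ∑ a, (∑ e, f e (T a e)) ^ n =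
      Fintype.card G * ∑ g : ι → Z, (∑ e, f e (g e)) ^ n := by
  simp only [Fintype.sum_pow]
  rw [Finset.sum_comm, Finset.sum_comm (s := Finset.univ (α := ι → Z)), Finset.mul_sum, Finset.mul_sum]
  refine Finset.sum_congr rfl fun s _ => ?_
  set S := Finset.univ.image s with hS
  have hsS : ∀ i, s i ∈ S := fun i => Finset.mem_image_of_mem _ (Finset.mem_univ i)
  let ρ : (ι → Z) →+ (S → Z) :=
    { toFun := fun g e => g e, map_zero' := rfl, map_add' := fun _ _ => rfl }
  set Φ : (S → Z) → ℝ := fun b => ∏ i, f (s i) (b ⟨s i, hsS i⟩) with hΦ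
  have hcard : S.card ≤ t := Finset.card_image_le.trans (by simpa using hn)
  have h1 := card_mul_sum_comp (ρ.comp T) (fun y => by
    obtain ⟨a, ha⟩ := hT S hcard fun e => if h : e ∈ S then y ⟨e, h⟩ else 0
    refine ⟨a, funext fun e => ?_⟩
    change T a e = y e
    rw [ha e e.2, dif_pos e.2]) Φ
  have h2 := card_mul_sum_comp ρ (fun y =>
    ⟨fun e => if h : e ∈ S then y ⟨e, h⟩ else 0, funext fun e => by
      change (if h : (e : ι) ∈ S then y ⟨e, h⟩ else 0) = y e
      rw [dif_pos e.2]⟩) Φ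
  have e1 : ∀ a, Φ ((ρ.comp T) a) = ∏ i, f (s i) (T a (s i)) := fun a => rfl
  have e2 : ∀ g, Φ (ρ g) = ∏ i, f (s i) (g (s i)) := fun g => rfl
  simp only [e1] at h1
  simp only [e2] at h2
  have hpos : (0 : ℝ) < Fintype.card (S → Z) := by exact_mod_cast Fintype.card_pos
  refine mul_left_cancel₀ hpos.ne' ?_
  calc _ = (Fintype.card (ι → Z) : ℝ) * ((Fintype.card (S → Z) : ℝ) * ∑ a, ∏ i, f (s i) (T a (s i))) := by
        ring
    _ = (Fintype.card G : ℝ) * ((Fintype.card (ι → Z) : ℝ) * ∑ b, Φ b) := by rw [h1]; ring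
    _ = _ := by rw [← h2]; ring

omit [AddCommGroup Z] in
-- Under full independence the exponential moment factorizes. Each factor is estimated by `exp x ≤ 1
-- + x + x ^ 2` for `|x| ≤ 1`, where the linear term averages to zero.
theorem sum_exp_le {f : ι → Z → ℝ} {v : ι → ℝ} {μ l : ℝ} (h0 : ∀ e, ∑ z, f e z = 0)
    (h1 : ∀ e z, |f e z| ≤ 1) (h2 : ∀ e, ∑ z, f e z ^ 2 ≤ Fintype.card Z * v e)
    (hv : ∑ e, v e ≤ μ) (hl : |l| ≤ 1) :
    ∑ g : ι → Z, Real.exp (l * ∑ e, f e (g e)) ≤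
      Fintype.card (ι → Z) * Real.exp (l ^ 2 * μ) := by
  have e1 : ∀ g : ι → Z, Real.exp (l * ∑ e, f e (g e)) = ∏ e, Real.exp (l * f e (g e)) := fun g => by
    rw [Finset.mul_sum, Real.exp_sum]
  simp only [e1]
  rw [← Fintype.piFinset_univ, ← Finset.prod_univ_sum (fun _ => Finset.univ)
    (fun e z => Real.exp (l * f e z))]
  have key : ∀ e, ∑ z, Real.exp (l * f e z) ≤ Fintype.card Z * Real.exp (l ^ 2 * v e) := by
    intro e
    calc ∑ z, Real.exp (l * f e z) ≤ ∑ z, (1 + l * f e z + l ^ 2 * f e z ^ 2) := by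
          refine Finset.sum_le_sum fun z _ => ?_
          have hx : |l * f e z| ≤ 1 := by
            rw [abs_mul]
            exact mul_le_one₀ hl (abs_nonneg _) (h1 e z)
          have := Real.abs_exp_sub_one_sub_id_le hx
          have := (abs_le.1 this).2
          nlinarith
      _ = Fintype.card Z + l ^ 2 * ∑ z, f e z ^ 2 := by
          rw [Finset.sum_add_distrib, Finset.sum_add_distrib, ← Finset.mul_sum, ← Finset.mul_sum, h0 e]
          simp
      _ ≤ Fintype.card Z + l ^ 2 * (Fintype.card Z * v e) := by
          have := mul_le_mul_of_nonneg_left (h2 e) (sq_nonneg l)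
          linarith
      _ = Fintype.card Z * (l ^ 2 * v e + 1) := by ring
      _ ≤ _ := mul_le_mul_of_nonneg_left (Real.add_one_le_exp _) (Nat.cast_nonneg _)
  calc ∏ e, ∑ z, Real.exp (l * f e z) ≤ ∏ e, (Fintype.card Z * Real.exp (l ^ 2 * v e)) :=
        Finset.prod_le_prod (fun e _ => Finset.sum_nonneg fun z _ => (Real.exp_pos _).le)
          fun e _ => key e
    _ = Fintype.card (ι → Z) * Real.exp (l ^ 2 * ∑ e, v e) := by
        rw [Finset.prod_mul_distrib, ← Real.exp_sum, Finset.mul_sum]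
        simp
    _ ≤ _ := by
        refine mul_le_mul_of_nonneg_left (Real.exp_le_exp.2 ?_) (Nat.cast_nonneg _)
        exact mul_le_mul_of_nonneg_left hv (sq_nonneg l)

theorem pow_le_exp_add_exp (r : ℕ) (x : ℝ) :
    x ^ (2 * r) ≤ (2 * r).factorial * (Real.exp x + Real.exp (-x)) := by
  have h1 : x ^ (2 * r) = |x| ^ (2 * r) := by rw [pow_mul, pow_mul, sq_abs]
  have h2 := Real.pow_div_factorial_le_exp |x| (abs_nonneg x) (2 * r)
  have h3 : Real.exp |x| ≤ Real.exp x + Real.exp (-x) := by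
    rcases abs_cases x with h | h
    · rw [h.1]; linarith [Real.exp_pos (-x)]
    · rw [h.1]; linarith [Real.exp_pos x]
  have hf : (0 : ℝ) < (2 * r).factorial := by exact_mod_cast Nat.factorial_pos _
  rw [div_le_iff₀ hf] at h2
  rw [h1]
  nlinarith

/-- An even power is bounded by its term in the exponential series. The scale `l = sqrt (r / μ)`
turns the exponent `l ^ 2 * μ` into `r`, and `r ≤ μ` ensures `l ≤ 1`. The constant `12` is the `4`
of `(2 * r)! ≤ (4 * r ^ 2) ^ r` times the `3` of `exp 1 ≤ 3`. -/
theorem sum_pow_le {f : ι → Z → ℝ} {v : ι → ℝ} {μ : ℝ} {r : ℕ} (h0 : ∀ e, ∑ z, f e z = 0)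
    (h1 : ∀ e z, |f e z| ≤ 1) (h2 : ∀ e, ∑ z, f e z ^ 2 ≤ Fintype.card Z * v e)
    (hv : ∑ e, v e ≤ μ) (hr : 1 ≤ r) (hμ : (r : ℝ) ≤ μ) :
    ∑ g : ι → Z, (∑ e, f e (g e)) ^ (2 * r) ≤
      Fintype.card (ι → Z) * (2 * (12 * r * μ) ^ r) := by
  have hr0 : (0 : ℝ) < r := by exact_mod_cast hr
  have hμ0 : 0 < μ := hr0.trans_le hμ
  set l := Real.sqrt (r / μ) with hl
  have hl2 : l ^ 2 = r / μ := Real.sq_sqrt (by positivity)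
  have hl0 : 0 < l := Real.sqrt_pos.2 (by positivity)
  have hl1 : l ≤ 1 := Real.sqrt_le_one.2 ((div_le_one hμ0).2 hμ)
  have hlμ : l ^ 2 * μ = r := by rw [hl2]; field_simp
  have hsum : ∑ g : ι → Z, (l * ∑ e, f e (g e)) ^ (2 * r) ≤
      (2 * r).factorial * (2 * (Fintype.card (ι → Z) * Real.exp r)) := by
    calc _ ≤ ∑ g : ι → Z, ((2 * r).factorial : ℝ) * (Real.exp (l * ∑ e, f e (g e)) +
          Real.exp (-l * ∑ e, f e (g e))) := by
          refine Finset.sum_le_sum fun g _ => ?_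
          rw [neg_mul]
          exact pow_le_exp_add_exp r _
      _ = (2 * r).factorial * (∑ g : ι → Z, Real.exp (l * ∑ e, f e (g e)) +
          ∑ g : ι → Z, Real.exp (-l * ∑ e, f e (g e))) := by
          rw [← Finset.mul_sum, Finset.sum_add_distrib]
      _ ≤ _ := by
          refine mul_le_mul_of_nonneg_left ?_ (Nat.cast_nonneg _)
          have a1 := sum_exp_le h0 h1 h2 hv (l := l) (by rwa [abs_of_pos hl0])
          have a2 := sum_exp_le h0 h1 h2 hv (l := -l) (by rwa [abs_neg, abs_of_pos hl0])
          rw [neg_sq] at a2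
          rw [hlμ] at a1 a2
          linarith
  simp only [mul_pow] at hsum
  rw [← Finset.mul_sum, pow_mul, hl2] at hsum
  have hfac : ((2 * r).factorial : ℝ) ≤ (4 * (r : ℝ) ^ 2) ^ r := by
    have : ((2 * r).factorial : ℝ) ≤ ((2 * r : ℕ) : ℝ) ^ (2 * r) := by
      exact_mod_cast Nat.factorial_le_pow (2 * r)
    refine this.trans (le_of_eq ?_)
    push_cast
    rw [pow_mul]
    ring
  have hexp : Real.exp r ≤ 3 ^ r := by
    rw [← Real.exp_one_pow]
    exact pow_le_pow_left₀ (Real.exp_pos _).le (by linarith [Real.exp_one_lt_d9]) r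
  have hrm : (0 : ℝ) < (r / μ) ^ r := by positivity
  refine le_of_mul_le_mul_left (hsum.trans ?_) hrm
  calc ((2 * r).factorial : ℝ) * (2 * (Fintype.card (ι → Z) * Real.exp r)) ≤
      (4 * (r : ℝ) ^ 2) ^ r * (2 * (Fintype.card (ι → Z) * 3 ^ r)) := by gcongr
    _ = Fintype.card (ι → Z) * 2 * (12 * (r : ℝ) ^ 2) ^ r := by
        rw [show (12 * (r : ℝ) ^ 2) = 4 * (r : ℝ) ^ 2 * 3 by ring, mul_pow _ 3]
        ring
    _ = (r / μ) ^ r * (Fintype.card (ι → Z) * (2 * (12 * r * μ) ^ r)) := by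
        have : (r / μ) ^ r * (12 * r * μ) ^ r = (12 * (r : ℝ) ^ 2) ^ r := by
          rw [← mul_pow]
          congr 1
          field_simp
        rw [← this]
        ring

/-- Markov's inequality for the power `2 * r`, after passing from limited to full independence. -/
theorem LimitedIndep.card_le {T : G →+ (ι → Z)} {r : ℕ} (hT : LimitedIndep T (2 * r))
    {f : ι → Z → ℝ} {v : ι → ℝ} {μ τ : ℝ} (h0 : ∀ e, ∑ z, f e z = 0)
    (h1 : ∀ e z, |f e z| ≤ 1) (h2 : ∀ e, ∑ z, f e z ^ 2 ≤ Fintype.card Z * v e)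
    (hv : ∑ e, v e ≤ μ) (hr : 1 ≤ r) (hμ : (r : ℝ) ≤ μ) (hτ : 0 < τ) :
    ((Finset.univ.filter fun a => τ < |∑ e, f e (T a e)|).card : ℝ) ≤
      Fintype.card G * (2 * (12 * r * μ / τ ^ 2) ^ r) := by
  have hcp : (0 : ℝ) < Fintype.card (ι → Z) := by exact_mod_cast Fintype.card_pos
  have hle : ∑ a, (∑ e, f e (T a e)) ^ (2 * r) ≤ Fintype.card G * (2 * (12 * r * μ) ^ r) := by
    refine le_of_mul_le_mul_left ?_ hcp
    rw [hT.sum_pow le_rfl]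
    have := mul_le_mul_of_nonneg_left (sum_pow_le h0 h1 h2 hv hr hμ) (Nat.cast_nonneg (Fintype.card G))
    linarith
  have hτr : (0 : ℝ) < (τ ^ 2) ^ r := by positivity
  have hlow : ((Finset.univ.filter fun a => τ < |∑ e, f e (T a e)|).card : ℝ) * (τ ^ 2) ^ r ≤
      ∑ a, (∑ e, f e (T a e)) ^ (2 * r) := by
    rw [← nsmul_eq_mul, ← Finset.sum_const]
    refine (Finset.sum_le_sum fun a ha => ?_).trans (Finset.sum_le_sum_of_subset_of_nonneg
      (Finset.filter_subset _ _) fun a _ _ => ?_)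
    · rw [pow_mul]
      refine pow_le_pow_left₀ (sq_nonneg _) ?_ r
      rw [← sq_abs (∑ e, f e (T a e))]
      exact pow_le_pow_left₀ hτ.le (Finset.mem_filter.1 ha).2.le 2
    · rw [pow_mul]
      positivity
  refine le_of_mul_le_mul_right ((hlow.trans hle).trans (le_of_eq ?_)) hτr
  rw [div_pow]
  field_simp

end Moments

end KCover

namespace KCover

open WordRAM

/-! ### The hash function -/

/-- Horner's scheme reads the leading coefficient first, whence the exponent `d - 1 - j`. -/
theorem natCast_hashVal (q d : ℕ) (co : ℕ → ℕ) (e : ℕ) :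
    (hashVal q d co e : ZMod q) = ∑ j : Fin d, (co j : ZMod q) * (e : ZMod q) ^ (d - 1 - j) := by
  induction d with
  | zero => simp [hashVal]
  | succ d ih =>
    rw [hashVal_succ, ZMod.natCast_mod, Nat.cast_add, Nat.cast_mul, ih, Fin.sum_univ_castSucc,
      Finset.sum_mul]
    congr 1
    · refine Finset.sum_congr rfl fun j _ => ?_
      have : d + 1 - 1 - (j.castSucc : ℕ) = d - 1 - j + 1 := by
        simp only [Fin.val_castSucc]
        omega
      rw [this, pow_succ, Fin.val_castSucc]
      ring
    · simp

/-- The hash values as a function of the coefficients. -/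
def hashHom (q d m : ℕ) : (Fin d → ZMod q) →+ (Fin m → ZMod q) where
  toFun c e := ∑ j, c j * (e : ZMod q) ^ (d - 1 - j)
  map_zero' := by funext e; simp
  map_add' a b := by funext e; simp [add_mul, Finset.sum_add_distrib]

/-- Lagrange interpolation: values at `d` distinct points are attained by a polynomial of degree
less than `d`. The elements stay distinct modulo `q` because `m ≤ q`. -/
theorem limitedIndep_hashHom {q d m : ℕ} [Fact q.Prime] (hm : m ≤ q) :
    LimitedIndep (hashHom q d m) d := by
  intro S hS y
  have hinj : Set.InjOn (fun e : Fin m => (e : ZMod q)) S := by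
    intro a _ b _ hab
    have := (ZMod.natCast_eq_natCast_iff' _ _ _).1 hab
    rw [Nat.mod_eq_of_lt (by omega), Nat.mod_eq_of_lt (by omega)] at this
    exact Fin.ext this
  set p := Lagrange.interpolate S (fun e : Fin m => (e : ZMod q)) y with hp
  have hdeg : p.degree < d := (Lagrange.degree_interpolate_lt _ hinj).trans_le (by exact_mod_cast hS)
  refine ⟨fun j => p.coeff (d - 1 - j), fun e he => ?_⟩
  rw [← Lagrange.eval_interpolate_at_node y hinj he, ← hp]
  have hd : 0 < d := (Finset.card_pos.2 ⟨e, he⟩).trans_le hS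
  have hnat : p.natDegree < d := by
    by_cases h0 : p = 0
    · simpa [h0] using hd
    · exact (Polynomial.natDegree_lt_iff_degree_lt h0).2 hdeg
  rw [Polynomial.eval_eq_sum_range' hnat, ← Finset.sum_range_reflect]
  exact Fin.sum_univ_eq_sum_range (fun j => p.coeff (d - 1 - j) * (e : ZMod q) ^ (d - 1 - j)) d

/-- The indicator of the elements with hash value less than `θ`, minus the probability of this
event. -/
noncomputable def deviation {q : ℕ} (θ : ℕ) (z : ZMod q) : ℝ :=
  (if z.val < θ then 1 else 0) - (θ : ℝ) / q

theorem card_val_lt {q θ : ℕ} [NeZero q] (h : θ ≤ q) :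
    (Finset.univ.filter fun z : ZMod q => z.val < θ).card = θ := by
  conv_rhs => rw [← Finset.card_range θ]
  refine Finset.card_bij (fun z _ => z.val) (fun z hz => by simpa using hz)
    (fun a _ b _ hab => ZMod.val_injective q hab) fun i hi => ?_
  rw [Finset.mem_range] at hi
  exact ⟨(i : ZMod q), by simpa [ZMod.val_natCast_of_lt (hi.trans_le h)] using hi,
    ZMod.val_natCast_of_lt (hi.trans_le h)⟩

/-- An indicator of probability `p = θ / q` has variance `p * (1 - p) ≤ p`, and a weight in `[0, 1]`
dominates its square. So the total variance is at most the expected weight of the sample, hence at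
most `μ`. -/
theorem card_deviation_le {q d m r θ : ℕ} [Fact q.Prime] (hm : m ≤ q) (hθ : θ ≤ q) (hd : d = 2 * r)
    {a : Fin m → ℝ} (ha0 : ∀ e, 0 ≤ a e) (ha1 : ∀ e, a e ≤ 1) {μ τ : ℝ}
    (hμ : (θ : ℝ) / q * ∑ e, a e ≤ μ) (hr : 1 ≤ r) (hrμ : (r : ℝ) ≤ μ) (hτ : 0 < τ) :
    ((Finset.univ.filter fun c : Fin d → ZMod q =>
      τ < |∑ e, a e * deviation θ (hashHom q d m c e)|).card : ℝ) ≤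
      (q : ℝ) ^ d * (2 * (12 * r * μ / τ ^ 2) ^ r) := by
  subst hd
  have hq0 : (0 : ℝ) < q := by exact_mod_cast (Fact.out : q.Prime).pos
  set p : ℝ := (θ : ℝ) / q with hp
  have hp0 : 0 ≤ p := by positivity
  have hp1 : p ≤ 1 := (div_le_one hq0).2 (by exact_mod_cast hθ)
  have hind : ∑ z : ZMod q, (if z.val < θ then (1 : ℝ) else 0) = θ := by
    rw [Finset.sum_boole, card_val_lt hθ]
  have hpq : p * q = θ := by rw [hp]; field_simp
  have hdev : ∀ z : ZMod q, |deviation θ z| ≤ 1 := by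
    intro z
    unfold deviation
    rw [← hp]
    split_ifs <;> rw [abs_le] <;> constructor <;> linarith
  have h := (limitedIndep_hashHom (d := 2 * r) hm).card_le (r := r)
    (f := fun e z => a e * deviation θ z) (v := fun e => a e * p) (μ := μ) (τ := τ)
    (fun e => ?_) (fun e z => ?_) (fun e => ?_) ?_ hr hrμ hτ
  · simpa [ZMod.card] using h
  · rw [← Finset.mul_sum]
    simp only [deviation, Finset.sum_sub_distrib, hind]
    simp [ZMod.card, ← hp, mul_comm (q : ℝ) p, hpq]
  · rw [abs_mul, abs_of_nonneg (ha0 e)]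
    exact mul_le_one₀ (ha1 e) (abs_nonneg _) (hdev z)
  · have hsq : ∀ z : ZMod q, deviation θ z ^ 2 =
        (1 - 2 * p) * (if z.val < θ then (1 : ℝ) else 0) + p ^ 2 := by
      intro z
      unfold deviation
      rw [← hp]
      split_ifs <;> ring
    simp only [mul_pow]
    rw [← Finset.mul_sum]
    simp only [hsq, Finset.sum_add_distrib]
    rw [← Finset.mul_sum, hind]
    simp only [Finset.sum_const, Finset.card_univ, ZMod.card, nsmul_eq_mul]
    rw [← hpq]
    have e1 : (1 - 2 * p) * (p * q) + q * p ^ 2 = q * (p * (1 - p)) := by ring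
    rw [e1]
    have e2 : a e ^ 2 ≤ a e := by nlinarith [ha0 e, ha1 e]
    have e3 : p * (1 - p) ≤ p := by nlinarith
    calc a e ^ 2 * (q * (p * (1 - p))) ≤ a e * (q * p) := by
          have : 0 ≤ p * (1 - p) := mul_nonneg hp0 (by linarith)
          have h0 := ha0 e
          gcongr
      _ = q * (a e * p) := by ring
  · rw [← Finset.sum_mul, mul_comm]
    exact hμ

/-! ### The probability of an event -/

/-- Each vector of coefficients is a cylinder event in `d` coordinates of the product measure;
summing over the bad vectors turns probability into counting. -/
theorem coinMeasure_le (d b : ℕ) (Bad : Finset (Fin d → Fin (b + 1))) :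
    coinMeasure {ω | (fun j : Fin d => ω (j, b)) ∈ Bad} ≤
      ENNReal.ofReal ((Bad.card : ℝ) / (b + 1 : ℝ) ^ d) := by
  classical
  have hcyl : ∀ c : Fin d → Fin (b + 1), coinMeasure {ω | (fun j : Fin d => ω (j, b)) = c} =
      ENNReal.ofReal (1 / (b + 1 : ℝ) ^ d) := by
    intro c
    set s : Finset (ℕ × ℕ) := Finset.univ.image fun j : Fin d => ((j : ℕ), b) with hs
    set t : (i : ℕ × ℕ) → Set (Fin (i.2 + 1)) := fun i =>
      {x | ∀ h : i.1 < d, (x : ℕ) = c ⟨i.1, h⟩} with ht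
    have hset : {ω : Coins | (fun j : Fin d => ω (j, b)) = c} = Set.pi s t := by
      ext ω
      simp only [Set.mem_ofPred_eq, Set.mem_pi, hs, ht, Finset.coe_image, Finset.coe_univ,
        Set.image_univ, Set.mem_range, forall_exists_index, forall_apply_eq_imp_iff]
      constructor
      · intro h j _
        rw [← h]
      · intro h
        funext j
        exact Fin.ext (h j j.2)
    have hinst : ∀ i : ℕ × ℕ, IsProbabilityMeasure
        ((PMF.uniformOfFintype (Fin (i.2 + 1))).toMeasure) := fun i => inferInstance
    rw [hset, coinMeasure, Measure.infinitePi_pi _ (fun i _ => MeasurableSet.of_discrete),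
      hs, Finset.prod_image (fun a _ b _ h => Fin.ext (Prod.ext_iff.1 h).1)]
    have hone : ∀ j : Fin d, (PMF.uniformOfFintype (Fin (b + 1))).toMeasure (t ((j : ℕ), b)) =
        ENNReal.ofReal (1 / (b + 1 : ℝ)) := by
      intro j
      have : t ((j : ℕ), b) = {c j} := by
        ext x
        simp only [ht, Set.mem_ofPred_eq, Set.mem_singleton_iff]
        constructor
        · intro h
          exact Fin.ext (h j.2)
        · rintro rfl _
          rfl
      rw [this, PMF.toMeasure_apply_singleton _ _ (MeasurableSet.singleton _),
        PMF.uniformOfFintype_apply, Fintype.card_fin, one_div, ENNReal.ofReal_inv_of_pos (by positivity)]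
      congr 1
      rw [ENNReal.ofReal_add (by positivity) (by norm_num)]
      simp
    rw [Finset.prod_congr rfl fun j _ => hone j, Finset.prod_const, Finset.card_univ,
      Fintype.card_fin, ← ENNReal.ofReal_pow (by positivity), one_div, one_div, inv_pow]
  have hU : {ω : Coins | (fun j : Fin d => ω (j, b)) ∈ Bad} =
      ⋃ c ∈ Bad, {ω | (fun j : Fin d => ω (j, b)) = c} := by
    ext ω
    simp
  rw [hU]
  refine (measure_biUnion_finset_le _ _).trans ?_
  rw [Finset.sum_congr rfl fun c _ => hcyl c, Finset.sum_const, nsmul_eq_mul,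
    ← ENNReal.ofReal_natCast, ← ENNReal.ofReal_mul (Nat.cast_nonneg _)]
  exact ENNReal.ofReal_le_ofReal (by rw [mul_one_div])

end KCover

namespace KCover

/-! ### Coverage -/

section Coverage

variable {n m : ℕ} {G G' : Finset (Fin n × Fin m)} {P P' : Finset (Fin n)} {k : ℕ}

/-- The elements that belong to a set in `P`. -/
def covered (G : Finset (Fin n × Fin m)) (P : Finset (Fin n)) : Finset (Fin m) :=
  (G.filter fun x => x.1 ∈ P).image Prod.snd

/-- The sets to which the element `e` belongs. -/
def setsOf (G : Finset (Fin n × Fin m)) (e : Fin m) : Finset (Fin n) :=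
  Finset.univ.filter fun S => (S, e) ∈ G

theorem card_covered : (covered G P).card = coverage G P := rfl

theorem mem_covered {e : Fin m} : e ∈ covered G P ↔ ∃ S ∈ P, (S, e) ∈ G := by
  simp only [covered, Finset.mem_image, Finset.mem_filter, Prod.exists, exists_eq_right]
  exact exists_congr fun S => and_comm

theorem mem_setsOf {S : Fin n} {e : Fin m} : S ∈ setsOf G e ↔ (S, e) ∈ G := by simp [setsOf]

theorem covered_mono (h : P ⊆ P') : covered G P ⊆ covered G P' := fun e he => by
  obtain ⟨S, hS, h'⟩ := mem_covered.1 he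
  exact mem_covered.2 ⟨S, h hS, h'⟩

theorem coverage_mono (h : P ⊆ P') : coverage G P ≤ coverage G P' :=
  Finset.card_le_card (covered_mono h)

theorem coverage_mono_left (h : G' ⊆ G) : coverage G' P ≤ coverage G P :=
  Finset.card_le_card fun e he => by
    obtain ⟨S, hS, h'⟩ := mem_covered.1 he
    exact mem_covered.2 ⟨S, hS, h h'⟩

theorem coverage_le_opt (hk : k ≤ n) (hP : P.card ≤ k) : coverage G P ≤ opt k G := by
  obtain ⟨Q, hPQ, -, hQ⟩ := Finset.exists_subsuperset_card_eq (Finset.subset_univ P) hP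
    (by simpa using hk)
  exact (coverage_mono hPQ).trans (Finset.le_sup (f := coverage G)
    (Finset.mem_powersetCard.2 ⟨Finset.subset_univ _, hQ⟩))

theorem exists_coverage_eq_opt (G : Finset (Fin n × Fin m)) (hk : k ≤ n) :
    ∃ P : Finset (Fin n), P.card = k ∧ coverage G P = opt k G := by
  obtain ⟨P, hP, h⟩ := Finset.exists_mem_eq_sup ((Finset.univ : Finset (Fin n)).powersetCard k)
    (Finset.powersetCard_nonempty.2 (by simpa using hk)) (coverage G)
  exact ⟨P, (Finset.mem_powersetCard.1 hP).2, h.symm⟩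

theorem card_tuples_avoiding (D : Finset (Fin n)) (s : ℕ) :
    (Finset.univ.filter fun f : Fin s → Fin n => ∀ i, f i ∉ D).card = (n - D.card) ^ s := by
  have : (Finset.univ.filter fun f : Fin s → Fin n => ∀ i, f i ∉ D) =
      Fintype.piFinset fun _ => Dᶜ := by
    ext f
    simp [Fintype.mem_piFinset]
  rw [this, Fintype.card_piFinset_const, Finset.card_compl, Fintype.card_fin]

theorem mem_covered_image {s : ℕ} {f : Fin s → Fin n} {e : Fin m} :
    e ∈ covered G (Finset.univ.image f) ↔ ¬ ∀ i, f i ∉ setsOf G e := by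
  simp [mem_covered, mem_setsOf]

/-- From `(1 - x) * (1 + x) ≤ 1` and Bernoulli's inequality, `(1 - x) ^ k ≤ 1 / (1 + k * x)`; and `t
/ (1 + t)` is at least half of `min 1 t`. -/
theorem half_min_le {x : ℝ} (hx0 : 0 ≤ x) (hx1 : x ≤ 1) (k : ℕ) :
    min 1 (k * x) / 2 ≤ 1 - (1 - x) ^ k := by
  have h1 : 1 + k * x ≤ (1 + x) ^ k := one_add_mul_le_pow (by linarith) k
  have h2 : (1 - x) ^ k * (1 + x) ^ k ≤ 1 := by
    rw [← mul_pow]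
    exact pow_le_one₀ (by nlinarith) (by nlinarith)
  have h3 : 0 ≤ (1 - x) ^ k := pow_nonneg (by linarith) k
  have h4 : (1 - x) ^ k * (1 + k * x) ≤ 1 := (mul_le_mul_of_nonneg_left h1 h3).trans h2
  have h5 : 0 ≤ (k : ℝ) * x := by positivity
  rcases le_total 1 ((k : ℝ) * x) with h | h
  · rw [min_eq_left h]
    nlinarith
  · rw [min_eq_right h]
    nlinarith

/-- The total capped degree is at most twice the optimal coverage. -/
theorem sum_min_le_two_mul_opt (hk : k ≤ n) (hn : 0 < n) (G : Finset (Fin n × Fin m)) :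
    ∑ e, min 1 ((k : ℝ) * ((setsOf G e).card / n)) ≤ 2 * opt k G := by
  have hn' : (0 : ℝ) < n := by exact_mod_cast hn
  -- A uniformly random `k`-tuple of sets misses an element with probability `(1 - deg / n) ^ k`,
  -- and no tuple covers more than the optimum. Double counting of elements and tuples compares the
  -- two.
  have hcount : ∀ e, ((Finset.univ.filter fun f : Fin k → Fin n =>
      e ∈ covered G (Finset.univ.image f)).card : ℝ) =
      (n : ℝ) ^ k * (1 - (1 - (setsOf G e).card / n) ^ k) := by
    intro e
    have h1 := Finset.card_filter_add_card_filter_not (s := (Finset.univ : Finset (Fin k → Fin n)))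
      (fun f => ∀ i, f i ∉ setsOf G e)
    rw [card_tuples_avoiding] at h1
    simp only [mem_covered_image]
    have hD : (setsOf G e).card ≤ n := by simpa using Finset.card_le_univ (setsOf G e)
    have h2 : (((n - (setsOf G e).card) ^ k : ℕ) : ℝ) = (n : ℝ) ^ k * (1 - (setsOf G e).card / n) ^ k := by
      rw [← mul_pow]
      push_cast [Nat.cast_sub hD]
      congr 1
      field_simp
    have h3 : (Finset.univ : Finset (Fin k → Fin n)).card = n ^ k := by simp
    have h4 : (((n - (setsOf G e).card) ^ k : ℕ) : ℝ) + ((Finset.univ.filter fun f : Fin k → Fin n =>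
        ¬ ∀ i, f i ∉ setsOf G e).card : ℝ) = (n : ℝ) ^ k := by
      rw [h3] at h1
      exact_mod_cast h1
    rw [h2] at h4
    linarith
  have hsum : ∑ e, (n : ℝ) ^ k * (1 - (1 - (setsOf G e).card / n) ^ k) ≤ (n : ℝ) ^ k * opt k G := by
    simp only [← hcount]
    have hsw := Finset.sum_card_bipartiteAbove_eq_sum_card_bipartiteBelow
      (s := (Finset.univ : Finset (Fin m))) (t := (Finset.univ : Finset (Fin k → Fin n)))
      (fun e f => e ∈ covered G (Finset.univ.image f))
    simp only [Finset.bipartiteAbove, Finset.bipartiteBelow] at hsw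
    rw [← Nat.cast_sum, hsw]
    have : ∑ f : Fin k → Fin n, (Finset.univ.filter fun e =>
        e ∈ covered G (Finset.univ.image f)).card ≤ n ^ k * opt k G := by
      refine (Finset.sum_le_card_nsmul _ _ (opt k G) fun f _ => ?_).trans (by simp)
      rw [Finset.filter_mem_eq_inter, Finset.univ_inter, card_covered]
      exact coverage_le_opt hk (Finset.card_image_le.trans (by simp))
    exact_mod_cast this
  rw [← Finset.mul_sum] at hsum
  have h2 := le_of_mul_le_mul_left hsum (by positivity)
  have h3 : ∑ e, min 1 ((k : ℝ) * ((setsOf G e).card / n)) / 2 ≤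
      ∑ e, (1 - (1 - ((setsOf G e).card : ℝ) / n) ^ k) := by
    refine Finset.sum_le_sum fun e _ => half_min_le (by positivity) ((div_le_one hn').2 ?_) k
    exact_mod_cast (by simpa using Finset.card_le_univ (setsOf G e) : (setsOf G e).card ≤ n)
  rw [← Finset.sum_div] at h3
  linarith

/-- Removing a set loses the elements that it alone covers. These losses are disjoint for different
sets, so some set loses at most the average. -/
theorem exists_erase_coverage (hP : P.Nonempty) :
    ∃ S ∈ P, (P.card - 1) * coverage G P ≤ P.card * coverage G (P.erase S) := by
  by_contra! hcon
  have h1 : ∑ S ∈ P, (covered G P \ covered G (P.erase S)).card ≤ coverage G P := by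
    rw [← Finset.card_biUnion, ← card_covered]
    · refine Finset.card_le_card fun e he => ?_
      obtain ⟨S, -, hS⟩ := Finset.mem_biUnion.1 he
      exact (Finset.mem_sdiff.1 hS).1
    · intro S hS S' hS' hne
      rw [Function.onFun, Finset.disjoint_left]
      intro e he he'
      obtain ⟨h1, h2⟩ := Finset.mem_sdiff.1 he
      obtain ⟨S₀, hS₀, hG⟩ := mem_covered.1 h1
      have h3 := (Finset.mem_sdiff.1 he').2
      by_cases h : S₀ = S
      · exact h3 (mem_covered.2 ⟨S₀, Finset.mem_erase.2 ⟨fun e' => hne (h ▸ e'), hS₀⟩, hG⟩)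
      · exact h2 (mem_covered.2 ⟨S₀, Finset.mem_erase.2 ⟨h, hS₀⟩, hG⟩)
  have h2 : ∀ S ∈ P, (covered G P \ covered G (P.erase S)).card + coverage G (P.erase S) =
      coverage G P := fun S _ =>
    Finset.card_sdiff_add_card_eq_card (covered_mono (Finset.erase_subset _ _))
  have hc : 0 < P.card := Finset.card_pos.2 hP
  have h3 : ∑ S ∈ P, coverage G P < ∑ S ∈ P, P.card * (covered G P \ covered G (P.erase S)).card := by
    refine Finset.sum_lt_sum_of_nonempty hP fun S hS => ?_
    have h4 := hcon S hS
    have h5 := h2 S hS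
    have h6 : (P.card - 1) * coverage G P + coverage G P = P.card * coverage G P := by
      rw [← Nat.succ_mul]
      congr 1
      omega
    have h7 : P.card * (covered G P \ covered G (P.erase S)).card + P.card * coverage G (P.erase S) =
        P.card * coverage G P := by rw [← mul_add, h5]
    omega
  rw [← Finset.mul_sum, Finset.sum_const, smul_eq_mul] at h3
  exact absurd (Nat.mul_le_mul_left P.card h1) (not_le.2 h3)

theorem exists_subset_coverage (G : Finset (Fin n × Fin m)) (P : Finset (Fin n)) {j : ℕ}
    (hj : j ≤ P.card) : ∃ Q ⊆ P, Q.card = j ∧ j * coverage G P ≤ P.card * coverage G Q := by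
  induction h : P.card - j generalizing j with
  | zero => exact ⟨P, Finset.Subset.refl P, by omega, by rw [show j = P.card by omega]⟩
  | succ t ih =>
    obtain ⟨Q, hQP, hQ, hcov⟩ := ih (j := j + 1) (by omega) (by omega)
    obtain ⟨S, hS, hle⟩ := exists_erase_coverage (G := G) (Finset.card_pos.1 (by omega) : Q.Nonempty)
    refine ⟨Q.erase S, (Finset.erase_subset _ _).trans hQP, by rw [Finset.card_erase_of_mem hS]; omega, ?_⟩
    rw [hQ, Nat.add_sub_cancel] at hle
    have h1 : (j + 1) * (j * coverage G P) ≤ (j + 1) * (P.card * coverage G (Q.erase S)) := by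
      calc (j + 1) * (j * coverage G P) = j * ((j + 1) * coverage G P) := by ring
        _ ≤ j * (P.card * coverage G Q) := Nat.mul_le_mul_left _ hcov
        _ = P.card * (j * coverage G Q) := by ring
        _ ≤ P.card * ((j + 1) * coverage G (Q.erase S)) := Nat.mul_le_mul_left _ hle
        _ = _ := by ring
    exact Nat.le_of_mul_le_mul_left h1 (Nat.succ_pos j)

/-- The first moment method: on average over all `s`-tuples at most a `δ` fraction of `T` is missed.
-/
theorem exists_tuple_covering (T : Finset (Fin m)) {s : ℕ} {δ : ℝ} (hn : 0 < n)
    (hT : ∀ e ∈ T, (1 - ((setsOf G e).card : ℝ) / n) ^ s ≤ δ) :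
    ∃ f : Fin s → Fin n, ((T \ covered G (Finset.univ.image f)).card : ℝ) ≤ δ * T.card := by
  have hn' : (0 : ℝ) < n := by exact_mod_cast hn
  have hsw := Finset.sum_card_bipartiteAbove_eq_sum_card_bipartiteBelow
    (s := T) (t := (Finset.univ : Finset (Fin s → Fin n)))
    (fun e f => ∀ i, f i ∉ setsOf G e)
  simp only [Finset.bipartiteAbove, Finset.bipartiteBelow, card_tuples_avoiding] at hsw
  have h1 : ((∑ e ∈ T, (n - (setsOf G e).card) ^ s : ℕ) : ℝ) ≤ (n : ℝ) ^ s * (δ * T.card) := by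
    push_cast
    calc ∑ e ∈ T, ((n - (setsOf G e).card : ℕ) : ℝ) ^ s ≤ ∑ e ∈ T, (n : ℝ) ^ s * δ := by
          refine Finset.sum_le_sum fun e he => ?_
          have hD : (setsOf G e).card ≤ n := by simpa using Finset.card_le_univ (setsOf G e)
          refine le_trans (le_of_eq ?_) (mul_le_mul_of_nonneg_left (hT e he) (by positivity))
          rw [← mul_pow]
          push_cast [Nat.cast_sub hD]
          congr 1
          field_simp
      _ = _ := by rw [Finset.sum_const, nsmul_eq_mul]; ring
  by_contra! hcon
  have : Nonempty (Fin s → Fin n) := ⟨fun _ => ⟨0, hn⟩⟩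
  have h2 : ∑ f : Fin s → Fin n, δ * T.card <
      ∑ f : Fin s → Fin n, ((T \ covered G (Finset.univ.image f)).card : ℝ) :=
    Finset.sum_lt_sum_of_nonempty Finset.univ_nonempty fun f _ => hcon f
  have h3 : ∀ f : Fin s → Fin n, T.filter (fun e => ∀ i, f i ∉ setsOf G e) =
      T \ covered G (Finset.univ.image f) := by
    intro f
    ext e
    rw [Finset.mem_filter, Finset.mem_sdiff, mem_covered_image, not_not]
  simp only [h3] at hsw
  rw [Finset.sum_const, Finset.card_univ, Fintype.card_fun, Fintype.card_fin, Fintype.card_fin,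
    nsmul_eq_mul, ← Nat.cast_sum, ← hsw] at h2
  push_cast at h2 h1
  linarith

/-- Dropping all but `D` of the edges of each element costs little. -/
theorem exists_coverage_truncated {A D : ℕ} (hk : 1 ≤ k) (hkn : k ≤ n) (hA : 1 ≤ A) (hsub : G' ⊆ G)
    (hdeg : ∀ e, min (setsOf G e).card D ≤ (setsOf G' e).card)
    (hD : (n : ℝ) * (16 * A * (A.size + 3)) / k ≤ D) :
    ∃ P : Finset (Fin n), P.card ≤ k ∧ (1 - 1 / (4 * A : ℝ)) * opt k G ≤ coverage G' P := by
  have hn : 0 < n := by omega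
  have hn' : (0 : ℝ) < n := by exact_mod_cast hn
  have hk' : (0 : ℝ) < k := by exact_mod_cast hk
  have hA' : (1 : ℝ) ≤ A := by exact_mod_cast hA
  obtain ⟨O, hO, hopt⟩ := exists_coverage_eq_opt G hkn
  have hfull : ∀ e, (setsOf G e).card ≤ D → setsOf G' e = setsOf G e := fun e he => by
    refine Finset.eq_of_subset_of_card_le (fun S hS => mem_setsOf.2 (hsub (mem_setsOf.1 hS))) ?_
    have := hdeg e
    rwa [min_eq_left he] at this
  -- The number of sets given up. If it is `0`, then `k < 8 * A` and `D` is at least `n`, so nothing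
  -- was truncated.
  set s := k / (8 * A) with hs
  rcases Nat.eq_zero_or_pos s with h0 | hpos
  · have hk8 : k < 8 * A := by
      rcases (Nat.div_eq_zero_iff).1 h0 with h | h <;> omega
    have hDn : n ≤ D := by
      have : (n : ℝ) ≤ D := by
        refine le_trans ?_ hD
        rw [le_div_iff₀ hk']
        have h1 : (k : ℝ) ≤ 8 * A := by exact_mod_cast hk8.le
        have h2 : (0 : ℝ) ≤ A.size := Nat.cast_nonneg _
        refine mul_le_mul_of_nonneg_left ?_ hn'.le
        nlinarith
      exact_mod_cast this
    refine ⟨O, hO.le, ?_⟩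
    have : coverage G' O = coverage G O := by
      refine le_antisymm (coverage_mono_left hsub) (Finset.card_le_card fun e he => ?_)
      obtain ⟨S, hS, hG⟩ := mem_covered.1 he
      refine mem_covered.2 ⟨S, hS, mem_setsOf.1 ?_⟩
      rw [hfull e]
      · exact mem_setsOf.2 hG
      · exact le_trans (by simpa using Finset.card_le_univ (setsOf G e)) hDn
    rw [this, hopt]
    have : 0 ≤ 1 / (4 * A : ℝ) * opt k G := by positivity
    linarith
  · have hs1 : s * (8 * A) ≤ k := Nat.div_mul_le_self k (8 * A)
    have hs2 : k < 16 * A * s := by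
      have h1 : k < 8 * A * (s + 1) := Nat.lt_mul_div_succ k (by omega)
      nlinarith
    have hsk : s ≤ k := Nat.div_le_self _ _
    obtain ⟨Q, hQO, hQ, hcov⟩ := exists_subset_coverage G O (j := k - s) (by omega)
    rw [hO, hopt] at hcov
    set T := (covered G Q).filter fun e => D < (setsOf G e).card with hT
    -- Elements that lost edges still have at least `D` of them. The choice of `D` makes `s * D / n`
    -- at least `A.size + 3`, so `s` random sets miss such an element with probability at most `exp
    -- (-(A.size + 3)) ≤ 1 / (8 * A)`.
    obtain ⟨f, hf⟩ := exists_tuple_covering (G := G') T (s := s) (δ := 1 / (8 * A : ℝ)) hn (by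
      intro e he
      have hDe : D ≤ (setsOf G' e).card := by
        have := hdeg e
        rwa [min_eq_right (Finset.mem_filter.1 he).2.le] at this
      set x : ℝ := (setsOf G' e).card / n with hx
      have hx1 : x ≤ 1 := (div_le_one hn').2 (by
        exact_mod_cast (by simpa using Finset.card_le_univ (setsOf G' e) : (setsOf G' e).card ≤ n))
      have hsx : (A.size + 3 : ℝ) ≤ s * x := by
        have h1 : (D : ℝ) ≤ (setsOf G' e).card := by exact_mod_cast hDe
        have h2 : (k : ℝ) ≤ 16 * A * s := by exact_mod_cast hs2.le
        have h3 : (n : ℝ) * (16 * A * (A.size + 3)) ≤ D * k := (div_le_iff₀ hk').1 hD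
        have h4 : (D : ℝ) * k ≤ (setsOf G' e).card * (16 * A * s) :=
          mul_le_mul h1 h2 hk'.le (Nat.cast_nonneg _)
        have h5 : (setsOf G' e).card = x * n := by rw [hx]; field_simp
        rw [h5] at h4
        have h6 : (n * (16 * A) : ℝ) * (A.size + 3) ≤ (n * (16 * A)) * (s * x) := by
          calc _ = (n : ℝ) * (16 * A * (A.size + 3)) := by ring
            _ ≤ _ := h3.trans h4
            _ = _ := by ring
        exact le_of_mul_le_mul_left h6 (by positivity)
      have hle : (1 - x) ^ s ≤ Real.exp (-(A.size + 3)) := by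
        calc (1 - x) ^ s ≤ (Real.exp (-x)) ^ s :=
              pow_le_pow_left₀ (by linarith) (Real.one_sub_le_exp_neg x) s
          _ = Real.exp (-(s * x)) := by rw [← Real.exp_nat_mul]; ring_nf
          _ ≤ _ := Real.exp_le_exp.2 (by linarith)
      refine hle.trans ?_
      rw [Real.exp_neg, ← one_div]
      refine one_div_le_one_div_of_le (by positivity) ?_
      have h2 : (2 : ℝ) ≤ Real.exp 1 := by linarith [Real.add_one_le_exp (1 : ℝ)]
      have h3 : (2 : ℝ) ^ (A.size + 3) ≤ Real.exp (A.size + 3) := by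
        calc (2 : ℝ) ^ (A.size + 3) ≤ Real.exp 1 ^ (A.size + 3) := pow_le_pow_left₀ (by norm_num) h2 _
          _ = _ := by rw [← Real.exp_nat_mul]; push_cast; ring_nf
      have h4 : (A : ℝ) ≤ 2 ^ A.size := by exact_mod_cast (Nat.lt_size_self A).le
      rw [pow_add] at h3
      linarith)
    have hTle : (T.card : ℝ) ≤ opt k G := by
      refine le_trans ?_ (show (coverage G Q : ℝ) ≤ opt k G by
        exact_mod_cast coverage_le_opt hkn (by omega))
      exact_mod_cast Finset.card_le_card (Finset.filter_subset _ _)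
    refine ⟨Q ∪ Finset.univ.image f, ?_, ?_⟩
    · refine (Finset.card_union_le _ _).trans ?_
      have : (Finset.univ.image f).card ≤ s := Finset.card_image_le.trans (by simp)
      omega
    · have hsubset : covered G Q \ (T \ covered G' (Finset.univ.image f)) ⊆
          covered G' (Q ∪ Finset.univ.image f) := by
        intro e he
        obtain ⟨he1, he2⟩ := Finset.mem_sdiff.1 he
        by_cases heT : e ∈ T
        · have : e ∈ covered G' (Finset.univ.image f) := by
            by_contra hcon
            exact he2 (Finset.mem_sdiff.2 ⟨heT, hcon⟩)
          exact covered_mono Finset.subset_union_right this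
        · obtain ⟨S, hS, hG⟩ := mem_covered.1 he1
          have hle : (setsOf G e).card ≤ D := by
            by_contra hcon
            exact heT (Finset.mem_filter.2 ⟨he1, not_le.1 hcon⟩)
          refine mem_covered.2 ⟨S, Finset.mem_union_left _ hS, mem_setsOf.1 ?_⟩
          rw [hfull e hle]
          exact mem_setsOf.2 hG
      have h1 := Finset.card_le_card hsubset
      have h2 := Finset.le_card_sdiff (T \ covered G' (Finset.univ.image f)) (covered G Q)
      rw [card_covered] at h1 h2
      have h3 : (coverage G Q : ℝ) ≤ coverage G' (Q ∪ Finset.univ.image f) +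
          (T \ covered G' (Finset.univ.image f)).card := by
        exact_mod_cast (by omega : coverage G Q ≤ _ + _)
      have h4 : ((k - s : ℕ) : ℝ) * opt k G ≤ k * coverage G Q := by exact_mod_cast hcov
      rw [Nat.cast_sub hsk] at h4
      have h5 : (s : ℝ) / k ≤ 1 / (8 * A) := by
        rw [div_le_div_iff₀ hk' (by positivity)]
        have : (s : ℝ) * (8 * A) ≤ k := by exact_mod_cast hs1
        linarith
      have h6 : (1 - (s : ℝ) / k) * opt k G ≤ coverage G Q := by
        have : (1 - (s : ℝ) / k) * opt k G = ((k - s : ℝ) * opt k G) / k := by field_simp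
        rw [this, div_le_iff₀ hk']
        linarith
      have hop : (0 : ℝ) ≤ opt k G := Nat.cast_nonneg _
      have h7 : (s : ℝ) / k * opt k G ≤ 1 / (8 * A) * opt k G := mul_le_mul_of_nonneg_right h5 hop
      have h8 : 1 / (8 * A : ℝ) * T.card ≤ 1 / (8 * A) * opt k G :=
        mul_le_mul_of_nonneg_left hTle (by positivity)
      have h9 : 1 / (4 * A : ℝ) = 1 / (8 * A) + 1 / (8 * A) := by field_simp; norm_num
      rw [h9]
      linarith

end Coverage

/-! ### The greedy bound -/

/-- The sets of `T` together close the gap to the coverage of `T`, so one of them closes a `1 / k`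
share, and the greedy choice does no worse. After `k` steps at most `(1 - 1 / k) ^ k ≤ 1 / e` of the
gap is left. -/
theorem IsGreedy.le {n m k : ℕ} {Es sel T : List ℕ} (h : IsGreedy n m Es sel) (hk : 1 ≤ k)
    (hsel : sel.length = k) (hT : T.length ≤ k) (hTn : ∀ S ∈ T, S < n) :
    (1 - 1 / Real.exp 1) * (covSet m Es T).card ≤ (covSet m Es sel).card := by
  have hk' : (0 : ℝ) < k := by exact_mod_cast hk
  set c : ℝ := ((covSet m Es T).card : ℝ) with hc
  set a : ℕ → ℕ := fun j => (covSet m Es (sel.take j)).card with ha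
  -- Submodularity: if no single set adds more than `b` to `X`, then all of `T` adds at most `b` per
  -- set.
  have hunion : ∀ (T X : List ℕ), (∀ S ∈ T, S < n) → ∀ b,
      (∀ S < n, (covSet m Es (S :: X)).card ≤ b + (covSet m Es X).card) →
      (covSet m Es T ∪ covSet m Es X).card ≤ T.length * b + (covSet m Es X).card := by
    intro T X hTn b hb
    induction T with
    | nil => simp [covSet]
    | cons S T ih =>
      have h1 := ih fun S' hS' => hTn S' (List.mem_cons_of_mem _ hS')
      have h2 := hb S (hTn S (by simp))
      rw [covSet_cons] at h2 ⊢
      set Y := ((atSet m S Es).map (· % m)).toFinset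
      set X' := covSet m Es X
      set T' := covSet m Es T
      have h3 : (X' ∪ Y).card = X'.card + (Y \ X').card := by
        rw [← Finset.card_union_of_disjoint Finset.disjoint_sdiff, Finset.union_sdiff_self_eq_union]
      have h4 : T' ∪ Y ∪ X' ⊆ (T' ∪ X') ∪ (Y \ X') := by
        intro e he
        simp only [Finset.mem_union, Finset.mem_sdiff] at he ⊢
        tauto
      have h5 := (Finset.card_le_card h4).trans (Finset.card_union_le _ _)
      rw [List.length_cons, add_one_mul]
      omega
  have hstep : ∀ j < k, c - a (j + 1) ≤ (1 - 1 / k) * (c - a j) := by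
    intro j hj
    have hmono : a j ≤ a (j + 1) := by
      refine Finset.card_le_card fun e he => ?_
      obtain ⟨x, h1, h2, h3⟩ := mem_covSet.1 he
      exact mem_covSet.2 ⟨x, h1, List.take_subset_take_left _ (Nat.le_succ j) h2, h3⟩
    have h1 := hunion T (sel.take j) hTn (a (j + 1) - a j) fun S hS => by
      have := h j (by omega) S hS
      simp only [ha] at hmono ⊢
      omega
    have h2 := (Finset.card_le_card (Finset.subset_union_left (s₁ := covSet m Es T)
      (s₂ := covSet m Es (sel.take j)))).trans h1
    have h3 : T.length * (a (j + 1) - a j) ≤ k * (a (j + 1) - a j) := Nat.mul_le_mul_right _ hT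
    have h4 : c ≤ k * (a (j + 1) - a j) + a j := by
      rw [hc, ← Nat.cast_sub hmono]
      exact_mod_cast h2.trans (Nat.add_le_add_right h3 _)
    have h5 : (c - a j) / k ≤ a (j + 1) - a j := by
      rw [div_le_iff₀ hk']
      linarith
    have h6 : (1 - 1 / (k : ℝ)) * (c - a j) = (c - a j) - (c - a j) / k := by ring
    rw [h6]
    linarith
  have hind : ∀ j ≤ k, c - a j ≤ (1 - 1 / k) ^ j * c := by
    intro j
    induction j with
    | zero => simp [ha, covSet]
    | succ j ih =>
      intro hj
      refine (hstep j hj).trans ?_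
      rw [pow_succ', mul_assoc]
      refine mul_le_mul_of_nonneg_left (ih (by omega)) ?_
      have : 1 / (k : ℝ) ≤ 1 := by
        rw [div_le_one hk']
        exact_mod_cast hk
      linarith
  have hfin := hind k le_rfl
  have hak : a k = (covSet m Es sel).card := by
    simp only [ha]
    rw [List.take_of_length_le (by omega)]
  have hexp : (1 - 1 / (k : ℝ)) ^ k ≤ 1 / Real.exp 1 := by
    have h1 : 1 - 1 / (k : ℝ) ≤ Real.exp (-(1 / k)) := Real.one_sub_le_exp_neg _
    have h0 : 0 ≤ 1 - 1 / (k : ℝ) := by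
      have : 1 / (k : ℝ) ≤ 1 := by
        rw [div_le_one hk']
        exact_mod_cast hk
      linarith
    refine (pow_le_pow_left₀ h0 h1 k).trans (le_of_eq ?_)
    rw [← Real.exp_nat_mul, one_div (Real.exp 1), ← Real.exp_neg]
    congr 1
    field_simp
  rw [hak] at hfin
  have : (1 - 1 / (k : ℝ)) ^ k * c ≤ 1 / Real.exp 1 * c := mul_le_mul_of_nonneg_right hexp (by positivity)
  linarith

end KCover

namespace KCover

/-! ### Graphs given by lists of codes -/

section Codes

variable {n m : ℕ} {G : Finset (Fin n × Fin m)} {R : List ℕ}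

/-- The code of an edge. -/
def code (x : Fin n × Fin m) : ℕ := (x.1 + 1) * m + x.2

theorem code_mod (x : Fin n × Fin m) : code x % m = x.2 := by
  rw [code, Nat.mul_add_mod_self_right, Nat.mod_eq_of_lt x.2.2]

theorem code_div (x : Fin n × Fin m) : code x / m = x.1 + 1 := by
  have hm : 0 < m := x.2.pos
  rw [code, mul_comm, Nat.mul_add_div hm, Nat.div_eq_of_lt x.2.2, add_zero]

theorem code_injective : Function.Injective (code : Fin n × Fin m → ℕ) := by
  intro x y h
  have h1 := code_div x
  have h2 := code_mod x
  rw [h] at h1 h2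
  rw [code_div] at h1
  rw [code_mod] at h2
  exact Prod.ext (Fin.ext (by omega)) (Fin.ext h2.symm)

theorem le_code (x : Fin n × Fin m) : m ≤ code x := by
  rw [code, add_one_mul]
  omega

theorem code_lt (x : Fin n × Fin m) : code x < (n + 1) * m := by
  have h1 : (x.1 + 1 + 1 : ℕ) * m ≤ (n + 1) * m := Nat.mul_le_mul_right _ (by omega)
  have h2 := x.2.2
  rw [add_one_mul] at h1
  rw [code]
  omega

/-- The list `R` holds the codes of the edges in `G`, without repetitions. -/
structure Codes (G : Finset (Fin n × Fin m)) (R : List ℕ) : Prop where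
  nodup : R.Nodup
  mem : ∀ x, x ∈ R ↔ ∃ y ∈ G, code y = x

theorem Codes.code_mem (h : Codes G R) {y : Fin n × Fin m} : code y ∈ R ↔ y ∈ G := by
  rw [h.mem]
  exact ⟨fun ⟨z, hz, e⟩ => code_injective e ▸ hz, fun hy => ⟨y, hy, rfl⟩⟩

theorem Codes.filter (h : Codes G R) (p : ℕ → Prop) [DecidablePred p] :
    Codes (G.filter fun y => p (code y)) (R.filter fun x => p x) := by
  refine ⟨h.nodup.filter _, fun x => ?_⟩
  simp only [List.mem_filter, h.mem, Finset.mem_filter, decide_eq_true_eq]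
  constructor
  · rintro ⟨⟨y, hy, rfl⟩, hp⟩
    exact ⟨y, ⟨hy, hp⟩, rfl⟩
  · rintro ⟨y, ⟨hy, hp⟩, rfl⟩
    exact ⟨⟨y, hy, rfl⟩, hp⟩

theorem Codes.card_setsOf (h : Codes G R) (e : Fin m) :
    (setsOf G e).card = (atElem m e R).length := by
  rw [← List.toFinset_card_of_nodup (l := atElem m e R) (h.nodup.filter _)]
  refine Finset.card_bij (fun S _ => code (S, e)) (fun S hS => ?_) (fun S _ S' _ he => ?_) fun x hx => ?_
  · rw [List.mem_toFinset, atElem, List.mem_filter, h.code_mem]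
    exact ⟨mem_setsOf.1 hS, by simp [code_mod]⟩
  · exact (Prod.ext_iff.1 (code_injective he)).1
  · rw [List.mem_toFinset, atElem, List.mem_filter, h.mem] at hx
    obtain ⟨⟨y, hy, rfl⟩, hmod⟩ := hx
    have : y.2 = e := Fin.ext (by simpa [code_mod] using hmod)
    exact ⟨y.1, mem_setsOf.2 (by rw [← this]; exact hy), by rw [← this]⟩

theorem length_filter_mod {m : ℕ} (p : ℕ → Prop) [DecidablePred p] {R : List ℕ} (hm : R ≠ [] → 0 < m) :
    (R.filter fun x => p (x % m)).length =
      ∑ e : Fin m, if p e then (atElem m e R).length else 0 := by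
  induction R with
  | nil => simp [atElem]
  | cons x R ih =>
    have hm0 : 0 < m := hm (by simp)
    have hlt := Nat.mod_lt x hm0
    have h1 : ∀ e : Fin m, (if p e then (atElem m e (x :: R)).length else 0) =
        (if e = ⟨x % m, hlt⟩ then (if p (x % m) then 1 else 0) else 0) +
          if p e then (atElem m e R).length else 0 := by
      intro e
      by_cases he : e = ⟨x % m, hlt⟩
      · subst he
        by_cases hp : p (x % m) <;> simp [atElem, hp, add_comm]
      · have : ¬ x % m = e := fun h => he (Fin.ext h.symm)
        by_cases hp : p e <;> simp [atElem, hp, he, this]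
    rw [Finset.sum_congr rfl fun e _ => h1 e, Finset.sum_add_distrib, ← ih fun _ => hm0]
    by_cases hp : p (x % m) <;> simp [hp, add_comm]

theorem card_covSet_eq (h : Codes G R) {hv : ℕ → ℕ} {θ : ℕ} {Es sel : List ℕ}
    (hEs : ∀ x, x ∈ Es ↔ x ∈ R ∧ hv (x % m) < θ) {P : Finset (Fin n)}
    (hP : ∀ S : Fin n, S ∈ P ↔ (S : ℕ) ∈ sel) :
    (covSet m Es sel).card = ((covered G P).filter fun e : Fin m => hv e < θ).card := by
  symm
  refine Finset.card_bij (fun e _ => (e : ℕ)) (fun e he => ?_) (fun a _ b _ hab => Fin.ext hab)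
    fun e he => ?_
  · obtain ⟨h1, h2⟩ := Finset.mem_filter.1 he
    obtain ⟨S, hS, hG⟩ := mem_covered.1 h1
    refine mem_covSet.2 ⟨code (S, e), (hEs _).2 ⟨h.code_mem.2 hG, by rwa [code_mod]⟩, ?_, code_mod _⟩
    rw [code_div]
    exact (hP S).1 hS
  · obtain ⟨x, hx, hS, rfl⟩ := mem_covSet.1 he
    obtain ⟨hxR, hlt⟩ := (hEs x).1 hx
    obtain ⟨y, hy, rfl⟩ := (h.mem x).1 hxR
    rw [code_div] at hS
    rw [code_mod] at hlt ⊢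
    exact ⟨y.2, Finset.mem_filter.2 ⟨mem_covered.2 ⟨y.1, (hP _).2 hS, hy⟩, hlt⟩, rfl⟩

end Codes

/-! ### The good event -/

section Good

variable {n m k W A L : ℕ}

/-- The smallest expected size of a sample for which the concentration is good enough. -/
def sampleSize (n k W A L : ℕ) : ℕ := 1536 * (A * A) * halfIndep n k W L

/-- The level of the smallest sufficient sample. -/
noncomputable def goodLevel (n m k W A L opt : ℕ) : ℕ :=
  Nat.findGreatest (fun i => sampleSize n k W A L * nextPrime (m + 4 * W + 2) ≤
    nextPrime (m + 4 * W + 2) / 2 ^ i * opt) W.size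

/-- Level `0` is excluded because `Nat.findGreatest` returns it also when no level is large enough.
That level is the whole ground set and needs no concentration. -/
theorem sampleSize_le_of_le_goodLevel {o i : ℕ} (hi : i ≤ goodLevel n m k W A L o) (h0 : i ≠ 0) :
    sampleSize n k W A L * nextPrime (m + 4 * W + 2) ≤ nextPrime (m + 4 * W + 2) / 2 ^ i * o := by
  have h1 : sampleSize n k W A L * nextPrime (m + 4 * W + 2) ≤
      nextPrime (m + 4 * W + 2) / 2 ^ goodLevel n m k W A L o * o :=
    Nat.findGreatest_of_ne_zero (P := fun i => sampleSize n k W A L * nextPrime (m + 4 * W + 2) ≤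
      nextPrime (m + 4 * W + 2) / 2 ^ i * o) rfl (by omega)
  exact h1.trans (Nat.mul_le_mul_right _ (Nat.div_le_div_left (Nat.pow_le_pow_right (by norm_num) hi)
    (by positivity)))

theorem goodLevel_le {o : ℕ} : goodLevel n m k W A L o ≤ W.size := Nat.findGreatest_le _

/-- The next level is too small and halving loses a factor `2`; rounding the threshold costs at most
`o ≤ q` more, whence `3`. At the cap `W.size` the expected sample is at most one element, as the
optimum is at most `W`. -/
theorem goodLevel_mul_le {o : ℕ} (hoW : o ≤ W) (hom : o ≤ m) (hA : 1 ≤ A) :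
    nextPrime (m + 4 * W + 2) / 2 ^ goodLevel n m k W A L o * o ≤
      3 * (sampleSize n k W A L * nextPrime (m + 4 * W + 2)) := by
  set q := nextPrime (m + 4 * W + 2) with hq
  have hqm : m + 4 * W + 2 ≤ q := le_nextPrime _
  set i := goodLevel n m k W A L o with hi
  have hμ : 1 ≤ sampleSize n k W A L := by
    have : 1 ≤ halfIndep n k W L := by unfold halfIndep; omega
    have := Nat.mul_pos (Nat.mul_pos (show 0 < 1536 by norm_num) (Nat.mul_pos hA hA)) this
    exact this
  have hμq : q ≤ sampleSize n k W A L * q := Nat.le_mul_of_pos_left _ hμ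
  rcases Nat.lt_or_eq_of_le (goodLevel_le (n := n) (m := m) (k := k) (W := W) (A := A) (L := L)
    (o := o)) with h | h
  · have h1 : ¬ sampleSize n k W A L * q ≤ q / 2 ^ (i + 1) * o :=
      Nat.findGreatest_is_greatest (P := fun i => sampleSize n k W A L * q ≤ q / 2 ^ i * o)
        (Nat.lt_succ_self _) h
    have h2 : q / 2 ^ i ≤ 2 * (q / 2 ^ (i + 1)) + 1 := by
      rw [pow_succ, ← Nat.div_div_eq_div_mul]
      omega
    have h3 := Nat.mul_le_mul_right o h2
    rw [add_mul, one_mul, mul_assoc] at h3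
    omega
  · rw [← hi] at h
    rw [h]
    have h1 : o ≤ 2 ^ W.size := hoW.trans (Nat.lt_size_self W).le
    have h2 : q / 2 ^ W.size * o ≤ q := (Nat.mul_le_mul_left _ h1).trans (Nat.div_mul_le_self _ _)
    omega

/-- The sample of each sufficient size is representative for all covers, and the sample of the
smallest sufficient size is not too large. -/
structure Good (n m k W A L : ℕ) (G G' : Finset (Fin n × Fin m)) {q : ℕ} (z : Fin m → ZMod q) :
    Prop where
  cover : ∀ i ≤ goodLevel n m k W A L (opt k G), i ≠ 0 →
    ∀ P ∈ (Finset.univ : Finset (Fin n)).powersetCard k,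
    |∑ e, (if e ∈ covered G' P then (1 : ℝ) else 0) * deviation (q / 2 ^ i) (z e)| ≤
      1 / (8 * A) * (((q / 2 ^ i : ℕ) : ℝ) / q * opt k G)
  weight : |∑ e, ((setsOf G' e).card / maxDegree n k A : ℝ) *
    deviation (q / 2 ^ goodLevel n m k W A L (opt k G)) (z e)| ≤ 6 * sampleSize n k W A L

theorem deviation_self {q : ℕ} [NeZero q] (z : ZMod q) : deviation q z = 0 := by
  have : (q : ℝ) ≠ 0 := by exact_mod_cast NeZero.ne q
  rw [deviation, if_pos (ZMod.val_lt z), div_self this, sub_self]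

theorem sum_deviation {q θ : ℕ} (C : Finset (Fin m)) (z : Fin m → ZMod q) :
    ∑ e, (if e ∈ C then (1 : ℝ) else 0) * deviation θ (z e) =
      (C.filter fun e => (z e).val < θ).card - (θ : ℝ) / q * C.card := by
  simp only [ite_mul, one_mul, zero_mul, Finset.sum_ite_mem, Finset.univ_inter, deviation,
    Finset.sum_sub_distrib, Finset.sum_boole, Finset.sum_const, nsmul_eq_mul]
  ring

theorem le_maxDegree (hk : 1 ≤ k) : (n : ℝ) * (16 * A * (A.size + 3)) / k ≤ maxDegree n k A := by
  have hk' : (0 : ℝ) < k := by exact_mod_cast hk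
  rw [div_le_iff₀ hk', maxDegree]
  have := (Nat.lt_mul_div_succ (n * (16 * A * (A.size + 3))) (show 0 < k by omega)).le
  rw [mul_comm k] at this
  exact_mod_cast this

/-- As the maximal degree is at least `n / k`, each weight is at most the capped degree of
`sum_min_le_two_mul_opt`. -/
theorem sum_weight_le (hk : 1 ≤ k) (hkn : k ≤ n) (hA : 1 ≤ A) {G G' : Finset (Fin n × Fin m)}
    (hsub : ∀ e, (setsOf G' e).card ≤ (setsOf G e).card)
    (hD : ∀ e, (setsOf G' e).card ≤ maxDegree n k A) :
    ∑ e, ((setsOf G' e).card / maxDegree n k A : ℝ) ≤ 2 * opt k G := by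
  have hn' : (0 : ℝ) < n := by exact_mod_cast (by omega : 0 < n)
  have hk' : (0 : ℝ) < k := by exact_mod_cast hk
  refine le_trans (Finset.sum_le_sum fun e _ => ?_) (sum_min_le_two_mul_opt hkn (by omega) G)
  have hD0 : (0 : ℝ) < maxDegree n k A := by
    exact_mod_cast (Nat.succ_pos _ : 0 < maxDegree n k A)
  refine le_min ((div_le_one hD0).2 (by exact_mod_cast hD e)) ?_
  rw [div_le_iff₀ hD0]
  have h1 := le_maxDegree (n := n) (k := k) (A := A) hk
  have h2 : (n : ℝ) / k ≤ maxDegree n k A := by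
    refine le_trans ?_ h1
    have hA' : (1 : ℝ) ≤ A := by exact_mod_cast hA
    have hs : (0 : ℝ) ≤ A.size := Nat.cast_nonneg _
    refine div_le_div_of_nonneg_right ?_ hk'.le
    exact le_mul_of_one_le_right hn'.le (by nlinarith)
  have h3 : ((setsOf G' e).card : ℝ) ≤ (setsOf G e).card := by exact_mod_cast hsub e
  calc ((setsOf G' e).card : ℝ) ≤ (setsOf G e).card := h3
    _ = k * ((setsOf G e).card / n) * (n / k) := by field_simp
    _ ≤ _ := mul_le_mul_of_nonneg_left h2 (by positivity)

/-- A union bound over one event for each useful level and each `k`-cover, and one event for the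
number of sampled edges. -/
theorem card_bad_le (hk : 1 ≤ k) (hkn : k ≤ n) (hA : 1 ≤ A) {G G' : Finset (Fin n × Fin m)}
    (hGW : G.card ≤ W) (hsub : G' ⊆ G) (hD : ∀ e, (setsOf G' e).card ≤ maxDegree n k A) {q : ℕ}
    (hq : q = nextPrime (m + 4 * W + 2)) [Fact q.Prime] {d : ℕ} (hd : d = 2 * halfIndep n k W L) :
    ∃ Bad : Finset (Fin d → ZMod q), (∀ c, c ∉ Bad → Good n m k W A L G G' (hashHom q d m c)) ∧
      (Bad.card : ℝ) ≤ (q : ℝ) ^ d * (1 / 2) ^ L := by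
  classical
  set r := halfIndep n k W L with hr
  set o := opt k G with ho
  set μ := sampleSize n k W A L with hμ
  set I := goodLevel n m k W A L o with hI
  have hqm : m + 4 * W + 2 ≤ q := hq ▸ le_nextPrime _
  have hq0 : (0 : ℝ) < q := by exact_mod_cast (Fact.out : q.Prime).pos
  have hA' : (1 : ℝ) ≤ A := by exact_mod_cast hA
  have hr1 : 1 ≤ r := by rw [hr, halfIndep]; omega
  have hr' : (1 : ℝ) ≤ r := by exact_mod_cast hr1
  have hμr : (μ : ℝ) = 1536 * (A * A) * r := by rw [hμ, sampleSize]; push_cast; rfl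
  have hrμ : (r : ℝ) ≤ μ := by rw [hμr]; nlinarith [mul_le_mul hA' hA' zero_le_one (by linarith)]
  have hμ0 : (0 : ℝ) < μ := by linarith
  have hmq : m ≤ q := by omega
  have hoP : ∀ P ∈ (Finset.univ : Finset (Fin n)).powersetCard k, coverage G' P ≤ o := fun P hP =>
    (coverage_mono_left hsub).trans (coverage_le_opt hkn (Finset.mem_powersetCard.1 hP).2.le)
  have hocov : ∃ P : Finset (Fin n), coverage G P = o := by
    obtain ⟨P, -, hP⟩ := exists_coverage_eq_opt G hkn
    exact ⟨P, hP⟩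
  have hoW : o ≤ W := by
    obtain ⟨P, hP⟩ := hocov
    rw [← hP]
    exact (Finset.card_image_le.trans (Finset.card_filter_le _ _)).trans hGW
  have hom : o ≤ m := by
    obtain ⟨P, hP⟩ := hocov
    rw [← hP, ← card_covered]
    simpa using Finset.card_le_univ (covered G P)
  set bad1 : ℕ → Finset (Fin n) → Finset (Fin d → ZMod q) := fun i P => Finset.univ.filter fun c =>
    1 / (8 * A : ℝ) * (((q / 2 ^ i : ℕ) : ℝ) / q * o) <
      |∑ e, (if e ∈ covered G' P then (1 : ℝ) else 0) * deviation (q / 2 ^ i) (hashHom q d m c e)|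
    with hbad1
  set bad2 : Finset (Fin d → ZMod q) := Finset.univ.filter fun c => 6 * (μ : ℝ) <
      |∑ e, ((setsOf G' e).card / maxDegree n k A : ℝ) * deviation (q / 2 ^ I) (hashHom q d m c e)|
    with hbad2
  have h1 : ∀ i ∈ Finset.Icc 1 I, ∀ P ∈ (Finset.univ : Finset (Fin n)).powersetCard k,
      ((bad1 i P).card : ℝ) ≤ (q : ℝ) ^ d * (2 * (1 / 2) ^ r) := by
    intro i hi P hP
    obtain ⟨hi1, hi2⟩ := Finset.mem_Icc.1 hi
    set p : ℝ := ((q / 2 ^ i : ℕ) : ℝ) / q with hp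
    have hle := sampleSize_le_of_le_goodLevel hi2 (by omega)
    rw [← hq, ← hμ] at hle
    have hμp : (μ : ℝ) ≤ p * o := by
      rw [hp, div_mul_eq_mul_div, le_div_iff₀ hq0]
      exact_mod_cast hle
    have hpo : 0 < p * o := hμ0.trans_le hμp
    refine (card_deviation_le hmq (Nat.div_le_self _ _) hd (fun e => by split_ifs <;> norm_num)
      (fun e => by split_ifs <;> norm_num) (μ := p * o) (r := r) ?_ hr1 (hrμ.trans hμp)
      (by positivity)).trans ?_
    · rw [← hp, Finset.sum_boole, Finset.filter_mem_eq_inter, Finset.univ_inter, card_covered]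
      refine mul_le_mul_of_nonneg_left ?_ (by positivity)
      exact_mod_cast hoP P hP
    · refine mul_le_mul_of_nonneg_left (mul_le_mul_of_nonneg_left (pow_le_pow_left₀ (by positivity) ?_ r)
        (by norm_num)) (by positivity)
      rw [div_le_iff₀ (by positivity)]
      -- For the deviation `p * o / (8 * A)` the base of the tail bound is at most `1 / 2` exactly
      -- if `p * o ≥ 1536 * A ^ 2 * r`; this dictates `sampleSize`.
      have e1 : 1 / 2 * (1 / (8 * (A : ℝ)) * (p * o)) ^ 2 = (p * o) * ((p * o) / (128 * (A * A))) := by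
        field_simp
        ring
      rw [e1, mul_comm (12 * (r : ℝ))]
      refine mul_le_mul_of_nonneg_left ?_ hpo.le
      rw [le_div_iff₀ (by positivity)]
      linarith
  have hgl := goodLevel_mul_le (n := n) (m := m) (k := k) (W := W) (A := A) (L := L) hoW hom hA
  rw [← hq, ← hμ, ← hI] at hgl
  have h2 : (bad2.card : ℝ) ≤ (q : ℝ) ^ d * (2 * (1 / 2) ^ r) := by
    have hD0 : (0 : ℝ) < maxDegree n k A := by
      exact_mod_cast (Nat.succ_pos _ : 0 < maxDegree n k A)
    have hsw := sum_weight_le hk hkn hA (G := G) (G' := G')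
      (fun e => Finset.card_le_card fun S hS => mem_setsOf.2 (hsub (mem_setsOf.1 hS))) hD
    refine (card_deviation_le hmq (Nat.div_le_self _ _) hd (fun e => by positivity)
      (fun e => (div_le_one hD0).2 (by exact_mod_cast hD e)) (μ := 6 * (μ : ℝ)) (r := r) ?_ hr1
      (by linarith) (by positivity)).trans ?_
    · calc ((q / 2 ^ I : ℕ) : ℝ) / q * ∑ e, ((setsOf G' e).card / maxDegree n k A : ℝ) ≤
            ((q / 2 ^ I : ℕ) : ℝ) / q * (2 * o) := mul_le_mul_of_nonneg_left hsw (by positivity)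
        _ ≤ 6 * μ := by
          rw [div_mul_eq_mul_div, div_le_iff₀ hq0]
          have : ((q / 2 ^ I : ℕ) : ℝ) * o ≤ 3 * (μ * q) := by exact_mod_cast hgl
          linarith
    · refine mul_le_mul_of_nonneg_left (mul_le_mul_of_nonneg_left (pow_le_pow_left₀ (by positivity) ?_ r)
        (by norm_num)) (by positivity)
      rw [div_le_iff₀ (by positivity)]
      -- Expectation bound and deviation are both `6 * μ`, so the base of the tail bound is `2 * r /
      -- μ`.
      have : 4 * (r : ℝ) ≤ μ := by rw [hμr]; nlinarith [mul_le_mul hA' hA' zero_le_one (by linarith)]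
      nlinarith
  refine ⟨bad2 ∪ (Finset.Icc 1 I).biUnion fun i =>
    ((Finset.univ : Finset (Fin n)).powersetCard k).biUnion (bad1 i), fun c hc => ?_, ?_⟩
  · rw [Finset.mem_union, not_or] at hc
    refine ⟨fun i hi h0 P hP => ?_, ?_⟩
    · by_contra hcon
      refine hc.2 (Finset.mem_biUnion.2 ⟨i, Finset.mem_Icc.2 ⟨by omega, hi⟩,
        Finset.mem_biUnion.2 ⟨P, hP, ?_⟩⟩)
      rw [hbad1]
      exact Finset.mem_filter.2 ⟨Finset.mem_univ _, not_le.1 hcon⟩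
    · by_contra hcon
      refine hc.1 ?_
      rw [hbad2]
      exact Finset.mem_filter.2 ⟨Finset.mem_univ _, not_le.1 hcon⟩
  · have hIW : I ≤ W.size := goodLevel_le
    set B : ℝ := (q : ℝ) ^ d * (2 * (1 / 2) ^ r) with hB
    have hB0 : 0 ≤ B := by positivity
    have h3 : ∀ i ∈ Finset.Icc 1 I, ((((Finset.univ : Finset (Fin n)).powersetCard k).biUnion
        (bad1 i)).card : ℝ) ≤ (n : ℝ) ^ k * B := by
      intro i hi
      calc ((((Finset.univ : Finset (Fin n)).powersetCard k).biUnion (bad1 i)).card : ℝ) ≤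
            ∑ P ∈ (Finset.univ : Finset (Fin n)).powersetCard k, ((bad1 i P).card : ℝ) := by
            exact_mod_cast Finset.card_biUnion_le
        _ ≤ ∑ P ∈ (Finset.univ : Finset (Fin n)).powersetCard k, B :=
            Finset.sum_le_sum fun P hP => h1 i hi P hP
        _ = (n.choose k : ℝ) * B := by
            rw [Finset.sum_const, Finset.card_powersetCard, Finset.card_univ, Fintype.card_fin,
              nsmul_eq_mul]
        _ ≤ _ := mul_le_mul_of_nonneg_right (by exact_mod_cast Nat.choose_le_pow n k) hB0
    have h4 : ((((Finset.Icc 1 I).biUnion fun i =>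
        ((Finset.univ : Finset (Fin n)).powersetCard k).biUnion (bad1 i)).card : ℕ) : ℝ) ≤
        I * ((n : ℝ) ^ k * B) := by
      calc _ ≤ ∑ i ∈ Finset.Icc 1 I, ((((Finset.univ : Finset (Fin n)).powersetCard k).biUnion
            (bad1 i)).card : ℝ) := by exact_mod_cast Finset.card_biUnion_le
        _ ≤ ∑ i ∈ Finset.Icc 1 I, (n : ℝ) ^ k * B := Finset.sum_le_sum h3
        _ = _ := by simp
    have h5 : ((bad2 ∪ (Finset.Icc 1 I).biUnion fun i =>
        ((Finset.univ : Finset (Fin n)).powersetCard k).biUnion (bad1 i)).card : ℝ) ≤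
        B + I * ((n : ℝ) ^ k * B) := by
      refine le_trans ?_ (add_le_add h2 h4)
      exact_mod_cast Finset.card_union_le _ _
    refine h5.trans ?_
    -- The summands of `r` pay for the covers, the levels and the failure probability in turn; its
    -- final `2` gives a factor `1 / 4` that absorbs the `2` of the tail bound.
    have h6 : (n : ℝ) ^ k ≤ 2 ^ (k * n.size) := by
      rw [mul_comm, pow_mul]
      exact pow_le_pow_left₀ (Nat.cast_nonneg _) (by exact_mod_cast (Nat.lt_size_self n).le) k
    have h7 : (I : ℝ) + 1 ≤ 2 ^ W.size.size := by
      exact_mod_cast (Nat.succ_le_of_lt (hIW.trans_lt (Nat.lt_size_self _)))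
    have h8 : (1 : ℝ) ≤ (2 : ℝ) ^ (k * n.size) := one_le_pow₀ (by norm_num)
    have h9 : B + I * ((n : ℝ) ^ k * B) ≤ 2 ^ W.size.size * 2 ^ (k * n.size) * B := by
      have hI0 : (0 : ℝ) ≤ I := Nat.cast_nonneg _
      have a1 : (I : ℝ) * (n : ℝ) ^ k ≤ I * 2 ^ (k * n.size) := mul_le_mul_of_nonneg_left h6 hI0
      have a2 : (1 : ℝ) + I * (n : ℝ) ^ k ≤ 2 ^ W.size.size * 2 ^ (k * n.size) := by
        nlinarith
      calc B + I * ((n : ℝ) ^ k * B) = (1 + I * (n : ℝ) ^ k) * B := by ring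
        _ ≤ _ := mul_le_mul_of_nonneg_right a2 hB0
    refine h9.trans ?_
    have h10 : (2 : ℝ) ^ W.size.size * 2 ^ (k * n.size) * (1 / 2) ^ r = (1 / 2) ^ L * (1 / 4) := by
      have : r = k * n.size + L + W.size.size + 2 := rfl
      rw [this, pow_add, pow_add, pow_add]
      have e : ∀ t : ℕ, (2 : ℝ) ^ t * (1 / 2) ^ t = 1 := fun t => by
        rw [← mul_pow]; norm_num
      calc _ = (2 ^ W.size.size * (1 / 2) ^ W.size.size) * (2 ^ (k * n.size) * (1 / 2) ^ (k * n.size)) *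
            ((1 / 2 : ℝ) ^ L * (1 / 2) ^ 2) := by ring
        _ = _ := by rw [e, e]; norm_num
    have h11 : (0 : ℝ) ≤ (q : ℝ) ^ d * (1 / 2) ^ L := by positivity
    calc 2 ^ W.size.size * 2 ^ (k * n.size) * B =
          (q : ℝ) ^ d * 2 * (2 ^ W.size.size * 2 ^ (k * n.size) * (1 / 2) ^ r) := by rw [hB]; ring
      _ = (q : ℝ) ^ d * (1 / 2) ^ L * (1 / 2) := by rw [h10]; ring
      _ ≤ _ := by linarith

end Good

end KCover

namespace KCover

/-! ### The quality of the answer -/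

/-- In units of `o / A`, truncation loses `1 / 4`, sampling the comparison cover `1 / 8` and the
final rescaling at most `1 / 8`; sampling the answer costs another `1 / 8` when its true coverage is
bounded. The divisor `1 + 1 / (8 * A)` absorbs an overestimate by the sample, so the reported value
never exceeds the optimum. -/
theorem approx_arith {κ A p o c N c' N' : ℝ} (hκ1 : κ ≤ 1) (hA : 1 ≤ A) (hp : 0 < p)
    (ho : 0 ≤ o) (h1 : |c - p * N| ≤ 1 / (8 * A) * (p * o)) (h2 : |c' - p * N'| ≤ 1 / (8 * A) * (p * o))
    (h3 : (1 - 1 / (4 * A)) * o ≤ N') (h4 : κ * c' ≤ c) (h5 : N ≤ o) (hκ0 : 0 ≤ κ) :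
    (κ - 1 / A) * o ≤ c / (p * (1 + 1 / (8 * A))) ∧ c / (p * (1 + 1 / (8 * A))) ≤ o ∧
      (κ - 1 / A) * o ≤ N := by
  set a := 1 / A with ha
  have ha0 : 0 < a := by positivity
  have ha1 : a ≤ 1 := by rw [ha, div_le_one (by linarith)]; exact hA
  have e8 : 1 / (8 * A) = a / 8 := by rw [ha]; field_simp
  have e4 : 1 / (4 * A) = a / 4 := by rw [ha]; field_simp
  rw [e8] at h1 h2 ⊢
  rw [e4] at h3
  obtain ⟨x, rfl⟩ : ∃ x, c = p * x := ⟨c / p, by field_simp⟩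
  obtain ⟨y, rfl⟩ : ∃ y, c' = p * y := ⟨c' / p, by field_simp⟩
  have key : ∀ u v : ℝ, |p * u - p * v| ≤ a / 8 * (p * o) → |u - v| ≤ a / 8 * o := by
    intro u v h
    rw [← mul_sub, abs_mul, abs_of_pos hp] at h
    refine le_of_mul_le_mul_left ?_ hp
    linarith
  have h1' := abs_le.1 (key _ _ h1)
  have h2' := abs_le.1 (key _ _ h2)
  have h4' : κ * y ≤ x := by
    refine le_of_mul_le_mul_left ?_ hp
    linarith
  rw [mul_div_mul_left _ _ hp.ne']
  have hy : (1 - 3 * a / 8) * o ≤ y := by nlinarith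
  have hx : (κ - 3 * a / 8) * o ≤ x := by
    have : κ * ((1 - 3 * a / 8) * o) ≤ κ * y := mul_le_mul_of_nonneg_left hy hκ0
    have h6 : 0 ≤ (1 - κ) * (a * o) := mul_nonneg (by linarith) (by positivity)
    nlinarith
  have hao : 0 ≤ a * o := by positivity
  refine ⟨?_, ?_, ?_⟩
  · rw [le_div_iff₀ (by positivity)]
    have h6 : 0 ≤ (1 - κ) * (a * o) := mul_nonneg (by linarith) hao
    have h7 : 0 ≤ a * (a * o) := by positivity
    nlinarith
  · rw [div_le_iff₀ (by positivity)]
    nlinarith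
  · nlinarith

section Answer

variable {n m k W A L : ℕ} {G : Finset (Fin n × Fin m)} {ρ : List ℕ}

/-- The graph without the edges that are not among the `D` latest ones of their element. -/
def latest (D : ℕ) (G : Finset (Fin n × Fin m)) (R : List ℕ) : Finset (Fin n × Fin m) :=
  G.filter fun y => code y ∈ (atElem m (code y % m) R).take D

theorem codes_latest {D : ℕ} {R : List ℕ} (h : Codes G R) : Codes (latest D G R) (trunc m D R) :=
  h.filter fun x => x ∈ (atElem m (x % m) R).take D

theorem card_setsOf_latest {D : ℕ} {R : List ℕ} (h : Codes G R) (e : Fin m) :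
    (setsOf (latest D G R) e).card = min D (setsOf G e).card := by
  rw [(codes_latest h).card_setsOf, atElem_trunc h.nodup, List.length_take, h.card_setsOf]

theorem take_eq_self_of_length_lt {B : ℕ} {R : List ℕ} (h : (R.take B).length < B) : R.take B = R := by
  rw [List.length_take] at h
  exact List.take_of_length_le (by omega)

/-- Levels with fewer than `B` edges were not cut, so the collected edges are the full sample of the
truncated graph. -/
theorem mem_edgesFrom_kept {D B LV : ℕ} {lev : ℕ → ℕ} {i : ℕ} (hlev : ∀ e, lev e < LV)
    (hc : ∀ l, i ≤ l → l < LV → (kept W m D B lev ρ l).length < B) {x : ℕ} :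
    x ∈ edgesFrom (kept W m D B lev ρ) i LV ↔
      x ∈ trunc m D (recency W ρ) ∧ i ≤ lev (x % m) := by
  have hk : ∀ l, i ≤ l → l < LV → kept W m D B lev ρ l = atLevel m lev l (trunc m D (recency W ρ)) :=
    fun l h1 h2 => take_eq_self_of_length_lt (hc l h1 h2)
  rw [mem_edgesFrom]
  constructor
  · rintro ⟨l, h1, h2, h3⟩
    rw [hk l h1 h2, atLevel, List.mem_filter] at h3
    have h4 : lev (x % m) = l := by simpa using h3.2
    exact ⟨h3.1, by omega⟩
  · rintro ⟨h1, h2⟩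
    refine ⟨lev (x % m), h2, hlev _, ?_⟩
    rw [hk _ h2 (hlev _), atLevel, List.mem_filter]
    exact ⟨h1, by simp⟩

/-- This is what the summand `4 * W + 2` of the modulus is for: `2 ^ (W.size + 1)` does not exceed
it, so no threshold, and no denominator of the output, vanishes. -/
theorem div_two_pow_size_pos {i : ℕ} (hi : i ≤ W.size + 1) :
    0 < nextPrime (m + 4 * W + 2) / 2 ^ i := by
  have hq : m + 4 * W + 2 ≤ nextPrime (m + 4 * W + 2) := le_nextPrime _
  refine Nat.div_pos ?_ (by positivity)
  have h1 : 2 ^ i ≤ 2 ^ (W.size + 1) := Nat.pow_le_pow_right (by norm_num) hi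
  have h2 : 2 ^ W.size ≤ 2 * W + 1 := by
    rcases Nat.eq_zero_or_pos W with rfl | hW
    · simp
    · have h3 : 2 ^ (W.size - 1) ≤ W := Nat.lt_size.1 (by have := Nat.size_pos.2 hW; omega)
      have h4 : W.size = W.size - 1 + 1 := by have := Nat.size_pos.2 hW; omega
      rw [h4, pow_succ]
      omega
  rw [pow_succ] at h1
  omega

/-- The number of sampled edges is `D` times the sampled sum of the weights `deg / D`. Its
expectation is at most `6 * μ` by the bound on capped degrees and its deviation at most `6 * μ` by
`Good.weight`; the total `12 * μ * D` is just below `maxEdges`. -/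
theorem edges_lt_of_good (hk : 1 ≤ k) (hkn : k ≤ n) (hA : 1 ≤ A) (hG : Codes G (recency W ρ))
    (hGW : G.card ≤ W) {q : ℕ} (hq : q = nextPrime (m + 4 * W + 2)) [Fact q.Prime]
    {z : Fin m → ZMod q} {hv : ℕ → ℕ} (hz : ∀ e : Fin m, (z e).val = hv e)
    (hgood : Good n m k W A L G (latest (maxDegree n k A) G (recency W ρ)) z) :
    ((trunc m (maxDegree n k A) (recency W ρ)).filter fun x =>
      hv (x % m) < q / 2 ^ goodLevel n m k W A L (opt k G)).length < maxEdges n k W A L := by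
  set D := maxDegree n k A with hD
  set R := recency W ρ with hR
  set G' := latest D G R with hG'
  set o := opt k G with ho
  set I := goodLevel n m k W A L o with hI
  set μ := sampleSize n k W A L with hμ
  have hD0 : (0 : ℝ) < D := by exact_mod_cast (Nat.succ_pos _ : 0 < maxDegree n k A)
  have hq0 : (0 : ℝ) < q := by exact_mod_cast (Fact.out : q.Prime).pos
  have hocov : ∃ P : Finset (Fin n), coverage G P = o := by
    obtain ⟨P, -, hP⟩ := exists_coverage_eq_opt G hkn
    exact ⟨P, hP⟩
  have hoW : o ≤ W := by
    obtain ⟨P, hP⟩ := hocov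
    rw [← hP]
    exact (Finset.card_image_le.trans (Finset.card_filter_le _ _)).trans hGW
  have hom : o ≤ m := by
    obtain ⟨P, hP⟩ := hocov
    rw [← hP, ← card_covered]
    simpa using Finset.card_le_univ (covered G P)
  have hgl := goodLevel_mul_le (n := n) (m := m) (k := k) (W := W) (A := A) (L := L) hoW hom hA
  rw [← hq, ← hμ, ← hI] at hgl
  have hdeg : ∀ e, (setsOf G' e).card = min D (setsOf G e).card := card_setsOf_latest hG
  have hsw := sum_weight_le hk hkn hA (G := G) (G' := G') (fun e => by rw [hdeg]; exact min_le_right _ _)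
    (fun e => by rw [hdeg]; exact min_le_left _ _)
  rw [← hD, ← ho] at hsw
  have hne : trunc m D R ≠ [] → 0 < m := by
    intro hne
    obtain ⟨x, hx⟩ := List.exists_mem_of_ne_nil _ hne
    obtain ⟨y, -, -⟩ := ((codes_latest hG).mem x).1 hx
    exact y.2.pos
  have hlen := length_filter_mod (fun e => hv e < q / 2 ^ I) hne
  have hw := (abs_le.1 hgood.weight).2
  rw [← hD, ← ho, ← hI, ← hμ] at hw
  simp only [deviation, mul_sub, Finset.sum_sub_distrib] at hw
  rw [← Finset.sum_mul] at hw
  have h1 : (∑ e, ((setsOf G' e).card / D : ℝ)) * (((q / 2 ^ I : ℕ) : ℝ) / q) ≤ 6 * μ := by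
    calc _ ≤ (2 * o : ℝ) * (((q / 2 ^ I : ℕ) : ℝ) / q) := mul_le_mul_of_nonneg_right hsw (by positivity)
      _ ≤ 6 * μ := by
        rw [mul_div_assoc', div_le_iff₀ hq0]
        have : ((q / 2 ^ I : ℕ) : ℝ) * o ≤ 3 * (μ * q) := by exact_mod_cast hgl
        linarith
  have h2 : (((trunc m D R).filter fun x => hv (x % m) < q / 2 ^ I).length : ℝ) =
      D * ∑ e, ((setsOf G' e).card / D : ℝ) * (if (z e).val < q / 2 ^ I then 1 else 0) := by
    rw [hlen, Finset.mul_sum]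
    push_cast
    refine Finset.sum_congr rfl fun e _ => ?_
    rw [(codes_latest hG).card_setsOf e, hz e]
    split_ifs <;> field_simp
    simp
  have h3 : (((trunc m D R).filter fun x => hv (x % m) < q / 2 ^ I).length : ℝ) ≤ 12 * μ * D := by
    rw [h2]
    have := mul_le_mul_of_nonneg_left (show ∑ e, ((setsOf G' e).card / D : ℝ) *
      (if (z e).val < q / 2 ^ I then 1 else 0) ≤ 12 * μ by linarith) hD0.le
    linarith
  have h4 : ((trunc m D R).filter fun x => hv (x % m) < q / 2 ^ I).length ≤ 12 * μ * D := by
    exact_mod_cast h3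
  have h5 : maxEdges n k W A L = 12 * μ * D + 1 := rfl
  omega

/-- The greedy sets and a near-optimal cover of the truncated graph are compared inside the sample,
and `Good.cover` translates both counts back. That cover is enlarged to exactly `k` sets, since
concentration is known for those only. -/
theorem answer_of_good (hk : 1 ≤ k) (hkn : k ≤ n) (hA : 1 ≤ A) (hG : Codes G (recency W ρ))
    (hGW : G.card ≤ W) {K : Conf} (hK : K = conf n m k W A L) {q : ℕ} [Fact q.Prime]
    (hqK : K.q = q) {co : ℕ → ℕ} {z : Fin m → ZMod q}
    (hz : ∀ e : Fin m, (z e).val = hashVal q K.d co e)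
    (hgood : Good n m k W A L G (latest K.D G (recency W ρ)) z) {i : ℕ} {sel : List ℕ}
    (hi : i ≤ K.LV)
    (hc : ∀ l, i ≤ l → l < K.LV → (kept K.W K.m K.D K.B (K.lev co) ρ l).length < K.B)
    (hc' : i ≠ 0 → K.B ≤ (kept K.W K.m K.D K.B (K.lev co) ρ (i - 1)).length)
    (hlen : sel.length = K.k) (hnd : sel.Nodup) (hlt : ∀ S ∈ sel, S < K.n)
    (hgr : IsGreedy K.n K.m (edgesFrom (kept K.W K.m K.D K.B (K.lev co) ρ) i K.LV) sel) {c : ℕ}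
    (hcc : c = (covSet K.m (edgesFrom (kept K.W K.m K.D K.B (K.lev co) ρ) i K.LV) sel).card) :
    0 < q / 2 ^ i ∧
    (1 - 1 / Real.exp 1 - 1 / A) * opt k G ≤
      ((c * q * (8 * K.A) : ℕ) : ℝ) / ((q / 2 ^ i * (8 * K.A + 1) : ℕ) : ℝ) ∧
    ((c * q * (8 * K.A) : ℕ) : ℝ) / ((q / 2 ^ i * (8 * K.A + 1) : ℕ) : ℝ) ≤ opt k G ∧
    ∃ f : Fin k ↪ Fin n, (∀ j : Fin k, ∀ h : (j : ℕ) < sel.length, sel[j] = f j) ∧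
      (1 - 1 / Real.exp 1 - 1 / A) * opt k G ≤ coverage G (Finset.univ.map f) := by
  have hKn : K.n = n := by rw [hK]; rfl
  have hKm : K.m = m := by rw [hK]; rfl
  have hKk : K.k = k := by rw [hK]; rfl
  have hKW : K.W = W := by rw [hK]; rfl
  have hKA : K.A = A := by rw [hK]; rfl
  have hKq : q = nextPrime (m + 4 * W + 2) := by rw [← hqK, hK]; rfl
  have hKLV : K.LV = W.size + 1 := by rw [hK]; rfl
  have hKD : K.D = maxDegree n k A := by rw [hK]; rfl
  have hKB : K.B = maxEdges n k W A L := by rw [hK]; rfl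
  rw [hKn] at hlt hgr
  rw [hKm, hKW] at hc hc' hgr hcc
  rw [hKk] at hlen
  rw [hKA]
  set D := K.D with hD
  set R := recency W ρ with hR
  set G' := latest D G R with hG'
  set o := opt k G with ho
  set I := goodLevel n m k W A L o with hI
  set hv := hashVal q K.d co with hhv
  have hqpos : 0 < q := (Fact.out : q.Prime).pos
  have hq0 : (0 : ℝ) < q := by exact_mod_cast hqpos
  have hA' : (1 : ℝ) ≤ A := by exact_mod_cast hA
  have hIW : I ≤ W.size := goodLevel_le
  have hCG' : Codes G' (trunc m D R) := codes_latest hG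
  have hlev : ∀ e, K.lev co e < K.LV := fun e => levelOf_lt (by omega)
  have hlev_iff : ∀ j, j ≤ W.size → ∀ e, j ≤ K.lev co e ↔ hv e < q / 2 ^ j := by
    intro j hj e
    rw [hhv, ← hqK]
    exact le_levelOf_iff (by omega) (hashVal_lt (hqK ▸ hqpos) _ _ _)
  have hsmall : ∀ l, I ≤ l → (kept W m D K.B (K.lev co) ρ l).length < K.B := by
    intro l hl
    have h1 := edges_lt_of_good hk hkn hA hG hGW hKq hz (by rw [← hKD]; exact hgood)
    rw [← hKD, ← hKB] at h1
    refine lt_of_le_of_lt ?_ h1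
    rw [kept, List.length_take]
    refine (min_le_right _ _).trans (List.monotone_filter_right _ ?_).length_le
    intro x hx
    simp only [decide_eq_true_eq] at hx ⊢
    rw [← hlev_iff I hIW, hx]
    exact hl
  -- Otherwise level `i - 1` would be full although it is not below `I`, contrary to `hsmall`.
  have hiI : i ≤ I := by
    by_contra hcon
    have h1 := hc' (by omega)
    have h2 := hsmall (i - 1) (by omega)
    omega
  set θ := q / 2 ^ i with hθ
  have hθ0 : 0 < θ := by
    have := div_two_pow_size_pos (m := m) (W := W) (i := i) (by omega)
    rwa [← hKq] at this
  set Es := edgesFrom (kept W m D K.B (K.lev co) ρ) i K.LV with hEs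
  have hmem : ∀ x, x ∈ Es ↔ x ∈ trunc m D R ∧ hv (x % m) < θ := by
    intro x
    rw [hEs, mem_edgesFrom_kept hlev hc, hlev_iff i (by omega)]
  -- the selected sets
  have hsel : ∀ j : Fin k, sel[(j : ℕ)]'(by omega) < n := fun j => hlt _ (List.getElem_mem _)
  let f : Fin k ↪ Fin n := ⟨fun j => ⟨sel[(j : ℕ)]'(by omega), hsel j⟩, fun a b hab => by
    have := (List.Nodup.getElem_inj_iff hnd).1 (Fin.mk.inj hab)
    exact Fin.ext this⟩
  set P := Finset.univ.map f with hP
  have hPsel : ∀ S : Fin n, S ∈ P ↔ (S : ℕ) ∈ sel := by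
    intro S
    rw [hP, Finset.mem_map]
    constructor
    · rintro ⟨j, -, rfl⟩
      exact List.getElem_mem _
    · intro hS
      obtain ⟨j, hj, hj'⟩ := List.getElem_of_mem hS
      exact ⟨⟨j, by omega⟩, Finset.mem_univ _, Fin.ext hj'⟩
  have hPk : P.card = k := by simp [hP]
  -- the best sets of the truncated graph
  obtain ⟨T, hTk, hT⟩ : ∃ T : Finset (Fin n), T.card = k ∧
      (1 - 1 / (4 * A : ℝ)) * o ≤ coverage G' T := by
    obtain ⟨T, hTk, hT⟩ := exists_coverage_truncated (G := G) (G' := G') (A := A) (D := D) hk hkn hA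
      (Finset.filter_subset _ _) (fun e => by rw [hG', card_setsOf_latest hG, min_comm])
      (by rw [hKD]; exact le_maxDegree hk)
    obtain ⟨T', hTT', -, hT'⟩ := Finset.exists_subsuperset_card_eq (Finset.subset_univ T) hTk
      (by simpa using hkn)
    exact ⟨T', hT', hT.trans (by exact_mod_cast coverage_mono hTT')⟩
  set TL := T.toList.map (fun S : Fin n => (S : ℕ)) with hTL
  have hTsel : ∀ S : Fin n, S ∈ T ↔ (S : ℕ) ∈ TL := by
    intro S
    rw [hTL, List.mem_map]
    constructor
    · intro h
      exact ⟨S, Finset.mem_toList.2 h, rfl⟩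
    · rintro ⟨S', hS', he⟩
      rw [← Fin.ext he]
      exact Finset.mem_toList.1 hS'
  have hgreedy := hgr.le hk hlen (T := TL) (by simp [hTL, hTk]) (by
    intro S hS
    obtain ⟨S', -, rfl⟩ := List.mem_map.1 hS
    exact S'.2)
  rw [card_covSet_eq hCG' hmem hPsel] at hgreedy hcc
  rw [card_covSet_eq hCG' hmem hTsel] at hgreedy
  have hz' : ∀ C : Finset (Fin m), (C.filter fun e => (z e).val < θ) = C.filter fun e : Fin m => hv e < θ :=
    fun C => Finset.filter_congr fun e _ => by rw [hz e]
  have hdev : ∀ Q : Finset (Fin n), Q.card = k →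
      |(((covered G' Q).filter fun e : Fin m => hv e < θ).card : ℝ) - (θ : ℝ) / q * coverage G' Q| ≤
        1 / (8 * A) * ((θ : ℝ) / q * o) := by
    intro Q hQ
    have h1 : |∑ e, (if e ∈ covered G' Q then (1 : ℝ) else 0) * deviation θ (z e)| ≤
        1 / (8 * A) * ((θ : ℝ) / q * o) := by
      -- Level `0` samples everything, so its deviation is zero and the good event need not speak of
      -- it.
      rcases Nat.eq_zero_or_pos i with h0 | h0
      · have : θ = q := by rw [hθ, h0, pow_zero, Nat.div_one]
        rw [this]
        simp only [deviation_self, mul_zero, Finset.sum_const_zero, abs_zero]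
        positivity
      · exact hgood.cover i hiI h0.ne' Q (Finset.mem_powersetCard.2 ⟨Finset.subset_univ _, hQ⟩)
    rw [sum_deviation, hz', card_covered] at h1
    exact h1
  have hexp : 1 / Real.exp 1 ≤ 1 := by
    rw [div_le_one (Real.exp_pos 1)]
    linarith [Real.add_one_le_exp (1 : ℝ)]
  have hexp0 : 0 < 1 / Real.exp 1 := by positivity
  have hθr : (0 : ℝ) < θ := by exact_mod_cast hθ0
  have hNo : (coverage G' P : ℝ) ≤ o := by
    exact_mod_cast (coverage_mono_left (Finset.filter_subset _ _)).trans (coverage_le_opt hkn hPk.le)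
  obtain ⟨r1, r2, r3⟩ := approx_arith (κ := 1 - 1 / Real.exp 1) (A := (A : ℝ)) (p := (θ : ℝ) / q)
    (o := (o : ℝ)) (by linarith) hA' (by positivity) (Nat.cast_nonneg _) (hdev P hPk) (hdev T hTk) hT
    hgreedy hNo (by linarith)
  rw [← hcc] at r1 r2
  have hval : ((c * q * (8 * A) : ℕ) : ℝ) / ((θ * (8 * A + 1) : ℕ) : ℝ) =
      (c : ℝ) / ((θ : ℝ) / q * (1 + 1 / (8 * A))) := by
    push_cast
    field_simp
  rw [hval]
  refine ⟨hθ0, r1, r2, f, fun j h => rfl, r3.trans ?_⟩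
  exact_mod_cast coverage_mono_left (Finset.filter_subset _ _)

end Answer

end KCover

namespace KCover

open WordRAM

/-! ### The word length -/

section Words

/-- The number `a` is at most `P ^ i`. -/
def PowBound (P i a : ℕ) : Prop := a ≤ P ^ i

/-- All integer parameters are at most `P`. -/
structure Small (P n m k W A L : ℕ) : Prop where
  base : 48 ≤ P
  n : PowBound P 1 n
  m : PowBound P 1 m
  k : PowBound P 1 k
  W : PowBound P 1 W
  A : PowBound P 1 A
  L : PowBound P 1 L

theorem size_le_self (a : ℕ) : a.size ≤ a := Nat.size_le.2 Nat.lt_two_pow_self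

variable {P n m k W A L a b i j : ℕ}

theorem PowBound.le_trans (h : a ≤ b) (hb : PowBound P i b) : PowBound P i a := h.trans hb

theorem PowBound.size (h : PowBound P i a) : PowBound P i a.size := (size_le_self a).trans h

theorem PowBound.mul (ha : PowBound P i a) (hb : PowBound P j b) : PowBound P (i + j) (a * b) := by
  rw [PowBound, pow_add]
  exact Nat.mul_le_mul ha hb

namespace Small

variable (h : Small P n m k W A L)
include h

theorem weaken (ha : PowBound P i a) (hij : i ≤ j) : PowBound P j a :=
  ha.trans (Nat.pow_le_pow_right (by have := h.base; omega) hij)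

/-- A base of at least `2` absorbs the doubling in one extra exponent. Overflow checks thus become
bookkeeping of exponents, all of which stay below `20`. -/
theorem add (ha : PowBound P i a) (hb : PowBound P j b) : PowBound P (max i j + 1) (a + b) := by
  have h1 := h.weaken ha (le_max_left i j)
  have h2 := h.weaken hb (le_max_right i j)
  have h3 : P ^ max i j * 2 ≤ P ^ max i j * P := Nat.mul_le_mul_left _ (by have := h.base; omega)
  rw [PowBound] at h1 h2 ⊢
  rw [pow_succ]
  omega

theorem lit (i : ℕ) (ha : a ≤ 48 ^ i) : PowBound P i a := ha.trans (Nat.pow_le_pow_left h.base i)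

theorem lit_one (ha : a ≤ 48) : PowBound P 1 a := h.lit 1 (by simpa using ha)

theorem halfIndep : PowBound P 5 (halfIndep n k W L) :=
  h.weaken (h.add (h.add (h.add (h.k.mul h.n.size) h.L) h.W.size.size)
    (h.lit_one (by norm_num))) (by norm_num)

theorem degree : PowBound P 5 (n * (16 * A * (A.size + 3))) :=
  h.weaken (h.n.mul (((h.lit_one (by norm_num)).mul h.A).mul
    (h.add h.A.size (h.lit_one (by norm_num))))) (by norm_num)

theorem maxDegree : PowBound P 6 (maxDegree n k A) :=
  h.weaken (h.add (h.degree.le_trans (Nat.div_le_self _ _)) (h.lit_one (by norm_num))) (by norm_num)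

theorem sample : PowBound P 10 (12 * (1536 * (A * A) * KCover.halfIndep n k W L)) :=
  h.weaken ((h.lit_one (by norm_num)).mul (((h.lit 2 (by norm_num)).mul (h.A.mul h.A)).mul
    h.halfIndep)) (by norm_num)

theorem maxEdges : PowBound P 17 (maxEdges n k W A L) :=
  h.weaken (h.add (h.sample.mul h.maxDegree) (h.lit_one (by norm_num))) (by norm_num)

theorem start : PowBound P 4 (m + 4 * W + 2) :=
  h.weaken (h.add (h.add h.m ((h.lit_one (by norm_num)).mul h.W)) (h.lit_one (by norm_num)))
    (by norm_num)

theorem prime : PowBound P 5 (nextPrime (m + 4 * W + 2)) :=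
  ((h.lit_one (by norm_num)).mul h.start).le_trans (nextPrime_le_two_mul (by omega))

theorem codes : PowBound P 3 ((n + 1) * m) := (h.add h.n (h.lit_one (by norm_num))).mul h.m

variable {N : ℕ} (hN : P ^ 20 ≤ N)
include hN

theorem lt_of_bound (ha : PowBound P i a) (hi : i < 20) : a < N :=
  (lt_of_le_of_lt ha (Nat.pow_lt_pow_right (by have := h.base; omega) hi)).trans_le hN

theorem initFits : InitFits N n m k W A L where
  half := h.lt_of_bound hN (h.add h.halfIndep ((h.lit_one (by norm_num)).mul h.halfIndep)) (by norm_num)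
  deg := h.lt_of_bound hN (h.add h.degree (h.lit_one (by norm_num))) (by norm_num)
  edges := h.lt_of_bound hN h.maxEdges (by norm_num)
  big := h.lt_of_bound hN (h.add (h.add ((h.lit 2 (by norm_num)).mul (h.A.mul h.A)) h.sample)
    (h.lit 2 (by norm_num))) (by norm_num)
  start := h.lt_of_bound hN (h.add ((h.lit_one (by norm_num)).mul h.start) (h.lit_one (by norm_num)))
    (by norm_num)
  codes := h.lt_of_bound hN (h.add (h.add (h.add (h.add h.codes h.n) h.W.size)
    (h.lit_one (by norm_num))) h.A.size) (by norm_num)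

theorem fits : (conf n m k W A L).Fits N where
  cells := (h.lt_of_bound hN (h.add ((h.lit_one (by norm_num)).mul (h.add h.codes
    (h.add h.W.size (h.lit_one (by norm_num))))) (h.lit 2 (by norm_num))) (by norm_num)).le
  coefs := (h.lt_of_bound hN (h.add ((h.lit_one (by norm_num)).mul
    ((h.lit_one (by norm_num)).mul h.halfIndep)) (h.lit 2 (by norm_num))) (by norm_num)).le
  hash := (h.lt_of_bound hN (h.add (h.prime.mul h.m) h.prime) (by norm_num)).le
  window := h.lt_of_bound hN (h.add h.W (h.lit_one (by norm_num))) (by norm_num)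
  set_index := (h.lt_of_bound hN (h.add h.codes h.m) (by norm_num)).le
  elem := (h.lt_of_bound hN (h.add ((h.lit_one (by norm_num)).mul h.m) (h.lit 2 (by norm_num)))
    (by norm_num)).le

theorem fitsQuery (hkn : k ≤ n) (hA : 0 < A) : (conf n m k W A L).FitsQuery N where
  sets := (h.lt_of_bound hN (h.add ((h.lit_one (by norm_num)).mul h.n) (h.lit 2 (by norm_num)))
    (by norm_num)).le
  value := h.lt_of_bound hN ((h.m.mul h.prime).mul ((h.lit_one (by norm_num)).mul h.A)) (by norm_num)
  denom := h.lt_of_bound hN (h.prime.mul (h.add ((h.lit_one (by norm_num)).mul h.A)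
    (h.lit_one (by norm_num)))) (by norm_num)
  k_le_n := hkn
  A_pos := hA
  q_pos := (prime_nextPrime _).pos

end Small

/-- The witness is `2` to the total bit length of the parameters. The bounds on `ε` and `δ` force
that length to be at least `6`, enough for the base `48`. -/
theorem small_params {I : Params} (hI : I.Valid) :
    ∃ P, Small P I.n I.m I.k I.W I.invAcc I.logConf ∧ P ^ 20 ≤ 2 ^ I.wordLength 20 := by
  have hs : ∀ a : ℕ, a < 2 ^ a.size := fun a => Nat.lt_size_self a
  have hmono : ∀ {a b : ℕ}, a ≤ b → 2 ^ a ≤ 2 ^ b := fun h => Nat.pow_le_pow_right (by norm_num) h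
  have h1 := hI.one_le_k.trans hI.k_le_n
  have hA : 3 ≤ I.invAcc := Nat.lt_ceil.2 (by
    rw [lt_div_iff₀ hI.ε_pos]
    have := hI.ε_lt
    push_cast
    linarith)
  have hL : 2 ≤ I.logConf := Nat.lt_ceil.2 (by
    push_cast
    rw [Real.lt_logb_iff_rpow_lt (by norm_num) (by have := hI.δ_pos; positivity),
      Real.rpow_one, lt_div_iff₀ hI.δ_pos]
    have := hI.δ_lt
    linarith)
  have sn : 1 ≤ I.n.size := Nat.size_pos.2 h1
  have sW : 1 ≤ I.W.size := Nat.size_pos.2 hI.one_le_W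
  have sA : 2 ≤ I.invAcc.size := Nat.lt_size.2 (by omega)
  have sL : 2 ≤ I.logConf.size := Nat.lt_size.2 (by omega)
  refine ⟨2 ^ (I.n.size + I.m.size + I.W.size + I.invAcc.size + I.logConf.size),
    ⟨(by norm_num : 48 ≤ 2 ^ 6).trans (hmono (by omega)), ?_, ?_, ?_, ?_, ?_, ?_⟩, ?_⟩
  · rw [PowBound, pow_one]; exact (hs I.n).le.trans (hmono (by omega))
  · rw [PowBound, pow_one]; exact (hs I.m).le.trans (hmono (by omega))
  · rw [PowBound, pow_one]; exact hI.k_le_n.trans ((hs I.n).le.trans (hmono (by omega)))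
  · rw [PowBound, pow_one]; exact (hs I.W).le.trans (hmono (by omega))
  · rw [PowBound, pow_one]; exact (hs I.invAcc).le.trans (hmono (by omega))
  · rw [PowBound, pow_one]; exact (hs I.logConf).le.trans (hmono (by omega))
  · rw [Params.wordLength, mul_comm, pow_mul]

end Words

/-! ### The number of cells in use -/

section Space

variable {K : Conf} {co lev : ℕ → ℕ} {st : ℕ → List ℕ} {ts : ℕ → ℕ} {s : State}

theorem eq_or_mem_of_nxt {a z : ℕ} {l : List ℕ} (h : nxt (a :: l) z ≠ 0) : z = a ∨ z ∈ l := by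
  by_contra hc
  exact h (nxt_of_notMem (by simpa using hc))

theorem ne_nil_of_nxt {a z : ℕ} {l : List ℕ} (h : nxt (a :: l) z ≠ 0) : l ≠ [] := by
  rintro rfl
  exact h rfl

theorem space_le_sum (Z : ℕ → Finset ℕ) (h : ∀ j < 16, ∀ i, s.arr j i ≠ 0 → i ∈ Z j) :
    s.space ≤ ∑ j ∈ Finset.range 16, (Z j).card := by
  have hsub : s.mem.support ⊆ (Finset.range 16).biUnion fun j => (Z j).image (16 * · + j) := by
    intro a ha
    rw [Finset.mem_biUnion]
    have e : 16 * (a / 16) + a % 16 = a := Nat.div_add_mod a 16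
    refine ⟨a % 16, Finset.mem_range.2 (Nat.mod_lt _ (by norm_num)), Finset.mem_image.2
      ⟨a / 16, h _ (Nat.mod_lt _ (by norm_num)) _ ?_, e⟩⟩
    rw [State.arr, e]
    exact Finsupp.mem_support_iff.1 ha
  exact (Finset.card_le_card hsub).trans (Finset.card_biUnion_le.trans
    (Finset.sum_le_sum fun j _ => Finset.card_image_le))

/-- A pointer is nonzero only at a stored edge or at the head of a nonempty list, as unlinked cells
are cleared. The sparse address range therefore costs nothing. -/
theorem Rep.space_le (hW : Wf K lev st) (h : Rep K co lev st ts s) (hlev : ∀ e, lev e < K.LV) :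
    s.space ≤ K.d + 3 * K.LV + 8 * (edgesFrom st 0 K.LV).length := by
  classical
  set E := (edgesFrom st 0 K.LV).toFinset with hE
  have hEc : E.card = (edgesFrom st 0 K.LV).length := List.toFinset_card_of_nodup (nodup_edgesFrom hW 0 _)
  have hmem : ∀ l, ∀ x ∈ st l, l < K.LV ∧ x ∈ E := by
    intro l x hx
    have h1 : l < K.LV := hW.level l x hx ▸ hlev _
    exact ⟨h1, by rw [hE, List.mem_toFinset, mem_edgesFrom]; exact ⟨l, zero_le, h1, hx⟩⟩
  set H := (Finset.range K.LV).image (K.codes + ·) with hH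
  have hHc : H.card ≤ K.LV := Finset.card_image_le.trans (by simp)
  set F := E.image (· % K.m) with hF
  have hFc : F.card ≤ E.card := Finset.card_image_le
  have hmemF : ∀ e x, x ∈ atElem K.m e (st (lev e)) → x ∈ E ∧ e ∈ F := by
    intro e x hx
    rw [atElem, List.mem_filter] at hx
    have h1 := (hmem _ _ hx.1).2
    exact ⟨h1, Finset.mem_image.2 ⟨x, h1, by simpa using hx.2⟩⟩
  have hlevel : ∀ z (l : ℕ) (t : List ℕ), (∀ x ∈ t, x ∈ st l) → nxt ((K.codes + l) :: t) z ≠ 0 → z ∈ H ∪ E := by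
    intro z l t ht hz
    obtain ⟨y, hy⟩ := List.exists_mem_of_ne_nil _ (ne_nil_of_nxt hz)
    rcases eq_or_mem_of_nxt hz with h1 | h1
    · exact Finset.mem_union_left _
        (Finset.mem_image.2 ⟨l, Finset.mem_range.2 (hmem _ _ (ht _ hy)).1, h1.symm⟩)
    · exact Finset.mem_union_right _ (hmem _ _ (ht _ h1)).2
  have helem : ∀ z (e : ℕ) (t : List ℕ), (∀ x ∈ t, x ∈ atElem K.m e (st (lev e))) →
      nxt (e :: t) z ≠ 0 → z ∈ F ∪ E := by
    intro z e t ht hz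
    obtain ⟨y, hy⟩ := List.exists_mem_of_ne_nil _ (ne_nil_of_nxt hz)
    rcases eq_or_mem_of_nxt hz with h1 | h1
    · exact Finset.mem_union_left _ (h1 ▸ (hmemF _ _ (ht _ hy)).2)
    · exact Finset.mem_union_right _ (hmemF _ _ (ht _ h1)).1
  set Z : ℕ → Finset ℕ := fun j => if j = 0 then Finset.range K.d else if j = 1 then ∅
    else if j ≤ 3 then H ∪ E else if j ≤ 5 then F ∪ E else if j = 6 then E
    else if j = 7 then Finset.range K.LV else if j = 8 then F else ∅ with hZ
  have hsup := space_le_sum (s := s) Z (by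
    intro j hj i hi
    obtain ⟨r1, r9, r10, r11, r12, r13, r14, r15⟩ := h.rest i
    interval_cases j <;> simp only [hZ] <;> norm_num <;> try contradiction
    · rw [h.coef] at hi
      by_contra hc
      rw [if_neg hc] at hi
      exact hi rfl
    · rw [h.level.nx_eq] at hi
      exact Finset.mem_union.1 (hlevel i _ _ (fun x hx => hx) hi)
    · rw [h.level.pv_eq] at hi
      exact Finset.mem_union.1 (hlevel i _ _ (fun x hx => List.mem_reverse.1 hx) hi)
    · rw [h.elem.nx_eq] at hi
      exact Finset.mem_union.1 (helem i _ _ (fun x hx => hx) hi)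
    · rw [h.elem.pv_eq] at hi
      exact Finset.mem_union.1 (helem i _ _ (fun x hx => List.mem_reverse.1 hx) hi)
    · rw [h.time] at hi
      by_contra hc
      rw [if_neg fun hx => hc (hmem _ _ hx).2] at hi
      exact hi rfl
    · rw [h.count, Ne, List.length_eq_zero_iff] at hi
      obtain ⟨y, hy⟩ := List.exists_mem_of_ne_nil _ hi
      exact (hmem _ _ hy).1
    · rw [h.elem_count, Ne, List.length_eq_zero_iff] at hi
      obtain ⟨y, hy⟩ := List.exists_mem_of_ne_nil _ hi
      exact (hmemF _ _ hy).2)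
  have c1 := Finset.card_union_le H E
  have c2 := Finset.card_union_le F E
  simp [Finset.sum_range_succ, hZ] at hsup
  omega

theorem length_edgesFrom_le {B : ℕ} (h : ∀ l, (st l).length ≤ B) (i j : ℕ) :
    (edgesFrom st i j).length ≤ (j - i) * B := by
  rw [edgesFrom, List.length_reverse, List.length_flatMap]
  refine (List.sum_le_card_nsmul _ B fun x hx => ?_).trans (by simp)
  obtain ⟨l, -, rfl⟩ := List.mem_map.1 hx
  exact h l

end Space

end KCover

namespace KCover

open WordRAM

/-! ### The resource bounds in terms of the parameters -/

section Bounds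

theorem one_le_lg (x : ℝ) : 1 ≤ lg x := le_max_left _ _

theorem logb_le_lg (x : ℝ) : Real.logb 2 x ≤ lg x := le_max_right _ _

theorem size_le_logb {v : ℕ} (hv : 1 ≤ v) : (v.size : ℝ) ≤ Real.logb 2 v + 1 := by
  have h0 := Nat.size_pos.2 hv
  have h1 : 2 ^ (v.size - 1) ≤ v := Nat.lt_size.1 (by omega)
  have h2 : ((v.size - 1 : ℕ) : ℝ) ≤ Real.logb 2 v := by
    rw [Real.le_logb_iff_rpow_le (by norm_num) (by exact_mod_cast hv), Real.rpow_natCast]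
    exact_mod_cast h1
  rw [Nat.cast_sub h0] at h2
  push_cast at h2
  linarith

theorem size_le_lg {v : ℕ} (hv : 1 ≤ v) : (v.size : ℝ) ≤ 2 * lg v := by
  linarith [size_le_logb hv, logb_le_lg v, one_le_lg v]

variable {I : Params}

/-- The term for the union over the levels is of order `log log W`, and that is what dividing the
failure probability by `lg W` adds to its logarithm. -/
theorem logConf_add_size_le (hI : I.Valid) :
    (I.logConf : ℝ) + I.W.size.size + 2 ≤ 6 * lg (1 / I.δ₀) := by
  have hδ := hI.δ_pos
  have hW := one_le_lg I.W
  have h1 : (I.logConf : ℝ) ≤ Real.logb 2 (1 / I.δ) + 1 := by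
    refine (Nat.ceil_lt_add_one (Real.logb_nonneg (by norm_num) ?_)).le
    rw [le_div_iff₀ hδ]
    linarith [hI.δ_lt]
  have hs := Nat.size_pos.2 hI.one_le_W
  have h2 : (I.W.size.size : ℝ) ≤ Real.logb 2 (lg I.W) + 2 := by
    have h3 : Real.logb 2 I.W.size ≤ Real.logb 2 (2 * lg I.W) :=
      Real.logb_le_logb_of_le (by norm_num) (by exact_mod_cast hs) (size_le_lg hI.one_le_W)
    rw [Real.logb_mul (by norm_num) (by linarith), Real.logb_self_eq_one (by norm_num)] at h3
    linarith [size_le_logb hs]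
  have h3 : Real.logb 2 (1 / I.δ₀) = Real.logb 2 (lg I.W) + Real.logb 2 (1 / I.δ) := by
    rw [Params.δ₀, ← Real.logb_mul (by linarith) (by positivity)]
    congr 1
    field_simp
  linarith [logb_le_lg (1 / I.δ₀), one_le_lg (1 / I.δ₀)]

theorem halfIndep_le (hI : I.Valid) :
    (halfIndep I.n I.k I.W I.logConf : ℝ) ≤ I.k * (8 * (lg I.n * lg (1 / I.δ₀))) := by
  have h1 := logConf_add_size_le hI
  have h2 := size_le_lg (hI.one_le_k.trans hI.k_le_n)
  have hk : (1 : ℝ) ≤ I.k := by exact_mod_cast hI.one_le_k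
  have ha := one_le_lg I.n
  have hb := one_le_lg (1 / I.δ₀)
  rw [halfIndep]
  push_cast
  have h3 : lg (1 / I.δ₀) ≤ lg I.n * lg (1 / I.δ₀) := le_mul_of_one_le_left (by linarith) ha
  have h4 : lg I.n ≤ lg I.n * lg (1 / I.δ₀) := le_mul_of_one_le_right (by linarith) hb
  have h5 := mul_le_mul_of_nonneg_left (h2.trans (mul_le_mul_of_nonneg_left h4 (by norm_num)))
    (show (0 : ℝ) ≤ I.k by linarith)
  have h6 : lg I.n * lg (1 / I.δ₀) ≤ I.k * (lg I.n * lg (1 / I.δ₀)) :=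
    le_mul_of_one_le_left (by positivity) hk
  linarith

theorem level_le (hI : I.Valid) : ((I.W.size + 1 : ℕ) : ℝ) ≤ 3 * lg I.W := by
  push_cast
  linarith [size_le_lg hI.one_le_W, one_le_lg I.W]

theorem updateTime_le (hI : I.Valid) :
    ((440 * (I.W.size + 1) + 40 * (2 * halfIndep I.n I.k I.W I.logConf) + 1470 : ℕ) : ℝ) ≤
      4000 * I.updateBound := by
  have h1 := level_le hI
  have h2 := halfIndep_le hI
  have hk : (1 : ℝ) ≤ I.k := by exact_mod_cast hI.one_le_k
  have ha := one_le_lg I.n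
  have hb := one_le_lg (1 / I.δ₀)
  have hc := one_le_lg I.W
  set u := (I.k : ℝ) * (lg I.n * lg (1 / I.δ₀)) with hu
  have hu1 : 1 ≤ u := one_le_mul_of_one_le_of_one_le hk (one_le_mul_of_one_le_of_one_le ha hb)
  have hU : I.updateBound = u * lg I.W := by rw [Params.updateBound, hu]; ring
  have h3 : u ≤ u * lg I.W := le_mul_of_one_le_right (by linarith) hc
  have h4 : lg I.W ≤ u * lg I.W := le_mul_of_one_le_left (by linarith) hu1
  push_cast at h1 ⊢
  rw [hU]
  linarith

theorem invAcc_le (hI : I.Valid) : (I.invAcc : ℝ) ≤ 2 * (1 / I.ε) := by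
  have hε := hI.ε_pos
  have h1 : 1 ≤ 1 / I.ε := by rw [le_div_iff₀ hε]; linarith [hI.ε_lt]
  have h2 := (Nat.ceil_lt_add_one (show 0 ≤ 1 / I.ε by positivity)).le
  rw [Params.invAcc]
  linarith

theorem invAcc_pos (hI : I.Valid) : 1 ≤ I.invAcc :=
  Nat.ceil_pos.2 (by have := hI.ε_pos; positivity)

theorem size_invAcc_le (hI : I.Valid) : (I.invAcc.size : ℝ) + 3 ≤ 6 * lg (1 / I.ε) := by
  have hA : (1 : ℝ) ≤ I.invAcc := by exact_mod_cast invAcc_pos hI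
  have h1 := Real.logb_le_logb_of_le (b := 2) (by norm_num) (by linarith) (invAcc_le hI)
  rw [Real.logb_mul (by norm_num) (by have := hI.ε_pos; positivity),
    Real.logb_self_eq_one (by norm_num)] at h1
  linarith [size_le_logb (invAcc_pos hI), logb_le_lg (1 / I.ε), one_le_lg (1 / I.ε)]

/-- The factor `k` of `halfIndep` cancels the division by `k` in `maxDegree`; for this reason the
space is linear in `n` and free of `k`. -/
theorem mul_maxDegree_le {n k A : ℕ} (hkn : k ≤ n) (hA : 1 ≤ A) :
    (k : ℝ) * maxDegree n k A ≤ 32 * (n * (A * (A.size + 3))) := by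
  have h1 : k * maxDegree n k A ≤ n * (16 * A * (A.size + 3)) + n := by
    rw [maxDegree, mul_add, mul_one]
    exact Nat.add_le_add (Nat.mul_div_le _ _) hkn
  have h2 : n ≤ n * (A * (A.size + 3)) :=
    Nat.le_mul_of_pos_right _ (Nat.mul_pos hA (by omega))
  have h3 : k * maxDegree n k A ≤ 32 * (n * (A * (A.size + 3))) := by
    have : n * (16 * A * (A.size + 3)) = 16 * (n * (A * (A.size + 3))) := by ring
    omega
  exact_mod_cast h3

theorem maxEdges_le (hI : I.Valid) :
    (((I.W.size + 1) * maxEdges I.n I.k I.W I.invAcc I.logConf : ℕ) : ℝ) ≤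
      10 ^ 10 * I.sizeBound := by
  have hε := hI.ε_pos
  have hn : (1 : ℝ) ≤ I.n := by exact_mod_cast hI.one_le_k.trans hI.k_le_n
  have ha := one_le_lg I.n
  have hb := one_le_lg (1 / I.δ₀)
  have hc := one_le_lg I.W
  have hd := one_le_lg (1 / I.ε)
  have he : 1 ≤ 1 / I.ε := by rw [le_div_iff₀ hε]; linarith [hI.ε_lt]
  have hA : (0 : ℝ) ≤ I.invAcc := Nat.cast_nonneg _
  have hk : (0 : ℝ) ≤ I.k := Nat.cast_nonneg _
  have hF : I.sizeBound = I.n * (lg I.n * lg (1 / I.δ₀)) * lg (1 / I.ε) * (1 / I.ε) ^ 3 * lg I.W := by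
    rw [Params.sizeBound]
    field_simp
  set A := I.invAcc with hA'
  set u := lg I.n * lg (1 / I.δ₀) with hu
  set x := 1 / I.ε with hx
  set y := lg x with hy
  have hu1 : 1 ≤ u := one_le_mul_of_one_le_of_one_le ha hb
  have h1 : (halfIndep I.n I.k I.W I.logConf : ℝ) * maxDegree I.n I.k A ≤
      8 * u * (32 * (I.n * (2 * x * (6 * y)))) := by
    calc _ ≤ (I.k * (8 * u)) * maxDegree I.n I.k A :=
          mul_le_mul_of_nonneg_right (halfIndep_le hI) (Nat.cast_nonneg _)
      _ = 8 * u * (I.k * maxDegree I.n I.k A) := by ring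
      _ ≤ 8 * u * (32 * (I.n * (A * (A.size + 3)))) :=
          mul_le_mul_of_nonneg_left (mul_maxDegree_le hI.k_le_n (invAcc_pos hI)) (by positivity)
      _ ≤ _ := by
          have := mul_le_mul (invAcc_le hI) (size_invAcc_le hI) (by positivity) (by positivity)
          gcongr
  have h2 : ((A : ℝ) * A) ≤ 2 * x * (2 * x) := mul_le_mul (invAcc_le hI) (invAcc_le hI) hA (by positivity)
  set v := I.n * u * y * x ^ 3 with hv
  have hv1 : 1 ≤ v := one_le_mul_of_one_le_of_one_le (one_le_mul_of_one_le_of_one_le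
    (one_le_mul_of_one_le_of_one_le hn hu1) hd) (one_le_pow₀ he)
  have h3 : (maxEdges I.n I.k I.W A I.logConf : ℝ) ≤ 226492416 * v + 1 := by
    -- The two factors `A` of the sample size and the one of the degree bound make up `1 / ε ^ 3`;
    -- the constant `226492416` is `12 * 1536 * 12288`.
    have := mul_le_mul h2 h1 (by positivity) (by positivity)
    rw [maxEdges]
    push_cast
    have e : 2 * x * (2 * x) * (8 * u * (32 * (I.n * (2 * x * (6 * y))))) = 12288 * v := by
      rw [hv]; ring
    rw [e] at this
    linarith
  rw [hF]
  push_cast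
  calc ((I.W.size : ℝ) + 1) * maxEdges I.n I.k I.W A I.logConf
      ≤ (3 * lg I.W) * (226492416 * v + 1) := by
        refine mul_le_mul (by simpa using level_le hI) h3 (by positivity) (by linarith)
    _ ≤ 3 * lg I.W * (226492417 * v) := mul_le_mul_of_nonneg_left (by linarith) (by linarith)
    _ ≤ _ := by
      have : 0 ≤ v * lg I.W := by positivity
      linarith

/-- Lets the edge capacity of the levels absorb the coefficients and the sets as lower order terms
of space and time. -/
theorem le_maxEdges {n k W A L : ℕ} (hkn : k ≤ n) (hA : 1 ≤ A) (hk : 1 ≤ k) :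
    2 * halfIndep n k W L ≤ maxEdges n k W A L ∧ n ≤ maxEdges n k W A L := by
  have hr : k ≤ halfIndep n k W L := by
    have : k ≤ k * n.size := Nat.le_mul_of_pos_right _ (Nat.size_pos.2 (by omega))
    unfold halfIndep
    omega
  have hD : n ≤ k * maxDegree n k A := by
    have h1 : n ≤ n * (16 * A * (A.size + 3)) :=
      Nat.le_mul_of_pos_right _ (Nat.mul_pos (by omega) (by omega))
    have h2 := (Nat.lt_mul_div_succ (n * (16 * A * (A.size + 3))) (show 0 < k by omega)).le
    exact h1.trans h2
  have h1 : 2 * (halfIndep n k W L * maxDegree n k A) ≤ maxEdges n k W A L := by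
    have h2 : 1 ≤ A * A := Nat.mul_pos hA hA
    have h3 : 1 * (halfIndep n k W L * maxDegree n k A) ≤
        A * A * (halfIndep n k W L * maxDegree n k A) := Nat.mul_le_mul_right _ h2
    have e : maxEdges n k W A L = 18432 * (A * A * (halfIndep n k W L * maxDegree n k A)) + 1 := by
      rw [maxEdges]; ring
    omega
  have h2 : halfIndep n k W L ≤ halfIndep n k W L * maxDegree n k A :=
    Nat.le_mul_of_pos_right _ (Nat.succ_pos _)
  have h3 : k * maxDegree n k A ≤ halfIndep n k W L * maxDegree n k A := Nat.mul_le_mul_right _ hr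
  constructor <;> omega

theorem total_le (hI : I.Valid) :
    ((600 * ((I.W.size + 1) * maxEdges I.n I.k I.W I.invAcc I.logConf + (I.W.size + 1) + I.n +
      2 * halfIndep I.n I.k I.W I.logConf + 4) : ℕ) : ℝ) ≤ 10 ^ 14 * I.sizeBound := by
  set B := maxEdges I.n I.k I.W I.invAcc I.logConf with hB
  obtain ⟨h1, h2⟩ := le_maxEdges (W := I.W) (L := I.logConf) hI.k_le_n (invAcc_pos hI) hI.one_le_k
  have hB1 : 1 ≤ B := Nat.succ_pos _
  have h3 : B ≤ (I.W.size + 1) * B := Nat.le_mul_of_pos_left _ (Nat.succ_pos _)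
  have h4 : I.W.size + 1 ≤ (I.W.size + 1) * B := Nat.le_mul_of_pos_right _ hB1
  have h5 : 600 * ((I.W.size + 1) * B + (I.W.size + 1) + I.n +
      2 * halfIndep I.n I.k I.W I.logConf + 4) ≤ 4800 * ((I.W.size + 1) * B) := by omega
  have h6 := maxEdges_le hI
  calc _ ≤ ((4800 * ((I.W.size + 1) * B) : ℕ) : ℝ) := by exact_mod_cast h5
    _ = 4800 * (((I.W.size + 1) * B : ℕ) : ℝ) := by push_cast; ring
    _ ≤ 4800 * (10 ^ 10 * I.sizeBound) := mul_le_mul_of_nonneg_left h6 (by norm_num)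
    _ ≤ _ := by
      have : 0 ≤ 10 ^ 10 * I.sizeBound := (Nat.cast_nonneg _).trans h6
      linarith

end Bounds

end KCover

namespace KCover

open WordRAM

/-! ### The algorithm -/

section Algorithm

/-- Keep, for every level of a subsampling of the elements, some of the most recent edges; run the
greedy algorithm on the finest level below which nothing was dropped. -/
def streamAlg : StreamAlg := ⟨initProg, updateProg, queryProg⟩

/-- The edge codes of a stream, the most recent ones first. -/
def history {n m : ℕ} (σ : List (Fin n × Fin m)) : List ℕ := (σ.map code).reverse

theorem codes_window {n m W : ℕ} (hW : 1 ≤ W) (σ : List (Fin n × Fin m)) :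
    Codes (window W σ) (recency W (history σ)) := by
  refine ⟨nodup_recency W _, fun x => ?_⟩
  rw [mem_recency hW, history, List.take_reverse, List.mem_reverse, List.length_map, ← List.map_drop,
    List.mem_map]
  simp only [window, List.mem_toFinset]

theorem card_window_le {n m W : ℕ} (σ : List (Fin n × Fin m)) : (window W σ).card ≤ W := by
  refine (List.toFinset_card_le _).trans ?_
  rw [List.length_drop]
  omega

theorem Ready.space_le {K : Conf} {co : ℕ → ℕ} {ρ : List ℕ} {s : State} (h : Ready K co ρ s)
    (hW : 1 ≤ K.W) (hLV : 1 ≤ K.LV) (hρ : ∀ x ∈ ρ, K.m ≤ x ∧ x < K.codes) :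
    s.space ≤ K.d + 3 * K.LV + 8 * (K.LV * K.B) := by
  have hwf : Wf K (K.lev co) (kept K.W K.m K.D K.B (K.lev co) ρ) := by
    simpa using wf_kept (K.lev co) hW hρ 0
  have h1 := h.rep.space_le hwf fun e => levelOf_lt hLV
  have h2 := length_edgesFrom_le (st := kept K.W K.m K.D K.B (K.lev co) ρ) (B := K.B)
    (fun l => by rw [kept, List.length_take]; exact min_le_left _ _) 0 K.LV
  rw [Nat.sub_zero] at h2
  omega

/-- The configuration of the algorithm for the parameters `I`. -/
noncomputable abbrev Params.conf (I : Params) : Conf :=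
  KCover.conf I.n I.m I.k I.W I.invAcc I.logConf

variable {I : Params} (ω : Coins)

/-- The coefficients of the random polynomial that subsamples the elements. -/
noncomputable abbrev Params.coef (I : Params) (ω : Coins) (i : ℕ) : ℕ := ω (i, I.conf.q - 1)

theorem Params.coef_lt (I : Params) (j : ℕ) : I.coef ω j < I.conf.q := by
  have h1 : 0 < I.conf.q := (prime_nextPrime _).pos
  have h2 := (ω (j, I.conf.q - 1)).2
  change _ < I.conf.q - 1 + 1 at h2
  change (ω (j, I.conf.q - 1) : ℕ) < I.conf.q
  omega

theorem history_bounds (σ : List (Fin I.n × Fin I.m)) :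
    ∀ x ∈ history σ, I.conf.m ≤ x ∧ x < I.conf.codes := by
  intro x hx
  rw [history, List.mem_reverse, List.mem_map] at hx
  obtain ⟨y, -, rfl⟩ := hx
  exact ⟨le_code y, code_lt y⟩

/-- Induction on the stream. The space during an update is at most the space before it plus its
running time, and the former is recomputed from `Ready`, so nothing accumulates along the stream. -/
theorem exists_processed (hI : I.Valid) (σ : List (Fin I.n × Fin I.m)) :
    ∃ s, Processed streamAlg (I.wordLength 20) ω (10 ^ 14 * I.sizeBound) (10 ^ 14 * I.updateBound)
      I.start σ s ∧ Ready I.conf (I.coef ω) (history σ) s := by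
  obtain ⟨P, hP, hN⟩ := small_params hI
  have hfits := hP.fits hN
  have hn := hI.one_le_k.trans hI.k_le_n
  have htot := total_le hI
  have hLV : I.conf.LV = I.W.size + 1 := rfl
  have hd : I.conf.d = 2 * halfIndep I.n I.k I.W I.logConf := rfl
  have hB : I.conf.B = maxEdges I.n I.k I.W I.invAcc I.logConf := rfl
  rw [← hLV, ← hd, ← hB] at htot
  induction σ using List.reverseRecOn with
  | nil =>
    obtain ⟨T, s1, t1, r1, -, hm, s2, t2, r2, ht2, hready⟩ := init_runs (ω := ω) (s := I.start)
      (hP.initFits hN) hn hfits.coefs rfl rfl rfl rfl rfl rfl rfl rfl rfl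
    have hsp : s1.space = 0 := by rw [State.space, hm]; rfl
    have hsp0 : I.start.space = 0 := rfl
    refine ⟨s2, .init (t := t1 + t2) (.seq ((r1.exec_noStore noStore_init).2 _ ?_) (r2.exec.2 _ ?_)), hready⟩
    · rw [hsp0]
      exact le_trans (by rw [Nat.cast_zero]; exact Nat.cast_nonneg _) htot
    · refine le_trans ?_ htot
      rw [hsp]
      change t2 ≤ 30 * I.conf.d + 10 at ht2
      have : 0 + t2 ≤ 600 * (I.conf.LV * I.conf.B + I.conf.LV + I.n + I.conf.d + 4) := by omega
      exact_mod_cast this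
  | append_singleton σ x ih =>
    obtain ⟨s, hs, hready⟩ := ih
    obtain ⟨s', t, hr, ht, hready'⟩ := updateProg_runs (ω := ω) hfits hI.one_le_W (Nat.succ_pos _)
      (Nat.succ_pos _) (Nat.succ_pos _) (prime_nextPrime _).pos (fun j _ => I.coef_lt ω j)
      (history_bounds σ) x.1.2 x.2.2 hready
    have hsp := hready.space_le hI.one_le_W (Nat.succ_pos _) (history_bounds σ)
    change t ≤ 440 * I.conf.LV + 40 * I.conf.d + 1470 at ht
    change s.space ≤ I.conf.d + 3 * I.conf.LV + 8 * (I.conf.LV * I.conf.B) at hsp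
    refine ⟨s', .update hs (hr.exec.2 _ ?_) ?_, ?_⟩
    · refine le_trans ?_ htot
      have : s.space + t ≤ 600 * (I.conf.LV * I.conf.B + I.conf.LV + I.n + I.conf.d + 4) := by omega
      exact_mod_cast this
    · have h1 := updateTime_le hI
      rw [← hLV, ← hd] at h1
      have h2 : (t : ℝ) ≤ ((440 * I.conf.LV + 40 * I.conf.d + 1470 : ℕ) : ℝ) := by exact_mod_cast ht
      have h3 : 0 ≤ 4000 * I.updateBound := (Nat.cast_nonneg _).trans h1
      linarith
    · have : history (σ ++ [x]) = code x :: history σ := by simp [history]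
      rw [this]
      exact hready'

/-- The deterministic half: halting and resource bounds hold for all coins, and the quality of the
answer follows from the good event. The prime is a variable so that it can later be written as a
successor. -/
theorem answers_streamAlg (hI : I.Valid) (σ : List (Fin I.n × Fin I.m)) :
    ∃ s, Answers streamAlg (I.wordLength 20) ω (10 ^ 14 * I.sizeBound) (10 ^ 14 * I.updateBound)
      (10 ^ 14 * I.sizeBound * lg I.sizeBound) I.start σ s ∧
      ∀ (q : ℕ) [Fact q.Prime], I.conf.q = q → ∀ z : Fin I.m → ZMod q,
        (∀ e : Fin I.m, (z e).val = hashVal q I.conf.d (I.coef ω) e) →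
        Good I.n I.m I.k I.W I.invAcc I.logConf (window I.W σ)
          (latest I.conf.D (window I.W σ) (recency I.W (history σ))) z →
        IsApprox (1 - 1 / Real.exp 1 - I.ε) I.k (window I.W σ) s := by
  obtain ⟨P, hP, hN⟩ := small_params hI
  obtain ⟨s, hs, hready⟩ := exists_processed ω hI σ
  have hfits := hP.fits hN
  have hwf : Wf I.conf (I.conf.lev (I.coef ω)) (kept I.conf.W I.conf.m I.conf.D I.conf.B
      (I.conf.lev (I.coef ω)) (history σ)) := by
    simpa using wf_kept (K := I.conf) (I.conf.lev (I.coef ω)) hI.one_le_W (history_bounds σ) 0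
  have hE : ∀ i, (edgesFrom (kept I.conf.W I.conf.m I.conf.D I.conf.B (I.conf.lev (I.coef ω))
      (history σ)) i I.conf.LV).length ≤ I.conf.LV * I.conf.B := fun i =>
    (length_edgesFrom_le (fun l => by rw [kept, List.length_take]; exact min_le_left _ _) i _).trans
      (Nat.mul_le_mul_right _ (Nat.sub_le _ _))
  obtain ⟨s', t, hr, ht, i, sel, hi, hc, hc', hlen, hnd, hlt, hgr, h0, h1, h2⟩ := query_runs (ω := ω)
    hfits (hP.fitsQuery hN hI.k_le_n (invAcc_pos hI)) hwf hready.rep hready.regs hE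
  have hsp := hready.space_le hI.one_le_W (Nat.succ_pos _) (history_bounds σ)
  change s.space ≤ I.conf.d + 3 * I.conf.LV + 8 * (I.conf.LV * I.conf.B) at hsp
  change t ≤ 500 * (I.conf.LV * I.conf.B + I.conf.LV + I.conf.n) + 300 at ht
  have htot := total_le hI
  have hLV : I.conf.LV = I.W.size + 1 := rfl
  have hd : I.conf.d = 2 * halfIndep I.n I.k I.W I.logConf := rfl
  have hB : I.conf.B = maxEdges I.n I.k I.W I.invAcc I.logConf := rfl
  have hn : I.conf.n = I.n := rfl
  rw [← hLV, ← hd, ← hB] at htot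
  have hle : s.space + t ≤ 600 * (I.conf.LV * I.conf.B + I.conf.LV + I.n + I.conf.d + 4) := by omega
  have hle' : (s.space : ℝ) + t ≤ 10 ^ 14 * I.sizeBound := le_trans (by exact_mod_cast hle) htot
  refine ⟨s', ⟨s, t, hs, hr.exec.2 _ hle', ?_⟩, fun q _ hq z hz hgood => ?_⟩
  · have h3 : (0 : ℝ) ≤ 10 ^ 14 * I.sizeBound := (Nat.cast_nonneg _).trans htot
    have h4 : (0 : ℝ) ≤ s.space := Nat.cast_nonneg _
    exact (show (t : ℝ) ≤ 10 ^ 14 * I.sizeBound by linarith).trans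
      (le_mul_of_one_le_right h3 (one_le_lg _))
  · obtain ⟨hpos, hv, hv', f, hf, hcov⟩ := answer_of_good hI.one_le_k hI.k_le_n (invAcc_pos hI)
      (codes_window hI.one_le_W σ) (card_window_le σ) rfl hq hz hgood hi hc hc' hlen hnd hlt hgr rfl
    have hε : 1 / (I.invAcc : ℝ) ≤ I.ε := by
      rw [one_div_le (by exact_mod_cast invAcc_pos hI) hI.ε_pos]
      exact Nat.le_ceil _
    have hmono : (1 - 1 / Real.exp 1 - I.ε) * opt I.k (window I.W σ) ≤
        (1 - 1 / Real.exp 1 - 1 / (I.invAcc : ℝ)) * opt I.k (window I.W σ) :=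
      mul_le_mul_of_nonneg_right (by linarith) (Nat.cast_nonneg _)
    rw [hq] at h0 h1
    refine ⟨⟨?_, ?_, ?_⟩, f, fun j => ?_, hmono.trans hcov⟩
    · rw [h1]
      exact Nat.mul_pos hpos (Nat.succ_pos _)
    · rw [h0, h1]
      exact hmono.trans hv
    · rw [h0, h1]
      exact hv'
    · have hj : (j : ℕ) < sel.length := by rw [hlen]; exact j.2
      exact (h2 j hj).trans (hf j hj)

/-- For a modulus `b + 1` the types `ZMod (b + 1)` and `Fin (b + 1)` coincide by definition, so the
coins themselves serve as coefficients. -/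
theorem natCast_coef_hashVal {b d m : ℕ} [Fact (b + 1).Prime] (e : Fin m) :
    (hashHom (b + 1) d m (fun j : Fin d => ω (j, b)) e).val =
      hashVal (b + 1) d (fun i => (ω (i, b) : ℕ)) e := by
  have h1 : (hashVal (b + 1) d (fun i => (ω (i, b) : ℕ)) e : ZMod (b + 1)) =
      hashHom (b + 1) d m (fun j : Fin d => ω (j, b)) e := by
    rw [natCast_hashVal]
    refine Finset.sum_congr rfl fun j _ => ?_
    congr 1
    exact ZMod.natCast_zmod_val (n := b + 1) (ω (j, b))
  rw [← h1, ZMod.val_natCast_of_lt (hashVal_lt (Nat.succ_pos b) _ _ _)]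

theorem half_pow_logConf_le (hI : I.Valid) : (1 / 2 : ℝ) ^ I.logConf ≤ I.δ := by
  have h1 : Real.logb 2 (1 / I.δ) ≤ I.logConf := Nat.le_ceil _
  rw [Real.logb_le_iff_le_rpow (by norm_num) (by have := hI.δ_pos; positivity), Real.rpow_natCast,
    div_le_iff₀ hI.δ_pos] at h1
  rw [div_pow, one_pow, div_le_iff₀ (by positivity)]
  linarith

/-- The stream is fixed before the coins, so failure forces the drawn vector into one finite bad
set. Monotonicity of the outer measure avoids any question of measurability of the failure event. -/
theorem coinMeasure_failure_le (hI : I.Valid) (σ : List (Fin I.n × Fin I.m)) :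
    coinMeasure {ω : Coins | ¬ ∃ s : State,
      Answers streamAlg (I.wordLength 20) ω (10 ^ 14 * I.sizeBound) (10 ^ 14 * I.updateBound)
        (10 ^ 14 * I.sizeBound * lg I.sizeBound) I.start σ s ∧
      IsApprox (1 - 1 / Real.exp 1 - I.ε) I.k (window I.W σ) s} ≤ ENNReal.ofReal I.δ := by
  set b := nextPrime (I.m + 4 * I.W + 2) - 1 with hb
  have hp := prime_nextPrime (I.m + 4 * I.W + 2)
  have hq : b + 1 = nextPrime (I.m + 4 * I.W + 2) := by have := hp.pos; omega
  have : Fact (b + 1).Prime := ⟨hq ▸ hp⟩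
  set G := window I.W σ with hG
  have hcodes := codes_window hI.one_le_W σ
  obtain ⟨Bad, hgood, hcard⟩ := card_bad_le (L := I.logConf)
    (G' := latest I.conf.D G (recency I.W (history σ))) hI.one_le_k hI.k_le_n (invAcc_pos hI)
    (card_window_le σ) (Finset.filter_subset _ _)
    (fun e => (card_setsOf_latest hcodes e).trans_le (min_le_left _ _)) hq (d := I.conf.d) rfl
  have hsub : {ω : Coins | ¬ ∃ s : State,
      Answers streamAlg (I.wordLength 20) ω (10 ^ 14 * I.sizeBound) (10 ^ 14 * I.updateBound)
        (10 ^ 14 * I.sizeBound * lg I.sizeBound) I.start σ s ∧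
      IsApprox (1 - 1 / Real.exp 1 - I.ε) I.k G s} ⊆
      {ω | (fun j : Fin I.conf.d => ω (j, b)) ∈ (Bad : Finset (Fin I.conf.d → Fin (b + 1)))} := by
    intro ω hω
    by_contra hnot
    obtain ⟨s, hs, h⟩ := answers_streamAlg ω hI σ
    exact hω ⟨s, hs, h (b + 1) hq.symm _ (natCast_coef_hashVal ω) (hgood _ hnot)⟩
  refine (measure_mono hsub).trans ((coinMeasure_le _ _ _).trans (ENNReal.ofReal_le_ofReal ?_))
  refine le_trans ?_ (half_pow_logConf_le hI)
  rw [div_le_iff₀ (by positivity), mul_comm]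
  exact_mod_cast hcard

end Algorithm

end KCover

theorem mainTheorem3 :
    ∃ (A : WordRAM.StreamAlg) (c : ℕ) (C : ℝ), 1 ≤ c ∧
      ∀ I : KCover.Params, I.Valid → ∀ σ : List (Fin I.n × Fin I.m),
        (∀ ω : WordRAM.Coins, ∃ s : WordRAM.State,
          KCover.Answers A (I.wordLength c) ω (C * I.sizeBound) (C * I.updateBound)
            (C * I.sizeBound * KCover.lg I.sizeBound) I.start σ s) ∧
        WordRAM.coinMeasure
          {ω : WordRAM.Coins | ¬ ∃ s : WordRAM.State,
            KCover.Answers A (I.wordLength c) ω (C * I.sizeBound) (C * I.updateBound)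
              (C * I.sizeBound * KCover.lg I.sizeBound) I.start σ s ∧
            KCover.IsApprox (1 - 1 / Real.exp 1 - I.ε) I.k (KCover.window I.W σ) s}
          ≤ ENNReal.ofReal I.δ :=
  ⟨KCover.streamAlg, 20, 10 ^ 14, by norm_num, fun _ hI σ =>
    ⟨fun ω => (KCover.answers_streamAlg ω hI σ).imp fun _ h => h.1,
      KCover.coinMeasure_failure_le hI σ⟩⟩
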